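/- **Permutative categories.** A *permutative category* is a symmetric monoidal category $(\mathcal C,\oplus,0,\gamma)$ which is strictly associative and strictly unital. For small permutative categories $\mathcal C_1,\dots,\mathcal C_k,\mathcal D$ let $\mathbf P_k(\mathcal C_1,\dots,\mathcal C_k;\mathcal D)$ be the following category. Its objects are the *$k$-linear functors*: functors $f\colon\mathcal C_1\times\dots\times\mathcal C_k\to\mathcal D$ with $f(c_1,\dots,c_k)=0$ if some $c_i=0$ (and $f(\varphi_1,\dots,\varphi_k)=\mathrm{id}_0$ if some $\varphi_i=\mathrm{id}_0$), together with, for every $i$, natural maps (not necessarily isomorphisms) $$\delta_i\colon f(c_1,\dots,c_i,\dots,c_k)\oplus f(c_1,\dots,c_i',\dots,c_k)\to f(c_1,\dots,c_i\oplus c_i',\dots,c_k)$$ such that $\delta_i=\mathrm{id}$ if $c_i'=0$ or some $c_j=0$; $f(1,\dots,\gamma,\dots,1)\circ\delta_i=\delta_i\circ\gamma$; $\delta_i\circ(\delta_i\oplus 1)=\delta_i\circ(1\oplus\delta_i)$ on triples $c_i,c_i',c_i''$; and, for $i\neq j$, $\delta_j\circ(\delta_i\oplus\delta_i)=\delta_i\circ(\delta_j\oplus\delta_j)\circ(1\oplus\gamma\oplus1)$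 as maps from the sum of the four objects with entries $c_i$ or $c_i'$ and $c_j$ or $c_j'$ to $f(\dots,c_i\oplus c_i',\dots,c_j\oplus c_j',\dots)$. Its morphisms are the natural transformations which commute with all $\delta_i$ and are $\mathrm{id}_0$ if some $c_i=0$. Permutations act by permuting the variables, units are identity functors, and $\Gamma(g;f_1,\dots,f_n)=g\circ(f_1\times\dots\times f_n)$, with $\delta$ of the composite in a variable of $f_i$ given by $g(1,\dots,\delta^{f_i},\dots,1)\circ\delta_i^g$; on morphisms the multiproduct is horizontal composition. **Symmetric functors.** Let $\mathbf n=\{0,\dots,n\}$, based at $0$, and let $\mathcal F^\infty$ be the category of sequences $(\mathbf n_1,\mathbf n_2,\dots)$ of such sets, almost all equal to $\mathbf 1$, whose morphisms are sequences of based maps, almost all equal to $\mathrm{id}_{\mathbf 1}$. A *symmetric functor* is a functor $F\colon\mathcal F^\infty\to\mathbf{Cat}$ such that $F\langle\mathbf n\rangle$ is terminal if some $\mathbf n_i=\mathbf 0$, with natural isomorphisms $\theta_!\colon F\theta^*\to F$ for $\theta\in\mathrm{Aut}(\mathbb N)$, where $\theta^*(\mathbf n_1,\mathbf n_2,\dots)=(\mathbf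 n_{\theta(1)},\mathbf n_{\theta(2)},\dots)$, such that $\mathrm{id}_!=\mathrm{id}$, $(\theta\theta')_!=\theta_!\circ\theta'_!$, and $\theta_!=\mathrm{id}$ at all $\langle\mathbf n\rangle$ with $\mathbf n_i=\mathbf 1$ whenever $\theta(i)\ne i$. A $k$-morphism $(F_1,\dots,F_k)\to G$ consists, for every injection $\beta\colon\{1,\dots,k\}\times\mathbb N\to\mathbb N$, of functors $$f_\beta\colon F_1\langle\mathbf n_1\rangle\times\dots\times F_k\langle\mathbf n_k\rangle\to G(\beta_*(\langle\mathbf n_1\rangle,\dots,\langle\mathbf n_k\rangle)),$$ natural in the $\langle\mathbf n_i\rangle$, where $\beta_*$ puts the $j$-th entry of $\langle\mathbf n_i\rangle$ at the place $\beta(i,j)$ and $\mathbf 1$ at all other places. These are required to satisfy $f_\beta\circ((\theta_1)_!\times\dots\times(\theta_k)_!)=\theta_!\circ f_\beta$ whenever $\theta\beta(i,j)=\beta(i,\theta_i(j))$ for all $i,j$, and $\theta_!\circ f_{\beta}=f_{\beta'}$ whenever $\theta\beta(i,j)=\beta'(i,j)$ for all $(i,j)$ with $(\mathbf n_i)_j\ne\mathbf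 1$. (For $k\ge1$ it is equivalent to use bijections $\beta$ only.) The $k$-morphisms form a category, whose morphisms are the natural transformations compatible with all this structure; permutations act by permuting the sources, units are identities, and multiproducts are composites of products of functors. **Symmetric spectra.** Let $S^1=\Delta[1]/\partial\Delta[1]$, whose set of $n$-simplices is $\mathbf n$. A *symmetric spectrum* $X$ (of simplicial sets) consists of based simplicial sets $X(p)$, $p\ge0$, with actions of $\Sigma_p$ by based maps and maps $X(p)\times S^1\to X(p+1)$ which factor over the smash product and whose iterates $X(p)\times(S^1)^q\to X(p+q)$ are $\Sigma_p\times\Sigma_q$-equivariant. The $b$-simplices of the simplicial set of $k$-morphisms $(X_1,\dots,X_k)\to Y$ are the families of maps $$X_1(p_1)\times\dots\times X_k(p_k)\times\Delta[b]\to Y(p_1+\dots+p_k)$$ which are $\Sigma_{p_1}\times\dots\times\Sigma_{p_k}$-equivariant, send tuples with an entry at the basepoint to the basepoint, and commute with suspension in each variable up to the permutation which moves the last coordinate to its place in the block of that variable. Permutations act by permuting factors and blocks, units are identities, and multiproducts are given by products and composition. **The functors.** For a permutative category $\mathcal C$ and finite based sets $A_1,\dots,A_n$ let $\overline{\mathcal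 C}_{(A_1,\dots,A_n)}$ be the category of systems of objects $C_{\langle S\rangle}$ of $\mathcal C$, one for each tuple of basepoint-free subsets $S_i\subset A_i$, with maps $$\rho_{\langle S\rangle;i,T,U}\colon C_{(S_1,\dots,T,\dots,S_n)}\oplus C_{(S_1,\dots,U,\dots,S_n)}\to C_{\langle S\rangle}$$ for $S_i=T\sqcup U$, such that $C_{\langle S\rangle}=0$ if some $S_k=\emptyset$, $\rho=\mathrm{id}$ if some $S_k$, $T$ or $U$ is empty, and the $\rho$ satisfy the symmetry, associativity and exchange conditions analogous to those for $\delta_i$ above. Its morphisms are the families of maps $C_{\langle S\rangle}\to C'_{\langle S\rangle}$ that commute with all $\rho$ and are $\mathrm{id}_0$ if some $S_k=\emptyset$. It is functorial in the $A_i$ by inverse images. For a based set $A$ let $\overline{\mathcal C}_A\subset\overline{\mathcal C}_{(A)}$ be the full subcategory of systems for which all $\rho$ are isomorphisms. The nerve of a simplicial category is the diagonal of its degreewise nerve; write $N$ for it. *Segal's $K$-theory* is the symmetric spectrum $K^{\mathrm{Seg}}\mathcal C$ with $(K^{\mathrm{Seg}}\mathcal C)(p)=N\overline{\mathcal C}_{S^1\wedge\dots\wedge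 S^1}$ ($p$ factors), with the action of $\Sigma_p$ by permuting the smash factors and the suspension maps induced by $A\cong A\wedge\{0,x\}\to A\wedge S^1_q$ for $x\in S^1_q$. It is functorial for *strong* $1$-morphisms $f$ of permutative categories (those for which the maps $\delta_1$ are isomorphisms). For a permutative category $\mathcal C$ let $J\mathcal C$ be the symmetric functor $J\mathcal C\langle\mathbf n\rangle=\operatorname{colim}_m\overline{\mathcal C}_{(\mathbf n_1,\dots,\mathbf n_m)}$, the colimit being taken along the isomorphisms $\overline{\mathcal C}_{(A_1,\dots,A_m)}\cong\overline{\mathcal C}_{(A_1,\dots,A_m,\mathbf 1)}$ that insert the subset $\{1\}$ in the last place, with $\theta_!$ given by permuting the entries. For a symmetric functor $F$ let $IF$ be the symmetric spectrum of simplicial categories with $IF(p)=F(S^1,\dots,S^1,\mathbf 1,\mathbf 1,\dots)$ (diagonal, $p$ entries $S^1$), with the action of $\Sigma_p$ given by the $\theta_!$, basepoints coming from the terminal category $F(\mathbf 0,\mathbf 1,\mathbf 1,\dots)$, and suspension maps induced by the maps $\mathbf 1\to S^1_q$, $1\mapsto x$, in the position $p+1$. Its nerve $N(IF)$ is a symmetric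 spectrum of simplicial sets. **Theorem.** 1. With the structure described above, the small permutative categories form a multicategory $\mathbf P$ enriched over the category of small categories; the symmetric functors form a multicategory enriched over small categories; and the symmetric spectra form a multicategory enriched over simplicial sets. 2. $\mathcal C\mapsto J\mathcal C$ extends to a multifunctor $J$ enriched over small categories from $\mathbf P$ to symmetric functors, given on a $k$-linear functor $f$ by $$(Jf)_\beta(A_1,\dots,A_k)\langle T\rangle=f\big(A_1\langle T_{\beta(1,j)}\rangle_j,\dots,A_k\langle T_{\beta(k,j)}\rangle_j\big)$$ for every sequence $\langle T\rangle$ whose entries outside the image of $\beta$ are nonempty, with the maps $\rho$ at the place $\beta(i,j)$ given by the composites of $\delta_i$ with $f$ applied to the map $\rho$ of $A_i$ at the place $j$, and given on morphisms by applying $f$, respectively the natural transformations, componentwise. 3. $F\mapsto N(IF)$ extends to a simplicially enriched multifunctor $I$ from symmetric functors (enriched over simplicial sets via nerves) to symmetric spectra, given on $k$-morphisms by $$f_\beta\colon F_1(\underbrace{S^1,\dots,S^1}_{p_1},\mathbf 1,\dots)\times\dots\times F_k(\underbrace{S^1,\dots,S^1}_{p_k},\mathbf 1,\dots)\to G(\underbrace{S^1,\dots,S^1}_{p_1+\dots+p_k},\mathbf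 1,\dots)$$ for any $\beta$ which maps $(1,1),\dots,(1,p_1),\dots,(k,1),\dots,(k,p_k)$ in this order to $1,\dots,p_1+\dots+p_k$, and on higher simplices (diagrams of $k$-morphisms) by applying diagrams of $k$-morphisms to diagrams of objects. 4. The composite $K=I\circ J$ is therefore a simplicially enriched multifunctor from $\mathbf P$ (enriched over simplicial sets via nerves) to symmetric spectra, and its underlying functor is equivalent to Segal's $K$-theory: there are maps of symmetric spectra $K^{\mathrm{Seg}}\mathcal C\to K\mathcal C$, for all small permutative categories $\mathcal C$, which are weak equivalences of simplicial sets in every level $p$ and which are natural with respect to strong $1$-morphisms of permutative categories. -/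

import Mathlib

open CategoryTheory MonoidalCategory Opposite

universe u v w

noncomputable section

namespace MultKTheory

/-! ### Multicategories -/

/-- The data of the multimorphisms on a collection `O` of objects: `H ι a b` stands for the
`ι`-ary morphisms with sources `a i` (`i : ι`) and target `b`. The sources are indexed by an
arbitrary finite set `ι`; for `ι = Fin k` these are the `k`-morphisms `(a₁, …, a_k) ⟶ b`. -/
abbrev MGraph (O : Type u) := ∀ (ι : Type) [Finite ι], (ι → O) → O → Type v

/-- A (symmetric) multicategory with objects `O` and multimorphisms `H`. Bijections of indexing
sets act on the right (for `ι = κ = Fin k` this is the action of the symmetric group `Σ_k`),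
and the multiproduct `Γ (g; f₁, …, f_n)` is `comp g f`, its sources being indexed by the
disjoint union of the indexing sets. Because bijections between different indexing
sets are allowed, block permutations, block sums of permutations and the reassociation of
iterated disjoint unions are all instances of `act`. -/
structure Multicat {O : Type u} (H : MGraph.{u, v} O) where
  act : ∀ {ι κ : Type} [Finite ι] [Finite κ] (e : κ ≃ ι) {a : ι → O} {b : O},
    H ι a b → H κ (fun k => a (e k)) b
  one : ∀ a : O, H Unit (fun _ => a) a
  comp : ∀ {ι : Type} [Finite ι] {κ : ι → Type} [∀ i, Finite (κ i)] {a : ∀ i, κ i → O}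
    {b : ι → O} {c : O}, H ι b c → (∀ i, H (κ i) (a i) (b i)) →
    H (Σ i, κ i) (fun x => a x.1 x.2) c
  act_refl : ∀ {ι : Type} [Finite ι] {a : ι → O} {b : O} (f : H ι a b),
    act (Equiv.refl ι) f = f
  act_trans : ∀ {ι κ μ : Type} [Finite ι] [Finite κ] [Finite μ] (d : μ ≃ κ) (e : κ ≃ ι)
    {a : ι → O} {b : O} (f : H ι a b), act (d.trans e) f = act d (act e f)
  assoc : ∀ {ι : Type} [Finite ι] {κ : ι → Type} [∀ i, Finite (κ i)]
    {μ : ∀ i, κ i → Type} [∀ i k, Finite (μ i k)]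
    {a : ∀ i k, μ i k → O} {b : ∀ i, κ i → O} {c : ι → O} {d : O}
    (g : H ι c d) (f : ∀ i, H (κ i) (b i) (c i)) (h : ∀ i k, H (μ i k) (a i k) (b i k)),
    comp (comp g f) (fun x => h x.1 x.2) =
      act (Equiv.sigmaAssoc μ) (comp g (fun i => comp (f i) (h i)))
  comp_one : ∀ {ι : Type} [Finite ι] {a : ι → O} {b : O} (f : H ι a b),
    comp f (fun i => one (a i)) = act (Equiv.sigmaUnique ι (fun _ => Unit)) f
  one_comp : ∀ {ι : Type} [Finite ι] {a : ι → O} {b : O} (f : H ι a b),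
    comp (one b) (fun _ => f) = act (Equiv.uniqueSigma (fun _ : Unit => ι)) f
  act_comp : ∀ {ι ι' : Type} [Finite ι] [Finite ι'] (e : ι' ≃ ι) {κ : ι → Type}
    [∀ i, Finite (κ i)] {a : ∀ i, κ i → O} {b : ι → O} {c : O}
    (g : H ι b c) (f : ∀ i, H (κ i) (a i) (b i)),
    comp (act e g) (fun i => f (e i)) = act (Equiv.sigmaCongrLeft (β := κ) e) (comp g f)
  comp_act : ∀ {ι : Type} [Finite ι] {κ κ' : ι → Type}
    [∀ i, Finite (κ i)] [∀ i, Finite (κ' i)] (e : ∀ i, κ' i ≃ κ i)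
    {a : ∀ i, κ i → O} {b : ι → O} {c : O}
    (g : H ι b c) (f : ∀ i, H (κ i) (a i) (b i)),
    comp g (fun i => act (e i) (f i)) = act (Equiv.sigmaCongrRight e) (comp g f)

/-- A multicategory enriched over small categories: the multimorphisms form categories, the
actions and the multiproduct are functors, and the identities of a multicategory hold for
these functors, that is, on objects (the fields of `Multicat`) and on morphisms. -/
structure CatMulticat {O : Type u} (H : MGraph.{u, v} O)
    [∀ (ι : Type) [Finite ι] (a : ι → O) (b : O), Category.{v} (H ι a b)]
    extends Multicat H where
  actMap : ∀ {ι κ : Type} [Finite ι] [Finite κ] (e : κ ≃ ι) {a : ι → O} {b : O}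
    {f g : H ι a b}, (f ⟶ g) → (act e f ⟶ act e g)
  compMap : ∀ {ι : Type} [Finite ι] {κ : ι → Type} [∀ i, Finite (κ i)] {a : ∀ i, κ i → O}
    {b : ι → O} {c : O} {g g' : H ι b c} {f f' : ∀ i, H (κ i) (a i) (b i)},
    (g ⟶ g') → (∀ i, f i ⟶ f' i) → (comp g f ⟶ comp g' f')
  actMap_id : ∀ {ι κ : Type} [Finite ι] [Finite κ] (e : κ ≃ ι) {a : ι → O} {b : O}
    (f : H ι a b), actMap e (𝟙 f) = 𝟙 (act e f)
  actMap_comp : ∀ {ι κ : Type} [Finite ι] [Finite κ] (e : κ ≃ ι) {a : ι → O} {b : O}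
    {f g h : H ι a b} (φ : f ⟶ g) (ψ : g ⟶ h), actMap e (φ ≫ ψ) = actMap e φ ≫ actMap e ψ
  compMap_id : ∀ {ι : Type} [Finite ι] {κ : ι → Type} [∀ i, Finite (κ i)]
    {a : ∀ i, κ i → O} {b : ι → O} {c : O} (g : H ι b c) (f : ∀ i, H (κ i) (a i) (b i)),
    compMap (𝟙 g) (fun i => 𝟙 (f i)) = 𝟙 (comp g f)
  compMap_comp : ∀ {ι : Type} [Finite ι] {κ : ι → Type} [∀ i, Finite (κ i)]
    {a : ∀ i, κ i → O} {b : ι → O} {c : O} {g g' g'' : H ι b c}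
    {f f' f'' : ∀ i, H (κ i) (a i) (b i)} (γ : g ⟶ g') (γ' : g' ⟶ g'')
    (φ : ∀ i, f i ⟶ f' i) (φ' : ∀ i, f' i ⟶ f'' i),
    compMap (γ ≫ γ') (fun i => φ i ≫ φ' i) = compMap γ φ ≫ compMap γ' φ'
  actMap_refl : ∀ {ι : Type} [Finite ι] {a : ι → O} {b : O} {f g : H ι a b} (φ : f ⟶ g),
    HEq (actMap (Equiv.refl ι) φ) φ
  actMap_trans : ∀ {ι κ μ : Type} [Finite ι] [Finite κ] [Finite μ] (d : μ ≃ κ) (e : κ ≃ ι)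
    {a : ι → O} {b : O} {f g : H ι a b} (φ : f ⟶ g),
    HEq (actMap (d.trans e) φ) (actMap d (actMap e φ))
  assocMap : ∀ {ι : Type} [Finite ι] {κ : ι → Type} [∀ i, Finite (κ i)]
    {μ : ∀ i, κ i → Type} [∀ i k, Finite (μ i k)]
    {a : ∀ i k, μ i k → O} {b : ∀ i, κ i → O} {c : ι → O} {d : O}
    {g g' : H ι c d} {f f' : ∀ i, H (κ i) (b i) (c i)}
    {h h' : ∀ i k, H (μ i k) (a i k) (b i k)}
    (γ : g ⟶ g') (φ : ∀ i, f i ⟶ f' i) (χ : ∀ i k, h i k ⟶ h' i k),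
    HEq (compMap (f := fun x : Σ i, κ i => h x.1 x.2) (f' := fun x => h' x.1 x.2)
        (compMap γ φ) (fun x => χ x.1 x.2))
      (actMap (Equiv.sigmaAssoc μ) (compMap γ (fun i => compMap (φ i) (χ i))))
  compMap_one : ∀ {ι : Type} [Finite ι] {a : ι → O} {b : O} {f g : H ι a b} (φ : f ⟶ g),
    HEq (compMap φ (fun i => 𝟙 (one (a i))))
      (actMap (Equiv.sigmaUnique ι (fun _ => Unit)) φ)
  one_compMap : ∀ {ι : Type} [Finite ι] {a : ι → O} {b : O} {f g : H ι a b} (φ : f ⟶ g),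
    HEq (compMap (𝟙 (one b)) (fun _ => φ)) (actMap (Equiv.uniqueSigma (fun _ : Unit => ι)) φ)
  actMap_compMap : ∀ {ι ι' : Type} [Finite ι] [Finite ι'] (e : ι' ≃ ι) {κ : ι → Type}
    [∀ i, Finite (κ i)] {a : ∀ i, κ i → O} {b : ι → O} {c : O}
    {g g' : H ι b c} {f f' : ∀ i, H (κ i) (a i) (b i)} (γ : g ⟶ g') (φ : ∀ i, f i ⟶ f' i),
    HEq (compMap (actMap e γ) (fun i => φ (e i)))
      (actMap (Equiv.sigmaCongrLeft (β := κ) e) (compMap γ φ))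
  compMap_actMap : ∀ {ι : Type} [Finite ι] {κ κ' : ι → Type}
    [∀ i, Finite (κ i)] [∀ i, Finite (κ' i)] (e : ∀ i, κ' i ≃ κ i)
    {a : ∀ i, κ i → O} {b : ι → O} {c : O}
    {g g' : H ι b c} {f f' : ∀ i, H (κ i) (a i) (b i)} (γ : g ⟶ g') (φ : ∀ i, f i ⟶ f' i),
    HEq (compMap γ (fun i => actMap (e i) (φ i)))
      (actMap (Equiv.sigmaCongrRight e) (compMap γ φ))

/-- The data of simplicial sets of multimorphisms on a collection of objects. -/
abbrev SGraph (O : Type u) := ∀ (ι : Type) [Finite ι], (ι → O) → O → SSet.{v}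

/-- A multicategory enriched over simplicial sets: in each simplicial degree the simplices of
the simplicial sets of multimorphisms form a multicategory, and the actions, the units and
the multiproducts are maps of simplicial sets. -/
structure SMulticat {O : Type u} (H : SGraph.{u, v} O) where
  lvl : ∀ d : SimplexCategoryᵒᵖ, Multicat (fun ι _ a b => (H ι a b).obj d)
  act_nat : ∀ {d d' : SimplexCategoryᵒᵖ} (θ : d ⟶ d') {ι κ : Type} [Finite ι] [Finite κ]
    (e : κ ≃ ι) {a : ι → O} {b : O} (f : (H ι a b).obj d),
    (H _ _ _).map θ ((lvl d).act e f) = (lvl d').act e ((H _ _ _).map θ f)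
  one_nat : ∀ {d d' : SimplexCategoryᵒᵖ} (θ : d ⟶ d') (a : O),
    (H _ _ _).map θ ((lvl d).one a) = (lvl d').one a
  comp_nat : ∀ {d d' : SimplexCategoryᵒᵖ} (θ : d ⟶ d') {ι : Type} [Finite ι] {κ : ι → Type}
    [∀ i, Finite (κ i)] {a : ∀ i, κ i → O} {b : ι → O} {c : O} (g : (H ι b c).obj d)
    (f : ∀ i, (H (κ i) (a i) (b i)).obj d),
    (H _ _ _).map θ ((lvl d).comp g f) =
      (lvl d').comp ((H _ _ _).map θ g) (fun i => (H _ _ _).map θ (f i))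

section CatNerve

variable {O : Type u} {H : MGraph.{u, v} O}
  [∀ (ι : Type) [Finite ι] (a : ι → O) (b : O), Category.{v} (H ι a b)]

/-- The action of a bijection as a functor. -/
def CatMulticat.actF (M : CatMulticat H) {ι κ : Type} [Finite ι] [Finite κ] (e : κ ≃ ι)
    (a : ι → O) (b : O) : H ι a b ⥤ H κ (fun k => a (e k)) b where
  obj f := M.act e f
  map φ := M.actMap e φ
  map_id f := M.actMap_id e f
  map_comp φ ψ := M.actMap_comp e φ ψ

/-- The multiproduct applied to diagrams of shape `J`. -/
def CatMulticat.compF (M : CatMulticat H) {J : Type} [SmallCategory J] {ι : Type} [Finite ι]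
    {κ : ι → Type} [∀ i, Finite (κ i)] {a : ∀ i, κ i → O} {b : ι → O} {c : O}
    (g : J ⥤ H ι b c) (f : ∀ i, J ⥤ H (κ i) (a i) (b i)) :
    J ⥤ H (Σ i, κ i) (fun x => a x.1 x.2) c where
  obj t := M.comp (g.obj t) (fun i => (f i).obj t)
  map s := M.compMap (g.map s) (fun i => (f i).map s)
  map_id t := by
    have h : (fun i => (f i).map (𝟙 t)) = fun i => 𝟙 ((f i).obj t) :=
      funext fun i => (f i).map_id t
    rw [h, g.map_id]
    exact M.compMap_id _ _
  map_comp s t := by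
    have h : (fun i => (f i).map (s ≫ t)) = fun i => (f i).map s ≫ (f i).map t :=
      funext fun i => (f i).map_comp s t
    rw [h, g.map_comp]
    exact M.compMap_comp _ _ _ _

/-- The simplicial sets of multimorphisms of a multicategory enriched over categories. -/
abbrev nerveGraph (H : MGraph.{u, v} O)
    [∀ (ι : Type) [Finite ι] (a : ι → O) (b : O), Category.{v} (H ι a b)] : SGraph.{u, v} O :=
  fun ι _ a b => nerve (H ι a b)

/-- A multicategory enriched over small categories, considered as a multicategory enriched
over simplicial sets via the nerve. -/
def CatMulticat.nerve (M : CatMulticat H) : SMulticat (nerveGraph H) where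
  lvl _ :=
    { act := fun {_ _} _ _ e {a} {b} f => f ⋙ M.actF e a b
      one := fun a => (Functor.const _).obj (M.one a)
      comp := fun g f => M.compF g f
      act_refl := fun f => Functor.hext (fun t => M.act_refl (f.obj t))
        (fun _ _ s => M.actMap_refl (f.map s))
      act_trans := fun d' e _ _ _ =>
        Functor.hext (fun _ => M.act_trans d' e _) (fun _ _ _ => M.actMap_trans d' e _)
      assoc := fun g f h => Functor.hext
        (fun _ => M.assoc _ (fun i => (f i).obj _) (fun i k => (h i k).obj _))
        (fun _ _ s => M.assocMap (g.map s) (fun i => (f i).map s) (fun i k => (h i k).map s))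
      comp_one := fun f => Functor.hext (fun t => M.comp_one (f.obj t))
        (fun _ _ s => M.compMap_one (f.map s))
      one_comp := fun f => Functor.hext (fun t => M.one_comp (f.obj t))
        (fun _ _ s => M.one_compMap (f.map s))
      act_comp := fun e _ _ _ _ _ g f => Functor.hext
        (fun _ => M.act_comp e _ (fun i => (f i).obj _))
        (fun _ _ s => M.actMap_compMap e (g.map s) (fun i => (f i).map s))
      comp_act := fun e _ _ _ g f => Functor.hext
        (fun _ => M.comp_act e _ (fun i => (f i).obj _))
        (fun _ _ s => M.compMap_actMap e (g.map s) (fun i => (f i).map s)) }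
  act_nat _ _ _ _ _ _ _ _ _ := rfl
  one_nat _ _ := rfl
  comp_nat _ _ _ _ _ _ _ _ _ _ := rfl

end CatNerve

/-- An (enriched) multifunctor between multicategories enriched over small categories, given
on objects by `obj`. -/
structure CatMultifunctor {O : Type u} {H : MGraph.{u, v} O}
    [∀ (ι : Type) [Finite ι] (a : ι → O) (b : O), Category.{v} (H ι a b)]
    {O' : Type u} {H' : MGraph.{u, v} O'}
    [∀ (ι : Type) [Finite ι] (a : ι → O') (b : O'), Category.{v} (H' ι a b)]
    (M : CatMulticat H) (M' : CatMulticat H') (obj : O → O') where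
  fn : ∀ {ι : Type} [Finite ι] (a : ι → O) (b : O), H ι a b ⥤ H' ι (fun i => obj (a i)) (obj b)
  fn_act : ∀ {ι κ : Type} [Finite ι] [Finite κ] (e : κ ≃ ι) {a : ι → O} {b : O} (f : H ι a b),
    (fn _ b).obj (M.act e f) = M'.act e ((fn a b).obj f)
  fn_actMap : ∀ {ι κ : Type} [Finite ι] [Finite κ] (e : κ ≃ ι) {a : ι → O} {b : O}
    {f g : H ι a b} (φ : f ⟶ g),
    HEq ((fn _ b).map (M.actMap e φ)) (M'.actMap e ((fn a b).map φ))
  fn_one : ∀ a : O, (fn (fun _ : Unit => a) a).obj (M.one a) = M'.one (obj a)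
  fn_comp : ∀ {ι : Type} [Finite ι] {κ : ι → Type} [∀ i, Finite (κ i)] {a : ∀ i, κ i → O}
    {b : ι → O} {c : O} (g : H ι b c) (f : ∀ i, H (κ i) (a i) (b i)),
    (fn _ c).obj (M.comp g f) = M'.comp ((fn b c).obj g) (fun i => (fn (a i) (b i)).obj (f i))
  fn_compMap : ∀ {ι : Type} [Finite ι] {κ : ι → Type} [∀ i, Finite (κ i)] {a : ∀ i, κ i → O}
    {b : ι → O} {c : O} {g g' : H ι b c} {f f' : ∀ i, H (κ i) (a i) (b i)}
    (γ : g ⟶ g') (φ : ∀ i, f i ⟶ f' i),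
    HEq ((fn _ c).map (M.compMap γ φ))
      (M'.compMap ((fn b c).map γ) (fun i => (fn (a i) (b i)).map (φ i)))

/-- An (enriched) multifunctor between multicategories enriched over simplicial sets, given
on objects by `obj`. -/
structure SMultifunctor {O : Type u} {H : SGraph.{u, v} O} {O' : Type u}
    {H' : SGraph.{u, v} O'} (M : SMulticat H) (M' : SMulticat H') (obj : O → O') where
  fn : ∀ {ι : Type} [Finite ι] (a : ι → O) (b : O), H ι a b ⟶ H' ι (fun i => obj (a i)) (obj b)
  fn_act : ∀ (d : SimplexCategoryᵒᵖ) {ι κ : Type} [Finite ι] [Finite κ] (e : κ ≃ ι)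
    {a : ι → O} {b : O} (f : (H ι a b).obj d),
    (fn _ b).app d ((M.lvl d).act e f) = (M'.lvl d).act e ((fn a b).app d f)
  fn_one : ∀ (d : SimplexCategoryᵒᵖ) (a : O),
    (fn (fun _ : Unit => a) a).app d ((M.lvl d).one a) = (M'.lvl d).one (obj a)
  fn_comp : ∀ (d : SimplexCategoryᵒᵖ) {ι : Type} [Finite ι] {κ : ι → Type}
    [∀ i, Finite (κ i)] {a : ∀ i, κ i → O} {b : ι → O} {c : O} (g : (H ι b c).obj d)
    (f : ∀ i, (H (κ i) (a i) (b i)).obj d),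
    (fn _ c).app d ((M.lvl d).comp g f) =
      (M'.lvl d).comp ((fn b c).app d g) (fun i => (fn (a i) (b i)).app d (f i))

/-- The composite of two simplicial multifunctors. -/
def SMultifunctor.comp {O : Type u} {H : SGraph.{u, v} O} {O' : Type u}
    {H' : SGraph.{u, v} O'} {O'' : Type u} {H'' : SGraph.{u, v} O''}
    {M : SMulticat H} {M' : SMulticat H'} {M'' : SMulticat H''} {obj : O → O'}
    {obj' : O' → O''} (F : SMultifunctor M M' obj) (G : SMultifunctor M' M'' obj') :
    SMultifunctor M M'' (fun a => obj' (obj a)) where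
  fn a b := F.fn a b ≫ G.fn _ _
  fn_act d _ _ _ _ e a _ f := (congrArg _ (F.fn_act d e f)).trans
    (G.fn_act (a := fun i => obj (a i)) d e ((F.fn _ _).app d f))
  fn_one d a := (congrArg _ (F.fn_one d a)).trans (G.fn_one d _)
  fn_comp d _ _ _ _ a _ _ g f := (congrArg _ (F.fn_comp d g f)).trans
    (G.fn_comp (a := fun i k => obj (a i k)) d ((F.fn _ _).app d g)
      (fun i => (F.fn _ _).app d (f i)))

/-- A multifunctor enriched over small categories induces one enriched over simplicial sets. -/
def CatMultifunctor.nerve {O : Type u} {H : MGraph.{u, v} O}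
    [∀ (ι : Type) [Finite ι] (a : ι → O) (b : O), Category.{v} (H ι a b)]
    {O' : Type u} {H' : MGraph.{u, v} O'}
    [∀ (ι : Type) [Finite ι] (a : ι → O') (b : O'), Category.{v} (H' ι a b)]
    {M : CatMulticat H} {M' : CatMulticat H'} {obj : O → O'} (F : CatMultifunctor M M' obj) :
    SMultifunctor M.nerve M'.nerve obj where
  fn a b := nerveMap (F.fn a b)
  fn_act d _ _ _ _ e _ _ f :=
    Functor.hext (fun t => F.fn_act e (f.obj t)) (fun _ _ s => F.fn_actMap e (f.map s))
  fn_one d a := Functor.hext (fun _ => F.fn_one a) (fun _ _ _ => by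
    have h : HEq ((F.fn _ a).map (𝟙 (M.one a))) (𝟙 (M'.one (obj a))) := by
      rw [(F.fn _ a).map_id, F.fn_one]
    exact h)
  fn_comp d _ _ _ _ _ _ _ g f := Functor.hext
    (fun t => F.fn_comp (g.obj t) (fun i => (f i).obj t))
    (fun _ _ s => F.fn_compMap (g.map s) (fun i => (f i).map s))

/-! ### The multicategory of permutative categories -/

/-- A permutative category is a symmetric monoidal category, written `(⊗, 𝟙_)` below instead
of `(⊕, 0)`, which is strictly associative and strictly unital: the associator and the unitors
are identities. -/
class Permutative (C : Type u) [Category.{v} C] [MonoidalCategory C] : Prop where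
  assoc : ∀ x y z : C, (x ⊗ y) ⊗ z = x ⊗ (y ⊗ z)
  unit_left : ∀ x : C, 𝟙_ C ⊗ x = x
  unit_right : ∀ x : C, x ⊗ 𝟙_ C = x
  associator_eq : ∀ x y z : C, (α_ x y z).hom = eqToHom (assoc x y z)
  leftUnitor_eq : ∀ x : C, (λ_ x).hom = eqToHom (unit_left x)
  rightUnitor_eq : ∀ x : C, (ρ_ x).hom = eqToHom (unit_right x)

/-- A small permutative category. -/
structure PermCat where
  carrier : Type u
  [cat : SmallCategory carrier]
  [mon : MonoidalCategory carrier]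
  [symm : SymmetricCategory carrier]
  [perm : Permutative carrier]

instance : CoeSort PermCat.{u} (Type u) := ⟨PermCat.carrier⟩

attribute [instance] PermCat.cat PermCat.mon PermCat.symm PermCat.perm

section MultiLin

variable {ι : Type} {C : ι → PermCat.{u}}

/-- `z` is obtained from `x` and `y` by addition in the `i`-th variable: `x`, `y`, `z` agree
outside `i`, and `z i = x i ⊕ y i`. -/
def IsSum (i : ι) (x y z : ∀ j, C j) : Prop :=
  z i = x i ⊗ y i ∧ ∀ j, j ≠ i → y j = x j ∧ z j = x j

/-- The same for morphisms. -/
def IsSumHom (i : ι) {x y z x' y' z' : ∀ j, C j} (φ : x ⟶ x') (ψ : y ⟶ y') (χ : z ⟶ z') :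
    Prop :=
  HEq (χ i) (φ i ⊗ₘ ψ i) ∧ ∀ j, j ≠ i → HEq (ψ j) (φ j) ∧ HEq (χ j) (φ j)

/-- `χ` is the morphism of tuples given by `f` in the `i`-th variable and by the identity in
all other variables. -/
def IsSingle (i : ι) {x y : ∀ j, C j} {a b : C i} (f : a ⟶ b) (χ : x ⟶ y) : Prop :=
  x i = a ∧ y i = b ∧ HEq (χ i) f ∧ ∀ j, j ≠ i → y j = x j ∧ HEq (χ j) (𝟙 (x j))

/-- A multilinear functor `∏ C i ⥤ D`: a functor `F` which is zero (on objects and on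
morphisms) when one of the variables is zero, with lax distributivity maps
`δ i : F (x) ⊕ F (y) ⟶ F (z)`, where `z` arises from `x` and `y` by addition in the `i`-th
variable. -/
@[ext]
structure MultiLin (C : ι → PermCat.{u}) (D : PermCat.{u}) where
  F : (∀ i, C i) ⥤ D
  F_zero : ∀ (i : ι) (x : ∀ i, C i), x i = 𝟙_ (C i) → F.obj x = 𝟙_ D
  F_map_zero : ∀ (i : ι) (x y : ∀ i, C i) (φ : x ⟶ y), x i = 𝟙_ (C i) → y i = 𝟙_ (C i) →
    HEq (φ i) (𝟙 (𝟙_ (C i))) → HEq (F.map φ) (𝟙 (𝟙_ D))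
  δ : ∀ (i : ι) (x y z : ∀ i, C i), IsSum i x y z → (F.obj x ⊗ F.obj y ⟶ F.obj z)
  δ_nat : ∀ (i : ι) (x y z x' y' z' : ∀ i, C i) (h : IsSum i x y z) (h' : IsSum i x' y' z')
    (φ : x ⟶ x') (ψ : y ⟶ y') (χ : z ⟶ z'), IsSumHom i φ ψ χ →
    (F.map φ ⊗ₘ F.map ψ) ≫ δ i x' y' z' h' = δ i x y z h ≫ F.map χ
  δ_id : ∀ (i : ι) (x y z : ∀ i, C i) (h : IsSum i x y z),
    (y i = 𝟙_ (C i) ∨ ∃ j, x j = 𝟙_ (C j)) → HEq (δ i x y z h) (𝟙 (F.obj z))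
  δ_symm : ∀ (i : ι) (x y z z' : ∀ i, C i) (h : IsSum i x y z) (h' : IsSum i y x z')
    (χ : z ⟶ z'), IsSingle i (β_ (x i) (y i)).hom χ →
    δ i x y z h ≫ F.map χ = (β_ (F.obj x) (F.obj y)).hom ≫ δ i y x z' h'
  δ_assoc : ∀ (i : ι) (x y z xy yz w : ∀ i, C i) (h₁ : IsSum i x y xy) (h₂ : IsSum i xy z w)
    (h₃ : IsSum i y z yz) (h₄ : IsSum i x yz w),
    (δ i x y xy h₁ ▷ F.obj z) ≫ δ i xy z w h₂ =
      (α_ (F.obj x) (F.obj y) (F.obj z)).hom ≫ (F.obj x ◁ δ i y z yz h₃) ≫ δ i x yz w h₄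
  δ_exch : ∀ (i j : ι), i ≠ j → ∀ (a b c d ab cd ac bd t : ∀ i, C i)
    (h₁ : IsSum i a b ab) (h₂ : IsSum i c d cd) (h₃ : IsSum j ab cd t)
    (h₄ : IsSum j a c ac) (h₅ : IsSum j b d bd) (h₆ : IsSum i ac bd t),
    (δ i a b ab h₁ ⊗ₘ δ i c d cd h₂) ≫ δ j ab cd t h₃ =
      tensorμ (F.obj a) (F.obj b) (F.obj c) (F.obj d) ≫
        (δ j a c ac h₄ ⊗ₘ δ j b d bd h₅) ≫ δ i ac bd t h₆

/-- Morphisms of multilinear functors: natural transformations which commute with the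
distributivity maps and are the identity of `0` when one of the variables is zero. -/
@[ext]
structure MultiLin.Hom {D : PermCat.{u}} (f g : MultiLin C D) where
  nat : f.F ⟶ g.F
  zero : ∀ (i : ι) (x : ∀ i, C i), x i = 𝟙_ (C i) → HEq (nat.app x) (𝟙 (𝟙_ D))
  comm : ∀ (i : ι) (x y z : ∀ i, C i) (h : IsSum i x y z),
    f.δ i x y z h ≫ nat.app z = (nat.app x ⊗ₘ nat.app y) ≫ g.δ i x y z h

instance {D : PermCat.{u}} : Category.{u} (MultiLin C D) where
  Hom f g := MultiLin.Hom f g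
  id f :=
    { nat := 𝟙 _
      zero := fun i x h => by
        rw [NatTrans.id_app, f.F_zero i x h]
      comm := fun i x y z h => by simp }
  comp φ ψ :=
    { nat := φ.nat ≫ ψ.nat
      zero := fun i x h => by
        have h₁ := φ.zero i x h
        have h₂ := ψ.zero i x h
        rw [NatTrans.comp_app]
        revert h₁ h₂
        generalize φ.nat.app x = p
        generalize ψ.nat.app x = q
        revert p q
        rw [MultiLin.F_zero _ i x h, MultiLin.F_zero _ i x h, MultiLin.F_zero _ i x h]
        intro p q h₁ h₂
        rw [eq_of_heq h₁, eq_of_heq h₂, Category.comp_id]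
      comm := fun i x y z h => by
        rw [NatTrans.comp_app, ← Category.assoc, φ.comm, Category.assoc, ψ.comm]
        simp }
  id_comp φ := MultiLin.Hom.ext (Category.id_comp φ.nat)
  comp_id φ := MultiLin.Hom.ext (Category.comp_id φ.nat)
  assoc φ ψ χ := MultiLin.Hom.ext (Category.assoc φ.nat ψ.nat χ.nat)

end MultiLin

/-- The categories of `k`-morphisms of permutative categories. -/
abbrev permGraph : MGraph.{u + 1, u} PermCat.{u} := fun _ _ C D => MultiLin C D

/-- `P` is *the* multicategory of permutative categories: the actions, the units and the
multiproducts are given by the standard formulas. -/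
structure IsPermMulticat (P : CatMulticat permGraph.{u}) : Prop where
  /-- `(σ^* f) (c_{σ 1}, …, c_{σ k}) = f (c_1, …, c_k)`, with the distributivity maps of `f`. -/
  act_obj : ∀ {ι κ : Type} [Finite ι] [Finite κ] (e : κ ≃ ι) {C : ι → PermCat.{u}}
    {D : PermCat.{u}} (f : MultiLin C D) (x : ∀ i, C i),
    (P.act e f).F.obj (fun k => x (e k)) = f.F.obj x
  act_map : ∀ {ι κ : Type} [Finite ι] [Finite κ] (e : κ ≃ ι) {C : ι → PermCat.{u}}
    {D : PermCat.{u}} (f : MultiLin C D) (x y : ∀ i, C i) (φ : x ⟶ y),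
    HEq ((P.act e f).F.map (X := fun k => x (e k)) (Y := fun k => y (e k)) (fun k => φ (e k)))
      (f.F.map φ)
  act_δ : ∀ {ι κ : Type} [Finite ι] [Finite κ] (e : κ ≃ ι) {C : ι → PermCat.{u}}
    {D : PermCat.{u}} (f : MultiLin C D) (k : κ) (x y z : ∀ i, C i)
    (h : IsSum (e k) x y z)
    (h' : IsSum (C := fun k => C (e k)) k (fun k => x (e k)) (fun k => y (e k))
      (fun k => z (e k))),
    HEq ((P.act e f).δ k _ _ _ h') (f.δ (e k) x y z h)
  actMap_app : ∀ {ι κ : Type} [Finite ι] [Finite κ] (e : κ ≃ ι) {C : ι → PermCat.{u}}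
    {D : PermCat.{u}} {f g : MultiLin C D} (φ : f ⟶ g) (x : ∀ i, C i),
    HEq ((P.actMap e φ).nat.app (fun k => x (e k))) (φ.nat.app x)
  /-- The unit is the identity functor with identity distributivity maps. -/
  one_obj : ∀ (C : PermCat.{u}) (x : ∀ _ : Unit, C), (P.one C).F.obj x = x ()
  one_map : ∀ (C : PermCat.{u}) (x y : ∀ _ : Unit, C) (φ : x ⟶ y),
    HEq ((P.one C).F.map φ) (φ ())
  one_δ : ∀ (C : PermCat.{u}) (x y z : ∀ _ : Unit, C)
    (h : IsSum (C := fun _ : Unit => C) () x y z), HEq ((P.one C).δ () x y z h) (𝟙 (z ()))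
  /-- `Γ (g; f_1, …, f_n) = g ∘ (f_1 × ⋯ × f_n)`. -/
  comp_obj : ∀ {ι : Type} [Finite ι] {κ : ι → Type} [∀ i, Finite (κ i)]
    {C : ∀ i, κ i → PermCat.{u}} {D : ι → PermCat.{u}} {E : PermCat.{u}} (g : MultiLin D E)
    (f : ∀ i, MultiLin (C i) (D i)) (x : ∀ s : Σ i, κ i, C s.1 s.2),
    (P.comp g f).F.obj x = g.F.obj (fun i => (f i).F.obj (fun k => x ⟨i, k⟩))
  comp_map : ∀ {ι : Type} [Finite ι] {κ : ι → Type} [∀ i, Finite (κ i)]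
    {C : ∀ i, κ i → PermCat.{u}} {D : ι → PermCat.{u}} {E : PermCat.{u}} (g : MultiLin D E)
    (f : ∀ i, MultiLin (C i) (D i)) (x y : ∀ s : Σ i, κ i, C s.1 s.2) (φ : x ⟶ y),
    HEq ((P.comp g f).F.map φ)
      (g.F.map (X := fun i => (f i).F.obj (fun k => x ⟨i, k⟩))
        (Y := fun i => (f i).F.obj (fun k => y ⟨i, k⟩))
        (fun i => (f i).F.map (X := fun k => x ⟨i, k⟩) (Y := fun k => y ⟨i, k⟩)
          (fun k => φ ⟨i, k⟩)))
  /-- The distributivity map of the composite in the variable `⟨i, k⟩` is the composite of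
  `δ i` for `g` and of `g` applied to `δ k` for `f i`. -/
  comp_δ : ∀ {ι : Type} [Finite ι] {κ : ι → Type} [∀ i, Finite (κ i)]
    {C : ∀ i, κ i → PermCat.{u}} {D : ι → PermCat.{u}} {E : PermCat.{u}} (g : MultiLin D E)
    (f : ∀ i, MultiLin (C i) (D i)) (i : ι) (k : κ i) (x y z : ∀ s : Σ i, κ i, C s.1 s.2)
    (h : IsSum (C := fun s : Σ i, κ i => C s.1 s.2) ⟨i, k⟩ x y z)
    (h' : IsSum (C := C i) k (fun k => x ⟨i, k⟩) (fun k => y ⟨i, k⟩) (fun k => z ⟨i, k⟩))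
    (w : ∀ i, D i)
    (hw : IsSum i (fun i => (f i).F.obj (fun k => x ⟨i, k⟩))
      (fun i => (f i).F.obj (fun k => y ⟨i, k⟩)) w)
    (χ : w ⟶ fun i => (f i).F.obj (fun k => z ⟨i, k⟩)),
    IsSingle i ((f i).δ k _ _ _ h') χ →
    HEq ((P.comp g f).δ ⟨i, k⟩ x y z h) (g.δ i _ _ w hw ≫ g.F.map χ)
  compMap_app : ∀ {ι : Type} [Finite ι] {κ : ι → Type} [∀ i, Finite (κ i)]
    {C : ∀ i, κ i → PermCat.{u}} {D : ι → PermCat.{u}} {E : PermCat.{u}}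
    {g g' : MultiLin D E} {f f' : ∀ i, MultiLin (C i) (D i)} (γ : g ⟶ g')
    (φ : ∀ i, f i ⟶ f' i) (x : ∀ s : Σ i, κ i, C s.1 s.2),
    HEq ((P.compMap γ φ).nat.app x)
      (g.F.map (X := fun i => (f i).F.obj (fun k => x ⟨i, k⟩))
          (Y := fun i => (f' i).F.obj (fun k => x ⟨i, k⟩))
          (fun i => (φ i).nat.app (fun k => x ⟨i, k⟩)) ≫
        γ.nat.app (fun i => (f' i).F.obj (fun k => x ⟨i, k⟩)))

/-! ### Systems of objects indexed by tuples of subsets -/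

section Bar

variable {I : Type} {X : I → Type} {J : Type} {Y : J → Type} {K : Type} {Z : K → Type}

/-- Tuples of subsets `S i ⊆ A i`. Here and below a finite based set is given by the
set `A i` of its elements different from the basepoint, inside of an ambient type `X i`. -/
def Tup (A : ∀ i, Set (X i)) := {S : ∀ i, Set (X i) // ∀ i, S i ⊆ A i}

/-- `S i` is the disjoint union of `T i` and `U i`, and `S`, `T`, `U` agree outside `i`. -/
def IsSplit {A : ∀ i, Set (X i)} (i : I) (T U S : Tup A) : Prop :=
  T.1 i ∪ U.1 i = S.1 i ∧ Disjoint (T.1 i) (U.1 i) ∧ ∀ j, j ≠ i → U.1 j = T.1 j ∧ S.1 j = T.1 j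

theorem IsSplit.symm {A : ∀ i, Set (X i)} {i : I} {T U S : Tup A} (h : IsSplit i T U S) :
    IsSplit i U T S :=
  ⟨by rw [Set.union_comm]; exact h.1, h.2.1.symm, fun j hj =>
    ⟨(h.2.2 j hj).1.symm, (h.2.2 j hj).2.trans (h.2.2 j hj).1.symm⟩⟩

/-- The objects of the category `C̄_(A_1, …, A_n)`: systems of objects `C S` of a permutative
category, indexed by tuples of subsets, with compatible morphisms
`ρ : C T ⊕ C U ⟶ C S` whenever `S` is split in the `i`-th coordinate into `T` and `U`. -/
@[ext]
structure Bar (D : PermCat.{u}) (A : ∀ i, Set (X i)) where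
  C : Tup A → D
  ρ : ∀ (i : I) (T U S : Tup A), IsSplit i T U S → (C T ⊗ C U ⟶ C S)
  C_empty : ∀ (k : I) (S : Tup A), S.1 k = ∅ → C S = 𝟙_ D
  ρ_id : ∀ (i : I) (T U S : Tup A) (h : IsSplit i T U S),
    (T.1 i = ∅ ∨ U.1 i = ∅ ∨ ∃ k, S.1 k = ∅) → HEq (ρ i T U S h) (𝟙 (C S))
  ρ_symm : ∀ (i : I) (T U S : Tup A) (h : IsSplit i T U S) (h' : IsSplit i U T S),
    ρ i T U S h = (β_ (C T) (C U)).hom ≫ ρ i U T S h'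
  ρ_assoc : ∀ (i : I) (T U V TU UV S : Tup A) (h₁ : IsSplit i T U TU) (h₂ : IsSplit i TU V S)
    (h₃ : IsSplit i U V UV) (h₄ : IsSplit i T UV S),
    (ρ i T U TU h₁ ▷ C V) ≫ ρ i TU V S h₂ =
      (α_ (C T) (C U) (C V)).hom ≫ (C T ◁ ρ i U V UV h₃) ≫ ρ i T UV S h₄
  ρ_exch : ∀ (i j : I), i ≠ j → ∀ (TV UV TW UW V W T U S : Tup A)
    (h₁ : IsSplit i TV UV V) (h₂ : IsSplit i TW UW W) (h₃ : IsSplit j V W S)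
    (h₄ : IsSplit j TV TW T) (h₅ : IsSplit j UV UW U) (h₆ : IsSplit i T U S),
    (ρ i TV UV V h₁ ⊗ₘ ρ i TW UW W h₂) ≫ ρ j V W S h₃ =
      tensorμ (C TV) (C UV) (C TW) (C UW) ≫
        (ρ j TV TW T h₄ ⊗ₘ ρ j UV UW U h₅) ≫ ρ i T U S h₆

variable {A : ∀ i, Set (X i)} {B : ∀ j, Set (Y j)} {E : ∀ k, Set (Z k)}

/-- Morphisms of systems. -/
@[ext]
structure Bar.Hom {D : PermCat.{u}} (a b : Bar D A) where
  f : ∀ S : Tup A, a.C S ⟶ b.C S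
  f_empty : ∀ (k : I) (S : Tup A), S.1 k = ∅ → HEq (f S) (𝟙 (𝟙_ D))
  comm : ∀ (i : I) (T U S : Tup A) (h : IsSplit i T U S),
    a.ρ i T U S h ≫ f S = (f T ⊗ₘ f U) ≫ b.ρ i T U S h

instance {D : PermCat.{u}} : Category.{u} (Bar D A) where
  Hom a b := Bar.Hom a b
  id a :=
    { f := fun S => 𝟙 _
      f_empty := fun k S h => by rw [a.C_empty k S h]
      comm := fun i T U S h => by simp }
  comp {a b c} φ ψ :=
    { f := fun S => φ.f S ≫ ψ.f S
      f_empty := fun k S h => by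
        have h₁ := φ.f_empty k S h
        have h₂ := ψ.f_empty k S h
        revert h₁ h₂
        generalize φ.f S = p
        generalize ψ.f S = q
        revert p q
        rw [a.C_empty k S h, b.C_empty k S h, c.C_empty k S h]
        intro p q h₁ h₂
        rw [eq_of_heq h₁, eq_of_heq h₂, Category.comp_id]
      comm := fun i T U S h => by
        rw [← Category.assoc, φ.comm, Category.assoc, ψ.comm]
        simp }
  id_comp φ := Bar.Hom.ext (funext fun S => Category.id_comp (φ.f S))
  comp_id φ := Bar.Hom.ext (funext fun S => Category.comp_id (φ.f S))
  assoc φ ψ χ := Bar.Hom.ext (funext fun S => Category.assoc (φ.f S) (ψ.f S) (χ.f S))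

/-- An operation on tuples of subsets along which systems can be reindexed. -/
structure BarMap (A : ∀ i, Set (X i)) (B : ∀ j, Set (Y j)) where
  Φ : Tup B → Tup A
  idx : J → I
  inj : Function.Injective idx
  split : ∀ (j : J) (T U S : Tup B), IsSplit j T U S → IsSplit (idx j) (Φ T) (Φ U) (Φ S)

theorem BarMap.empty (m : BarMap A B) (j : J) (S : Tup B) (h : S.1 j = ∅) :
    (m.Φ S).1 (m.idx j) = ∅ := by
  have hs : IsSplit j S S S := ⟨by rw [h, Set.union_empty], by rw [h]; exact disjoint_bot_left,
    fun _ _ => ⟨rfl, rfl⟩⟩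
  have := (m.split j S S S hs).2.1
  simpa using this

/-- Reindexing of systems. -/
def Bar.pull (D : PermCat.{u}) (m : BarMap A B) : Bar D A ⥤ Bar D B where
  obj a :=
    { C := fun S => a.C (m.Φ S)
      ρ := fun j T U S h => a.ρ (m.idx j) (m.Φ T) (m.Φ U) (m.Φ S) (m.split j T U S h)
      C_empty := fun k S h => a.C_empty (m.idx k) (m.Φ S) (m.empty k S h)
      ρ_id := fun j T U S h h' => a.ρ_id _ _ _ _ _ (by
        rcases h' with h' | h' | ⟨k, h'⟩
        · exact Or.inl (m.empty j T h')
        · exact Or.inr (Or.inl (m.empty j U h'))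
        · exact Or.inr (Or.inr ⟨_, m.empty k S h'⟩))
      ρ_symm := fun j T U S h h' => a.ρ_symm _ _ _ _ _ _
      ρ_assoc := fun j T U V TU UV S h₁ h₂ h₃ h₄ => a.ρ_assoc _ _ _ _ _ _ _ _ _ _ _
      ρ_exch := fun i j hij TV UV TW UW V W T U S h₁ h₂ h₃ h₄ h₅ h₆ =>
        a.ρ_exch _ _ (fun h => hij (m.inj h)) _ _ _ _ _ _ _ _ _ _ _ _ _ _ _ }
  map φ :=
    { f := fun S => φ.f (m.Φ S)
      f_empty := fun k S h => φ.f_empty (m.idx k) (m.Φ S) (m.empty k S h)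
      comm := fun j T U S h => φ.comm _ _ _ _ _ }
  map_id _ := rfl
  map_comp _ _ := rfl

/-- The operation on tuples of subsets given by taking inverse images under functions `g i`,
which are thought of as based maps: elements outside of `A i` are identified with the
basepoint. -/
def BarMap.ofFun {X' : I → Type} {A' : ∀ i, Set (X' i)} (g : ∀ i, X i → X' i)
    (hg : ∀ i x, g i x ∈ A' i → x ∈ A i) : BarMap A A' where
  Φ S := ⟨fun i => g i ⁻¹' S.1 i, fun i x hx => hg i x (S.2 i hx)⟩
  idx := id
  inj := Function.injective_id
  split j T U S h := ⟨by
      change g j ⁻¹' T.1 j ∪ g j ⁻¹' U.1 j = g j ⁻¹' S.1 j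
      rw [← h.1, Set.preimage_union], Disjoint.preimage _ h.2.1,
    fun k hk => ⟨congrArg (fun V => g k ⁻¹' V) (h.2.2 k hk).1,
      congrArg (fun V => g k ⁻¹' V) (h.2.2 k hk).2⟩⟩

/-- The zero system. -/
def Bar.zero (D : PermCat.{u}) (A : ∀ i, Set (X i)) : Bar D A where
  C _ := 𝟙_ D
  ρ _ _ _ _ _ := (λ_ (𝟙_ D)).hom
  C_empty _ _ _ := rfl
  ρ_id _ _ _ _ _ _ := by
    rw [Permutative.leftUnitor_eq]
    exact eqToHom_heq_id_cod _ _ _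
  ρ_symm _ _ _ _ _ _ := by
    rw [braiding_tensorUnit_left, ← unitors_inv_equal]
    simp
  ρ_assoc _ _ _ _ _ _ _ _ _ _ _ := by
    simp [unitors_equal]
  ρ_exch _ _ _ _ _ _ _ _ _ _ _ _ _ _ _ _ _ _ := by
    have h := tensor_left_unitality (𝟙_ D.carrier) (𝟙_ D.carrier)
    have h' : tensorμ (𝟙_ D.carrier) (𝟙_ D.carrier) (𝟙_ D.carrier) (𝟙_ D.carrier) ≫
        ((λ_ (𝟙_ D.carrier)).hom ⊗ₘ (λ_ (𝟙_ D.carrier)).hom) =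
        ((λ_ (𝟙_ D.carrier)).hom ▷ _) ≫ (λ_ (𝟙_ D.carrier ⊗ 𝟙_ D.carrier)).hom := by
      rw [h]
      simp
    rw [← Category.assoc (tensorμ _ _ _ _), h', MonoidalCategory.tensorHom_def]
    simp

theorem Bar.ext_heq {D : PermCat.{u}} {a b : Bar D A} (hC : ∀ S, a.C S = b.C S)
    (hρ : ∀ i T U S h, HEq (a.ρ i T U S h) (b.ρ i T U S h)) : a = b := by
  have hC' : a.C = b.C := funext hC
  cases a
  cases b
  dsimp only at hC'
  subst hC'
  congr
  funext i T U S h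
  exact eq_of_heq (hρ i T U S h)

theorem Bar.Hom.heq {D : PermCat.{u}} {a b a' b' : Bar D A} (ha : a = a') (hb : b = b')
    (φ : a ⟶ b) (ψ : a' ⟶ b') (h : ∀ S, HEq (φ.f S) (ψ.f S)) : HEq φ ψ := by
  subst ha hb
  exact heq_of_eq (Bar.Hom.ext (funext fun S => eq_of_heq (h S)))

theorem Bar.map_heq {D : PermCat.{u}} (a : Bar D A) {i i' : I} {T T' U U' S S' : Tup A}
    (hi : i = i') (hT : T = T') (hU : U = U') (hS : S = S') (h : IsSplit i T U S)
    (h' : IsSplit i' T' U' S') : HEq (a.ρ i T U S h) (a.ρ i' T' U' S' h') := by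
  subst hi hT hU hS
  rfl

theorem Bar.id_heq {D : PermCat.{u}} {x y x' y' z z' : D} (f : x ⟶ y) (g : x' ⟶ y')
    (hf : HEq f (𝟙 z)) (hg : HEq g (𝟙 z')) (h : z = z') : HEq f g := by
  subst h
  exact hf.trans hg.symm

/-- Two reindexings agree if they agree on the tuples without empty entries. -/
theorem Bar.pull_eq (D : PermCat.{u}) (m m' : BarMap A B)
    (h : ∀ S, (∀ k, S.1 k ≠ ∅) → m.Φ S = m'.Φ S)
    (hi : ∀ (j : J) (T U S : Tup B), IsSplit j T U S → T.1 j = ∅ ∨ U.1 j = ∅ ∨ m.idx j = m'.idx j) :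
    Bar.pull D m = Bar.pull D m' := by
  have hC : ∀ (a : Bar D A) (S : Tup B), a.C (m.Φ S) = a.C (m'.Φ S) := fun a S => by
    by_cases hS : ∀ k, S.1 k ≠ ∅
    · rw [h S hS]
    · obtain ⟨k, hk⟩ := not_forall.1 hS
      have hk := not_not.1 hk
      rw [a.C_empty _ _ (m.empty k S hk), a.C_empty _ _ (m'.empty k S hk)]
  have hobj : ∀ a, (Bar.pull D m).obj a = (Bar.pull D m').obj a := fun a => by
    refine Bar.ext_heq (hC a) fun j T U S hs => ?_
    by_cases hS : T.1 j = ∅ ∨ U.1 j = ∅ ∨ ∃ k, S.1 k = ∅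
    · exact Bar.id_heq _ _ (((Bar.pull D m).obj a).ρ_id j T U S hs hS)
        (((Bar.pull D m').obj a).ρ_id j T U S hs hS) (hC a S)
    · have hT' : ¬ T.1 j = ∅ := fun h => hS (Or.inl h)
      have hU' : ¬ U.1 j = ∅ := fun h => hS (Or.inr (Or.inl h))
      have hS' : ∀ k, S.1 k ≠ ∅ := fun k h => hS (Or.inr (Or.inr ⟨k, h⟩))
      have hT : ∀ k, T.1 k ≠ ∅ := fun k => by
        by_cases hk : k = j
        · subst hk
          exact hT'
        · rw [← (hs.2.2 k hk).2]
          exact hS' k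
      have hU : ∀ k, U.1 k ≠ ∅ := fun k => by
        by_cases hk : k = j
        · subst hk
          exact hU'
        · rw [(hs.2.2 k hk).1]
          exact hT k
      exact Bar.map_heq a (((hi j T U S hs).resolve_left hT').resolve_left hU') (h T hT)
        (h U hU) (h S hS') _ _
  refine CategoryTheory.Functor.hext hobj fun a b φ => Bar.Hom.heq (hobj a) (hobj b) _ _ fun S => ?_
  by_cases hS : ∀ k, S.1 k ≠ ∅
  · change HEq (φ.f (m.Φ S)) (φ.f (m'.Φ S))
    rw [h S hS]
  · obtain ⟨k, hk⟩ := not_forall.1 hS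
    have hk := not_not.1 hk
    exact (φ.f_empty _ _ (m.empty k S hk)).trans (φ.f_empty _ _ (m'.empty k S hk)).symm

/-- A reindexing for which all new tuples involve the empty set yields the zero system. -/
theorem Bar.pull_zero (D : PermCat.{u}) (m : BarMap A B) (h : ∀ S, ∃ k, (m.Φ S).1 k = ∅) :
    Bar.pull D m = (Functor.const _).obj (Bar.zero D B) := by
  have hobj : ∀ a, (Bar.pull D m).obj a = Bar.zero D B := fun a => by
    refine Bar.ext_heq (fun S => ?_) fun j T U S hs => ?_
    · obtain ⟨k, hk⟩ := h S
      exact a.C_empty k _ hk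
    · have h₀ : HEq (λ_ (𝟙_ D.carrier)).hom (𝟙 (𝟙_ D.carrier)) := by
        rw [Permutative.leftUnitor_eq]
        exact eqToHom_heq_id_cod _ _ _
      refine Bar.id_heq _ _ (a.ρ_id _ _ _ _ _ (Or.inr (Or.inr (h S)))) h₀ ?_
      obtain ⟨k, hk⟩ := h S
      exact a.C_empty k _ hk
  refine CategoryTheory.Functor.hext hobj fun a b φ => Bar.Hom.heq (hobj a) (hobj b) _ _ fun S => ?_
  obtain ⟨k, hk⟩ := h S
  exact φ.f_empty _ _ hk

theorem Bar.pull_obj_zero (D : PermCat.{u}) (m : BarMap A B) :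
    (Bar.pull D m).obj (Bar.zero D A) = Bar.zero D B := rfl

end Bar


/-! ### The simplicial circle -/

/-- The identity of the based set `{0, …, k}`, extended by zero to all natural numbers. -/
def idOn (k x : ℕ) : ℕ := if x ≤ k then x else 0

/-- The position of the first vertex of `a` whose image under `θ` is at least `j`; it is
`a.len + 1` if there is none. -/
def firstPos {a b : SimplexCategory} (θ : a ⟶ b) (j : ℕ) : ℕ :=
  sInf {n : ℕ | ∀ x : Fin (a.len + 1), n ≤ x → j ≤ θ.toOrderHom x}

/-- The simplicial circle `Δ[1]/∂Δ[1]`: its based set of `n`-simplices is `{0, …, n}` with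
basepoint `0`, where `j ≥ 1` stands for the map `[n] ⟶ [1]` whose first vertex mapped to `1`
is `j`. The structure maps are extended by zero to all natural numbers. -/
def circMap {a b : SimplexCategory} (θ : a ⟶ b) (j : ℕ) : ℕ :=
  if firstPos θ j ≤ a.len then firstPos θ j else 0

theorem lt_firstPos {a b : SimplexCategory} (θ : a ⟶ b) (j : ℕ) (x : Fin (a.len + 1)) :
    (x : ℕ) < firstPos θ j ↔ (θ.toOrderHom x : ℕ) < j := by
  have hne : {n : ℕ | ∀ x : Fin (a.len + 1), n ≤ x → j ≤ θ.toOrderHom x}.Nonempty :=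
    ⟨a.len + 1, fun x hx => absurd x.2 (by omega)⟩
  constructor
  · intro h
    have h' := Nat.notMem_of_lt_sInf h
    simp only [Set.mem_ofPred_eq, not_forall, not_le] at h'
    obtain ⟨y, hxy, hy⟩ := h'
    exact lt_of_le_of_lt (θ.toOrderHom.monotone (show x ≤ y from hxy)) hy
  · intro h
    by_contra hx
    exact absurd (Nat.sInf_mem hne x (not_lt.1 hx)) (not_le.2 h)

theorem firstPos_le {a b : SimplexCategory} (θ : a ⟶ b) (j : ℕ) :
    firstPos θ j ≤ a.len + 1 :=
  Nat.sInf_le fun x hx => absurd x.2 (by omega)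

theorem firstPos_eq {a b : SimplexCategory} (θ : a ⟶ b) (j c : ℕ) (hc : c ≤ a.len + 1)
    (h : ∀ x : Fin (a.len + 1), (x : ℕ) < c ↔ (θ.toOrderHom x : ℕ) < j) :
    firstPos θ j = c := by
  have h₁ := firstPos_le θ j
  rcases lt_trichotomy (firstPos θ j) c with hlt | heq | hlt
  · have := (h ⟨firstPos θ j, by omega⟩).1 hlt
    rw [← lt_firstPos] at this
    exact absurd this (lt_irrefl _)
  · exact heq
  · have := (lt_firstPos θ j ⟨c, by omega⟩).1 hlt
    rw [← h] at this
    exact absurd this (lt_irrefl _)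

theorem circMap_zero {a b : SimplexCategory} (θ : a ⟶ b) : circMap θ 0 = 0 := by
  have : firstPos θ 0 = 0 := firstPos_eq θ 0 0 (Nat.zero_le _) (by simp)
  rw [circMap, this]
  simp

theorem circMap_le {a b : SimplexCategory} (θ : a ⟶ b) (j : ℕ) : circMap θ j ≤ a.len := by
  unfold circMap
  split_ifs with h
  · exact h
  · exact Nat.zero_le _

theorem circMap_of_lt {a b : SimplexCategory} (θ : a ⟶ b) (j : ℕ) (hj : b.len < j) :
    circMap θ j = 0 := by
  have : firstPos θ j = a.len + 1 := firstPos_eq θ j _ le_rfl fun x => by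
    have h₁ := x.2
    have h₂ := (θ.toOrderHom x).2
    constructor <;> intro _ <;> omega
  rw [circMap, this]
  simp

theorem circMap_id (a : SimplexCategory) : circMap (𝟙 a) = idOn a.len := by
  funext j
  unfold idOn
  split_ifs with h
  · have : firstPos (𝟙 a) j = j := firstPos_eq _ j j (by omega) fun x => by simp
    rw [circMap, this, if_pos h]
  · exact circMap_of_lt _ j (by omega)

theorem circMap_comp {a b c : SimplexCategory} (θ : a ⟶ b) (η : b ⟶ c) (j : ℕ) :
    circMap (θ ≫ η) j = circMap θ (circMap η j) := by
  have h₁ := firstPos_le η j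
  by_cases h : firstPos η j ≤ b.len
  · have h₂ : circMap η j = firstPos η j := if_pos h
    have : firstPos (θ ≫ η) j = firstPos θ (firstPos η j) := by
      refine firstPos_eq _ _ _ (firstPos_le _ _) fun x => ?_
      rw [lt_firstPos, lt_firstPos]
      rfl
    rw [h₂, circMap, circMap, this]
  · have h₂ : circMap η j = 0 := if_neg h
    have : firstPos (θ ≫ η) j = a.len + 1 := by
      refine firstPos_eq _ _ _ le_rfl fun x => ?_
      have h₃ := (lt_firstPos η j (θ.toOrderHom x)).1 (by omega)
      have h₄ := x.2
      constructor
      · intro _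
        exact h₃
      · intro _
        omega
    rw [h₂, circMap_zero, circMap, this]
    simp

/-! ### Symmetric functors -/

/-- The objects of `𝓕^∞`: sequences `(n 0, n 1, …)` of based sets `{0, …, n i}` which are
eventually constant with value `1`. -/
@[ext]
structure Finfty where
  n : ℕ → ℕ
  fin : {i | n i ≠ 1}.Finite

/-- The morphisms of `𝓕^∞`: sequences of based maps, almost all of which are the identity
of `{0, 1}`. We extend based maps `{0, …, m i} ⟶ {0, …, n i}` by zero to all natural numbers. -/
@[ext]
structure Finfty.Hom (m n : Finfty) where
  f : ℕ → ℕ → ℕ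
  f_zero : ∀ i, f i 0 = 0
  f_le : ∀ i x, f i x ≤ n.n i
  f_of_lt : ∀ i x, m.n i < x → f i x = 0
  fin : {i | f i ≠ idOn 1}.Finite

instance : Category.{0} Finfty where
  Hom := Finfty.Hom
  id n :=
    { f := fun i => idOn (n.n i)
      f_zero := fun i => by simp [idOn]
      f_le := fun i x => by unfold idOn; split_ifs <;> omega
      f_of_lt := fun i x h => if_neg (not_le.2 h)
      fin := n.fin.subset fun i hi h => hi (by rw [h]) }
  comp {l m n} φ ψ :=
    { f := fun i x => ψ.f i (φ.f i x)
      f_zero := fun i => by rw [φ.f_zero, ψ.f_zero]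
      f_le := fun i x => ψ.f_le i _
      f_of_lt := fun i x h => by rw [φ.f_of_lt i x h, ψ.f_zero]
      fin := (φ.fin.union ψ.fin).subset fun i hi => by
        by_contra h
        simp only [Set.mem_union, Set.mem_ofPred_eq, not_or, not_not] at h
        refine hi (funext fun x => ?_)
        rw [h.1, h.2]
        unfold idOn
        split_ifs <;> omega }
  id_comp {m n} φ := Finfty.Hom.ext (funext fun i => funext fun x => by
    change φ.f i (idOn (m.n i) x) = φ.f i x
    unfold idOn
    split_ifs with h
    · rfl
    · rw [φ.f_zero, φ.f_of_lt i x (not_le.1 h)])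
  comp_id {m n} φ := Finfty.Hom.ext (funext fun i => funext fun x =>
    if_pos (φ.f_le i x))
  assoc _ _ _ := rfl

/-- A symmetric functor with values in small categories. For `θ : Aut ℕ`, the component at `n`
of the natural isomorphism `θ_! : F θ^* ⟶ F` is `bang θ m n`, where `m = θ^* n`. -/
structure SymFun where
  F : Finfty ⥤ Cat.{u, u}
  term : ∀ n : Finfty, (∃ i, n.n i = 0) → Nonempty (Limits.IsTerminal (F.obj n))
  bang : ∀ (θ : Equiv.Perm ℕ) (m n : Finfty), (∀ i, m.n i = n.n (θ i)) → (F.obj m ⟶ F.obj n)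
  bang_nat : ∀ (θ : Equiv.Perm ℕ) (m n m' n' : Finfty) (h : ∀ i, m.n i = n.n (θ i))
    (h' : ∀ i, m'.n i = n'.n (θ i)) (φ : n ⟶ n') (φ' : m ⟶ m'), (∀ i, φ'.f i = φ.f (θ i)) →
    F.map φ' ≫ bang θ m' n' h' = bang θ m n h ≫ F.map φ
  bang_one : ∀ (n : Finfty) (h : ∀ i, n.n i = n.n ((1 : Equiv.Perm ℕ) i)),
    bang 1 n n h = 𝟙 (F.obj n)
  bang_mul : ∀ (θ₁ θ₂ : Equiv.Perm ℕ) (k m n : Finfty) (h₁ : ∀ i, m.n i = n.n (θ₁ i))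
    (h₂ : ∀ i, k.n i = m.n (θ₂ i)) (h : ∀ i, k.n i = n.n ((θ₁ * θ₂) i)),
    bang (θ₁ * θ₂) k n h = bang θ₂ k m h₂ ≫ bang θ₁ m n h₁
  bang_id : ∀ (θ : Equiv.Perm ℕ) (n : Finfty) (h : ∀ i, n.n i = n.n (θ i)),
    (∀ i, θ i ≠ i → n.n i = 1) → bang θ n n h = 𝟙 (F.obj n)

/-- The based set `{0, …, n i}` without its basepoint. -/
def Finfty.set (n : Finfty) (i : ℕ) : Set ℕ := Set.Icc 1 (n.n i)

/-- Inverse images under a morphism of `𝓕^∞`. -/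
def Finfty.Hom.barMap {m n : Finfty} (φ : Finfty.Hom m n) : BarMap m.set n.set :=
  BarMap.ofFun φ.f fun i x hx => by
    change 1 ≤ φ.f i x ∧ φ.f i x ≤ n.n i at hx
    change 1 ≤ x ∧ x ≤ m.n i
    constructor
    · by_contra h
      have : x = 0 := by omega
      rw [this, φ.f_zero] at hx
      omega
    · by_contra h
      rw [φ.f_of_lt i x (not_le.1 h)] at hx
      omega

/-- The permutation of tuples of subsets given by a permutation `θ` of the indices. -/
def permBarMap (θ : Equiv.Perm ℕ) {m n : Finfty} (h : ∀ i, m.n i = n.n (θ i)) :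
    BarMap m.set n.set where
  Φ S := ⟨fun i => S.1 (θ i), fun i x hx => by
    have := S.2 _ hx
    change 1 ≤ x ∧ x ≤ m.n i
    rw [h]
    exact this⟩
  idx := θ.symm
  inj := θ.symm.injective
  split j T U S hs := ⟨by
      change T.1 (θ (θ.symm j)) ∪ U.1 (θ (θ.symm j)) = S.1 (θ (θ.symm j))
      rw [Equiv.apply_symm_apply]
      exact hs.1, by
      change Disjoint (T.1 (θ (θ.symm j))) (U.1 (θ (θ.symm j)))
      rw [Equiv.apply_symm_apply]
      exact hs.2.1,
    fun k hk => hs.2.2 (θ k) fun hh => hk (by rw [← hh, Equiv.symm_apply_apply])⟩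

/-- The symmetric functor `J C`. The colimit of the categories `C̄_(n 0, …, n m)` along the
extension functors is described by systems indexed by infinite sequences of subsets: almost
all entries of `n` are `1`, and systems vanish on sequences with an empty entry. The
functoriality is by inverse images, and `θ_!` is induced by permuting the entries. -/
def JFun (C : PermCat.{u}) : SymFun.{u} where
  F :=
    { obj := fun n => Cat.of (Bar C n.set)
      map := fun {m n} φ => (Bar.pull C (Finfty.Hom.barMap φ)).toCatHom
      map_id := fun n => by
        refine Cat.ext (Bar.pull_eq C (Finfty.Hom.barMap (𝟙 n)) ⟨id, id, Function.injective_id,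
          fun _ _ _ _ h => h⟩ (fun S _ => Subtype.ext (funext fun i => ?_))
          (fun _ _ _ _ _ => Or.inr (Or.inr rfl)))
        change idOn (n.n i) ⁻¹' S.1 i = S.1 i
        ext x
        have h₀ : ∀ y, y ∈ S.1 i → 1 ≤ y ∧ y ≤ n.n i := fun y hy => S.2 i hy
        rw [Set.mem_preimage]
        unfold idOn
        split_ifs with h
        · rfl
        · constructor
          · intro hx
            exact absurd (h₀ _ hx).1 (Nat.not_succ_le_zero 0)
          · intro hx
            exact absurd (h₀ _ hx).2 h
      map_comp := fun φ ψ => rfl }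
  term n hn := by
    obtain ⟨i, hi⟩ := hn
    have hS : ∀ S : Tup n.set, S.1 i = ∅ := fun S => by
      refine Set.subset_eq_empty (S.2 i) ?_
      change Set.Icc 1 (n.n i) = ∅
      rw [hi]
      simp
    have key : ∀ a : Bar C n.set, a = Bar.zero C n.set := fun a => by
      have h := congrArg (fun F => F.obj a) (Bar.pull_zero C
        (⟨id, id, Function.injective_id, fun _ _ _ _ h => h⟩ : BarMap n.set n.set)
        (fun S => ⟨i, hS S⟩))
      exact h
    refine ⟨Limits.IsTerminal.ofUniqueHom
      (fun X => ((CategoryTheory.Functor.const X).obj (Bar.zero C n.set)).toCatHom)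
      fun X F => Cat.ext (CategoryTheory.Functor.hext (fun x => key _) fun x y f => ?_)⟩
    refine Bar.Hom.heq (key _) (key _) (F.toFunctor.map f) (𝟙 (Bar.zero C n.set)) fun S => ?_
    exact ((F.toFunctor.map f).f_empty i S (hS S))
  bang θ m n h := (Bar.pull C (permBarMap θ h)).toCatHom
  bang_nat θ m n m' n' h h' φ φ' hφ := by
    refine Cat.ext ?_
    have key : ∀ S : Tup n'.set, (Finfty.Hom.barMap φ').Φ ((permBarMap θ h').Φ S) =
        (permBarMap θ h).Φ ((Finfty.Hom.barMap φ).Φ S) := fun S =>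
      Subtype.ext (funext fun i => by
        change φ'.f i ⁻¹' S.1 (θ i) = φ.f (θ i) ⁻¹' S.1 (θ i)
        rw [hφ])
    have hC : ∀ (a : Bar C m.set) (S : Tup n'.set),
        a.C ((Finfty.Hom.barMap φ').Φ ((permBarMap θ h').Φ S)) =
        a.C ((permBarMap θ h).Φ ((Finfty.Hom.barMap φ).Φ S)) := fun a S => by rw [key]
    have hobj : ∀ a, (Bar.pull C (Finfty.Hom.barMap φ') ⋙ Bar.pull C (permBarMap θ h')).obj a =
        (Bar.pull C (permBarMap θ h) ⋙ Bar.pull C (Finfty.Hom.barMap φ)).obj a := fun a =>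
      Bar.ext_heq (hC a) fun j T U S hs => Bar.map_heq a rfl (key T) (key U) (key S) _ _
    refine CategoryTheory.Functor.hext hobj fun a b f =>
      Bar.Hom.heq (hobj a) (hobj b) _ _ fun S => ?_
    change HEq (f.f _) (f.f _)
    rw [key S]
  bang_one n h := by
    refine Cat.ext (Bar.pull_eq C (permBarMap 1 h) ⟨id, id, Function.injective_id,
      fun _ _ _ _ h => h⟩ (fun S _ => rfl) (fun _ _ _ _ _ => Or.inr (Or.inr rfl)))
  bang_mul θ₁ θ₂ k m n h₁ h₂ h := rfl
  bang_id θ n h hθ := by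
    have hone : ∀ (S : Tup n.set) (i : ℕ), n.n i = 1 → S.1 i ≠ ∅ → S.1 i = {1} := by
      intro S i hi hS
      have h₀ : S.1 i ⊆ {1} := fun x hx => by
        have : 1 ≤ x ∧ x ≤ n.n i := S.2 i hx
        rw [hi] at this
        exact le_antisymm this.2 this.1
      rcases Set.subset_singleton_iff_eq.1 h₀ with h₁ | h₁
      · exact absurd h₁ hS
      · exact h₁
    refine Cat.ext (Bar.pull_eq C (permBarMap θ h) ⟨id, id, Function.injective_id,
      fun _ _ _ _ h => h⟩ (fun S hS => Subtype.ext (funext fun i => ?_)) fun j T U S hs => ?_)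
    · change S.1 (θ i) = S.1 i
      by_cases hi : θ i = i
      · rw [hi]
      · rw [hone S i (hθ i hi) (hS i),
          hone S (θ i) (by rw [← h]; exact hθ i hi) (hS (θ i))]
    · by_cases hj : θ j = j
      · exact Or.inr (Or.inr (by
          change θ.symm j = j
          rw [Equiv.symm_apply_eq, hj]))
      · by_cases hT : T.1 j = ∅
        · exact Or.inl hT
        · by_cases hU : U.1 j = ∅
          · exact Or.inr (Or.inl hU)
          · have := hs.2.1
            rw [hone T j (hθ j hj) hT, hone U j (hθ j hj) hU] at this
            simp at this

/-! ### The multicategory of symmetric functors -/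

section SymFunHom

variable {ι : Type}

/-- `m` is obtained from the sequences `n i` by putting the entry `n i j` to the place
`β (i, j)`, all other entries being `1`. -/
def IsPush (β : ι × ℕ ↪ ℕ) (n : ι → Finfty) (m : Finfty) : Prop :=
  (∀ i j, m.n (β (i, j)) = (n i).n j) ∧ ∀ s, s ∉ Set.range β → m.n s = 1

/-- The same for morphisms. -/
def IsPushHom (β : ι × ℕ ↪ ℕ) {n n' : ι → Finfty} {m m' : Finfty}
    (φ : ∀ i, n i ⟶ n' i) (ψ : m ⟶ m') : Prop :=
  (∀ i j, ψ.f (β (i, j)) = (φ i).f j) ∧ ∀ s, s ∉ Set.range β → ψ.f s = idOn 1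

/-- The multimorphisms of symmetric functors: for each injection `β` natural functors
`∏ F i (n i) ⥤ G (m)`, where `m` has entry `n i j` at `β (i, j)` and `1` elsewhere, which are
compatible with the actions of `Aut ℕ` and with changes of `β`. (If the indexing set is
nonempty, it is equivalent to use bijections `β` only, because the entries `1` are immaterial;
injections have the advantage that they also exist for the empty indexing set.) -/
@[ext]
structure SymFunHom (F : ι → SymFun.{u}) (G : SymFun.{u}) where
  app : ∀ (β : ι × ℕ ↪ ℕ) (n : ι → Finfty) (m : Finfty), IsPush β n m →
    ((∀ i, (F i).F.obj (n i)) ⥤ G.F.obj m)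
  nat : ∀ (β : ι × ℕ ↪ ℕ) (n n' : ι → Finfty) (m m' : Finfty) (h : IsPush β n m)
    (h' : IsPush β n' m') (φ : ∀ i, n i ⟶ n' i) (ψ : m ⟶ m'), IsPushHom β φ ψ →
    CategoryTheory.Functor.pi (fun i => ((F i).F.map (φ i)).toFunctor) ⋙ app β n' m' h' =
      app β n m h ⋙ (G.F.map ψ).toFunctor
  equivariant : ∀ (β : ι × ℕ ↪ ℕ) (θ : ι → Equiv.Perm ℕ) (θ' : Equiv.Perm ℕ),
    (∀ i j, θ' (β (i, j)) = β (i, θ i j)) → ∀ (k n : ι → Finfty) (l m : Finfty)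
    (h : IsPush β n m) (h' : IsPush β k l) (hn : ∀ i j, (k i).n j = (n i).n (θ i j))
    (hm : ∀ s, l.n s = m.n (θ' s)),
    CategoryTheory.Functor.pi (fun i => ((F i).bang (θ i) (k i) (n i) (hn i)).toFunctor) ⋙
        app β n m h =
      app β k l h' ⋙ (G.bang θ' l m hm).toFunctor
  change_β : ∀ (β β' : ι × ℕ ↪ ℕ) (θ : Equiv.Perm ℕ) (n : ι → Finfty) (l m : Finfty)
    (h : IsPush β n l) (h' : IsPush β' n m) (hm : ∀ s, l.n s = m.n (θ s)),
    (∀ i j, (n i).n j ≠ 1 → θ (β (i, j)) = β' (i, j)) →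
    app β n l h ⋙ (G.bang θ l m hm).toFunctor = app β' n m h'

/-- Morphisms of multimorphisms of symmetric functors: natural transformations which are
compatible with all the structure. -/
@[ext]
structure SymFunHom.Hom {F : ι → SymFun.{u}} {G : SymFun.{u}} (f g : SymFunHom F G) where
  app : ∀ (β : ι × ℕ ↪ ℕ) (n : ι → Finfty) (m : Finfty) (h : IsPush β n m),
    f.app β n m h ⟶ g.app β n m h
  nat : ∀ (β : ι × ℕ ↪ ℕ) (n n' : ι → Finfty) (m m' : Finfty) (h : IsPush β n m)
    (h' : IsPush β n' m') (φ : ∀ i, n i ⟶ n' i) (ψ : m ⟶ m'), IsPushHom β φ ψ →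
    HEq (Functor.whiskerLeft
        (CategoryTheory.Functor.pi (fun i => ((F i).F.map (φ i)).toFunctor)) (app β n' m' h'))
      (Functor.whiskerRight (app β n m h) (G.F.map ψ).toFunctor)
  equivariant : ∀ (β : ι × ℕ ↪ ℕ) (θ : ι → Equiv.Perm ℕ) (θ' : Equiv.Perm ℕ),
    (∀ i j, θ' (β (i, j)) = β (i, θ i j)) → ∀ (k n : ι → Finfty) (l m : Finfty)
    (h : IsPush β n m) (h' : IsPush β k l) (hn : ∀ i j, (k i).n j = (n i).n (θ i j))
    (hm : ∀ s, l.n s = m.n (θ' s)),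
    HEq (Functor.whiskerLeft
        (CategoryTheory.Functor.pi (fun i => ((F i).bang (θ i) (k i) (n i) (hn i)).toFunctor))
        (app β n m h))
      (Functor.whiskerRight (app β k l h') (G.bang θ' l m hm).toFunctor)
  change_β : ∀ (β β' : ι × ℕ ↪ ℕ) (θ : Equiv.Perm ℕ) (n : ι → Finfty) (l m : Finfty)
    (h : IsPush β n l) (h' : IsPush β' n m) (hm : ∀ s, l.n s = m.n (θ s)),
    (∀ i j, (n i).n j ≠ 1 → θ (β (i, j)) = β' (i, j)) →
    HEq (Functor.whiskerRight (app β n l h) (G.bang θ l m hm).toFunctor) (app β' n m h')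

theorem comp_heq {E : Type v} [Category.{w} E] {x y z x' y' z' : E} (hx : x = x') (hy : y = y')
    (hz : z = z') {f : x ⟶ y} {g : y ⟶ z} {f' : x' ⟶ y'} {g' : y' ⟶ z'} (hf : HEq f f')
    (hg : HEq g g') : HEq (f ≫ g) (f' ≫ g') := by
  subst hx hy hz
  rw [eq_of_heq hf, eq_of_heq hg]

instance {F : ι → SymFun.{u}} {G : SymFun.{u}} : Category.{u} (SymFunHom F G) where
  Hom f g := SymFunHom.Hom f g
  id f :=
    { app := fun β n m h => 𝟙 _
      nat := fun β n n' m m' h h' φ ψ hψ => by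
        rw [Functor.whiskerLeft_id', Functor.whiskerRight_id', f.nat β n n' m m' h h' φ ψ hψ]
      equivariant := fun β θ θ' hθ k n l m h h' hn hm => by
        rw [Functor.whiskerLeft_id', Functor.whiskerRight_id',
          f.equivariant β θ θ' hθ k n l m h h' hn hm]
      change_β := fun β β' θ n l m h h' hm hθ => by
        rw [Functor.whiskerRight_id', f.change_β β β' θ n l m h h' hm hθ] }
  comp {f g e} p q :=
    { app := fun β n m h => p.app β n m h ≫ q.app β n m h
      nat := fun β n n' m m' h h' φ ψ hψ => by
        rw [Functor.whiskerLeft_comp, Functor.whiskerRight_comp]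
        exact comp_heq (f.nat β n n' m m' h h' φ ψ hψ) (g.nat β n n' m m' h h' φ ψ hψ)
          (e.nat β n n' m m' h h' φ ψ hψ) (p.nat β n n' m m' h h' φ ψ hψ)
          (q.nat β n n' m m' h h' φ ψ hψ)
      equivariant := fun β θ θ' hθ k n l m h h' hn hm => by
        rw [Functor.whiskerLeft_comp, Functor.whiskerRight_comp]
        exact comp_heq (f.equivariant β θ θ' hθ k n l m h h' hn hm)
          (g.equivariant β θ θ' hθ k n l m h h' hn hm)
          (e.equivariant β θ θ' hθ k n l m h h' hn hm)
          (p.equivariant β θ θ' hθ k n l m h h' hn hm)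
          (q.equivariant β θ θ' hθ k n l m h h' hn hm)
      change_β := fun β β' θ n l m h h' hm hθ => by
        rw [Functor.whiskerRight_comp]
        exact comp_heq (f.change_β β β' θ n l m h h' hm hθ)
          (g.change_β β β' θ n l m h h' hm hθ) (e.change_β β β' θ n l m h h' hm hθ)
          (p.change_β β β' θ n l m h h' hm hθ) (q.change_β β β' θ n l m h h' hm hθ) }
  id_comp p := SymFunHom.Hom.ext (by
    funext β n m h
    exact Category.id_comp _)
  comp_id p := SymFunHom.Hom.ext (by
    funext β n m h
    exact Category.comp_id _)
  assoc p q r := SymFunHom.Hom.ext (by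
    funext β n m h
    exact Category.assoc _ _ _)

/-- The value of a morphism between multimorphisms of symmetric functors at objects. -/
def SymFunHom.Hom.ev {F : ι → SymFun.{u}} {G : SymFun.{u}} {f g : SymFunHom F G} (p : f ⟶ g)
    (β : ι × ℕ ↪ ℕ) (n : ι → Finfty) (m : Finfty) (h : IsPush β n m)
    (x : ∀ i, (F i).F.obj (n i)) : (f.app β n m h).obj x ⟶ (g.app β n m h).obj x :=
  (SymFunHom.Hom.app p β n m h).app x

end SymFunHom

/-- The categories of multimorphisms of symmetric functors. -/
abbrev symFunGraph : MGraph.{u + 1, u} SymFun.{u} := fun _ _ F G => SymFunHom F G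

/-- `M` is *the* multicategory of symmetric functors: the actions, the units and the
multiproducts are given by the standard formulas. -/
structure IsSymFunMulticat (M : CatMulticat symFunGraph.{u}) : Prop where
  /-- A bijection `e` acts by permuting the sources. -/
  act_obj : ∀ {ι κ : Type} [Finite ι] [Finite κ] (e : κ ≃ ι) {F : ι → SymFun.{u}}
    {G : SymFun.{u}} (f : SymFunHom F G) (β : κ × ℕ ↪ ℕ) (β' : ι × ℕ ↪ ℕ),
    (∀ k j, β (k, j) = β' (e k, j)) → ∀ (n : ι → Finfty) (m : Finfty)
    (h : IsPush β (fun k => n (e k)) m) (h' : IsPush β' n m) (x : ∀ i, (F i).F.obj (n i)),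
    ((M.act e f).app β _ m h).obj (fun k => x (e k)) = (f.app β' n m h').obj x
  act_map : ∀ {ι κ : Type} [Finite ι] [Finite κ] (e : κ ≃ ι) {F : ι → SymFun.{u}}
    {G : SymFun.{u}} (f : SymFunHom F G) (β : κ × ℕ ↪ ℕ) (β' : ι × ℕ ↪ ℕ),
    (∀ k j, β (k, j) = β' (e k, j)) → ∀ (n : ι → Finfty) (m : Finfty)
    (h : IsPush β (fun k => n (e k)) m) (h' : IsPush β' n m) (x y : ∀ i, (F i).F.obj (n i))
    (φ : x ⟶ y),
    HEq (((M.act e f).app β _ m h).map (X := fun k => x (e k)) (Y := fun k => y (e k))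
      (fun k => φ (e k))) ((f.app β' n m h').map φ)
  actMap_app : ∀ {ι κ : Type} [Finite ι] [Finite κ] (e : κ ≃ ι) {F : ι → SymFun.{u}}
    {G : SymFun.{u}} {f g : SymFunHom F G} (p : f ⟶ g) (β : κ × ℕ ↪ ℕ) (β' : ι × ℕ ↪ ℕ),
    (∀ k j, β (k, j) = β' (e k, j)) → ∀ (n : ι → Finfty) (m : Finfty)
    (h : IsPush β (fun k => n (e k)) m) (h' : IsPush β' n m) (x : ∀ i, (F i).F.obj (n i)),
    HEq (SymFunHom.Hom.ev (M.actMap e p) β _ m h (fun k => x (e k)))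
      (SymFunHom.Hom.ev p β' n m h' x)
  /-- The unit is given by identity functors. -/
  one_obj : ∀ (F : SymFun.{u}) (β : Unit × ℕ ↪ ℕ), (∀ j, β ((), j) = j) → ∀ (n : Finfty)
    (h : IsPush β (fun _ => n) n) (x : ∀ _ : Unit, F.F.obj n),
    ((M.one F).app β _ n h).obj x = x ()
  one_map : ∀ (F : SymFun.{u}) (β : Unit × ℕ ↪ ℕ), (∀ j, β ((), j) = j) → ∀ (n : Finfty)
    (h : IsPush β (fun _ => n) n) (x y : ∀ _ : Unit, F.F.obj n) (φ : x ⟶ y),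
    HEq (((M.one F).app β _ n h).map φ) (φ ())
  /-- The multiproduct is given by composition of products of functors. -/
  comp_obj : ∀ {ι : Type} [Finite ι] {κ : ι → Type} [∀ i, Finite (κ i)]
    {F : ∀ i, κ i → SymFun.{u}} {G : ι → SymFun.{u}} {H : SymFun.{u}} (g : SymFunHom G H)
    (f : ∀ i, SymFunHom (F i) (G i)) (δ : (Σ i, κ i) × ℕ ↪ ℕ) (β : ι × ℕ ↪ ℕ)
    (α : ∀ i, κ i × ℕ ↪ ℕ), (∀ i k j, δ (⟨i, k⟩, j) = β (i, α i (k, j))) →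
    ∀ (n : (Σ i, κ i) → Finfty) (l : ι → Finfty) (m : Finfty) (h : IsPush δ n m)
    (h₁ : ∀ i, IsPush (α i) (fun k => n ⟨i, k⟩) (l i)) (h₂ : IsPush β l m)
    (x : ∀ s : Σ i, κ i, (F s.1 s.2).F.obj (n s)),
    ((M.comp g f).app δ n m h).obj x =
      (g.app β l m h₂).obj (fun i => ((f i).app (α i) _ (l i) (h₁ i)).obj (fun k => x ⟨i, k⟩))
  comp_map : ∀ {ι : Type} [Finite ι] {κ : ι → Type} [∀ i, Finite (κ i)]
    {F : ∀ i, κ i → SymFun.{u}} {G : ι → SymFun.{u}} {H : SymFun.{u}} (g : SymFunHom G H)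
    (f : ∀ i, SymFunHom (F i) (G i)) (δ : (Σ i, κ i) × ℕ ↪ ℕ) (β : ι × ℕ ↪ ℕ)
    (α : ∀ i, κ i × ℕ ↪ ℕ), (∀ i k j, δ (⟨i, k⟩, j) = β (i, α i (k, j))) →
    ∀ (n : (Σ i, κ i) → Finfty) (l : ι → Finfty) (m : Finfty) (h : IsPush δ n m)
    (h₁ : ∀ i, IsPush (α i) (fun k => n ⟨i, k⟩) (l i)) (h₂ : IsPush β l m)
    (x y : ∀ s : Σ i, κ i, (F s.1 s.2).F.obj (n s)) (φ : x ⟶ y),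
    HEq (((M.comp g f).app δ n m h).map φ)
      ((g.app β l m h₂).map
        (X := fun i => ((f i).app (α i) _ (l i) (h₁ i)).obj (fun k => x ⟨i, k⟩))
        (Y := fun i => ((f i).app (α i) _ (l i) (h₁ i)).obj (fun k => y ⟨i, k⟩))
        (fun i => ((f i).app (α i) _ (l i) (h₁ i)).map
          (X := fun k => x ⟨i, k⟩) (Y := fun k => y ⟨i, k⟩) (fun k => φ ⟨i, k⟩)))
  compMap_app : ∀ {ι : Type} [Finite ι] {κ : ι → Type} [∀ i, Finite (κ i)]
    {F : ∀ i, κ i → SymFun.{u}} {G : ι → SymFun.{u}} {H : SymFun.{u}} {g g' : SymFunHom G H}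
    {f f' : ∀ i, SymFunHom (F i) (G i)} (q : g ⟶ g') (p : ∀ i, f i ⟶ f' i)
    (δ : (Σ i, κ i) × ℕ ↪ ℕ) (β : ι × ℕ ↪ ℕ)
    (α : ∀ i, κ i × ℕ ↪ ℕ), (∀ i k j, δ (⟨i, k⟩, j) = β (i, α i (k, j))) →
    ∀ (n : (Σ i, κ i) → Finfty) (l : ι → Finfty) (m : Finfty) (h : IsPush δ n m)
    (h₁ : ∀ i, IsPush (α i) (fun k => n ⟨i, k⟩) (l i)) (h₂ : IsPush β l m)
    (x : ∀ s : Σ i, κ i, (F s.1 s.2).F.obj (n s)),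
    HEq (SymFunHom.Hom.ev (M.compMap q p) δ n m h x)
      ((g.app β l m h₂).map
        (X := fun i => ((f i).app (α i) _ (l i) (h₁ i)).obj (fun k => x ⟨i, k⟩))
        (Y := fun i => ((f' i).app (α i) _ (l i) (h₁ i)).obj (fun k => x ⟨i, k⟩))
        (fun i => SymFunHom.Hom.ev (p i) (α i) _ (l i) (h₁ i) (fun k => x ⟨i, k⟩)) ≫
      SymFunHom.Hom.ev q β l m h₂
        (fun i => ((f' i).app (α i) _ (l i) (h₁ i)).obj (fun k => x ⟨i, k⟩)))

/-- The multifunctor `J` from permutative categories to symmetric functors: on objects it is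
`JFun`, and `f : (C i) ⟶ D` is sent to the family of functors
`A ↦ (T ↦ f (A i (T (β (i, -)))))`, where the structure maps are the composites of
`δ i` for `f` and of `f` applied to the structure maps of `A i`. (At the entries outside
the image of `β` there is only one nonempty subset.) -/
structure IsJ {P : CatMulticat permGraph.{u}} {M : CatMulticat symFunGraph.{u}}
    (J : CatMultifunctor P M JFun.{u}) : Prop where
  fn_C : ∀ {ι : Type} [Finite ι] {C : ι → PermCat.{u}} {D : PermCat.{u}} (f : MultiLin C D)
    (β : ι × ℕ ↪ ℕ) (n : ι → Finfty) (m : Finfty) (h : IsPush β n m)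
    (A : ∀ i, Bar (C i) (n i).set) (T : Tup m.set) (S : ∀ i, Tup (n i).set),
    (∀ i j, (S i).1 j = T.1 (β (i, j))) → (∀ s, s ∉ Set.range β → T.1 s ≠ ∅) →
    Bar.C ((((J.fn C D).obj f).app β n m h).obj A) T = f.F.obj (fun i => (A i).C (S i))
  fn_ρ : ∀ {ι : Type} [Finite ι] {C : ι → PermCat.{u}} {D : PermCat.{u}} (f : MultiLin C D)
    (β : ι × ℕ ↪ ℕ) (n : ι → Finfty) (m : Finfty) (h : IsPush β n m)
    (A : ∀ i, Bar (C i) (n i).set) (i : ι) (j : ℕ) (U V T : Tup m.set)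
    (hT : IsSplit (β (i, j)) U V T) (U' V' T' : ∀ i, Tup (n i).set),
    (∀ i j, (U' i).1 j = U.1 (β (i, j))) → (∀ i j, (V' i).1 j = V.1 (β (i, j))) →
    (∀ i j, (T' i).1 j = T.1 (β (i, j))) → (∀ s, s ∉ Set.range β → T.1 s ≠ ∅) →
    ∀ (hT' : IsSplit j (U' i) (V' i) (T' i)) (w : ∀ i, C i)
    (hw : IsSum i (fun i => (A i).C (U' i)) (fun i => (A i).C (V' i)) w)
    (χ : w ⟶ fun i => (A i).C (T' i)),
    IsSingle i ((A i).ρ j (U' i) (V' i) (T' i) hT') χ →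
    HEq (Bar.ρ ((((J.fn C D).obj f).app β n m h).obj A) (β (i, j)) U V T hT)
      (f.δ i _ _ w hw ≫ f.F.map χ)
  fn_map : ∀ {ι : Type} [Finite ι] {C : ι → PermCat.{u}} {D : PermCat.{u}} (f : MultiLin C D)
    (β : ι × ℕ ↪ ℕ) (n : ι → Finfty) (m : Finfty) (h : IsPush β n m)
    (A B : ∀ i, Bar (C i) (n i).set) (φ : ∀ i, A i ⟶ B i) (T : Tup m.set)
    (S : ∀ i, Tup (n i).set),
    (∀ i j, (S i).1 j = T.1 (β (i, j))) → (∀ s, s ∉ Set.range β → T.1 s ≠ ∅) →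
    HEq (Bar.Hom.f ((((J.fn C D).obj f).app β n m h).map (X := A) (Y := B) φ) T)
      (f.F.map (X := fun i => (A i).C (S i)) (Y := fun i => (B i).C (S i))
        (fun i => Bar.Hom.f (φ i) (S i)))
  map_app : ∀ {ι : Type} [Finite ι] {C : ι → PermCat.{u}} {D : PermCat.{u}}
    {f g : MultiLin C D} (p : f ⟶ g)
    (β : ι × ℕ ↪ ℕ) (n : ι → Finfty) (m : Finfty) (h : IsPush β n m)
    (A : ∀ i, Bar (C i) (n i).set) (T : Tup m.set) (S : ∀ i, Tup (n i).set),
    (∀ i j, (S i).1 j = T.1 (β (i, j))) → (∀ s, s ∉ Set.range β → T.1 s ≠ ∅) →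
    HEq (Bar.Hom.f (SymFunHom.Hom.ev ((J.fn C D).map p) β n m h A) T)
      (p.nat.app (fun i => (A i).C (S i)))

/-! ### Symmetric spectra -/

/-- The structure maps of the simplicial circle on its `n`-simplices `{0, …, n}`. -/
def circ {d d' : SimplexCategoryᵒᵖ} (θ : d ⟶ d') (s : Fin (d.unop.len + 1)) :
    Fin (d'.unop.len + 1) :=
  ⟨circMap θ.unop s, Nat.lt_succ_of_le (circMap_le _ _)⟩

/-- The block sum of two permutations. -/
def blockPerm {p q : ℕ} (σ : Equiv.Perm (Fin p)) (τ : Equiv.Perm (Fin q)) :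
    Equiv.Perm (Fin (p + q)) :=
  finSumFinEquiv.permCongr (Equiv.Perm.sumCongr σ τ)

/-- Iteration of suspension maps: the map `X p × (S¹)^q ⟶ X (p + q)` in simplicial degree
`l` (so that `S¹` has the simplices `Fin (l + 1)`). -/
def iterSusp {l : ℕ} {X : ℕ → Type u} (susp : ∀ p, Fin (l + 1) → X p → X (p + 1)) (p : ℕ) :
    ∀ q : ℕ, (Fin q → Fin (l + 1)) → X p → X (p + q)
  | 0, _, x => x
  | q + 1, s, x => susp (p + q) (s (Fin.last q)) (iterSusp susp p q (fun i => s i.castSucc) x)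

/-- A symmetric spectrum in simplicial sets: simplicial sets `X p` with left actions of the
symmetric groups, invariant basepoints, and suspension maps `X p × S¹ ⟶ X (p + 1)` which
are compatible with basepoints (that is, are defined on the smash product) and whose iterates
`X p × (S¹)^q ⟶ X (p + q)` are equivariant. -/
structure SymSpec where
  X : ℕ → SSet.{u}
  act : ∀ p, Equiv.Perm (Fin p) → (X p ⟶ X p)
  act_one : ∀ p, act p 1 = 𝟙 _
  act_mul : ∀ p (σ τ : Equiv.Perm (Fin p)), act p (σ * τ) = act p τ ≫ act p σ
  base : ∀ p (d : SimplexCategoryᵒᵖ), (X p).obj d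
  base_nat : ∀ p {d d' : SimplexCategoryᵒᵖ} (θ : d ⟶ d'), (X p).map θ (base p d) = base p d'
  act_base : ∀ p (σ : Equiv.Perm (Fin p)) d, (act p σ).app d (base p d) = base p d
  susp : ∀ (d : SimplexCategoryᵒᵖ) p, Fin (d.unop.len + 1) → (X p).obj d → (X (p + 1)).obj d
  susp_nat : ∀ p {d d' : SimplexCategoryᵒᵖ} (θ : d ⟶ d') (s : Fin (d.unop.len + 1))
    (x : (X p).obj d),
    (X (p + 1)).map θ (susp d p s x) = susp d' p (circ θ s) ((X p).map θ x)
  susp_zero : ∀ p d (x : (X p).obj d), susp d p 0 x = base (p + 1) d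
  susp_base : ∀ p d (s : Fin (d.unop.len + 1)), susp d p s (base p d) = base (p + 1) d
  susp_act : ∀ p q d (σ : Equiv.Perm (Fin p)) (τ : Equiv.Perm (Fin q))
    (s : Fin q → Fin (d.unop.len + 1)) (x : (X p).obj d),
    (act (p + q) (blockPerm σ τ)).app d (iterSusp (susp d) p q s x) =
      iterSusp (susp d) p q (fun i => s (τ.symm i)) ((act p σ).app d x)

/-- Maps of symmetric spectra. -/
structure SymSpec.Hom (X Y : SymSpec.{u}) where
  app : ∀ p, X.X p ⟶ Y.X p
  act : ∀ p (σ : Equiv.Perm (Fin p)), X.act p σ ≫ app p = app p ≫ Y.act p σ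
  base : ∀ p d, (app p).app d (X.base p d) = Y.base p d
  susp : ∀ p d (s : Fin (d.unop.len + 1)) (x : (X.X p).obj d),
    (app (p + 1)).app d (X.susp d p s x) = Y.susp d p s ((app p).app d x)

section SpHom

variable {ι : Type}

/-- The `b`-simplices of the simplicial set of multimorphisms of symmetric spectra: maps
`(∏ X i (p i)) × Δ[b] ⟶ Y N`, compatible with the symmetric groups, with basepoints and with
suspension. Here `N = ∑ p i`, and the coordinates of `Y N` are identified with
the coordinates of all of the `X i (p i)` by a bijection `e`. (For `ι = Fin k` all of these maps
are determined by the ones for which `e` is the lexicographic ordering.) -/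
@[ext]
structure SpHom (X : ι → SymSpec.{u}) (Y : SymSpec.{u}) (b : SimplexCategory) where
  toFun : ∀ (p : ι → ℕ) (N : ℕ), ((Σ i, Fin (p i)) ≃ Fin N) → ∀ (d : SimplexCategoryᵒᵖ),
    (∀ i, ((X i).X (p i)).obj d) → (d.unop ⟶ b) → (Y.X N).obj d
  nat : ∀ (p : ι → ℕ) (N : ℕ) (e : (Σ i, Fin (p i)) ≃ Fin N) {d d' : SimplexCategoryᵒᵖ}
    (θ : d ⟶ d') (x : ∀ i, ((X i).X (p i)).obj d) (u : d.unop ⟶ b),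
    (Y.X N).map θ (toFun p N e d x u) =
      toFun p N e d' (fun i => ((X i).X (p i)).map θ (x i)) (θ.unop ≫ u)
  act_target : ∀ (p : ι → ℕ) (N : ℕ) (e : (Σ i, Fin (p i)) ≃ Fin N) (σ : Equiv.Perm (Fin N))
    (d : SimplexCategoryᵒᵖ) (x : ∀ i, ((X i).X (p i)).obj d) (u : d.unop ⟶ b),
    toFun p N (e.trans σ) d x u = (Y.act N σ).app d (toFun p N e d x u)
  act_source : ∀ (p : ι → ℕ) (N : ℕ) (e : (Σ i, Fin (p i)) ≃ Fin N)
    (σ : ∀ i, Equiv.Perm (Fin (p i))) (d : SimplexCategoryᵒᵖ)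
    (x : ∀ i, ((X i).X (p i)).obj d) (u : d.unop ⟶ b),
    toFun p N e d (fun i => ((X i).act (p i) (σ i)).app d (x i)) u =
      toFun p N ((Equiv.sigmaCongrRight σ).trans e) d x u
  base : ∀ (p : ι → ℕ) (N : ℕ) (e : (Σ i, Fin (p i)) ≃ Fin N) (d : SimplexCategoryᵒᵖ)
    (x : ∀ i, ((X i).X (p i)).obj d) (u : d.unop ⟶ b),
    (∃ i, x i = (X i).base (p i) d) → toFun p N e d x u = Y.base N d
  /-- If `x'` arises from `x` by suspension of the `i`-th entry, then its image is the suspension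
  of the image of `x`; the new coordinate is the last one in `X i (p i + 1)` and in
  `Y (N + 1)`. -/
  susp : ∀ (i : ι) (p p' : ι → ℕ), p' i = p i + 1 → (∀ j, j ≠ i → p' j = p j) → ∀ (N : ℕ)
    (e : (Σ i, Fin (p i)) ≃ Fin N) (e' : (Σ i, Fin (p' i)) ≃ Fin (N + 1)),
    (∀ j (a : Fin (p j)) (a' : Fin (p' j)), (a' : ℕ) = a → (e' ⟨j, a'⟩ : ℕ) = e ⟨j, a⟩) →
    (∀ a' : Fin (p' i), (a' : ℕ) = p i → (e' ⟨i, a'⟩ : ℕ) = N) →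
    ∀ (d : SimplexCategoryᵒᵖ) (x : ∀ i, ((X i).X (p i)).obj d)
    (x' : ∀ i, ((X i).X (p' i)).obj d) (s : Fin (d.unop.len + 1)) (u : d.unop ⟶ b),
    HEq (x' i) ((X i).susp d (p i) s (x i)) → (∀ j, j ≠ i → HEq (x' j) (x j)) →
    toFun p' (N + 1) e' d x' u = Y.susp d N s (toFun p N e d x u)

/-- The simplicial sets of multimorphisms of symmetric spectra. -/
def SpMap (X : ι → SymSpec.{u}) (Y : SymSpec.{u}) : SSet.{u} where
  obj b := SpHom X Y b.unop
  map η := ↾fun f =>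
    { toFun := fun p N e d x u => f.toFun p N e d x (u ≫ η.unop)
      nat := fun p N e d d' θ x u => by rw [f.nat, Category.assoc]
      act_target := fun p N e σ d x u => f.act_target p N e σ d x _
      act_source := fun p N e σ d x u => f.act_source p N e σ d x _
      base := fun p N e d x u h => f.base p N e d x _ h
      susp := fun i p p' h h' N e e' he he' d x x' s u hx hx' =>
        f.susp i p p' h h' N e e' he he' d x x' s _ hx hx' }
  map_id b := by
    refine ConcreteCategory.hom_ext _ _ fun f => SpHom.ext ?_
    funext p N e d x u
    exact congrArg (SpHom.toFun f p N e d x) (Category.comp_id u)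
  map_comp η η' := by
    refine ConcreteCategory.hom_ext _ _ fun f => SpHom.ext ?_
    funext p N e d x u
    exact congrArg (SpHom.toFun f p N e d x) (Category.assoc u _ _).symm

end SpHom

/-- The simplicial sets of multimorphisms of symmetric spectra. -/
abbrev spGraph : SGraph.{u + 1, u} SymSpec.{u} := fun _ _ X Y => SpMap X Y

/-- `M` is *the* multicategory of symmetric spectra: the actions, the units and the
multiproducts are given by the standard formulas. -/
structure IsSpMulticat (M : SMulticat spGraph.{u}) : Prop where
  act_toFun : ∀ (b : SimplexCategoryᵒᵖ) {ι κ : Type} [Finite ι] [Finite κ] (ε : κ ≃ ι)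
    {X : ι → SymSpec.{u}} {Y : SymSpec.{u}} (f : SpHom X Y b.unop) (p : ι → ℕ) (N : ℕ)
    (e : (Σ i, Fin (p i)) ≃ Fin N) (d : SimplexCategoryᵒᵖ)
    (x : ∀ i, ((X i).X (p i)).obj d) (u : d.unop ⟶ b.unop),
    SpHom.toFun ((M.lvl b).act ε (a := X) (b := Y) f) (fun k => p (ε k)) N
        ((Equiv.sigmaCongrLeft (β := fun i => Fin (p i)) ε).trans e) d (fun k => x (ε k)) u =
      f.toFun p N e d x u
  one_toFun : ∀ (b : SimplexCategoryᵒᵖ) (X : SymSpec.{u}) (p : ℕ) (d : SimplexCategoryᵒᵖ)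
    (x : (X.X p).obj d) (u : d.unop ⟶ b.unop),
    SpHom.toFun ((M.lvl b).one X) (fun _ => p) p (Equiv.uniqueSigma (fun _ : Unit => Fin p)) d
      (fun _ => x) u = x
  comp_toFun : ∀ (b : SimplexCategoryᵒᵖ) {ι : Type} [Finite ι] {κ : ι → Type}
    [∀ i, Finite (κ i)] {X : ∀ i, κ i → SymSpec.{u}} {Y : ι → SymSpec.{u}} {Z : SymSpec.{u}}
    (g : SpHom Y Z b.unop) (f : ∀ i, SpHom (X i) (Y i) b.unop)
    (p : (Σ i, κ i) → ℕ) (q : ι → ℕ) (N : ℕ)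
    (e : ∀ i, (Σ k, Fin (p ⟨i, k⟩)) ≃ Fin (q i)) (e' : (Σ i, Fin (q i)) ≃ Fin N)
    (d : SimplexCategoryᵒᵖ)
    (x : ∀ s : Σ i, κ i, ((X s.1 s.2).X (p s)).obj d) (u : d.unop ⟶ b.unop),
    SpHom.toFun ((M.lvl b).comp (a := X) (b := Y) (c := Z) g f) p N
        ((Equiv.sigmaAssoc (fun i k => Fin (p ⟨i, k⟩))).trans
          ((Equiv.sigmaCongrRight e).trans e')) d x u =
      g.toFun q N e' d
        (fun i => (f i).toFun (fun k => p ⟨i, k⟩) (q i) (e i) d (fun k => x ⟨i, k⟩) u) u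

/-- A symmetric spectrum in simplicial categories: the same as a symmetric spectrum in
simplicial sets, with simplicial sets replaced by simplicial categories, and with a functor
`X p ⥤ X (p + 1)` for every simplex of `S¹`. -/
structure CatSymSpec where
  X : ℕ → SimplexCategoryᵒᵖ ⥤ Cat.{u, u}
  act : ∀ p, Equiv.Perm (Fin p) → (X p ⟶ X p)
  act_one : ∀ p, act p 1 = 𝟙 _
  act_mul : ∀ p (σ τ : Equiv.Perm (Fin p)), act p (σ * τ) = act p τ ≫ act p σ
  base : ∀ p (d : SimplexCategoryᵒᵖ), (X p).obj d
  base_nat : ∀ p {d d' : SimplexCategoryᵒᵖ} (θ : d ⟶ d'),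
    ((X p).map θ).toFunctor.obj (base p d) = base p d'
  act_base : ∀ p (σ : Equiv.Perm (Fin p)) d,
    ((act p σ).app d).toFunctor.obj (base p d) = base p d
  susp : ∀ (d : SimplexCategoryᵒᵖ) p, Fin (d.unop.len + 1) → ((X p).obj d ⥤ (X (p + 1)).obj d)
  susp_nat : ∀ p {d d' : SimplexCategoryᵒᵖ} (θ : d ⟶ d') (s : Fin (d.unop.len + 1)),
    susp d p s ⋙ ((X (p + 1)).map θ).toFunctor =
      ((X p).map θ).toFunctor ⋙ susp d' p (circ θ s)
  susp_zero : ∀ p d, susp d p 0 = (Functor.const _).obj (base (p + 1) d)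
  susp_base : ∀ p d (s : Fin (d.unop.len + 1)), (susp d p s).obj (base p d) = base (p + 1) d
  susp_act : ∀ p q d (σ : Equiv.Perm (Fin p)) (τ : Equiv.Perm (Fin q))
    (s : Fin q → Fin (d.unop.len + 1)),
    iterSusp (X := fun r => (X p).obj d ⥤ (X r).obj d) (fun r s x => x ⋙ susp d r s) p q s (𝟭 _) ⋙
        ((act (p + q) (blockPerm σ τ)).app d).toFunctor =
      ((act p σ).app d).toFunctor ⋙
        iterSusp (X := fun r => (X p).obj d ⥤ (X r).obj d) (fun r s x => x ⋙ susp d r s) p q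
          (fun i => s (τ.symm i)) (𝟭 _)

/-- The nerve of a simplicial category: the diagonal of the degreewise nerve. -/
def diagNerve (D : SimplexCategoryᵒᵖ ⥤ Cat.{u, u}) : SSet.{u} :=
  Functor.diag _ ⋙ Functor.uncurry.obj (D ⋙ nerveFunctor)

/-- The induced map of nerves. -/
def diagNerveMap {D D' : SimplexCategoryᵒᵖ ⥤ Cat.{u, u}} (f : D ⟶ D') :
    diagNerve D ⟶ diagNerve D' :=
  Functor.whiskerLeft _ (Functor.uncurry.map (Functor.whiskerRight f nerveFunctor))

/-- A simplex of the nerve of a simplicial category is a sequence of composable arrows. -/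
def toArrows {D : SimplexCategoryᵒᵖ ⥤ Cat.{u, u}} {d : SimplexCategoryᵒᵖ}
    (x : (diagNerve D).obj d) : Fin (d.unop.len + 1) ⥤ D.obj d := x

/-- A sequence of composable arrows as a simplex of the nerve of a simplicial category. -/
def ofArrows {D : SimplexCategoryᵒᵖ ⥤ Cat.{u, u}} {d : SimplexCategoryᵒᵖ}
    (x : Fin (d.unop.len + 1) ⥤ D.obj d) : (diagNerve D).obj d := x

/-- The map on ordered sets of vertices as a functor. -/
def vertexFun {a b : SimplexCategory} (θ : a ⟶ b) : Fin (a.len + 1) ⥤ Fin (b.len + 1) :=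
  θ.toOrderHom.monotone.functor

theorem diagNerve_map {D : SimplexCategoryᵒᵖ ⥤ Cat.{u, u}} {d d' : SimplexCategoryᵒᵖ}
    (θ : d ⟶ d') (x : (diagNerve D).obj d) :
    (diagNerve D).map θ x = ofArrows (vertexFun θ.unop ⋙ toArrows x ⋙ (D.map θ).toFunctor) :=
  rfl

theorem diagNerveMap_app {D D' : SimplexCategoryᵒᵖ ⥤ Cat.{u, u}} (f : D ⟶ D')
    (d : SimplexCategoryᵒᵖ) (x : (diagNerve D).obj d) :
    (diagNerveMap f).app d x = ofArrows (toArrows x ⋙ (f.app d).toFunctor) :=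
  rfl

theorem CatSymSpec.iterSusp_eq (X : CatSymSpec.{u}) (p q : ℕ) (d : SimplexCategoryᵒᵖ)
    (s : Fin q → Fin (d.unop.len + 1)) (x : (diagNerve (X.X p)).obj d) :
    iterSusp (X := fun r => (diagNerve (X.X r)).obj d)
        (fun r s x => ofArrows (toArrows x ⋙ X.susp d r s)) p q s x =
      ofArrows (toArrows x ⋙ iterSusp (X := fun r => (X.X p).obj d ⥤ (X.X r).obj d)
        (fun r s x => x ⋙ X.susp d r s) p q s (𝟭 _)) := by
  induction q with
  | zero => rfl
  | succ q ih =>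
    change ofArrows (toArrows (iterSusp (X := fun r => (diagNerve (X.X r)).obj d) _ p q _ x) ⋙
      X.susp d (p + q) _) = _
    rw [ih]
    rfl

/-- The nerve of a symmetric spectrum in simplicial categories. -/
def CatSymSpec.nerve (X : CatSymSpec.{u}) : SymSpec.{u} where
  X p := diagNerve (X.X p)
  act p σ := diagNerveMap (X.act p σ)
  act_one p := by
    rw [X.act_one]
    rfl
  act_mul p σ τ := by
    rw [X.act_mul]
    rfl
  base p d := ofArrows ((Functor.const _).obj (X.base p d))
  base_nat p d d' θ := by
    rw [diagNerve_map, ← X.base_nat p θ]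
    exact congrArg ofArrows (CategoryTheory.Functor.hext (fun _ => rfl) fun _ _ _ =>
      heq_of_eq (((X.X p).map θ).toFunctor.map_id _))
  act_base p σ d := by
    rw [diagNerveMap_app]
    refine congrArg ofArrows (CategoryTheory.Functor.hext (fun _ => X.act_base p σ d) fun _ _ _ => ?_)
    refine (heq_of_eq (((X.act p σ).app d).toFunctor.map_id _)).trans ?_
    change HEq (𝟙 (((X.act p σ).app d).toFunctor.obj (X.base p d))) (𝟙 (X.base p d))
    rw [X.act_base]
  susp d p s x := ofArrows (toArrows x ⋙ X.susp d p s)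
  susp_nat p d d' θ s x :=
    congrArg (fun F => ofArrows (vertexFun θ.unop ⋙ toArrows x ⋙ F)) (X.susp_nat p θ s)
  susp_zero p d x := by
    rw [X.susp_zero]
    rfl
  susp_base p d s := by
    refine congrArg ofArrows (CategoryTheory.Functor.hext (fun _ => X.susp_base p d s) fun _ _ _ => ?_)
    refine (heq_of_eq ((X.susp d p s).map_id _)).trans ?_
    change HEq (𝟙 ((X.susp d p s).obj (X.base p d))) (𝟙 (X.base (p + 1) d))
    rw [X.susp_base]
  susp_act p q d σ τ s x := by
    rw [CatSymSpec.iterSusp_eq, CatSymSpec.iterSusp_eq, diagNerveMap_app, diagNerveMap_app]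
    exact congrArg (fun F => ofArrows (toArrows x ⋙ F)) (X.susp_act p q d σ τ s)

/-! ### From symmetric functors to symmetric spectra -/

/-- The sequence `(k, …, k, 1, 1, …)` with `p` entries `k`. -/
def diagObj (p k : ℕ) : Finfty where
  n i := if i < p then k else 1
  fin := (Set.finite_lt_nat p).subset fun i hi => by
    by_contra h
    exact hi (if_neg h)

/-- A morphism out of a sequence `m` given by finitely many based maps. -/
def mkHom (m n : Finfty) (f : ℕ → ℕ → ℕ) (h₀ : ∀ i, f i 0 = 0) (h₁ : ∀ i x, f i x ≤ n.n i)
    (h₂ : ∀ i x, m.n i < x → f i x = 0) (h₃ : {i | f i ≠ idOn 1}.Finite) : m ⟶ n :=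
  ⟨f, h₀, h₁, h₂, h₃⟩

theorem hom_ext {m n : Finfty} (φ ψ : m ⟶ n)
    (h : ∀ i x, Finfty.Hom.f φ i x = Finfty.Hom.f ψ i x) : φ = ψ :=
  Finfty.Hom.ext (funext fun i => funext fun x => h i x)

/-- The simplicial object `(S¹, …, S¹, 1, 1, …)` with `p` entries `S¹`. -/
def diagS (p : ℕ) : SimplexCategoryᵒᵖ ⥤ Finfty where
  obj d := diagObj p d.unop.len
  map {d d'} θ := mkHom _ _ (fun i => if i < p then circMap θ.unop else idOn 1)
    (fun i => by
      split_ifs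
      · exact circMap_zero _
      · rfl)
    (fun i x => by
      change (if i < p then circMap θ.unop else idOn 1) x ≤ if i < p then d'.unop.len else 1
      split_ifs
      · exact circMap_le _ _
      · unfold idOn
        split_ifs <;> omega)
    (fun i x hx => by
      change (if i < p then d.unop.len else 1) < x at hx
      split_ifs at hx ⊢
      · exact circMap_of_lt _ _ hx
      · exact if_neg (not_le.2 hx))
    ((Set.finite_lt_nat p).subset fun i hi => by
      by_contra h
      exact hi (if_neg h))
  map_id d := hom_ext _ _ fun i x => by
    change (if i < p then circMap (𝟙 d.unop) else idOn 1) x =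
      idOn (if i < p then d.unop.len else 1) x
    rw [circMap_id]
    split_ifs <;> rfl
  map_comp {d d' d''} θ η := hom_ext _ _ fun i x => by
    change (if i < p then circMap (η.unop ≫ θ.unop) else idOn 1) x =
      (if i < p then circMap η.unop else idOn 1) ((if i < p then circMap θ.unop else idOn 1) x)
    split_ifs
    · exact circMap_comp _ _ _
    · unfold idOn
      split_ifs <;> omega

/-- The morphism `(k, …, k, 1, 1, …) ⟶ (k, …, k, k, …, k, 1, …)` with `p` entries `k` in the
source and `p + q` entries `k` in the target, which is the identity on the first `p` entries
and maps the element `1` of the next `q` entries to the elements `s 0, …, s (q - 1)`. -/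
def insertS (p q k : ℕ) (s : Fin q → Fin (k + 1)) : diagObj p k ⟶ diagObj (p + q) k :=
  mkHom _ _ (fun i x => if i < p then idOn k x else
      if h : p ≤ i ∧ i < p + q then (if x = 1 then s ⟨i - p, by omega⟩ else 0) else idOn 1 x)
    (fun i => by
      split_ifs <;> first | rfl | (exfalso; omega))
    (fun i x => by
      change _ ≤ if i < p + q then k else 1
      dsimp only [idOn]
      split_ifs <;> omega)
    (fun i x hx => by
      change (if i < p then k else 1) < x at hx
      dsimp only [idOn]
      split_ifs at hx ⊢ <;> first | rfl | (exfalso; omega))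
    ((Set.finite_lt_nat (p + q)).subset fun i hi => by
      by_contra h
      have h' : ¬ i < p + q := h
      refine hi (funext fun x => ?_)
      rw [if_neg (by omega), dif_neg (by omega)])

/-- The extension of a permutation of `{0, …, p - 1}` to a permutation of the natural numbers
fixing all other numbers. -/
def extPerm {p : ℕ} (σ : Equiv.Perm (Fin p)) : Equiv.Perm ℕ :=
  σ.extendDomain Fin.equivSubtype

theorem extPerm_of_lt {p : ℕ} (σ : Equiv.Perm (Fin p)) (a : Fin p) :
    extPerm σ a = σ a :=
  Equiv.Perm.extendDomain_apply_image σ Fin.equivSubtype a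

theorem extPerm_of_ge {p : ℕ} (σ : Equiv.Perm (Fin p)) (i : ℕ) (hi : ¬ i < p) :
    extPerm σ i = i :=
  Equiv.Perm.extendDomain_apply_not_subtype σ Fin.equivSubtype hi

theorem extPerm_lt_iff {p : ℕ} (σ : Equiv.Perm (Fin p)) (i : ℕ) : extPerm σ i < p ↔ i < p := by
  by_cases hi : i < p
  · have := extPerm_of_lt σ ⟨i, hi⟩
    simp only at this
    rw [this]
    exact iff_of_true (σ _).2 hi
  · rw [extPerm_of_ge σ i hi]

theorem diagObj_perm {p : ℕ} (σ : Equiv.Perm (Fin p)) (r k : ℕ) (hr : r = p) (i : ℕ) :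
    (diagObj r k).n i = (diagObj r k).n (extPerm σ i) := by
  subst hr
  change (if _ then _ else _) = if _ then _ else _
  rw [if_congr (extPerm_lt_iff σ i) rfl rfl]

theorem blockPerm_castAdd {p q : ℕ} (σ : Equiv.Perm (Fin p)) (τ : Equiv.Perm (Fin q))
    (a : Fin p) : blockPerm σ τ (Fin.castAdd q a) = Fin.castAdd q (σ a) := by
  simp [blockPerm, Equiv.permCongr_apply]

theorem blockPerm_natAdd {p q : ℕ} (σ : Equiv.Perm (Fin p)) (τ : Equiv.Perm (Fin q))
    (a : Fin q) : blockPerm σ τ (Fin.natAdd p a) = Fin.natAdd p (τ a) := by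
  simp [blockPerm, Equiv.permCongr_apply]

/-- The sequence `n` with the `i`-th entry replaced by the one point set `{0}`. -/
def Finfty.kill (n : Finfty) (i : ℕ) : Finfty where
  n j := if j = i then 0 else n.n j
  fin := (n.fin.union (Set.finite_singleton i)).subset fun j hj => by
    by_contra h
    simp only [Set.mem_union, Set.mem_ofPred_eq, not_or, not_not, Set.mem_singleton_iff] at h
    exact hj ((if_neg h.2).trans h.1)

/-- The morphism `φ` with the `i`-th entry replaced by the zero map. -/
def Finfty.Hom.kill {m n n' : Finfty} (φ : m ⟶ n) (i : ℕ) (h : ∀ j, j ≠ i → n'.n j = n.n j) :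
    m ⟶ n' :=
  mkHom _ _ (fun j x => if j = i then 0 else Finfty.Hom.f φ j x)
    (fun j => by
      split_ifs
      · rfl
      · exact Finfty.Hom.f_zero φ j)
    (fun j x => by
      split_ifs with hj
      · exact Nat.zero_le _
      · rw [h j hj]
        exact Finfty.Hom.f_le φ j x)
    (fun j x hx => by
      split_ifs
      · rfl
      · exact Finfty.Hom.f_of_lt φ j x hx)
    (((Finfty.Hom.fin φ).union (Set.finite_singleton i)).subset fun j hj => by
      by_contra h
      simp only [Set.mem_union, Set.mem_ofPred_eq, not_or, not_not, Set.mem_singleton_iff] at h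
      refine hj (funext fun x => ?_)
      rw [if_neg h.2, h.1])

/-- The inclusion of the sequence in which the `i`-th entry is replaced by `{0}`. -/
def Finfty.kill_incl (n : Finfty) (i : ℕ) : n.kill i ⟶ n :=
  mkHom _ _ (fun j => idOn ((n.kill i).n j)) (fun j => by simp [idOn])
    (fun j x => by
      unfold idOn Finfty.kill
      dsimp only
      split_ifs <;> omega)
    (fun j x hx => if_neg (not_le.2 hx))
    ((n.kill i).fin.subset fun j hj h => hj (by rw [h]))

/-- The sequence `({0}, 1, 1, …)`. -/
def Finfty.nul : Finfty := (diagObj 0 0).kill 0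

/-- The canonical morphism `({0}, 1, 1, …) ⟶ n`, which is the identity in all positions
`i > 0` with `n i = 1`, and zero in the other positions. -/
def Finfty.nulHom (n : Finfty) : Finfty.nul ⟶ n :=
  mkHom _ _ (fun j x => if j ≠ 0 ∧ n.n j = 1 then idOn 1 x else 0)
    (fun j => by simp [idOn])
    (fun j x => by
      unfold idOn
      split_ifs <;> omega)
    (fun j x hx => by
      change (if j = 0 then 0 else 1) < x at hx
      unfold idOn
      split_ifs at hx ⊢ <;> omega)
    ((n.fin.union (Set.finite_singleton 0)).subset fun j hj => by
      by_contra h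
      simp only [Set.mem_union, Set.mem_ofPred_eq, not_or, not_not, Set.mem_singleton_iff] at h
      refine hj (funext fun x => ?_)
      rw [if_pos ⟨h.2, h.1⟩])

/-- The object of the terminal category `F ({0}, 1, 1, …)`. -/
def SymFun.pt (F : SymFun.{u}) : F.F.obj Finfty.nul :=
  ((F.term Finfty.nul ⟨0, rfl⟩).some.from (Cat.of (Discrete PUnit.{u + 1}))).toFunctor.obj ⟨⟨⟩⟩

/-- The basepoint of `F n`: the image of the terminal category `F ({0}, 1, 1, …)`. -/
def SymFun.base (F : SymFun.{u}) (n : Finfty) : F.F.obj n :=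
  (F.F.map n.nulHom).toFunctor.obj F.pt

theorem terminal_functor_ext {E : Type u} [SmallCategory E] {D : Cat.{u, u}}
    (hD : Limits.IsTerminal D) (F G : E ⥤ D) : F = G :=
  congrArg Cat.Hom.toFunctor (hD.hom_ext (Cat.Hom.ofFunctor F : Cat.of E ⟶ D)
    (Cat.Hom.ofFunctor G))

theorem terminal_obj_ext {D : Cat.{u, u}} (hD : Limits.IsTerminal D) (x y : D) : x = y :=
  congrArg (fun F : Discrete PUnit.{u + 1} ⥤ D => F.obj ⟨⟨⟩⟩)
    (terminal_functor_ext hD ((Functor.const _).obj x) ((Functor.const _).obj y))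

/-- Morphisms of `𝓕^∞` with a zero entry induce constant functors at the basepoint. -/
theorem SymFun.map_zero (F : SymFun.{u}) {m n : Finfty} (φ : m ⟶ n) (i : ℕ)
    (h : ∀ x, Finfty.Hom.f φ i x = 0) :
    (F.F.map φ).toFunctor = (Functor.const _).obj (F.base n) := by
  obtain ⟨hz⟩ := F.term (n.kill i) ⟨i, if_pos rfl⟩
  have hk : ∀ j, j ≠ i → (n.kill i).n j = n.n j := fun j hj => if_neg hj
  have h₁ : φ = Finfty.Hom.kill φ i hk ≫ n.kill_incl i := hom_ext _ _ fun j x => by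
    change Finfty.Hom.f φ j x =
      idOn (if j = i then 0 else n.n j) (if j = i then 0 else Finfty.Hom.f φ j x)
    have := Finfty.Hom.f_le φ j x
    by_cases hj : j = i
    · subst hj
      rw [h]
      simp [idOn]
    · rw [if_neg hj, if_neg hj, idOn, if_pos this]
  let w : Finfty := Finfty.nul.kill i
  obtain ⟨hw⟩ := F.term w ⟨i, if_pos rfl⟩
  have h₂ : Finfty.kill_incl Finfty.nul i ≫ n.nulHom =
      Finfty.Hom.kill (Finfty.kill_incl Finfty.nul i ≫ n.nulHom) i hk ≫ n.kill_incl i :=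
    hom_ext _ _ fun j x => by
      change Finfty.Hom.f n.nulHom j (idOn (if j = i then 0 else Finfty.nul.n j) x) =
        idOn (if j = i then 0 else n.n j) (if j = i then 0 else
          Finfty.Hom.f n.nulHom j (idOn (if j = i then 0 else Finfty.nul.n j) x))
      have := Finfty.Hom.f_le n.nulHom j (idOn (if j = i then 0 else Finfty.nul.n j) x)
      by_cases hj : j = i
      · subst hj
        have h₀ : idOn 0 x = 0 := by
          unfold idOn
          split_ifs <;> omega
        simp only [if_true]
        rw [h₀, Finfty.Hom.f_zero]
        rfl
      · rw [if_neg hj] at this ⊢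
        rw [if_neg hj, if_neg hj]
        exact (if_pos this).symm
  let ptw : F.F.obj w := (hw.from (Cat.of (Discrete PUnit.{u + 1}))).toFunctor.obj ⟨⟨⟩⟩
  let z : F.F.obj (n.kill i) :=
    (F.F.map (Finfty.Hom.kill (Finfty.kill_incl Finfty.nul i ≫ n.nulHom) i hk)).toFunctor.obj ptw
  obtain ⟨hn⟩ := F.term Finfty.nul ⟨0, rfl⟩
  have h₃ : F.base n = (F.F.map (n.kill_incl i)).toFunctor.obj z := by
    have e : F.pt = (F.F.map (Finfty.kill_incl Finfty.nul i)).toFunctor.obj ptw :=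
      terminal_obj_ext hn _ _
    have h₄ := congrArg (fun ψ => (F.F.map ψ).toFunctor.obj ptw) h₂
    rw [F.F.map_comp, F.F.map_comp] at h₄
    unfold SymFun.base
    rw [e]
    exact h₄
  rw [h₁, F.F.map_comp]
  have h₅ := terminal_functor_ext hz
    (F.F.map (Finfty.Hom.kill φ i hk)).toFunctor ((Functor.const _).obj z)
  change (F.F.map _).toFunctor ⋙ (F.F.map _).toFunctor = _
  rw [h₅, h₃]
  exact CategoryTheory.Functor.hext (fun _ => rfl) fun _ _ _ =>
    heq_of_eq ((F.F.map (n.kill_incl i)).toFunctor.map_id z)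

theorem SymFun.map_base (F : SymFun.{u}) {m n : Finfty} (φ : m ⟶ n) :
    (F.F.map φ).toFunctor.obj (F.base m) = F.base n := by
  have h := F.map_zero (m.nulHom ≫ φ) 0 (fun x => by
    change Finfty.Hom.f φ 0 (if (0 : ℕ) ≠ 0 ∧ m.n 0 = 1 then idOn 1 x else 0) = 0
    rw [if_neg (fun h => h.1 rfl), Finfty.Hom.f_zero])
  rw [F.F.map_comp] at h
  exact congrArg (fun G => G.obj F.pt) h

theorem SymFun.bang_base (F : SymFun.{u}) (θ : Equiv.Perm ℕ) (m n : Finfty)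
    (h : ∀ i, m.n i = n.n (θ i)) : (F.bang θ m n h).toFunctor.obj (F.base m) = F.base n := by
  let ψ := Finfty.Hom.kill (𝟙 n) 0 (n' := n) (fun _ _ => rfl)
  let φ : m ⟶ m := mkHom _ _ (fun i => Finfty.Hom.f ψ (θ i)) (fun i => Finfty.Hom.f_zero ψ _)
    (fun i x => by
      rw [h]
      exact Finfty.Hom.f_le ψ _ x)
    (fun i x hx => by
      rw [h] at hx
      exact Finfty.Hom.f_of_lt ψ _ x hx)
    (Set.Finite.preimage θ.injective.injOn (Finfty.Hom.fin ψ))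
  have h₁ := F.bang_nat θ m n m n h h ψ φ (fun i => rfl)
  have h₂ := congrArg (fun G : F.F.obj m ⟶ F.F.obj n => G.toFunctor.obj (F.base m)) h₁
  change (F.bang θ m n h).toFunctor.obj ((F.F.map φ).toFunctor.obj (F.base m)) =
    (F.F.map ψ).toFunctor.obj ((F.bang θ m n h).toFunctor.obj (F.base m)) at h₂
  rw [F.map_base, F.map_zero ψ 0 (fun x => rfl)] at h₂
  exact h₂

theorem idOn_one_eq_one (x : ℕ) : idOn 1 x = 1 ↔ x = 1 := by
  unfold idOn
  grind

theorem insertS_zero (p k : ℕ) (s : Fin 0 → Fin (k + 1)) : insertS p 0 k s = 𝟙 _ :=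
  hom_ext _ _ fun i x => by
    change (if i < p then idOn k x else
      if h : p ≤ i ∧ i < p + 0 then (if x = 1 then (s ⟨i - p, by omega⟩ : ℕ) else 0)
      else idOn 1 x) = idOn (if i < p then k else 1) x
    by_cases h : i < p
    · rw [if_pos h, if_pos h]
    · rw [if_neg h, if_neg h, dif_neg (by omega)]

theorem insertS_succ (p q k : ℕ) (s : Fin (q + 1) → Fin (k + 1)) :
    insertS p (q + 1) k s =
      insertS p q k (fun i => s i.castSucc) ≫ insertS (p + q) 1 k (fun _ => s (Fin.last q)) :=
  hom_ext _ _ fun i x => by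
    change (if i < p then idOn k x else
        if h : p ≤ i ∧ i < p + (q + 1) then (if x = 1 then (s ⟨i - p, by omega⟩ : ℕ) else 0)
        else idOn 1 x) =
      (fun y => if i < p + q then idOn k y else
        if h : p + q ≤ i ∧ i < p + q + 1 then (if y = 1 then (s (Fin.last q) : ℕ) else 0)
        else idOn 1 y) (if i < p then idOn k x else
        if h : p ≤ i ∧ i < p + q then (if x = 1 then (s ⟨i - p, by omega⟩ : ℕ) else 0)
        else idOn 1 x)
    dsimp only
    by_cases h₁ : i < p
    · rw [if_pos h₁, if_pos h₁, if_pos (by omega)]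
      unfold idOn
      split_ifs <;> omega
    · rw [if_neg h₁, if_neg h₁]
      by_cases h₂ : i < p + q
      · rw [dif_pos (by omega), dif_pos (by omega), if_pos h₂]
        unfold idOn
        have := (s ⟨i - p, by omega⟩).2
        split_ifs <;> omega
      · rw [if_neg h₂]
        by_cases h₃ : i < p + q + 1
        · have hs : (⟨i - p, by omega⟩ : Fin (q + 1)) = Fin.last q := by
            ext
            simp
            omega
          rw [dif_pos (by omega), dif_pos (by omega), dif_neg (by omega), hs]
          simp only [idOn_one_eq_one]
        · rw [dif_neg (by omega), dif_neg (by omega), dif_neg (by omega)]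
          unfold idOn
          split_ifs <;> omega

theorem iterSusp_insertS (F : SymFun.{u}) (p q k : ℕ) (s : Fin q → Fin (k + 1)) :
    iterSusp (X := fun r => F.F.obj (diagObj p k) ⥤ F.F.obj (diagObj r k))
      (fun r t x => x ⋙ (F.F.map (insertS r 1 k (fun _ => t))).toFunctor) p q s (𝟭 _) =
      (F.F.map (insertS p q k s)).toFunctor := by
  induction q with
  | zero =>
    have h := F.F.map_id (diagObj p k)
    rw [insertS_zero]
    exact (congrArg Cat.Hom.toFunctor h).symm
  | succ q ih =>
    rw [insertS_succ, F.F.map_comp]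
    change iterSusp (X := fun r => F.F.obj (diagObj p k) ⥤ F.F.obj (diagObj r k)) _ p q _ _ ⋙
      _ = _ ⋙ _
    rw [ih]

/-- The symmetric spectrum in simplicial categories of a symmetric functor `F`: its `p`-th
term is the diagonal of `F (S¹, …, S¹, 1, 1, …)`, on which permutations `σ` act by `σ_!`. The
suspension map for an element `s` of `S¹` is given by the map `1 ⟶ S¹` in the position `p`
which sends `1` to `s`. -/
def IObj (F : SymFun.{u}) : CatSymSpec.{u} where
  X p := diagS p ⋙ F.F
  act p σ :=
    { app := fun d => F.bang (extPerm σ) (diagObj p d.unop.len) (diagObj p d.unop.len)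
        (diagObj_perm σ p _ rfl)
      naturality := fun d d' θ => F.bang_nat _ _ _ _ _ _ _ _ _ fun i => by
        change (if i < p then circMap θ.unop else idOn 1) =
          if extPerm σ i < p then circMap θ.unop else idOn 1
        rw [if_congr (extPerm_lt_iff σ i) rfl rfl] }
  act_one p := by
    refine NatTrans.ext (funext fun d => ?_)
    refine F.bang_id (extPerm 1) (diagObj p d.unop.len) (diagObj_perm 1 p _ rfl) fun i hi => ?_
    · by_cases h : i < p
      · exact absurd (extPerm_of_lt (1 : Equiv.Perm (Fin p)) ⟨i, h⟩) hi
      · exact if_neg h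
  act_mul p σ τ := by
    refine NatTrans.ext (funext fun d => ?_)
    have h : extPerm (σ * τ) = extPerm σ * extPerm τ :=
      (Equiv.Perm.extendDomain_mul Fin.equivSubtype σ τ).symm
    refine Eq.trans ?_ (F.bang_mul (extPerm σ) (extPerm τ) _ _ _
      (diagObj_perm σ p d.unop.len rfl) (diagObj_perm τ p d.unop.len rfl) (fun i => by
        rw [← h]
        exact diagObj_perm _ p _ rfl i))
    dsimp only
    congr 1
  base p d := F.base (diagObj p d.unop.len)
  base_nat p d d' θ := F.map_base ((diagS p).map θ)
  act_base p σ d := F.bang_base _ _ _ _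
  susp d p s := (F.F.map (insertS p 1 d.unop.len (fun _ => s))).toFunctor
  susp_nat p d d' θ s := by
    have h : insertS p 1 d.unop.len (fun _ => s) ≫ (diagS (p + 1)).map θ =
        (diagS p).map θ ≫ insertS p 1 d'.unop.len (fun _ => circ θ s) :=
      hom_ext _ _ fun i x => by
        change (if i < p + 1 then circMap θ.unop else idOn 1) (if i < p then idOn d.unop.len x else
            if h : p ≤ i ∧ i < p + 1 then (if x = 1 then (s : ℕ) else 0) else idOn 1 x) =
          (fun y => if i < p then idOn d'.unop.len y else
            if h : p ≤ i ∧ i < p + 1 then (if y = 1 then circMap θ.unop s else 0) else idOn 1 y)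
            ((if i < p then circMap θ.unop else idOn 1) x)
        dsimp only
        by_cases h₁ : i < p
        · rw [if_pos h₁, if_pos h₁, if_pos h₁, if_pos (by omega)]
          have h₂ := circMap_le θ.unop x
          have h₃ := circMap_of_lt θ.unop x
          have h₄ := circMap_zero θ.unop
          unfold idOn
          by_cases h₅ : x ≤ d.unop.len
          · rw [if_pos h₅, if_pos h₂]
          · rw [if_neg h₅, h₃ (by omega), h₄]
            rfl
        · rw [if_neg h₁, if_neg h₁, if_neg h₁]
          by_cases h₂ : i < p + 1
          · rw [if_pos h₂, dif_pos (by omega), dif_pos (by omega)]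
            have h₄ := circMap_zero θ.unop
            by_cases hx : x = 1
            · subst hx
              rfl
            · rw [if_neg hx, h₄, if_neg]
              rw [idOn_one_eq_one]
              exact hx
          · rw [if_neg h₂, dif_neg (by omega), dif_neg (by omega)]
    exact congrArg Cat.Hom.toFunctor ((F.F.map_comp _ _).symm.trans
      ((congrArg F.F.map h).trans (F.F.map_comp _ _)))
  susp_zero p d := F.map_zero _ p fun x => by
    change (if p < p then idOn d.unop.len x else
      if h : p ≤ p ∧ p < p + 1 then (if x = 1 then 0 else 0) else idOn 1 x) = 0
    rw [if_neg (lt_irrefl _), dif_pos (by omega)]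
    simp
  susp_base p d s := F.map_base _
  susp_act p q d σ τ s := by
    refine Eq.trans (congrArg (fun G => G ⋙ _) (iterSusp_insertS F p q _ s)) (Eq.trans ?_
      (congrArg (fun G => _ ⋙ G) (iterSusp_insertS F p q _ _).symm))
    have hlt : ∀ i, i < p → extPerm (blockPerm σ τ) i = extPerm σ i := fun i hi => by
      have h₁ := extPerm_of_lt (blockPerm σ τ) (Fin.castAdd q ⟨i, hi⟩)
      rw [blockPerm_castAdd] at h₁
      have h₂ := extPerm_of_lt σ ⟨i, hi⟩
      exact h₁.trans h₂.symm
    have hge : ∀ j : Fin q, extPerm (blockPerm σ τ) (p + j) = p + τ j := fun j => by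
      have h₁ := extPerm_of_lt (blockPerm σ τ) (Fin.natAdd p j)
      rw [blockPerm_natAdd] at h₁
      exact h₁
    have hlt_iff : ∀ i, extPerm (blockPerm σ τ) i < p ↔ i < p := fun i => by
      by_cases hi : i < p
      · rw [hlt i hi, extPerm_lt_iff]
      · refine iff_of_false ?_ hi
        by_cases hi' : i < p + q
        · have := hge ⟨i - p, by omega⟩
          simp only at this
          rw [show p + (i - p) = i by omega] at this
          omega
        · rw [extPerm_of_ge _ i hi']
          exact hi
    have hn : ∀ i, (diagObj p d.unop.len).n i =
        (diagObj p d.unop.len).n (extPerm (blockPerm σ τ) i) := fun i => by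
      change (if _ then _ else _) = if _ then _ else _
      rw [if_congr (hlt_iff i) rfl rfl]
    have h₁ := F.bang_nat (extPerm (blockPerm σ τ)) (diagObj p d.unop.len)
      (diagObj p d.unop.len) (diagObj (p + q) d.unop.len) (diagObj (p + q) d.unop.len) hn
      (diagObj_perm _ (p + q) _ rfl) (insertS p q _ (fun i => s (τ.symm i)))
      (insertS p q _ s) (fun i => funext fun x => by
        change (if i < p then idOn d.unop.len x else
          if h : p ≤ i ∧ i < p + q then (if x = 1 then (s ⟨i - p, by omega⟩ : ℕ) else 0)
            else idOn 1 x) =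
          (fun i' => if i' < p then idOn d.unop.len x else
          if h : p ≤ i' ∧ i' < p + q then
            (if x = 1 then (s (τ.symm ⟨i' - p, by omega⟩) : ℕ) else 0)
            else idOn 1 x) (extPerm (blockPerm σ τ) i)
        dsimp only
        by_cases h₁ : i < p
        · rw [if_pos h₁, if_pos ((hlt_iff i).2 h₁)]
        · rw [if_neg h₁, if_neg (fun h => h₁ ((hlt_iff i).1 h))]
          by_cases h₂ : i < p + q
          · obtain ⟨j, rfl⟩ : ∃ j : Fin q, i = p + j := ⟨⟨i - p, by omega⟩, by simp; omega⟩
            have h₃ := hge j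
            rw [dif_pos (by omega), dif_pos (by omega)]
            have h₄ : ∀ (a : ℕ) (ha : a < q), a = τ j → τ.symm ⟨a, ha⟩ = j := fun a ha h => by
              subst h
              simp
            rw [h₄ _ _ (by omega)]
            simp
          · rw [extPerm_of_ge _ i h₂, dif_neg (by omega), dif_neg (by omega)])
    have h₂ : F.bang (extPerm (blockPerm σ τ)) (diagObj p d.unop.len)
        (diagObj p d.unop.len) hn = F.bang (extPerm σ) (diagObj p d.unop.len)
        (diagObj p d.unop.len) (diagObj_perm σ p _ rfl) := by
      let ρ := (extPerm σ)⁻¹ * extPerm (blockPerm σ τ)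
      have hρ : ∀ i, i < p → ρ i = i := fun i hi => by
        change (extPerm σ).symm _ = i
        rw [Equiv.symm_apply_eq, hlt i hi]
      have hρ' : ∀ i, (diagObj p d.unop.len).n i = (diagObj p d.unop.len).n (ρ i) := fun i => by
        rw [diagObj_perm σ p _ rfl (ρ i), hn i]
        change _ = (diagObj p d.unop.len).n (extPerm σ ((extPerm σ).symm _))
        rw [Equiv.apply_symm_apply]
      have hmul : extPerm (blockPerm σ τ) = extPerm σ * ρ := (mul_inv_cancel_left _ _).symm
      have h₃ := F.bang_mul (extPerm σ) ρ (diagObj p d.unop.len) (diagObj p d.unop.len)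
        (diagObj p d.unop.len) (diagObj_perm σ p _ rfl) hρ' (fun i => by
          rw [← hmul]
          exact hn i)
      rw [F.bang_id ρ _ hρ' (fun i hi => if_neg fun h => hi (hρ i h)), Category.id_comp] at h₃
      rw [← h₃]
      congr 1
    rw [h₂] at h₁
    exact congrArg Cat.Hom.toFunctor h₁

/-! ### Segal's construction -/

section Seg

variable {X X' : Type}

/-- The category `C̄_A` for a based set `A` (given by its set of elements different from the
basepoint): the systems of objects indexed by the subsets of `A` for which all structure maps
are isomorphisms. -/
def SegBar (D : PermCat.{u}) (A : Set X) :=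
  {a : Bar D (fun _ : Unit => A) // ∀ i T U S h, IsIso (a.ρ i T U S h)}

instance (D : PermCat.{u}) (A : Set X) : Category.{u} (SegBar D A) where
  Hom a b := a.1 ⟶ b.1
  id a := 𝟙 a.1
  comp φ ψ := CategoryStruct.comp (obj := Bar D (fun _ : Unit => A)) φ ψ
  id_comp φ := Category.id_comp (obj := Bar D (fun _ : Unit => A)) φ
  comp_id φ := Category.comp_id (obj := Bar D (fun _ : Unit => A)) φ
  assoc φ ψ χ := Category.assoc (obj := Bar D (fun _ : Unit => A)) φ ψ χ

/-- The functoriality of `C̄_A` by inverse images. Elements outside of `A` are identified with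
the basepoint. -/
def SegBar.pull (D : PermCat.{u}) {A : Set X} {A' : Set X'} (g : X → X')
    (hg : ∀ x, g x ∈ A' → x ∈ A) : SegBar D A ⥤ SegBar D A' where
  obj a := ⟨(Bar.pull D (BarMap.ofFun (fun _ : Unit => g) fun _ => hg)).obj a.1,
    fun _ _ _ _ _ => a.2 _ _ _ _ _⟩
  map φ := (Bar.pull D (BarMap.ofFun (fun _ : Unit => g) fun _ => hg)).map φ
  map_id _ := rfl
  map_comp _ _ := rfl

/-- The zero system. -/
def SegBar.zero (D : PermCat.{u}) (A : Set X) : SegBar D A :=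
  ⟨Bar.zero D _, fun _ _ _ _ _ => inferInstanceAs (IsIso (λ_ _).hom)⟩

theorem SegBar.functor_ext {E : Type v} [Category.{w} E] {D : PermCat.{u}} {A : Set X}
    {F G : E ⥤ SegBar D A} (hobj : ∀ x, (F.obj x).1 = (G.obj x).1)
    (hmap : ∀ (x y : E) (φ : x ⟶ y) (S : Tup (fun _ : Unit => A)),
      HEq (Bar.Hom.f (F.map φ) S) (Bar.Hom.f (G.map φ) S)) : F = G := by
  refine CategoryTheory.Functor.hext (fun x => Subtype.ext (hobj x)) fun x y φ => ?_
  exact Bar.Hom.heq (hobj x) (hobj y) (F.map φ) (G.map φ) (hmap x y φ)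

theorem SegBar.pull_congr (D : PermCat.{u}) {A : Set X} {A' : Set X'} (g g' : X → X')
    (hg : ∀ x, g x ∈ A' → x ∈ A) (hg' : ∀ x, g' x ∈ A' → x ∈ A)
    (h : ∀ x, g x ∈ A' ∨ g' x ∈ A' → g x = g' x) :
    SegBar.pull D g hg = SegBar.pull D g' hg' := by
  have key := Bar.pull_eq D (BarMap.ofFun (fun _ : Unit => g) fun _ => hg)
    (BarMap.ofFun (A' := fun _ : Unit => A') (fun _ : Unit => g') fun _ => hg')
    (fun S _ => Subtype.ext (funext fun i => by
      change g ⁻¹' S.1 i = g' ⁻¹' S.1 i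
      ext x
      constructor
      · intro hx
        have := h x (Or.inl (S.2 i hx))
        rw [Set.mem_preimage, ← this]
        exact hx
      · intro hx
        have := h x (Or.inr (S.2 i hx))
        rw [Set.mem_preimage, this]
        exact hx)) (fun _ _ _ _ _ => Or.inr (Or.inr rfl))
  refine SegBar.functor_ext (fun a => congrArg (fun F => F.obj a.1) key) fun a b φ S => ?_
  change HEq (Bar.Hom.f ((Bar.pull D (BarMap.ofFun (fun _ : Unit => g) fun _ => hg)).map φ) S) _
  rw [key]
  rfl

theorem SegBar.pull_comm (D : PermCat.{u}) {Y Y' : Type} {A : Set X} {B : Set Y} {B' : Set Y'}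
    {A' : Set X'} (g : X → Y) (h : Y → X') (g' : X → Y') (h' : Y' → X')
    (hg : ∀ x, g x ∈ B → x ∈ A) (hh : ∀ x, h x ∈ A' → x ∈ B) (hg' : ∀ x, g' x ∈ B' → x ∈ A)
    (hh' : ∀ x, h' x ∈ A' → x ∈ B') (hc : ∀ x, h (g x) = h' (g' x)) :
    SegBar.pull D g hg ⋙ SegBar.pull D h hh = SegBar.pull D g' hg' ⋙ SegBar.pull D h' hh' :=
  SegBar.pull_congr D (fun x => h (g x)) (fun x => h' (g' x)) (fun _ hx => hg _ (hh _ hx))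
    (fun _ hx => hg' _ (hh' _ hx)) fun x _ => hc x

theorem SegBar.pull_zero (D : PermCat.{u}) {A : Set X} {A' : Set X'} (g : X → X')
    (hg : ∀ x, g x ∈ A' → x ∈ A) (h : ∀ x, g x ∉ A') :
    SegBar.pull D g hg = (Functor.const _).obj (SegBar.zero D A') := by
  have key := Bar.pull_zero D
    (BarMap.ofFun (A' := fun _ : Unit => A') (fun _ : Unit => g) fun _ => hg) (fun S => ⟨(), by
      change g ⁻¹' S.1 () = ∅
      ext x
      constructor
      · intro hx
        exact h x (S.2 () hx)
      · intro hx
        exact hx.elim⟩)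
  refine SegBar.functor_ext (fun a => congrArg (fun F => F.obj a.1) key) fun a b φ S => ?_
  change HEq (Bar.Hom.f ((Bar.pull D (BarMap.ofFun (fun _ : Unit => g) fun _ => hg)).map φ) S) _
  rw [key]
  rfl

end Seg

/-- The smash power `{0, …, k} ∧ ⋯ ∧ {0, …, k}` of `p` factors without its basepoint. -/
def smashSet (p k : ℕ) : Set (Fin p → ℕ) := {x | ∀ i, 1 ≤ x i ∧ x i ≤ k}

/-- The functor induced by a structure map of the circle. -/
def KSegMap (C : PermCat.{u}) (p : ℕ) {a b : SimplexCategory} (θ : a ⟶ b) :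
    SegBar C (smashSet p b.len) ⥤ SegBar C (smashSet p a.len) :=
  SegBar.pull C (fun (x : Fin p → ℕ) i => circMap θ (x i)) fun x h i => by
    have h₁ : 1 ≤ circMap θ (x i) := (h i).1
    constructor
    · by_contra h₂
      rw [show x i = 0 by omega, circMap_zero] at h₁
      omega
    · by_contra h₂
      rw [circMap_of_lt _ _ (not_le.1 h₂)] at h₁
      omega

/-- The functor induced by a permutation `σ` of the smash factors. -/
def KSegPerm (C : PermCat.{u}) (p k : ℕ) (σ : Equiv.Perm (Fin p)) :
    SegBar C (smashSet p k) ⥤ SegBar C (smashSet p k) :=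
  SegBar.pull C (fun (x : Fin p → ℕ) i => x (σ.symm i)) fun x h i => by
    have h₁ : 1 ≤ x (σ.symm (σ i)) ∧ x (σ.symm (σ i)) ≤ k := h (σ i)
    rw [Equiv.symm_apply_apply] at h₁
    exact h₁

/-- The functor induced by smashing with an element `s`. -/
def KSegSusp (C : PermCat.{u}) (p k : ℕ) (s : ℕ) :
    SegBar C (smashSet p k) ⥤ SegBar C (smashSet (p + 1) k) :=
  SegBar.pull C (fun y : Fin p → ℕ => Fin.snoc (α := fun _ => ℕ) y s) fun y h i => by
    have h₁ := h i.castSucc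
    rw [Fin.snoc_castSucc] at h₁
    exact h₁

/-- The functor induced by smashing with `q` elements. -/
def KSegAppend (C : PermCat.{u}) (p q k : ℕ) (s : Fin q → ℕ) :
    SegBar C (smashSet p k) ⥤ SegBar C (smashSet (p + q) k) :=
  SegBar.pull C (fun y : Fin p → ℕ => Fin.append y s) fun y h i => by
    have h₁ := h (Fin.castAdd q i)
    rw [Fin.append_left] at h₁
    exact h₁

theorem iterSusp_snoc (C : PermCat.{u}) (p q k : ℕ) (s : Fin q → Fin (k + 1)) :
    iterSusp (X := fun r => SegBar C (smashSet p k) ⥤ SegBar C (smashSet r k))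
      (fun r t x => x ⋙ KSegSusp C r k t) p q s (𝟭 _) =
      KSegAppend C p q k (fun i => s i) := by
  induction q with
  | zero =>
    change SegBar.pull C id (fun _ h => h) = _
    refine SegBar.pull_congr C _ _ _ _ fun y _ => funext fun i => ?_
    exact (Fin.append_left y _ i).symm
  | succ q ih =>
    change iterSusp (X := fun r => SegBar C (smashSet p k) ⥤ SegBar C (smashSet r k)) _ p q _ _ ⋙
      _ = _
    rw [ih]
    refine SegBar.pull_comm C _ _ (fun y : Fin p → ℕ => Fin.append y (fun i => (s i : ℕ))) id
      _ _ _ (fun _ h => h) fun y => funext fun i => ?_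
    change Fin.snoc (α := fun _ => ℕ) (Fin.append y (fun i : Fin q => (s i.castSucc : ℕ)))
      (s (Fin.last q) : ℕ) i = Fin.append y (fun i => (s i : ℕ)) i
    refine Fin.addCases (m := p) (n := q + 1) (fun a => ?_) (fun a => ?_) i
    · rw [Fin.append_left]
      have h : Fin.castAdd (q + 1) a = (Fin.castAdd q a).castSucc := rfl
      rw [h, Fin.snoc_castSucc, Fin.append_left]
    · rw [Fin.append_right]
      refine Fin.lastCases ?_ (fun b => ?_) a
      · have h : Fin.natAdd p (Fin.last q) = Fin.last (p + q) := rfl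
        rw [h]
        exact Fin.snoc_last _ _
      · have h : Fin.natAdd p b.castSucc = (Fin.natAdd p b).castSucc := rfl
        rw [h, Fin.snoc_castSucc, Fin.append_right]

/-- The simplicial category `C̄` applied to the `p`-fold smash power of the circle. -/
def KSegX (C : PermCat.{u}) (p : ℕ) : SimplexCategoryᵒᵖ ⥤ Cat.{u, u} where
  obj := fun d => Cat.of (SegBar C (smashSet p d.unop.len))
  map := fun {d d'} θ => (KSegMap C p θ.unop).toCatHom
  map_id := fun d => Cat.ext (SegBar.pull_congr C
        (fun (x : Fin p → ℕ) i => circMap (𝟙 d.unop) (x i)) id _ (fun _ h => h) fun x h =>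
        funext fun i => by
          change circMap (𝟙 d.unop) (x i) = x i
          have hle : x i ≤ d.unop.len := by
            rcases h with h | h
            · have h₁ : 1 ≤ circMap (𝟙 d.unop) (x i) := (h i).1
              by_contra h₂
              rw [circMap_of_lt _ _ (not_le.1 h₂)] at h₁
              omega
            · exact (h i).2
          rw [circMap_id, idOn, if_pos hle])
  map_comp := fun θ η => Cat.ext (SegBar.pull_comm C
    (fun (x : Fin p → ℕ) i => circMap (η.unop ≫ θ.unop) (x i)) id
    (fun (x : Fin p → ℕ) i => circMap θ.unop (x i))
    (fun (x : Fin p → ℕ) i => circMap η.unop (x i)) _ (fun _ h => h) _ _ fun x =>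
      funext fun i => circMap_comp _ _ _)

/-- Segal's construction of the `K`-theory of a permutative category, before taking nerves: the
`p`-th term is `C̄` applied to the `p`-fold smash power of the simplicial circle. -/
def KSegCat (C : PermCat.{u}) : CatSymSpec.{u} where
  X p := KSegX C p
  act p σ :=
    { app := fun d => (KSegPerm C p d.unop.len σ).toCatHom
      naturality := fun d d' θ => rfl }
  act_one p := rfl
  act_mul p σ τ := rfl
  base p d := SegBar.zero C _
  base_nat p d d' θ := rfl
  act_base p σ d := rfl
  susp d p s := KSegSusp C p d.unop.len s
  susp_nat p d d' θ s := by
    refine SegBar.pull_comm C _ _ _ _ _ _ _ _ fun y => funext fun i => ?_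
    change circMap θ.unop (Fin.snoc (α := fun _ => ℕ) y (s : ℕ) i) =
      Fin.snoc (α := fun _ => ℕ) (fun i => circMap θ.unop (y i)) (circMap θ.unop s) i
    refine Fin.lastCases ?_ (fun j => ?_) i
    · rw [Fin.snoc_last, Fin.snoc_last]
    · rw [Fin.snoc_castSucc, Fin.snoc_castSucc]
  susp_zero p d := SegBar.pull_zero C _ _ fun y h => by
    have := (h (Fin.last p)).1
    rw [Fin.snoc_last] at this
    exact absurd this (Nat.not_succ_le_zero 0)
  susp_base p d s := rfl
  susp_act p q d σ τ s := by
    refine Eq.trans (congrArg (fun G => G ⋙ _) (iterSusp_snoc C p q _ s)) (Eq.trans ?_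
      (congrArg (fun G => _ ⋙ G) (iterSusp_snoc C p q _ _).symm))
    refine SegBar.pull_comm C _ _ _ _ _ _ _ _ fun y => funext fun i => ?_
    refine Fin.addCases (fun a => ?_) (fun a => ?_) i
    · have h : (blockPerm σ τ).symm (Fin.castAdd q a) = Fin.castAdd q (σ.symm a) := by
        rw [Equiv.symm_apply_eq, blockPerm_castAdd, Equiv.apply_symm_apply]
      rw [h, Fin.append_left, Fin.append_left]
    · have h : (blockPerm σ τ).symm (Fin.natAdd p a) = Fin.natAdd p (τ.symm a) := by
        rw [Equiv.symm_apply_eq, blockPerm_natAdd, Equiv.apply_symm_apply]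
      rw [h, Fin.append_right, Fin.append_right]

/-- Segal's construction of the `K`-theory spectrum of a permutative category. -/
def KSeg (C : PermCat.{u}) : SymSpec.{u} := (KSegCat C).nerve

/-- A `1`-morphism of permutative categories is strong if its structure maps are
isomorphisms. -/
def IsStrong {C D : PermCat.{u}} (f : MultiLin (fun _ : Unit => C) D) : Prop :=
  ∀ x y z h, IsIso (f.δ () x y z h)

theorem isSum_unit {C : PermCat.{u}} (x y : C) :
    IsSum (C := fun _ : Unit => C) () (fun _ => x) (fun _ => y) (fun _ => x ⊗ y) :=
  ⟨rfl, fun _ hj => absurd rfl hj⟩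

theorem comp_heq_id {E : Type v} [Category.{w} E] {x y z : E} (f : x ⟶ y) (g : y ⟶ z)
    (hf : HEq f (𝟙 y)) (hg : HEq g (𝟙 z)) (hx : x = y) (hy : y = z) : HEq (f ≫ g) (𝟙 z) := by
  subst hx hy
  rw [eq_of_heq hf, eq_of_heq hg, Category.comp_id]

theorem map_heq_id {E : Type v} [Category.{w} E] {E' : Type u} [Category.{u} E'] (F : E ⥤ E')
    {x y : E} (f : x ⟶ y) (hx : x = y) (hf : HEq f (𝟙 y)) : HEq (F.map f) (𝟙 (F.obj y)) := by
  subst hx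
  rw [eq_of_heq hf, (F).map_id]

/-- The image of a system under a `1`-morphism `f`: the structure maps are the composites of
the structure maps of `f` with the images of the given ones. -/
def Bar.lin {C D : PermCat.{u}} (f : MultiLin (fun _ : Unit => C) D) {X : Type} {A : Set X}
    (a : Bar C (fun _ : Unit => A)) : Bar D (fun _ : Unit => A) where
  C S := f.F.obj (fun _ => a.C S)
  ρ i T U S h := f.δ () (fun _ => a.C T) (fun _ => a.C U) (fun _ => a.C T ⊗ a.C U)
      (isSum_unit _ _) ≫
    f.F.map (X := fun _ => a.C T ⊗ a.C U) (Y := fun _ => a.C S) (fun _ => a.ρ i T U S h)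
  C_empty k S h := f.F_zero () _ (a.C_empty k S h)
  ρ_id i T U S h h' := by
    have hT : T.1 i = ∅ ∨ U.1 i = ∅ := by
      rcases h' with h' | h' | ⟨k, h'⟩
      · exact Or.inl h'
      · exact Or.inr h'
      · exact Or.inl (Set.subset_eq_empty Set.subset_union_left (h.1.trans h'))
    have hsum : a.C T ⊗ a.C U = a.C S := by
      rcases hT with hT | hT
      · have : U = S := Subtype.ext (funext fun k => by
          have := h.1
          rw [hT, Set.empty_union] at this
          exact this)
        rw [a.C_empty i T hT, Permutative.unit_left, this]
      · have : T = S := Subtype.ext (funext fun k => by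
          have := h.1
          rw [hT, Set.union_empty] at this
          exact this)
        rw [a.C_empty i U hT, Permutative.unit_right, this]
    have hδ := f.δ_id () (fun _ => a.C T) (fun _ => a.C U) (fun _ => a.C T ⊗ a.C U)
      (isSum_unit _ _) (hT.elim (fun h => Or.inr ⟨(), a.C_empty i T h⟩)
        (fun h => Or.inl (a.C_empty i U h)))
    have hx : (f.F.obj (fun _ => a.C T) ⊗ f.F.obj (fun _ => a.C U)) =
        f.F.obj (fun _ => a.C T ⊗ a.C U) := by
      rcases hT with hT | hT
      · rw [a.C_empty i T hT, f.F_zero () (fun _ => 𝟙_ C) rfl, Permutative.unit_left,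
          Permutative.unit_left]
      · rw [a.C_empty i U hT, f.F_zero () (fun _ => 𝟙_ C) rfl, Permutative.unit_right,
          Permutative.unit_right]
    refine comp_heq_id _ _ hδ (map_heq_id f.F _ (funext fun _ => hsum) ?_) hx (by rw [hsum])
    have hρ := a.ρ_id i T U S h h'
    exact Function.hfunext rfl fun _ _ _ => hρ
  ρ_symm i T U S h h' := by
    have h₁ := f.δ_symm () (fun _ => a.C T) (fun _ => a.C U) (fun _ => a.C T ⊗ a.C U)
      (fun _ => a.C U ⊗ a.C T) (isSum_unit _ _) (isSum_unit _ _) (fun _ => (β_ _ _).hom)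
      ⟨rfl, rfl, HEq.rfl, fun _ hj => absurd rfl hj⟩
    rw [← Category.assoc, ← h₁, Category.assoc, ← (f.F).map_comp]
    congr 2
    funext _
    exact a.ρ_symm i T U S h h'
  ρ_assoc i T U V TU UV S h₁ h₂ h₃ h₄ := by
    have e₁ := f.δ_nat () _ _ _ _ _ _ (isSum_unit (a.C T ⊗ a.C U) (a.C V))
      (isSum_unit (a.C TU) (a.C V)) (fun _ => a.ρ i T U TU h₁) (fun _ => 𝟙 _)
      (fun _ => a.ρ i T U TU h₁ ⊗ₘ 𝟙 _) ⟨HEq.rfl, fun _ hj => absurd rfl hj⟩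
    have e₂ := f.δ_nat () _ _ _ _ _ _ (isSum_unit (a.C T) (a.C U ⊗ a.C V))
      (isSum_unit (a.C T) (a.C UV)) (fun _ => 𝟙 _) (fun _ => a.ρ i U V UV h₃)
      (fun _ => 𝟙 _ ⊗ₘ a.ρ i U V UV h₃) ⟨HEq.rfl, fun _ hj => absurd rfl hj⟩
    have hassoc : (fun _ : Unit => (a.C T ⊗ a.C U) ⊗ a.C V) =
        fun _ => a.C T ⊗ (a.C U ⊗ a.C V) := funext fun _ => Permutative.assoc _ _ _
    have e₃ := f.δ_assoc () (fun _ => a.C T) (fun _ => a.C U) (fun _ => a.C V) _ _ _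
      (isSum_unit (a.C T) (a.C U)) (isSum_unit (a.C T ⊗ a.C U) (a.C V))
      (isSum_unit (a.C U) (a.C V))
      ⟨Permutative.assoc _ _ _, fun _ hj => absurd rfl hj⟩
    have e₄ : f.δ () (fun _ => a.C T) (fun _ => a.C U ⊗ a.C V) (fun _ => (a.C T ⊗ a.C U) ⊗ a.C V)
        ⟨Permutative.assoc _ _ _, fun _ hj => absurd rfl hj⟩ ≫ f.F.map
          (X := fun _ => (a.C T ⊗ a.C U) ⊗ a.C V) (Y := fun _ => a.C T ⊗ (a.C U ⊗ a.C V))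
          (fun _ => (α_ _ _ _).hom) =
        f.δ () (fun _ => a.C T) (fun _ => a.C U ⊗ a.C V) (fun _ => a.C T ⊗ (a.C U ⊗ a.C V))
          (isSum_unit _ _) := by
      have gen : ∀ (w w' : Unit → C) (hw : w = w')
          (h : IsSum (C := fun _ : Unit => C) () (fun _ => a.C T) (fun _ => a.C U ⊗ a.C V) w)
          (h' : IsSum (C := fun _ : Unit => C) () (fun _ => a.C T) (fun _ => a.C U ⊗ a.C V) w')
          (g : ∀ u, w u ⟶ w' u), (∀ u, g u = eqToHom (congrFun hw u)) →
          f.δ () _ _ w h ≫ f.F.map (X := w) (Y := w') g = f.δ () _ _ w' h' := by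
        intro w w' hw h h' g hg
        subst hw
        have : g = (𝟙 w : w ⟶ w) := funext fun u => hg u
        rw [this, (f.F).map_id, Category.comp_id]
      exact gen _ _ hassoc _ _ _ fun _ => Permutative.associator_eq _ _ _
    simp only [comp_whiskerRight, MonoidalCategory.whiskerLeft_comp, Category.assoc]
    have e₁' : (f.F.map (X := fun _ => a.C T ⊗ a.C U) (Y := fun _ => a.C TU)
          (fun _ => a.ρ i T U TU h₁) ▷ f.F.obj (fun _ => a.C V)) ≫ f.δ () _ _ _
          (isSum_unit (a.C TU) (a.C V)) = f.δ () _ _ _ (isSum_unit (a.C T ⊗ a.C U) (a.C V)) ≫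
          f.F.map (X := fun _ => (a.C T ⊗ a.C U) ⊗ a.C V) (Y := fun _ => a.C TU ⊗ a.C V)
            (fun _ => a.ρ i T U TU h₁ ⊗ₘ 𝟙 _) := by
      rw [← e₁, ← MonoidalCategory.tensorHom_id]
      congr 2
      exact ((f.F).map_id _).symm
    have e₂' : (f.F.obj (fun _ => a.C T) ◁ f.F.map (X := fun _ => a.C U ⊗ a.C V)
          (Y := fun _ => a.C UV) (fun _ => a.ρ i U V UV h₃)) ≫ f.δ () _ _ _
          (isSum_unit (a.C T) (a.C UV)) = f.δ () _ _ _ (isSum_unit (a.C T) (a.C U ⊗ a.C V)) ≫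
          f.F.map (X := fun _ => a.C T ⊗ (a.C U ⊗ a.C V)) (Y := fun _ => a.C T ⊗ a.C UV)
            (fun _ => 𝟙 _ ⊗ₘ a.ρ i U V UV h₃) := by
      rw [← e₂, ← MonoidalCategory.id_tensorHom]
      congr 2
      exact ((f.F).map_id _).symm
    rw [reassoc_of% e₁', reassoc_of% e₂', reassoc_of% e₃, ← e₄]
    simp only [Category.assoc, ← (f.F).map_comp]
    congr 4
    funext _
    have := a.ρ_assoc i T U V TU UV S h₁ h₂ h₃ h₄
    simpa using this
  ρ_exch i j hij := absurd rfl hij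

/-- The functor between categories of systems induced by a `1`-morphism. -/
def Bar.linF {C D : PermCat.{u}} (f : MultiLin (fun _ : Unit => C) D) {X : Type} (A : Set X) :
    Bar C (fun _ : Unit => A) ⥤ Bar D (fun _ : Unit => A) where
  obj a := Bar.lin f a
  map {a b} φ := Bar.Hom.mk (a := Bar.lin f a) (b := Bar.lin f b)
    (fun S => f.F.map (X := fun _ => a.C S) (Y := fun _ => b.C S) (fun _ => Bar.Hom.f φ S))
    (fun k S h => f.F_map_zero () _ _ _ (a.C_empty k S h) (b.C_empty k S h)
      (Bar.Hom.f_empty φ k S h))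
    (fun i T U S h => by
      have e₁ := f.δ_nat () _ _ _ _ _ _ (isSum_unit (a.C T) (a.C U))
        (isSum_unit (b.C T) (b.C U)) (fun _ => Bar.Hom.f φ T) (fun _ => Bar.Hom.f φ U)
        (fun _ => Bar.Hom.f φ T ⊗ₘ Bar.Hom.f φ U) ⟨HEq.rfl, fun _ hj => absurd rfl hj⟩
      have e₂ : (f.δ () (fun _ => a.C T) (fun _ => a.C U) (fun _ => a.C T ⊗ a.C U)
            (isSum_unit _ _) ≫ f.F.map (X := fun _ => a.C T ⊗ a.C U) (Y := fun _ => a.C S)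
            (fun _ => a.ρ i T U S h)) ≫
            f.F.map (X := fun _ => a.C S) (Y := fun _ => b.C S) (fun _ => Bar.Hom.f φ S) =
          (f.F.map (X := fun _ => a.C T) (Y := fun _ => b.C T) (fun _ => Bar.Hom.f φ T) ⊗ₘ
            f.F.map (X := fun _ => a.C U) (Y := fun _ => b.C U) (fun _ => Bar.Hom.f φ U)) ≫
          f.δ () (fun _ => b.C T) (fun _ => b.C U) (fun _ => b.C T ⊗ b.C U)
            (isSum_unit _ _) ≫ f.F.map (X := fun _ => b.C T ⊗ b.C U) (Y := fun _ => b.C S)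
            (fun _ => b.ρ i T U S h) := by
        rw [reassoc_of% e₁, Category.assoc, ← (f.F).map_comp, ← (f.F).map_comp]
        congr 2
        funext _
        exact Bar.Hom.comm φ i T U S h
      exact e₂)
  map_id a := Bar.Hom.ext (funext fun S => (f.F).map_id _)
  map_comp {a b c} φ ψ := Bar.Hom.ext (funext fun S => (f.F).map_comp
    (X := fun _ => a.C S) (Y := fun _ => b.C S) (Z := fun _ => c.C S)
    (fun _ => Bar.Hom.f φ S) (fun _ => Bar.Hom.f ψ S))

theorem Bar.lin_isIso {C D : PermCat.{u}} (f : MultiLin (fun _ : Unit => C) D) (hf : IsStrong f)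
    {X : Type} {A : Set X} (a : Bar C (fun _ : Unit => A)) (i : Unit)
    (T U S : Tup (fun _ : Unit => A)) (h : IsSplit i T U S) (ha : IsIso (a.ρ i T U S h)) :
    IsIso ((Bar.lin f a).ρ i T U S h) := by
  have h₁ := hf (fun _ => a.C T) (fun _ => a.C U) _ (isSum_unit _ _)
  let g : (fun _ : Unit => a.C T ⊗ a.C U) ⟶ (fun _ => a.C S) := fun _ => a.ρ i T U S h
  have h₂ : IsIso g := ⟨fun _ => inv (a.ρ i T U S h), funext fun _ => IsIso.hom_inv_id _,
    funext fun _ => IsIso.inv_hom_id _⟩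
  have h₃ : IsIso (f.F.map g) := CategoryTheory.Functor.map_isIso f.F g
  exact IsIso.comp_isIso' h₁ h₃

/-- The functor `C̄_A ⥤ D̄_A` induced by a strong `1`-morphism from `C` to `D`. -/
def SegBar.lin {C D : PermCat.{u}} (f : MultiLin (fun _ : Unit => C) D) (hf : IsStrong f)
    {X : Type} (A : Set X) : SegBar C A ⥤ SegBar D A where
  obj a := ⟨Bar.lin f a.1, fun i T U S h => Bar.lin_isIso f hf a.1 i T U S h (a.2 i T U S h)⟩
  map φ := (Bar.linF f A).map φ
  map_id a := (Bar.linF f A).map_id a.1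
  map_comp φ ψ := CategoryTheory.Functor.map_comp (C := Bar C (fun _ : Unit => A)) (Bar.linF f A)
    φ ψ

/-- The map of Segal's `K`-theory spectra induced by a strong `1`-morphism. -/
def KSegLin {C D : PermCat.{u}} (f : MultiLin (fun _ : Unit => C) D) (hf : IsStrong f) (p : ℕ) :
    (KSeg C).X p ⟶ (KSeg D).X p :=
  diagNerveMap (D := KSegX C p) (D' := KSegX D p)
    { app := fun d => (SegBar.lin f hf (smashSet p d.unop.len)).toCatHom
      naturality := fun _ _ _ => rfl }

/-! ### The multifunctor from symmetric functors to symmetric spectra -/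

/-- The application of diagrams of multimorphisms of symmetric functors to diagrams of
objects. -/
def SymFunHom.evalF {ι : Type} {F : ι → SymFun.{u}} {G : SymFun.{u}} (β : ι × ℕ ↪ ℕ)
    (n : ι → Finfty) (m : Finfty) (h : IsPush β n m) {E : Type} [SmallCategory E]
    (x : E ⥤ SymFunHom F G) (y : ∀ i, E ⥤ (F i).F.obj (n i)) : E ⥤ G.F.obj m where
  obj t := ((x.obj t).app β n m h).obj (fun i => (y i).obj t)
  map {t t'} s := ((x.obj t).app β n m h).map (X := fun i => (y i).obj t)
      (Y := fun i => (y i).obj t') (fun i => (y i).map s) ≫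
    SymFunHom.Hom.ev (x.map s) β n m h (fun i => (y i).obj t')
  map_id t := by
    have h₁ : (fun i => (y i).map (𝟙 t)) = fun i => 𝟙 ((y i).obj t) :=
      funext fun i => (y i).map_id t
    rw [h₁, x.map_id]
    have h₂ : ((x.obj t).app β n m h).map (X := fun i => (y i).obj t)
        (Y := fun i => (y i).obj t) (fun i => 𝟙 ((y i).obj t)) = 𝟙 _ :=
      ((x.obj t).app β n m h).map_id _
    rw [h₂]
    exact Category.comp_id _
  map_comp {t t' t''} s s' := by
    have h₁ : (fun i => (y i).map (s ≫ s')) = fun i => (y i).map s ≫ (y i).map s' :=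
      funext fun i => (y i).map_comp s s'
    have h₂ := ((x.obj t).app β n m h).map_comp (X := fun i => (y i).obj t)
      (Y := fun i => (y i).obj t') (Z := fun i => (y i).obj t'') (fun i => (y i).map s)
      (fun i => (y i).map s')
    have h₃ : SymFunHom.Hom.ev (x.map (s ≫ s')) β n m h (fun i => (y i).obj t'') =
        SymFunHom.Hom.ev (x.map s) β n m h (fun i => (y i).obj t'') ≫
          SymFunHom.Hom.ev (x.map s') β n m h (fun i => (y i).obj t'') := by
      rw [x.map_comp]
      rfl
    have h₄ : ((x.obj t).app β n m h).map (X := fun i => (y i).obj t')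
        (Y := fun i => (y i).obj t'') (fun i => (y i).map s') ≫
          SymFunHom.Hom.ev (x.map s) β n m h (fun i => (y i).obj t'') =
        SymFunHom.Hom.ev (x.map s) β n m h (fun i => (y i).obj t') ≫
          ((x.obj t').app β n m h).map (X := fun i => (y i).obj t')
            (Y := fun i => (y i).obj t'') (fun i => (y i).map s') :=
      (SymFunHom.Hom.app (x.map s) β n m h).naturality (X := fun i => (y i).obj t')
        (Y := fun i => (y i).obj t'') (fun i => (y i).map s')
    rw [h₃, h₁]
    refine (congrArg (fun q => q ≫ _) h₂).trans ?_
    simp only [Category.assoc]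
    rw [reassoc_of% h₄]

/-- The multifunctor from symmetric functors to symmetric spectra: on objects it is the nerve of
`IObj`, and a multimorphism `f` is sent to the multimorphism given by `f.app β` for the
injections `β` which extend the given identification `e` of the coordinates of the source with
those of the target. On higher simplices `x` of the nerve of the category of multimorphisms,
it is given by applying the diagram `x` of multimorphisms to diagrams of objects. -/
def IsI {M : CatMulticat symFunGraph.{u}} {Sp : SMulticat spGraph.{u}}
    (I : SMultifunctor M.nerve Sp (fun F : SymFun.{u} => (IObj F).nerve)) : Prop :=
  ∀ {ι : Type} [Finite ι] (F : ι → SymFun.{u}) (G : SymFun.{u}) (b : SimplexCategoryᵒᵖ)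
    (x : Fin (b.unop.len + 1) ⥤ SymFunHom F G) (p : ι → ℕ) (N : ℕ)
    (e : (Σ i, Fin (p i)) ≃ Fin N) (β : ι × ℕ ↪ ℕ),
    (∀ i (a : Fin (p i)), β (i, a) = e ⟨i, a⟩) → ∀ (d : SimplexCategoryᵒᵖ)
    (h : IsPush β (fun i => diagObj (p i) d.unop.len) (diagObj N d.unop.len))
    (y : ∀ i, Fin (d.unop.len + 1) ⥤ (F i).F.obj (diagObj (p i) d.unop.len))
    (u : d.unop ⟶ b.unop),
    SpHom.toFun (X := fun i => (IObj (F i)).nerve) (Y := (IObj G).nerve)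
        ((I.fn F G).app b x) p N e d
        (fun i => ofArrows (D := (IObj (F i)).X (p i)) (y i)) u =
      ofArrows (D := (IObj G).X N) (SymFunHom.evalF β _ _ h (vertexFun u ⋙ x) y)

/-- A map of simplicial sets is a weak equivalence if for every Kan complex `Z` it induces
a bijection from the set of homotopy classes of maps `Y ⟶ Z` to the set of homotopy classes
of maps `X ⟶ Z`. -/
def IsWeakEq {X Y : SSet.{u}} (f : X ⟶ Y) : Prop :=
  ∀ (Z : SSet.{u}) [SSet.KanComplex Z],
    (∀ g : X ⟶ Z, ∃ h : Y ⟶ Z, Nonempty (SSet.Homotopy (f ≫ h) g)) ∧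
    ∀ h h' : Y ⟶ Z, Nonempty (SSet.Homotopy (f ≫ h) (f ≫ h')) → Nonempty (SSet.Homotopy h h')

end MultKTheory

end

open MultKTheory

noncomputable section

namespace MultKTheory

/-! ### Calculations in permutative categories -/

/-- The exchange of the two middle summands is compatible with an operation which is associative
and commutative. -/
theorem tensorμ_comp {D : Type u} [Category.{v} D] [MonoidalCategory D] [SymmetricCategory D]
    {a b c d ab cd ac bd bc bcd t : D} (m₁ : a ⊗ b ⟶ ab) (m₂ : c ⊗ d ⟶ cd) (m₃ : ab ⊗ cd ⟶ t)
    (m₄ : a ⊗ c ⟶ ac) (m₅ : b ⊗ d ⟶ bd) (m₆ : ac ⊗ bd ⟶ t) (n : b ⊗ c ⟶ bc) (n' : c ⊗ b ⟶ bc)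
    (p : bc ⊗ d ⟶ bcd) (q : b ⊗ cd ⟶ bcd) (r : c ⊗ bd ⟶ bcd) (s : a ⊗ bcd ⟶ t)
    (h₁ : (m₁ ▷ cd) ≫ m₃ = (α_ a b cd).hom ≫ (a ◁ q) ≫ s)
    (h₂ : (n ▷ d) ≫ p = (α_ b c d).hom ≫ (b ◁ m₂) ≫ q)
    (h₃ : (n' ▷ d) ≫ p = (α_ c b d).hom ≫ (c ◁ m₅) ≫ r)
    (h₄ : (m₄ ▷ bd) ≫ m₆ = (α_ a c bd).hom ≫ (a ◁ r) ≫ s)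
    (h₅ : n = (β_ b c).hom ≫ n') :
    (m₁ ⊗ₘ m₂) ≫ m₃ = tensorμ a b c d ≫ (m₄ ⊗ₘ m₅) ≫ m₆ := by
  have h₂' : (b ◁ m₂) ≫ q = (α_ b c d).inv ≫ (n ▷ d) ≫ p := by rw [h₂]; simp
  have h₃' : (c ◁ m₅) ≫ r = (α_ c b d).inv ≫ (n' ▷ d) ≫ p := by rw [h₃]; simp
  have e₁ : (m₁ ⊗ₘ m₂) ≫ m₃ = (α_ a b (c ⊗ d)).hom ≫ (a ◁ ((b ◁ m₂) ≫ q)) ≫ s := by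
    rw [MonoidalCategory.tensorHom_def', Category.assoc, h₁]
    simp
  have e₂ : (m₄ ⊗ₘ m₅) ≫ m₆ = (α_ a c (b ⊗ d)).hom ≫ (a ◁ ((c ◁ m₅) ≫ r)) ≫ s := by
    rw [MonoidalCategory.tensorHom_def', Category.assoc, h₄]
    simp
  rw [e₁, e₂, h₂', h₃', h₅, tensorμ]
  simp

section

variable {D : Type u} [Category.{v} D]

theorem heq_id_of {x y z : D} {f : x ⟶ y} (h : HEq f (𝟙 z)) (hz : y = z) : HEq f (𝟙 y) := by
  subst hz
  exact h

theorem eq_eqToHom_of_heq {x y z : D} {f : x ⟶ y} (h : HEq f (𝟙 z)) (hx : x = z) (hy : y = z) :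
    f = eqToHom (hx.trans hy.symm) := by
  subst hx hy
  exact eq_of_heq h

theorem heq_id_comp {x y z w : D} {f : x ⟶ y} {g : y ⟶ z} (hf : HEq f (𝟙 w)) (hx : x = w)
    (hy : y = w) : HEq (f ≫ g) g := by
  subst hx hy
  rw [eq_of_heq hf, Category.id_comp]

theorem heq_comp_id {x y z w : D} {f : x ⟶ y} {g : y ⟶ z} (hg : HEq g (𝟙 w)) (hx : y = w)
    (hy : z = w) : HEq (f ≫ g) f := by
  subst hx hy
  rw [eq_of_heq hg, Category.comp_id]

variable [MonoidalCategory D]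

theorem tensor_heq {a b c d a' b' c' d' : D} (ha : a = a') (hb : b = b') (hc : c = c')
    (hd : d = d') {f : a ⟶ b} {g : c ⟶ d} {f' : a' ⟶ b'} {g' : c' ⟶ d'} (hf : HEq f f')
    (hg : HEq g g') : HEq (f ⊗ₘ g) (f' ⊗ₘ g') := by
  subst ha hb hc hd
  rw [eq_of_heq hf, eq_of_heq hg]

theorem tensor_heq_id {a b c d : D} {f : a ⟶ b} {g : c ⟶ d} (hab : a = b) (hcd : c = d)
    (hf : HEq f (𝟙 b)) (hg : HEq g (𝟙 d)) : HEq (f ⊗ₘ g) (𝟙 (b ⊗ d)) := by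
  subst hab hcd
  rw [eq_of_heq hf, eq_of_heq hg, MonoidalCategory.id_tensorHom_id]

theorem tensor_comp_heq {a b c d e : D} {f : a ⟶ b} {g : c ⟶ d} (hf : HEq f (𝟙 a)) (hab : b = a)
    (hg : HEq g (𝟙 c)) (hcd : d = c) (h : b ⊗ d ⟶ e) : HEq ((f ⊗ₘ g) ≫ h) h := by
  subst hab hcd
  rw [eq_of_heq hf, eq_of_heq hg, MonoidalCategory.id_tensorHom_id, Category.id_comp]

variable [Permutative D]

theorem associator_comp_heq {x y z w : D} (f : x ⊗ (y ⊗ z) ⟶ w) :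
    HEq ((α_ x y z).hom ≫ f) f := by
  rw [Permutative.associator_eq]
  exact eqToHom_comp_heq _ _

theorem unit_tensor_heq {x y z w : D} (hz : z = 𝟙_ D) (hw : w = 𝟙_ D) {e : z ⟶ w}
    (he : HEq e (𝟙 (𝟙_ D))) (f : x ⟶ y) : HEq (e ⊗ₘ f) f := by
  subst hz hw
  rw [eq_of_heq he, MonoidalCategory.id_tensorHom]
  have h := MonoidalCategory.leftUnitor_naturality f
  rw [Permutative.leftUnitor_eq, Permutative.leftUnitor_eq] at h
  exact (comp_eqToHom_heq _ (Permutative.unit_left y)).symm.trans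
    ((heq_of_eq h).trans (eqToHom_comp_heq _ _))

theorem tensor_unit_heq {x y z w : D} (hz : z = 𝟙_ D) (hw : w = 𝟙_ D) {e : z ⟶ w}
    (he : HEq e (𝟙 (𝟙_ D))) (f : x ⟶ y) : HEq (f ⊗ₘ e) f := by
  subst hz hw
  rw [eq_of_heq he, MonoidalCategory.tensorHom_id]
  have h := MonoidalCategory.rightUnitor_naturality f
  rw [Permutative.rightUnitor_eq, Permutative.rightUnitor_eq] at h
  exact (comp_eqToHom_heq _ (Permutative.unit_right y)).symm.trans
    ((heq_of_eq h).trans (eqToHom_comp_heq _ _))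

variable [SymmetricCategory D]

theorem braiding_heq_id {x y : D} (h : x = 𝟙_ D ∨ y = 𝟙_ D) :
    HEq (β_ x y).hom (𝟙 (x ⊗ y)) := by
  have hl : ∀ z : D, HEq (λ_ z).hom (𝟙 z) := fun z => by
    rw [Permutative.leftUnitor_eq]
    exact eqToHom_heq_id_cod _ _ _
  have hr : ∀ z : D, HEq (ρ_ z).inv (𝟙 z) := fun z => by
    have : (ρ_ z).inv = eqToHom (Permutative.unit_right z).symm := by
      rw [← cancel_mono (ρ_ z).hom, Iso.inv_hom_id, Permutative.rightUnitor_eq, eqToHom_trans,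
        eqToHom_refl]
    rw [this]
    exact eqToHom_heq_id_dom _ _ _
  have hl' : ∀ z : D, HEq (λ_ z).inv (𝟙 z) := fun z => by
    have : (λ_ z).inv = eqToHom (Permutative.unit_left z).symm := by
      rw [← cancel_mono (λ_ z).hom, Iso.inv_hom_id, Permutative.leftUnitor_eq, eqToHom_trans,
        eqToHom_refl]
    rw [this]
    exact eqToHom_heq_id_dom _ _ _
  have hr' : ∀ z : D, HEq (ρ_ z).hom (𝟙 z) := fun z => by
    rw [Permutative.rightUnitor_eq]
    exact eqToHom_heq_id_cod _ _ _
  rcases h with rfl | rfl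
  · rw [braiding_tensorUnit_left]
    refine (heq_comp_id (hr y) rfl (Permutative.unit_right y)).trans ((hl y).trans ?_)
    rw [Permutative.unit_left]
  · rw [braiding_tensorUnit_right]
    refine (heq_comp_id (hl' x) rfl (Permutative.unit_left x)).trans ((hr' x).trans ?_)
    rw [Permutative.unit_right]

theorem tensorμ_heq_id {a b c d : D} (h : b = 𝟙_ D ∨ c = 𝟙_ D) :
    HEq (tensorμ a b c d) (𝟙 ((a ⊗ b) ⊗ (c ⊗ d))) := by
  have ha : ∀ x y z : D, HEq (α_ x y z).inv (𝟙 (x ⊗ (y ⊗ z))) := fun x y z => by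
    have : (α_ x y z).inv = eqToHom (Permutative.assoc x y z).symm := by
      rw [← cancel_mono (α_ x y z).hom, Iso.inv_hom_id, Permutative.associator_eq, eqToHom_trans,
        eqToHom_refl]
    rw [this]
    exact eqToHom_heq_id_dom _ _ _
  have hb : b ⊗ c = c ⊗ b := by
    rcases h with rfl | rfl <;> rw [Permutative.unit_left, Permutative.unit_right]
  have e₁ : (α_ a b (c ⊗ d)).hom = eqToHom (Permutative.assoc _ _ _) := Permutative.associator_eq ..
  have e₂ : (α_ b c d).inv = eqToHom (Permutative.assoc _ _ _).symm := eq_eqToHom_of_heq (ha b c d) rfl (Permutative.assoc _ _ _)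
  have e₃ : (β_ b c).hom = eqToHom hb := eq_eqToHom_of_heq (braiding_heq_id h) rfl hb.symm
  have e₄ : (α_ c b d).hom = eqToHom (Permutative.assoc _ _ _) := Permutative.associator_eq ..
  have e₅ : (α_ a c (b ⊗ d)).inv = eqToHom (Permutative.assoc _ _ _).symm :=
    eq_eqToHom_of_heq (ha _ _ _) rfl (Permutative.assoc _ _ _)
  rw [tensorμ, e₁, e₂, e₃, e₄, e₅, eqToHom_whiskerRight, whiskerLeft_eqToHom, whiskerLeft_eqToHom,
    whiskerLeft_eqToHom, eqToHom_trans, eqToHom_trans, eqToHom_trans, eqToHom_trans]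
  exact eqToHom_heq_id_dom _ _ _

end

/-! ### Sums in one variable of a multilinear functor -/

section push

variable {ι : Type} {D : ι → PermCat.{u}} {E : PermCat.{u}}

/-- `y` and `z` agree with `x` outside of `i`. -/
def Agree (i : ι) (x y z : ∀ j, D j) : Prop := ∀ j, j ≠ i → y j = x j ∧ z j = x j

open Classical in
theorem isSum_update (i : ι) (x y z : ∀ j, D j) (h : Agree i x y z) :
    IsSum i x y (Function.update x i (x i ⊗ y i)) :=
  ⟨by simp, fun j hj => ⟨(h j hj).1, by simp [hj]⟩⟩

/-- Extensionality for morphisms of tuples. -/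
theorem pi_hom_heq {x y x' y' : ∀ j, D j} (hx : x = x') (hy : y = y') (χ : x ⟶ y) (χ' : x' ⟶ y')
    (h : ∀ j, HEq (χ j) (χ' j)) : HEq χ χ' := by
  subst hx hy
  exact heq_of_eq (funext fun j => eq_of_heq (h j))

/-- A morphism of tuples with prescribed entry `i`, all others being isomorphic to those of `f`. -/
theorem exists_hom (i : ι) (x y x' y' : ∀ j, D j) (r : x i ⟶ y i) (φ : x' ⟶ y')
    (h : ∀ j, j ≠ i → x j = x' j ∧ y j = y' j) :
    ∃ χ : x ⟶ y, χ i = r ∧ ∀ j, j ≠ i → HEq (χ j) (φ j) := by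
  classical
  refine ⟨fun j => if hj : j = i then Eq.rec (motive := fun k _ => (x k ⟶ y k)) r hj.symm else
    eqToHom (h j hj).1 ≫ φ j ≫ eqToHom (h j hj).2.symm, dif_pos rfl, fun j hj => ?_⟩
  refine (heq_of_eq (dif_neg hj)).trans ?_
  exact (eqToHom_comp_heq _ _).trans (comp_eqToHom_heq _ _)

theorem exists_isSingle (i : ι) (x y z w : ∀ j, D j) (h : Agree i x y z) (hw : IsSum i x y w)
    (r : x i ⊗ y i ⟶ z i) : ∃ χ : w ⟶ z, IsSingle i r χ := by
  obtain ⟨χ, h₁, h₂⟩ := exists_hom i w z x x (eqToHom hw.1 ≫ r) (𝟙 x) fun j hj =>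
    ⟨(hw.2 j hj).2, (h j hj).2⟩
  refine ⟨χ, hw.1, rfl, ?_, fun j hj => ⟨(h j hj).2.trans (hw.2 j hj).2.symm, ?_⟩⟩
  · rw [h₁]
    exact eqToHom_comp_heq _ _
  · refine (h₂ j hj).trans ?_
    rw [(hw.2 j hj).2]
    rfl

open Classical in
/-- The composite of the distributivity map of `g` in the `i`-th variable and of `g` applied to
a morphism `r` in this variable. -/
def MultiLin.push (g : MultiLin D E) (i : ι) (x y z : ∀ j, D j) (h : Agree i x y z)
    (r : x i ⊗ y i ⟶ z i) : g.F.obj x ⊗ g.F.obj y ⟶ g.F.obj z :=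
  g.δ i x y _ (isSum_update i x y z h) ≫
    g.F.map (exists_isSingle i x y z _ h (isSum_update i x y z h) r).choose

variable (g : MultiLin D E)

theorem IsSingle.unique {i : ι} {x y : ∀ j, D j} {a b : D i} {r : a ⟶ b} {χ χ' : x ⟶ y}
    (h : IsSingle i r χ) (h' : IsSingle i r χ') : χ = χ' := by
  funext j
  by_cases hj : j = i
  · subst hj
    exact eq_of_heq (h.2.2.1.trans h'.2.2.1.symm)
  · exact eq_of_heq ((h.2.2.2 j hj).2.trans (h'.2.2.2 j hj).2.symm)

theorem IsSum.unique {i : ι} {x y z z' : ∀ j, D j} (h : IsSum i x y z) (h' : IsSum i x y z') :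
    z = z' := by
  funext j
  by_cases hj : j = i
  · subst hj
    exact h.1.trans h'.1.symm
  · exact (h.2 j hj).2.trans (h'.2 j hj).2.symm

theorem MultiLin.push_eq (i : ι) (x y z w : ∀ j, D j) (h : Agree i x y z) (r : x i ⊗ y i ⟶ z i)
    (hw : IsSum i x y w) (χ : w ⟶ z) (hχ : IsSingle i r χ) :
    g.push i x y z h r = g.δ i x y w hw ≫ g.F.map χ := by
  classical
  have hu := isSum_update i x y z h
  obtain rfl := hw.unique hu
  unfold push
  rw [IsSingle.unique (exists_isSingle i x y z _ h hu r).choose_spec hχ]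

theorem MultiLin.push_heq (i : ι) {x y z x' y' z' : ∀ j, D j} (hx : x = x') (hy : y = y')
    (hz : z = z') (h : Agree i x y z) (h' : Agree i x' y' z') {r : x i ⊗ y i ⟶ z i}
    {r' : x' i ⊗ y' i ⟶ z' i} (hr : HEq r r') : HEq (g.push i x y z h r) (g.push i x' y' z' h' r') := by
  subst hx hy hz
  rw [eq_of_heq hr]

theorem MultiLin.push_id_eq (i : ι) (x y z : ∀ j, D j) (h : IsSum i x y z) :
    g.push i x y z h.2 (eqToHom h.1.symm) = g.δ i x y z h := by
  rw [g.push_eq i x y z z h.2 _ h (𝟙 z) ⟨h.1, rfl, ?_, fun j _ => ⟨rfl, HEq.rfl⟩⟩, g.F.map_id,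
    Category.comp_id]
  exact (eqToHom_heq_id_cod _ _ _).symm

/-- Naturality of `push`. -/
theorem MultiLin.push_nat (i : ι) (x y z x' y' z' : ∀ j, D j) (h : Agree i x y z)
    (h' : Agree i x' y' z') (r : x i ⊗ y i ⟶ z i) (r' : x' i ⊗ y' i ⟶ z' i) (φ : x ⟶ x')
    (ψ : y ⟶ y') (χ : z ⟶ z') (hi : (φ i ⊗ₘ ψ i) ≫ r' = r ≫ χ i)
    (hj : ∀ j, j ≠ i → HEq (ψ j) (φ j) ∧ HEq (χ j) (φ j)) :
    (g.F.map φ ⊗ₘ g.F.map ψ) ≫ g.push i x' y' z' h' r' = g.push i x y z h r ≫ g.F.map χ := by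
  classical
  have hu := isSum_update i x y z h
  have hu' := isSum_update i x' y' z' h'
  obtain ⟨m, hm⟩ := exists_isSingle i x y z _ h hu r
  obtain ⟨m', hm'⟩ := exists_isSingle i x' y' z' _ h' hu' r'
  obtain ⟨ω, hω, hω'⟩ := exists_hom i _ _ x x' (eqToHom hu.1 ≫ (φ i ⊗ₘ ψ i) ≫ eqToHom hu'.1.symm) φ
    fun j hj => ⟨(hu.2 j hj).2, (hu'.2 j hj).2⟩
  rw [g.push_eq i x y z _ h r hu m hm, g.push_eq i x' y' z' _ h' r' hu' m' hm', ← Category.assoc,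
    g.δ_nat i _ _ _ _ _ _ hu hu' φ ψ ω ⟨?_, fun j hj' => ⟨(hj j hj').1, hω' j hj'⟩⟩,
    Category.assoc, Category.assoc, ← g.F.map_comp, ← g.F.map_comp]
  · congr 2
    funext j
    by_cases hij : j = i
    · subst hij
      refine eq_of_heq ?_
      change HEq (ω j ≫ m' j) (m j ≫ χ j)
      refine (comp_heq hu.1 hu'.1 rfl (g := m' j) (g' := r') ?_ hm'.2.2.1).trans
        ((heq_of_eq hi).trans (comp_heq hu.1 rfl rfl hm.2.2.1 HEq.rfl).symm)
      rw [hω]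
      exact (eqToHom_comp_heq _ _).trans (comp_eqToHom_heq _ _)
    · refine eq_of_heq ?_
      change HEq (ω j ≫ m' j) (m j ≫ χ j)
      refine (heq_comp_id (hm'.2.2.2 j hij).2 rfl (h' j hij |>.2.trans (hu'.2 j hij).2.symm)).trans
        (((hω' j hij).trans (hj j hij).2.symm).trans
        (heq_id_comp (hm.2.2.2 j hij).2 rfl ((h j hij).2.trans (hu.2 j hij).2.symm)).symm)
  · rw [hω]
    exact (eqToHom_comp_heq _ _).trans (comp_eqToHom_heq _ _)

/-- `push` is an identity if the given morphism is one and if one of the variables is zero. -/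
theorem MultiLin.push_heq_id (i : ι) (x y z : ∀ j, D j) (h : Agree i x y z)
    (r : x i ⊗ y i ⟶ z i) (hr : HEq r (𝟙 (z i))) (hr' : x i ⊗ y i = z i)
    (h' : y i = 𝟙_ (D i) ∨ ∃ j, x j = 𝟙_ (D j)) :
    HEq (g.push i x y z h r) (𝟙 (g.F.obj z)) := by
  have hs : IsSum i x y z := ⟨hr'.symm, h⟩
  rw [show r = eqToHom hs.1.symm from eq_eqToHom_of_heq hr hr' rfl, g.push_id_eq]
  exact g.δ_id i x y z hs h'

/-- Symmetry of `push`. -/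
theorem MultiLin.push_symm (i : ι) (x y z z' : ∀ j, D j) (h : Agree i x y z)
    (h' : Agree i y x z') (r : x i ⊗ y i ⟶ z i) (r' : y i ⊗ x i ⟶ z' i) (χ : z ⟶ z')
    (hi : r ≫ χ i = (β_ (x i) (y i)).hom ≫ r') (hj : ∀ j, j ≠ i → HEq (χ j) (𝟙 (z j))) :
    g.push i x y z h r ≫ g.F.map χ = (β_ (g.F.obj x) (g.F.obj y)).hom ≫ g.push i y x z' h' r' := by
  classical
  have hu := isSum_update i x y z h
  have hu' := isSum_update i y x z' h'
  obtain ⟨m, hm⟩ := exists_isSingle i x y z _ h hu r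
  obtain ⟨m', hm'⟩ := exists_isSingle i y x z' _ h' hu' r'
  obtain ⟨ω, hω, hω'⟩ := exists_hom i _ _ x x (eqToHom hu.1 ≫ (β_ (x i) (y i)).hom ≫
    eqToHom hu'.1.symm) (𝟙 x) fun j hj => ⟨(hu.2 j hj).2, (hu'.2 j hj).2.trans (h j hj).1⟩
  rw [g.push_eq i x y z _ h r hu m hm, g.push_eq i y x z' _ h' r' hu' m' hm', ← Category.assoc,
    ← g.δ_symm i x y _ _ hu hu' ω ⟨hu.1, hu'.1, ?_, fun j hj' =>
      ⟨((hu'.2 j hj').2.trans (h j hj').1).trans (hu.2 j hj').2.symm, (hω' j hj').trans (by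
        rw [(hu.2 j hj').2]; rfl)⟩⟩, Category.assoc, Category.assoc, ← g.F.map_comp, ← g.F.map_comp]
  · congr 2
    funext j
    by_cases hij : j = i
    · subst hij
      refine eq_of_heq ?_
      change HEq (m j ≫ χ j) (ω j ≫ m' j)
      refine ((comp_heq hu.1 rfl rfl hm.2.2.1 HEq.rfl).trans (heq_of_eq hi)).trans
        (comp_heq hu.1 hu'.1 rfl (g := m' j) (g' := r') ?_ hm'.2.2.1).symm
      rw [hω]
      exact (eqToHom_comp_heq _ _).trans (comp_eqToHom_heq _ _)
    · refine eq_of_heq ?_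
      have a₁ := (hu.2 j hij).2
      have a₂ := (hu'.2 j hij).2.trans (h j hij).1
      have a₃ := (h j hij).2
      have a₄ := (h' j hij).2.trans (h j hij).1
      change HEq (m j ≫ χ j) (ω j ≫ m' j)
      refine (comp_heq_id _ _ (heq_id_of (hm.2.2.2 j hij).2 (a₃.trans a₁.symm))
        (heq_id_of (hj j hij) (a₄.trans a₃.symm)) (a₁.trans a₃.symm) (a₃.trans a₄.symm)).trans
        (comp_heq_id _ _ (heq_id_of (hω' j hij) a₂)
        (heq_id_of (hm'.2.2.2 j hij).2 (a₄.trans a₂.symm)) (a₁.trans a₂.symm)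
        (a₂.trans a₄.symm)).symm
  · rw [hω]
    exact (eqToHom_comp_heq _ _).trans (comp_eqToHom_heq _ _)

theorem exists_tuple (i : ι) (x : ∀ j, D j) (v : D i) :
    ∃ z : ∀ j, D j, (∀ j, j ≠ i → z j = x j) ∧ Nonempty (v ≅ z i) := by
  classical
  exact ⟨Function.update x i v, fun j hj => by simp [hj], ⟨eqToIso (by simp)⟩⟩

/-- Naturality of `push` with respect to a morphism in the variable `i` of the first summand. -/
theorem MultiLin.push_nat_left (i : ι) (x y z x' : ∀ j, D j) (h : Agree i x y z)
    (h' : Agree i x' y z) (φ : x ⟶ x') (hφ : ∀ j, j ≠ i → HEq (φ j) (𝟙 (x j)))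
    (r : x' i ⊗ y i ⟶ z i) :
    (g.F.map φ ▷ g.F.obj y) ≫ g.push i x' y z h' r =
      g.push i x y z h ((φ i ▷ y i) ≫ r) := by
  have := g.push_nat i x y z x' y z h h' ((φ i ▷ y i) ≫ r) r φ (𝟙 y) (𝟙 z) (by
    rw [Pi.id_apply, Pi.id_apply, Category.comp_id, MonoidalCategory.tensorHom_id])
    fun j hj => ⟨?_, ?_⟩
  · rw [g.F.map_id, g.F.map_id, Category.comp_id, MonoidalCategory.tensorHom_id] at this
    exact this
  · exact (Bar.id_heq _ _ HEq.rfl (hφ j hj) (h j hj).1)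
  · exact (Bar.id_heq _ _ HEq.rfl (hφ j hj) (h j hj).2)

theorem MultiLin.push_nat_right (i : ι) (x y z y' : ∀ j, D j) (h : Agree i x y z)
    (h' : Agree i x y' z) (φ : y ⟶ y') (hφ : ∀ j, j ≠ i → HEq (φ j) (𝟙 (y j)))
    (r : x i ⊗ y' i ⟶ z i) :
    (g.F.obj x ◁ g.F.map φ) ≫ g.push i x y' z h' r =
      g.push i x y z h ((x i ◁ φ i) ≫ r) := by
  have := g.push_nat i x y z x y' z h h' ((x i ◁ φ i) ≫ r) r (𝟙 x) φ (𝟙 z) (by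
    rw [Pi.id_apply, Pi.id_apply, Category.comp_id, MonoidalCategory.id_tensorHom])
    fun j hj => ⟨?_, ?_⟩
  · rw [g.F.map_id, g.F.map_id, Category.comp_id, MonoidalCategory.id_tensorHom] at this
    exact this
  · exact (Bar.id_heq _ _ (hφ j hj) HEq.rfl (h j hj).1)
  · exact (Bar.id_heq _ _ HEq.rfl HEq.rfl (h j hj).2)

/-- Postcomposition of `push` with a morphism in the variable `i`. -/
theorem MultiLin.push_comp (i : ι) (x y z z' : ∀ j, D j) (h : Agree i x y z)
    (h' : Agree i x y z') (r : x i ⊗ y i ⟶ z i) (c : z ⟶ z')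
    (hc : ∀ j, j ≠ i → HEq (c j) (𝟙 (z j))) :
    g.push i x y z' h' (r ≫ c i) = g.push i x y z h r ≫ g.F.map c := by
  have := g.push_nat i x y z x y z' h h' r (r ≫ c i) (𝟙 x) (𝟙 y) c (by
    rw [Pi.id_apply, Pi.id_apply, MonoidalCategory.id_tensorHom_id, Category.id_comp])
    fun j hj => ⟨?_, ?_⟩
  · rw [g.F.map_id, g.F.map_id, MonoidalCategory.id_tensorHom_id, Category.id_comp] at this
    exact this
  · exact (Bar.id_heq _ _ HEq.rfl HEq.rfl (h j hj).1)
  · exact (Bar.id_heq _ _ (hc j hj) HEq.rfl (h j hj).2)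

/-- A morphism of tuples which is given in the variable `i`, and the identity otherwise. -/
theorem exists_hom_id (i : ι) (x y : ∀ j, D j) (r : x i ⟶ y i) (h : ∀ j, j ≠ i → y j = x j) :
    ∃ χ : x ⟶ y, χ i = r ∧ ∀ j, j ≠ i → HEq (χ j) (𝟙 (x j)) :=
  exists_hom i x y x x r (𝟙 x) fun j hj => ⟨rfl, h j hj⟩

/-- Associativity of `push`. -/
theorem MultiLin.push_assoc (i : ι) (x y z xy yz w : ∀ j, D j) (h₁ : Agree i x y xy)
    (h₂ : Agree i xy z w) (h₃ : Agree i y z yz) (h₄ : Agree i x yz w) (r₁ : x i ⊗ y i ⟶ xy i)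
    (r₂ : xy i ⊗ z i ⟶ w i) (r₃ : y i ⊗ z i ⟶ yz i) (r₄ : x i ⊗ yz i ⟶ w i)
    (hr : (r₁ ▷ z i) ≫ r₂ = (α_ _ _ _).hom ≫ (x i ◁ r₃) ≫ r₄) :
    (g.push i x y xy h₁ r₁ ▷ g.F.obj z) ≫ g.push i xy z w h₂ r₂ =
      (α_ _ _ _).hom ≫ (g.F.obj x ◁ g.push i y z yz h₃ r₃) ≫ g.push i x yz w h₄ r₄ := by
  classical
  have u₁ := isSum_update i x y xy h₁
  have u₃ := isSum_update i y z yz h₃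
  obtain ⟨m₁, hm₁, hm₁'⟩ := exists_hom_id i _ xy (eqToHom u₁.1 ≫ r₁) fun j hj =>
    (h₁ j hj).2.trans (u₁.2 j hj).2.symm
  obtain ⟨m₃, hm₃, hm₃'⟩ := exists_hom_id i _ yz (eqToHom u₃.1 ≫ r₃) fun j hj =>
    (h₃ j hj).2.trans (u₃.2 j hj).2.symm
  have e₁ : g.push i x y xy h₁ r₁ = g.δ i x y _ u₁ ≫ g.F.map m₁ :=
    g.push_eq i x y xy _ h₁ r₁ u₁ m₁ ⟨u₁.1, rfl, by
      rw [hm₁]; exact eqToHom_comp_heq _ _, fun j hj =>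
      ⟨(h₁ j hj).2.trans (u₁.2 j hj).2.symm, hm₁' j hj⟩⟩
  have e₃ : g.push i y z yz h₃ r₃ = g.δ i y z _ u₃ ≫ g.F.map m₃ :=
    g.push_eq i y z yz _ h₃ r₃ u₃ m₃ ⟨u₃.1, rfl, by
      rw [hm₃]; exact eqToHom_comp_heq _ _, fun j hj =>
      ⟨(h₃ j hj).2.trans (u₃.2 j hj).2.symm, hm₃' j hj⟩⟩
  have k₂ : Agree i (Function.update x i (x i ⊗ y i)) z w := fun j hj =>
    ⟨(h₂ j hj).1.trans ((h₁ j hj).2.trans (u₁.2 j hj).2.symm),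
      (h₂ j hj).2.trans ((h₁ j hj).2.trans (u₁.2 j hj).2.symm)⟩
  have k₄ : Agree i x (Function.update y i (y i ⊗ z i)) w := fun j hj =>
    ⟨(u₃.2 j hj).2.trans (h₁ j hj).1, (h₄ j hj).2⟩
  have u₂ := isSum_update i _ z w k₂
  have u₄ := isSum_update i x _ w k₄
  have hu : Function.update (Function.update x i (x i ⊗ y i)) i
      (Function.update x i (x i ⊗ y i) i ⊗ z i) = Function.update x i
        (x i ⊗ Function.update y i (y i ⊗ z i) i) := by
    funext j
    by_cases hj : j = i
    · subst hj
      simp [Permutative.assoc]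
    · simp [hj]
  rw [← hu] at u₄
  obtain ⟨χ, hχ, hχ'⟩ := exists_hom_id i _ w (eqToHom u₂.1 ≫ (m₁ i ▷ z i) ≫ r₂) fun j hj =>
    (k₂ j hj).2.trans (u₂.2 j hj).2.symm
  have hχ'' : ∀ j, j ≠ i → _ ∧ HEq (χ j) (𝟙 _) := fun j hj =>
    ⟨(k₂ j hj).2.trans (u₂.2 j hj).2.symm, hχ' j hj⟩
  have hl : HEq (χ i) ((m₁ i ▷ z i) ≫ r₂) := by
    rw [hχ]
    exact eqToHom_comp_heq _ _
  have hrr : HEq ((m₁ i ▷ z i) ≫ r₂) ((x i ◁ m₃ i) ≫ r₄) := by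
    have a₁ : (m₁ i ▷ z i) ≫ r₂ = eqToHom (by rw [u₁.1]) ≫ (r₁ ▷ z i) ≫ r₂ := by
      rw [hm₁, MonoidalCategory.comp_whiskerRight, eqToHom_whiskerRight, Category.assoc]
    have a₂ : (x i ◁ m₃ i) ≫ r₄ = eqToHom (by rw [u₃.1]) ≫ (x i ◁ r₃) ≫ r₄ := by
      rw [hm₃, MonoidalCategory.whiskerLeft_comp, whiskerLeft_eqToHom, Category.assoc]
    rw [a₁, a₂, hr]
    exact (eqToHom_comp_heq _ _).trans ((associator_comp_heq _).trans (eqToHom_comp_heq _ _).symm)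
  rw [e₁, e₃, MonoidalCategory.comp_whiskerRight, MonoidalCategory.whiskerLeft_comp,
    Category.assoc, Category.assoc, g.push_nat_left i _ z w xy k₂ h₂ m₁ hm₁',
    g.push_nat_right i x _ w yz k₄ h₄ m₃ hm₃', g.push_eq i _ z w _ k₂ _ u₂ χ ⟨u₂.1, rfl, hl, hχ''⟩,
    g.push_eq i x _ w _ k₄ _ u₄ χ ⟨u₄.1, rfl, hl.trans hrr, hχ''⟩, ← Category.assoc,
    g.δ_assoc i x y z _ _ _ u₁ u₂ u₃ u₄]
  simp

/-- The exchange of sums in the same variable. -/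
theorem MultiLin.push_exch_same (i : ι) (a b c d ab cd ac bd t : ∀ j, D j)
    (h₁ : Agree i a b ab) (h₂ : Agree i c d cd) (h₃ : Agree i ab cd t) (h₄ : Agree i a c ac)
    (h₅ : Agree i b d bd) (h₆ : Agree i ac bd t) (r₁ : a i ⊗ b i ⟶ ab i) (r₂ : c i ⊗ d i ⟶ cd i)
    (r₃ : ab i ⊗ cd i ⟶ t i) (r₄ : a i ⊗ c i ⟶ ac i) (r₅ : b i ⊗ d i ⟶ bd i)
    (r₆ : ac i ⊗ bd i ⟶ t i)
    (hr : (r₁ ⊗ₘ r₂) ≫ r₃ = tensorμ (a i) (b i) (c i) (d i) ≫ (r₄ ⊗ₘ r₅) ≫ r₆) :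
    (g.push i a b ab h₁ r₁ ⊗ₘ g.push i c d cd h₂ r₂) ≫ g.push i ab cd t h₃ r₃ =
      tensorμ _ _ _ _ ≫ (g.push i a c ac h₄ r₄ ⊗ₘ g.push i b d bd h₅ r₅) ≫
        g.push i ac bd t h₆ r₆ := by
  obtain ⟨AB, kab, ⟨e₁⟩⟩ := exists_tuple i a (a i ⊗ b i)
  obtain ⟨CD, kcd, ⟨e₂⟩⟩ := exists_tuple i a (c i ⊗ d i)
  obtain ⟨AC, kac, ⟨e₄⟩⟩ := exists_tuple i a (a i ⊗ c i)
  obtain ⟨BD, kbd, ⟨e₅⟩⟩ := exists_tuple i a (b i ⊗ d i)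
  obtain ⟨BC, kbc, ⟨e₆⟩⟩ := exists_tuple i a (c i ⊗ b i)
  obtain ⟨BCD, kbcd, ⟨e₇⟩⟩ := exists_tuple i a (c i ⊗ (b i ⊗ d i))
  obtain ⟨T, kt, ⟨u⟩⟩ := exists_tuple i a ((a i ⊗ c i) ⊗ (b i ⊗ d i))
  have kb : ∀ j, j ≠ i → b j = a j := fun j hj => (h₁ j hj).1
  have kc : ∀ j, j ≠ i → c j = a j := fun j hj => (h₄ j hj).1
  have kd : ∀ j, j ≠ i → d j = a j := fun j hj => (h₅ j hj).1.trans (kb j hj)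
  have lab : ∀ j, j ≠ i → ab j = a j := fun j hj => (h₁ j hj).2
  have lcd : ∀ j, j ≠ i → cd j = a j := fun j hj => (h₂ j hj).2.trans (kc j hj)
  have lac : ∀ j, j ≠ i → ac j = a j := fun j hj => (h₄ j hj).2
  have lbd : ∀ j, j ≠ i → bd j = a j := fun j hj => (h₅ j hj).2.trans (kb j hj)
  have lt : ∀ j, j ≠ i → t j = a j := fun j hj => (h₃ j hj).2.trans (lab j hj)
  have mk : ∀ {x y z : ∀ j, D j}, (∀ j, j ≠ i → x j = a j) → (∀ j, j ≠ i → y j = a j) →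
      (∀ j, j ≠ i → z j = a j) → Agree i x y z := fun hx hy hz j hj =>
    ⟨(hy j hj).trans (hx j hj).symm, (hz j hj).trans (hx j hj).symm⟩
  have ka : ∀ j, j ≠ i → a j = a j := fun _ _ => rfl
  have key := tensorμ_comp (g.push i a b AB (mk ka kb kab) e₁.hom)
    (g.push i c d CD (mk kc kd kcd) e₂.hom)
    (g.push i AB CD T (mk kab kcd kt) ((e₁.inv ⊗ₘ e₂.inv) ≫ tensorμ _ _ _ _ ≫ u.hom))
    (g.push i a c AC (mk ka kc kac) e₄.hom) (g.push i b d BD (mk kb kd kbd) e₅.hom)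
    (g.push i AC BD T (mk kac kbd kt) ((e₄.inv ⊗ₘ e₅.inv) ≫ u.hom))
    (g.push i b c BC (mk kb kc kbc) ((β_ _ _).hom ≫ e₆.hom))
    (g.push i c b BC (mk kc kb kbc) e₆.hom)
    (g.push i BC d BCD (mk kbc kd kbcd) ((e₆.inv ▷ _) ≫ (α_ _ _ _).hom ≫ e₇.hom))
    (g.push i b CD BCD (mk kb kcd kbcd) ((_ ◁ e₂.inv) ≫ (α_ _ _ _).inv ≫ ((β_ _ _).hom ▷ _) ≫
      (α_ _ _ _).hom ≫ e₇.hom))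
    (g.push i c BD BCD (mk kc kbd kbcd) ((_ ◁ e₅.inv) ≫ e₇.hom))
    (g.push i a BCD T (mk ka kbcd kt) ((_ ◁ e₇.inv) ≫ (α_ _ _ _).inv ≫ u.hom))
    (g.push_assoc i a b CD AB BCD T _ _ _ _ _ _ _ _ (by
      simp [tensorμ, MonoidalCategory.tensorHom_def]))
    (g.push_assoc i b c d BC CD BCD _ _ _ _ _ _ _ _ (by simp))
    (g.push_assoc i c b d BC BD BCD _ _ _ _ _ _ _ _ (by simp))
    (g.push_assoc i a c BD AC BCD T _ _ _ _ _ _ _ _ (by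
      simp [MonoidalCategory.tensorHom_def]))
    (by
      have := g.push_symm i b c BC BC (mk kb kc kbc) (mk kc kb kbc) ((β_ _ _).hom ≫ e₆.hom) e₆.hom
        (𝟙 _) (Category.comp_id _) fun j _ => HEq.rfl
      rwa [g.F.map_id, Category.comp_id] at this)
  obtain ⟨χ₁, hχ₁, hχ₁'⟩ := exists_hom_id i AB ab (e₁.inv ≫ r₁) fun j hj =>
    (lab j hj).trans (kab j hj).symm
  obtain ⟨χ₂, hχ₂, hχ₂'⟩ := exists_hom_id i CD cd (e₂.inv ≫ r₂) fun j hj =>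
    (lcd j hj).trans (kcd j hj).symm
  obtain ⟨χ₄, hχ₄, hχ₄'⟩ := exists_hom_id i AC ac (e₄.inv ≫ r₄) fun j hj =>
    (lac j hj).trans (kac j hj).symm
  obtain ⟨χ₅, hχ₅, hχ₅'⟩ := exists_hom_id i BD bd (e₅.inv ≫ r₅) fun j hj =>
    (lbd j hj).trans (kbd j hj).symm
  obtain ⟨κ, hκ, hκ'⟩ := exists_hom_id i T t (u.inv ≫ (r₄ ⊗ₘ r₅) ≫ r₆) fun j hj =>
    (lt j hj).trans (kt j hj).symm
  have f₁ := g.push_comp i a b AB ab (mk ka kb kab) h₁ e₁.hom χ₁ hχ₁'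
  have f₂ := g.push_comp i c d CD cd (mk kc kd kcd) h₂ e₂.hom χ₂ hχ₂'
  have f₄ := g.push_comp i a c AC ac (mk ka kc kac) h₄ e₄.hom χ₄ hχ₄'
  have f₅ := g.push_comp i b d BD bd (mk kb kd kbd) h₅ e₅.hom χ₅ hχ₅'
  rw [hχ₁, Iso.hom_inv_id_assoc] at f₁
  rw [hχ₂, Iso.hom_inv_id_assoc] at f₂
  rw [hχ₄, Iso.hom_inv_id_assoc] at f₄
  rw [hχ₅, Iso.hom_inv_id_assoc] at f₅
  have n₃ := g.push_nat i AB CD T ab cd t (mk kab kcd kt) h₃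
    ((e₁.inv ⊗ₘ e₂.inv) ≫ tensorμ _ _ _ _ ≫ u.hom) r₃ χ₁ χ₂ κ (by
      rw [hχ₁, hχ₂, hκ, ← MonoidalCategory.tensorHom_comp_tensorHom, Category.assoc, hr]
      simp) fun j hj => ⟨Bar.id_heq _ _ (hχ₂' j hj) (hχ₁' j hj) ((kcd j hj).trans (kab j hj).symm),
        Bar.id_heq _ _ (hκ' j hj) (hχ₁' j hj) ((kt j hj).trans (kab j hj).symm)⟩
  have n₆ := g.push_nat i AC BD T ac bd t (mk kac kbd kt) h₆
    ((e₄.inv ⊗ₘ e₅.inv) ≫ u.hom) r₆ χ₄ χ₅ κ (by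
      rw [hχ₄, hχ₅, hκ, ← MonoidalCategory.tensorHom_comp_tensorHom, Category.assoc]
      simp) fun j hj => ⟨Bar.id_heq _ _ (hχ₅' j hj) (hχ₄' j hj) ((kbd j hj).trans (kac j hj).symm),
        Bar.id_heq _ _ (hκ' j hj) (hχ₄' j hj) ((kt j hj).trans (kac j hj).symm)⟩
  rw [f₁, f₂, f₄, f₅, ← MonoidalCategory.tensorHom_comp_tensorHom,
    ← MonoidalCategory.tensorHom_comp_tensorHom, Category.assoc, Category.assoc, n₃, n₆,
    ← Category.assoc, key]
  simp

/-- The exchange of sums in different variables. -/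
theorem MultiLin.push_exch_diff (i j : ι) (hij : i ≠ j) (a b c d ab cd ac bd t : ∀ j, D j)
    (h₁ : Agree i a b ab) (h₂ : Agree i c d cd) (h₃ : Agree j ab cd t) (h₄ : Agree j a c ac)
    (h₅ : Agree j b d bd) (h₆ : Agree i ac bd t) (r₁ : a i ⊗ b i ⟶ ab i) (r₂ : c i ⊗ d i ⟶ cd i)
    (r₃ : ab j ⊗ cd j ⟶ t j) (r₄ : a j ⊗ c j ⟶ ac j) (r₅ : b j ⊗ d j ⟶ bd j)
    (r₆ : ac i ⊗ bd i ⟶ t i) (hr₂ : HEq r₂ r₁) (hr₆ : HEq r₆ r₁) (hr₄ : HEq r₄ r₃)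
    (hr₅ : HEq r₅ r₃) :
    (g.push i a b ab h₁ r₁ ⊗ₘ g.push i c d cd h₂ r₂) ≫ g.push j ab cd t h₃ r₃ =
      tensorμ _ _ _ _ ≫ (g.push j a c ac h₄ r₄ ⊗ₘ g.push j b d bd h₅ r₅) ≫
        g.push i ac bd t h₆ r₆ := by
  classical
  have u₁ := isSum_update i a b ab h₁
  have u₂ := isSum_update i c d cd h₂
  have u₄ := isSum_update j a c ac h₄
  have u₅ := isSum_update j b d bd h₅
  generalize Function.update a i (a i ⊗ b i) = AB at u₁
  generalize Function.update c i (c i ⊗ d i) = CD at u₂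
  generalize Function.update a j (a j ⊗ c j) = AC at u₄
  generalize Function.update b j (b j ⊗ d j) = BD at u₅
  have hji : j ≠ i := hij.symm
  have k₃ : Agree j AB CD AB := fun k hk => ⟨by
    by_cases hki : k = i
    · subst hki
      rw [u₁.1, u₂.1, (h₄ k hk).1, (h₅ k hk).1]
    · rw [(u₁.2 k hki).2, (u₂.2 k hki).2, (h₄ k hk).1], rfl⟩
  have u₃ := isSum_update j AB CD AB k₃
  generalize Function.update AB j (AB j ⊗ CD j) = T at u₃
  have u₆ : IsSum i AC BD T := ⟨by
    rw [(u₃.2 i hij).2, u₁.1, (u₄.2 i hij).2, (u₅.2 i hij).2], fun k hk => by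
      by_cases hkj : k = j
      · subst hkj
        rw [u₄.1, u₅.1, u₃.1, (u₁.2 k hk).2, (u₂.2 k hk).2, (h₁ k hk).1, (h₂ k hk).1]
        exact ⟨rfl, rfl⟩
      · rw [(u₄.2 k hkj).2, (u₅.2 k hkj).2, (u₃.2 k hkj).2, (u₁.2 k hk).2, (h₁ k hk).1]
        exact ⟨rfl, rfl⟩⟩
  obtain ⟨m₁, s₁⟩ := exists_isSingle i a b ab _ h₁ u₁ r₁
  obtain ⟨m₂, s₂⟩ := exists_isSingle i c d cd _ h₂ u₂ r₂
  obtain ⟨m₄, s₄⟩ := exists_isSingle j a c ac _ h₄ u₄ r₄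
  obtain ⟨m₅, s₅⟩ := exists_isSingle j b d bd _ h₅ u₅ r₅
  obtain ⟨χ, hχ, hχ'⟩ := exists_hom j T t AB ab (eqToHom (by
    rw [u₃.1, (u₁.2 j hji).2, (u₂.2 j hji).2, ← (h₁ j hji).2, ← (h₂ j hji).2]) ≫ r₃) m₁
    fun k hk => ⟨(u₃.2 k hk).2, (h₃ k hk).2⟩
  have hχj : HEq (χ j) r₃ := by
    rw [hχ]
    exact eqToHom_comp_heq _ _
  have hχi : HEq (χ i) r₁ := (hχ' i hij).trans s₁.2.2.1
  have n₃ : (m₁ j ⊗ₘ m₂ j) ≫ r₃ = eqToHom u₃.1.symm ≫ χ j := eq_of_heq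
    ((tensor_comp_heq (s₁.2.2.2 j hji).2 (s₁.2.2.2 j hji).1 (s₂.2.2.2 j hji).2
      (s₂.2.2.2 j hji).1 _).trans (hχj.symm.trans (eqToHom_comp_heq _ _).symm))
  have n₆ : (m₄ i ⊗ₘ m₅ i) ≫ r₆ = eqToHom u₆.1.symm ≫ χ i := eq_of_heq
    ((tensor_comp_heq (s₄.2.2.2 i hij).2 (s₄.2.2.2 i hij).1 (s₅.2.2.2 i hij).2
      (s₅.2.2.2 i hij).1 _).trans ((hr₆.trans hχi.symm).trans (eqToHom_comp_heq _ _).symm))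
  rw [g.push_eq i a b ab _ h₁ r₁ u₁ m₁ s₁, g.push_eq i c d cd _ h₂ r₂ u₂ m₂ s₂,
    g.push_eq j a c ac _ h₄ r₄ u₄ m₄ s₄, g.push_eq j b d bd _ h₅ r₅ u₅ m₅ s₅,
    ← MonoidalCategory.tensorHom_comp_tensorHom, ← MonoidalCategory.tensorHom_comp_tensorHom,
    Category.assoc, Category.assoc,
    g.push_nat j AB CD T ab cd t u₃.2 h₃ (eqToHom u₃.1.symm) r₃ m₁ m₂ χ n₃ ?_,
    g.push_nat i AC BD T ac bd t u₆.2 h₆ (eqToHom u₆.1.symm) r₆ m₄ m₅ χ n₆ ?_,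
    g.push_id_eq j AB CD T u₃, g.push_id_eq i AC BD T u₆, ← Category.assoc,
    g.δ_exch i j hij a b c d _ _ _ _ _ u₁ u₂ u₃ u₄ u₅ u₆]
  · simp
  · intro k hk
    by_cases hkj : k = j
    · subst hkj
      exact ⟨(s₅.2.2.1.trans hr₅).trans (s₄.2.2.1.trans hr₄).symm,
        hχj.trans (s₄.2.2.1.trans hr₄).symm⟩
    · exact ⟨Bar.id_heq _ _ (s₅.2.2.2 k hkj).2 (s₄.2.2.2 k hkj).2 (u₆.2 k hk).1,
        Bar.id_heq _ _ ((hχ' k hkj).trans (s₁.2.2.2 k hk).2) (s₄.2.2.2 k hkj).2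
          ((u₃.2 k hkj).2.symm.trans (u₆.2 k hk).2)⟩
  · intro k hk
    refine ⟨?_, hχ' k hk⟩
    by_cases hki : k = i
    · subst hki
      exact (s₂.2.2.1.trans hr₂).trans s₁.2.2.1.symm
    · exact Bar.id_heq _ _ (s₂.2.2.2 k hki).2 (s₁.2.2.2 k hki).2 (u₃.2 k hk).1

end push

/-! ### Reindexing of tuples along a bijection -/

section reindex

/-- The functor between the categories with equal indices. -/
def castF {ι : Type*} (C : ι → Type v) [∀ i, Category.{w} (C i)] {i j : ι} (h : i = j) :
    C i ⥤ C j := h ▸ 𝟭 (C i)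

theorem castF_obj_heq {ι : Type*} (C : ι → Type v) [∀ i, Category.{w} (C i)] {i j : ι} (h : i = j)
    (x : C i) : HEq ((castF C h).obj x) x := by
  subst h
  rfl

theorem castF_map_heq {ι : Type*} (C : ι → Type v) [∀ i, Category.{w} (C i)] {i j : ι} (h : i = j)
    {x y : C i} (φ : x ⟶ y) : HEq ((castF C h).map φ) φ := by
  subst h
  rfl

variable {ι κ : Type} (e : κ ≃ ι) (C : ι → Type v) [∀ i, Category.{w} (C i)]

/-- Reindexing of tuples. -/
def reindex : (∀ k, C (e k)) ⥤ (∀ i, C i) where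
  obj x i := (castF C (e.apply_symm_apply i)).obj (x (e.symm i))
  map φ i := (castF C (e.apply_symm_apply i)).map (φ (e.symm i))
  map_id _ := funext fun i => (castF C (e.apply_symm_apply i)).map_id _
  map_comp _ _ := funext fun i => (castF C (e.apply_symm_apply i)).map_comp _ _

theorem reindex_obj_apply (x : ∀ k, C (e k)) (k : κ) : (reindex e C).obj x (e k) = x k := by
  apply eq_of_heq
  refine (castF_obj_heq C _ _).trans ?_
  rw [e.symm_apply_apply]

theorem reindex_map_apply {x y : ∀ k, C (e k)} (φ : x ⟶ y) (k : κ) :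
    HEq ((reindex e C).map φ (e k)) (φ k) := by
  refine (castF_map_heq C _ _).trans ?_
  rw [e.symm_apply_apply]

theorem reindex_obj_eq (x : ∀ k, C (e k)) (y : ∀ i, C i) (h : ∀ k, y (e k) = x k) :
    (reindex e C).obj x = y := by
  funext i
  obtain ⟨k, rfl⟩ := e.surjective i
  rw [reindex_obj_apply, h]

theorem hom_heq_of {C : ι → Type v} [∀ i, Category.{w} (C i)] {x y x' y' : ∀ j, C j} (hx : x = x')
    (hy : y = y') (χ : x ⟶ y) (χ' : x' ⟶ y') (h : ∀ j, HEq (χ j) (χ' j)) : HEq χ χ' := by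
  subst hx hy
  exact heq_of_eq (funext fun j => eq_of_heq (h j))

theorem reindex_map_heq {x x' : ∀ k, C (e k)} {y y' : ∀ i, C i} (h : ∀ k, y (e k) = x k)
    (h' : ∀ k, y' (e k) = x' k) (φ : x ⟶ x') (ψ : y ⟶ y') (hφ : ∀ k, HEq (ψ (e k)) (φ k)) :
    HEq ((reindex e C).map φ) ψ := by
  refine hom_heq_of (reindex_obj_eq e C x y h) (reindex_obj_eq e C x' y' h') _ _ fun i => ?_
  obtain ⟨k, rfl⟩ := e.surjective i
  exact (reindex_map_apply e C φ k).trans (hφ k).symm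

theorem functor_map_heq {A : Type*} [Category A] {B : Type*} [Category B] (F : A ⥤ B)
    {x y x' y' : A} (hx : x = x') (hy : y = y') {φ : x ⟶ y} {ψ : x' ⟶ y'} (h : HEq φ ψ) :
    HEq (F.map φ) (F.map ψ) := by
  subst hx hy
  rw [eq_of_heq h]

theorem natTrans_app_heq {A : Type*} [Category A] {B : Type*} [Category B] {F G : A ⥤ B}
    (φ : F ⟶ G) {x x' : A} (hx : x = x') : HEq (φ.app x) (φ.app x') := by
  subst hx
  rfl

end reindex

/-! ### The multicategory of permutative categories -/

section MultiLin

variable {ι κ : Type} {C : ι → PermCat.{u}} {D : PermCat.{u}}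

theorem MultiLin.ext_heq {f g : MultiLin C D} (hobj : ∀ x, f.F.obj x = g.F.obj x)
    (hmap : ∀ x y (φ : x ⟶ y), HEq (f.F.map φ) (g.F.map φ))
    (hδ : ∀ i x y z h, HEq (f.δ i x y z h) (g.δ i x y z h)) : f = g := by
  have hF : f.F = g.F := CategoryTheory.Functor.hext hobj hmap
  cases f
  cases g
  dsimp only at hF
  subst hF
  congr
  funext i x y z h
  exact eq_of_heq (hδ i x y z h)

theorem MultiLin.Hom.heq {f g f' g' : MultiLin C D} (hf : f = f') (hg : g = g') (φ : f ⟶ g)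
    (ψ : f' ⟶ g') (h : ∀ x, HEq (φ.nat.app x) (ψ.nat.app x)) : HEq φ ψ := by
  subst hf hg
  exact heq_of_eq (MultiLin.Hom.ext (NatTrans.ext (funext fun x => eq_of_heq (h x))))

theorem MultiLin.δ_heq (f : MultiLin C D) {i i' : ι} (hi : i = i') {x y z x' y' z' : ∀ i, C i}
    (hx : x = x') (hy : y = y') (hz : z = z') (h : IsSum i x y z) (h' : IsSum i' x' y' z') :
    HEq (f.δ i x y z h) (f.δ i' x' y' z' h') := by
  subst hi hx hy hz
  rfl

theorem MultiLin.Hom.comm_push {f g : MultiLin C D} (φ : f ⟶ g) (i : ι) (x y z : ∀ j, C j)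
    (h : Agree i x y z) (r : x i ⊗ y i ⟶ z i) :
    f.push i x y z h r ≫ φ.nat.app z =
      (φ.nat.app x ⊗ₘ φ.nat.app y) ≫ g.push i x y z h r := by
  unfold MultiLin.push
  rw [Category.assoc, φ.nat.naturality, ← Category.assoc, φ.comm, Category.assoc]

/-- `push` is an identity if one of the other variables is zero. -/
theorem MultiLin.push_heq_id_of_ne (g : MultiLin C D) (i j : ι) (hij : j ≠ i) (x y z : ∀ j, C j)
    (h : Agree i x y z) (r : x i ⊗ y i ⟶ z i) (hx : x j = 𝟙_ (C j)) :
    HEq (g.push i x y z h r) (𝟙 (g.F.obj z)) := by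
  classical
  have hu := isSum_update i x y z h
  obtain ⟨m, hm⟩ := exists_isSingle i x y z _ h hu r
  rw [g.push_eq i x y z _ h r hu m hm]
  have hz : z j = 𝟙_ (C j) := (h j hij).2.trans hx
  have e₁ := g.F_map_zero j _ _ m ((hu.2 j hij).2.trans hx) hz (by
    refine (hm.2.2.2 j hij).2.trans ?_
    rw [(hu.2 j hij).2, hx])
  have e₂ := g.δ_id i x y _ hu (Or.inr ⟨j, hx⟩)
  have o₁ := g.F_zero j _ ((hu.2 j hij).2.trans hx)
  have o₂ := g.F_zero j _ hz
  refine (heq_comp_id e₁ o₁ o₂).trans (e₂.trans ?_)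
  rw [o₁, o₂]

theorem isSum_reindex (e : κ ≃ ι) {k : κ} {x y z : ∀ k, C (e k)}
    (h : IsSum (C := fun k => C (e k)) k x y z) :
    IsSum (e k) ((reindex e fun i => C i).obj x) ((reindex e fun i => C i).obj y)
      ((reindex e fun i => C i).obj z) := by
  refine ⟨?_, fun j hj => ?_⟩
  · rw [reindex_obj_apply, reindex_obj_apply, reindex_obj_apply]
    exact h.1
  · obtain ⟨l, rfl⟩ := e.surjective j
    rw [reindex_obj_apply, reindex_obj_apply, reindex_obj_apply]
    exact h.2 l fun hl => hj (hl ▸ rfl)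

theorem isSingle_reindex (e : κ ≃ ι) {k : κ} {x y : ∀ k, C (e k)} {a b : C (e k)} {a' b' : C (e k)}
    {r : a ⟶ b} {r' : a' ⟶ b'} (ha : a = a') (hb : b = b') (hr : HEq r r') {χ : x ⟶ y}
    (h : IsSingle (C := fun k => C (e k)) k r χ) :
    IsSingle (e k) r' ((reindex e fun i => C i).map χ) := by
  subst ha hb
  obtain rfl := eq_of_heq hr
  refine ⟨(reindex_obj_apply e (fun i => C i) x k).trans h.1, (reindex_obj_apply e (fun i => C i) y k).trans h.2.1,
    (reindex_map_apply e (fun i => C i) χ k).trans h.2.2.1, fun j hj => ?_⟩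
  obtain ⟨l, rfl⟩ := e.surjective j
  have hl := h.2.2.2 l fun hl => hj (hl ▸ rfl)
  refine ⟨?_, (reindex_map_apply e (fun i => C i) χ l).trans (hl.2.trans ?_)⟩
  · rw [reindex_obj_apply, reindex_obj_apply]
    exact hl.1
  · rw [reindex_obj_apply]

/-- The action of bijections on multilinear functors. -/
def MultiLin.act (e : κ ≃ ι) (f : MultiLin C D) : MultiLin (fun k => C (e k)) D where
  F := reindex e (fun i => C i) ⋙ f.F
  F_zero k x h := f.F_zero (e k) _ ((reindex_obj_apply e (fun i => C i) x k).trans h)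
  F_map_zero k x y φ hx hy hφ := f.F_map_zero (e k) _ _ _ ((reindex_obj_apply e (fun i => C i) x k).trans hx)
    ((reindex_obj_apply e (fun i => C i) y k).trans hy) ((reindex_map_apply e (fun i => C i) φ k).trans hφ)
  δ k x y z h := f.δ (e k) _ _ _ (isSum_reindex e h)
  δ_nat k x y z x' y' z' h h' φ ψ χ hχ := f.δ_nat (e k) _ _ _ _ _ _ _ _ _ _ _ ⟨by
      refine (reindex_map_apply e (fun i => C i) χ k).trans (hχ.1.trans ?_)
      exact (tensor_heq (reindex_obj_apply e (fun i => C i) _ k) (reindex_obj_apply e (fun i => C i) _ k)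
        (reindex_obj_apply e (fun i => C i) _ k) (reindex_obj_apply e (fun i => C i) _ k)
        (reindex_map_apply e (fun i => C i) φ k) (reindex_map_apply e (fun i => C i) ψ k)).symm, by
      intro j hj
      obtain ⟨l, rfl⟩ := e.surjective j
      have := hχ.2 l fun hl => hj (hl ▸ rfl)
      exact ⟨(reindex_map_apply e (fun i => C i) ψ l).trans
          (this.1.trans (reindex_map_apply e (fun i => C i) φ l).symm),
        (reindex_map_apply e (fun i => C i) χ l).trans
          (this.2.trans (reindex_map_apply e (fun i => C i) φ l).symm)⟩⟩
  δ_id k x y z h h' := f.δ_id (e k) _ _ _ _ (by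
    rcases h' with h' | ⟨j, h'⟩
    · exact Or.inl ((reindex_obj_apply e (fun i => C i) y k).trans h')
    · exact Or.inr ⟨e j, (reindex_obj_apply e (fun i => C i) x j).trans h'⟩)
  δ_symm k x y z z' h h' χ hχ := f.δ_symm (e k) _ _ _ _ _ _ _ (isSingle_reindex e (by
      rw [reindex_obj_apply, reindex_obj_apply]) (by
      rw [reindex_obj_apply, reindex_obj_apply]) (by
      rw [reindex_obj_apply, reindex_obj_apply]) hχ)
  δ_assoc k x y z xy yz w h₁ h₂ h₃ h₄ := f.δ_assoc (e k) _ _ _ _ _ _ _ _ _ _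
  δ_exch k l hkl a b c d ab cd ac bd t h₁ h₂ h₃ h₄ h₅ h₆ := f.δ_exch (e k) (e l)
    (fun h => hkl (e.injective h)) _ _ _ _ _ _ _ _ _ _ _ _ _ _ _

theorem MultiLin.act_push (e : κ ≃ ι) (f : MultiLin C D) (k : κ) (x y z : ∀ k, C (e k))
    (h : Agree (D := fun k => C (e k)) k x y z) (x' y' z' : ∀ i, C i) (h' : Agree (e k) x' y' z')
    (hx : (reindex e fun i => C i).obj x = x') (hy : (reindex e fun i => C i).obj y = y')
    (hz : (reindex e fun i => C i).obj z = z')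
    (r : x k ⊗ y k ⟶ z k) (r' : x' (e k) ⊗ y' (e k) ⟶ z' (e k)) (hr : HEq r r') :
    HEq ((f.act e).push k x y z h r) (f.push (e k) x' y' z' h' r') := by
  classical
  subst hx hy hz
  have hu := isSum_update (D := fun k => C (e k)) k x y z h
  obtain ⟨m, hm⟩ := exists_isSingle (D := fun k => C (e k)) k x y z _ h hu r
  rw [(f.act e).push_eq k x y z _ h r hu m hm,
    f.push_eq (e k) _ _ _ _ h' r' (isSum_reindex e hu) _ (isSingle_reindex e (by
      rw [reindex_obj_apply, reindex_obj_apply]) (by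
      rw [reindex_obj_apply]) hr hm)]
  exact HEq.rfl

/-- The identity functor as a multilinear functor. -/
def MultiLin.one (C : PermCat.{u}) : MultiLin (fun _ : Unit => C) C where
  F := { obj := fun x => x (), map := fun φ => φ () }
  F_zero _ _ h := h
  F_map_zero _ _ _ _ _ _ h := h
  δ _ _ _ _ h := eqToHom h.1.symm
  δ_nat _ x y z x' y' z' h h' φ ψ χ hχ := by
    apply eq_of_heq
    exact (comp_eqToHom_heq _ _).trans (hχ.1.symm.trans (eqToHom_comp_heq _ _).symm)
  δ_id _ _ _ _ _ _ := eqToHom_heq_id_cod _ _ _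
  δ_symm _ _ _ _ _ h h' χ hχ := by
    apply eq_of_heq
    exact (eqToHom_comp_heq _ _).trans (hχ.2.2.1.trans (comp_eqToHom_heq _ _).symm)
  δ_assoc _ _ _ _ _ _ _ _ _ _ _ := by
    rw [Permutative.associator_eq, eqToHom_whiskerRight, whiskerLeft_eqToHom, eqToHom_trans,
      eqToHom_trans, eqToHom_trans]
  δ_exch i j hij := (hij rfl).elim

theorem MultiLin.one_push (C : PermCat.{u}) (x y z : Unit → C)
    (h : Agree (D := fun _ : Unit => C) () x y z) (r : x () ⊗ y () ⟶ z ()) :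
    HEq ((MultiLin.one C).push () x y z h r) r := by
  classical
  have hu := isSum_update (D := fun _ : Unit => C) () x y z h
  obtain ⟨m, hm⟩ := exists_isSingle (D := fun _ : Unit => C) () x y z _ h hu r
  rw [(MultiLin.one C).push_eq () x y z _ h r hu m hm]
  have : (MultiLin.one C).δ () x y _ hu ≫ (MultiLin.one C).F.map m = eqToHom hu.1.symm ≫ m () :=
    rfl
  exact (heq_of_eq this).trans ((eqToHom_comp_heq _ _).trans hm.2.2.1)

end MultiLin

section comp

variable {ι : Type} {κ : ι → Type} {C : ∀ i, κ i → PermCat.{u}} {D : ι → PermCat.{u}}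
  {E : PermCat.{u}} (f : ∀ i, MultiLin (C i) (D i))

/-- The product of functors, applied to tuples. -/
def MultiLin.prodF : (∀ s : Σ i, κ i, C s.1 s.2) ⥤ (∀ i, D i) where
  obj x i := (f i).F.obj (fun k => x ⟨i, k⟩)
  map {x y} φ i := (f i).F.map (X := fun k => x ⟨i, k⟩) (Y := fun k => y ⟨i, k⟩)
    (fun k => φ ⟨i, k⟩)
  map_id _ := funext fun i => (f i).F.map_id _
  map_comp _ _ := funext fun i => (f i).F.map_comp _ _

theorem MultiLin.prodF_map_heq {x y x' y' : ∀ s : Σ i, κ i, C s.1 s.2} (φ : x ⟶ y) (ψ : x' ⟶ y')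
    (i : ι) (hx : ∀ k, x ⟨i, k⟩ = x' ⟨i, k⟩) (hy : ∀ k, y ⟨i, k⟩ = y' ⟨i, k⟩)
    (h : ∀ k, HEq (φ ⟨i, k⟩) (ψ ⟨i, k⟩)) :
    HEq ((MultiLin.prodF f).map φ i) ((MultiLin.prodF f).map ψ i) :=
  functor_map_heq (f i).F (funext hx) (funext hy) (pi_hom_heq (funext hx) (funext hy) _ _ h)

theorem MultiLin.prodF_map_heq_id {x y : ∀ s : Σ i, κ i, C s.1 s.2} (φ : x ⟶ y)
    (i : ι) (hy : ∀ k, y ⟨i, k⟩ = x ⟨i, k⟩)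
    (h : ∀ k, HEq (φ ⟨i, k⟩) (𝟙 (x ⟨i, k⟩))) :
    HEq ((MultiLin.prodF f).map φ i) (𝟙 ((MultiLin.prodF f).obj x i)) := by
  have := MultiLin.prodF_map_heq f φ (𝟙 x) i (fun _ => rfl) hy h
  rw [(MultiLin.prodF f).map_id] at this
  exact this

theorem isSum_fiber {i : ι} {k : κ i} {x y z : ∀ s : Σ i, κ i, C s.1 s.2}
    (h : IsSum (C := fun s : Σ i, κ i => C s.1 s.2) ⟨i, k⟩ x y z) :
    IsSum (C := C i) k (fun k => x ⟨i, k⟩) (fun k => y ⟨i, k⟩) (fun k => z ⟨i, k⟩) :=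
  ⟨h.1, fun l hl => h.2 ⟨i, l⟩ fun h => hl (eq_of_heq (Sigma.mk.inj h).2)⟩

theorem agree_fiber {i : ι} {k : κ i} {x y z : ∀ s : Σ i, κ i, C s.1 s.2}
    (h : Agree (D := fun s : Σ i, κ i => C s.1 s.2) ⟨i, k⟩ x y z) :
    Agree (D := C i) k (fun k => x ⟨i, k⟩) (fun k => y ⟨i, k⟩) (fun k => z ⟨i, k⟩) :=
  fun l hl => h ⟨i, l⟩ fun h => hl (eq_of_heq (Sigma.mk.inj h).2)

theorem agree_prodF {i : ι} {k : κ i} {x y z : ∀ s : Σ i, κ i, C s.1 s.2}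
    (h : Agree (D := fun s : Σ i, κ i => C s.1 s.2) ⟨i, k⟩ x y z) :
    Agree i ((MultiLin.prodF f).obj x) ((MultiLin.prodF f).obj y) ((MultiLin.prodF f).obj z) :=
  fun j hj => by
    have : ∀ l, _ := fun l => h ⟨j, l⟩ fun h => hj (Sigma.mk.inj h).1
    exact ⟨congrArg (f j).F.obj (funext fun l => (this l).1),
      congrArg (f j).F.obj (funext fun l => (this l).2)⟩

theorem isSingle_fiber {i : ι} {k : κ i} {x y : ∀ s : Σ i, κ i, C s.1 s.2} {a b : C i k}
    {r : a ⟶ b} {χ : x ⟶ y} (h : IsSingle (C := fun s : Σ i, κ i => C s.1 s.2) ⟨i, k⟩ r χ) :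
    IsSingle (C := C i) (x := fun k => x ⟨i, k⟩) (y := fun k => y ⟨i, k⟩) k r
      (fun k => χ ⟨i, k⟩) :=
  ⟨h.1, h.2.1, h.2.2.1, fun l hl => h.2.2.2 ⟨i, l⟩ fun h => hl (eq_of_heq (Sigma.mk.inj h).2)⟩

/-- The multiproduct of multilinear functors. -/
def MultiLin.comp (g : MultiLin D E) : MultiLin (fun s : Σ i, κ i => C s.1 s.2) E where
  F := MultiLin.prodF f ⋙ g.F
  F_zero s x h := g.F_zero s.1 _ ((f s.1).F_zero s.2 _ h)
  F_map_zero s x y φ hx hy h := g.F_map_zero s.1 _ _ _ ((f s.1).F_zero s.2 _ hx)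
    ((f s.1).F_zero s.2 _ hy) ((f s.1).F_map_zero s.2 _ _ _ hx hy h)
  δ s x y z h := g.push s.1 _ _ _ (agree_prodF f h.2) ((f s.1).δ s.2 _ _ _ (isSum_fiber h))
  δ_nat s x y z x' y' z' h h' φ ψ χ hχ := by
    refine g.push_nat s.1 _ _ _ _ _ _ _ _ _ _ ((MultiLin.prodF f).map φ)
      ((MultiLin.prodF f).map ψ) ((MultiLin.prodF f).map χ) ?_ fun j hj => ?_
    · exact (f s.1).δ_nat s.2 _ _ _ _ _ _ _ _ _ _ _ ⟨hχ.1, fun l hl => hχ.2 ⟨s.1, l⟩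
        fun h => hl (eq_of_heq (Sigma.mk.inj h).2)⟩
    · have hne : ∀ l, (⟨j, l⟩ : Σ i, κ i) ≠ s := fun l h => hj (by rw [← h])
      exact ⟨MultiLin.prodF_map_heq f _ _ j (fun l => (h.2 _ (hne l)).1)
        (fun l => (h'.2 _ (hne l)).1) fun l => (hχ.2 _ (hne l)).1,
        MultiLin.prodF_map_heq f _ _ j (fun l => (h.2 _ (hne l)).2)
        (fun l => (h'.2 _ (hne l)).2) fun l => (hχ.2 _ (hne l)).2⟩
  δ_id s x y z h h' := by
    have key : (y s = 𝟙_ (C s.1 s.2) ∨ ∃ l, x ⟨s.1, l⟩ = 𝟙_ (C s.1 l)) → HEq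
        (g.push s.1 _ _ _ (agree_prodF f h.2) ((f s.1).δ s.2 _ _ _ (isSum_fiber h)))
        (𝟙 (g.F.obj ((MultiLin.prodF f).obj z))) := by
      intro h₀
      have hy : y s = 𝟙_ (C s.1 s.2) → (MultiLin.prodF f).obj y s.1 = 𝟙_ (D s.1) ∧
          (MultiLin.prodF f).obj z s.1 = (MultiLin.prodF f).obj x s.1 := fun hy =>
        ⟨(f s.1).F_zero s.2 _ hy, congrArg (f s.1).F.obj (funext fun l => by
          by_cases hl : (⟨s.1, l⟩ : Σ i, κ i) = s
          · have hl' : l = s.2 := eq_of_heq (Sigma.mk.inj (hl : (⟨s.1, l⟩ : Σ i, κ i) = ⟨s.1, s.2⟩)).2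
            subst hl'
            refine h.1.trans ?_
            have : y s = 𝟙_ _ := hy
            rw [this, Permutative.unit_right]
          · exact (h.2 _ hl).2)⟩
      have hx : ∀ l, x ⟨s.1, l⟩ = 𝟙_ (C s.1 l) → l ≠ s.2 →
          (MultiLin.prodF f).obj y s.1 = 𝟙_ (D s.1) ∧
          (MultiLin.prodF f).obj z s.1 = (MultiLin.prodF f).obj x s.1 := fun l hl hl' => by
        have hne : (⟨s.1, l⟩ : Σ i, κ i) ≠ s := fun h => hl' (eq_of_heq (Sigma.mk.inj (h : (⟨s.1, l⟩ : Σ i, κ i) = ⟨s.1, s.2⟩)).2)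
        exact ⟨(f s.1).F_zero l _ ((h.2 _ hne).1.trans hl), ((f s.1).F_zero l _
          ((h.2 _ hne).2.trans hl)).trans ((f s.1).F_zero l _ hl).symm⟩
      have hx' : x s = 𝟙_ (C s.1 s.2) → (MultiLin.prodF f).obj x s.1 = 𝟙_ (D s.1) ∧
          (MultiLin.prodF f).obj z s.1 = (MultiLin.prodF f).obj y s.1 := fun hx =>
        ⟨(f s.1).F_zero s.2 _ hx, congrArg (f s.1).F.obj (funext fun l => by
          by_cases hl : (⟨s.1, l⟩ : Σ i, κ i) = s
          · have hl' : l = s.2 := eq_of_heq (Sigma.mk.inj (hl : (⟨s.1, l⟩ : Σ i, κ i) = ⟨s.1, s.2⟩)).2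
            subst hl'
            refine h.1.trans ?_
            have : x s = 𝟙_ _ := hx
            rw [this, Permutative.unit_left]
          · exact (h.2 _ hl).2.trans (h.2 _ hl).1.symm)⟩
      have hr := (f s.1).δ_id s.2 _ _ _ (isSum_fiber h) h₀
      rcases h₀ with h₀ | ⟨l, h₀⟩
      · refine g.push_heq_id s.1 _ _ _ _ _ hr ?_ (Or.inl (hy h₀).1)
        have := hy h₀
        change (MultiLin.prodF f).obj x s.1 ⊗ (MultiLin.prodF f).obj y s.1 = _
        rw [this.1, Permutative.unit_right, this.2]
      · by_cases hl : l = s.2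
        · subst hl
          refine g.push_heq_id s.1 _ _ _ _ _ hr ?_ (Or.inr ⟨s.1, (hx' h₀).1⟩)
          have := hx' h₀
          change (MultiLin.prodF f).obj x s.1 ⊗ (MultiLin.prodF f).obj y s.1 = _
          rw [this.1, Permutative.unit_left, this.2]
        · refine g.push_heq_id s.1 _ _ _ _ _ hr ?_ (Or.inl (hx l h₀ hl).1)
          have := hx l h₀ hl
          change (MultiLin.prodF f).obj x s.1 ⊗ (MultiLin.prodF f).obj y s.1 = _
          rw [this.1, Permutative.unit_right, this.2]
    rcases h' with h' | ⟨⟨j, l⟩, h'⟩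
    · exact key (Or.inl h')
    · by_cases hj : j = s.1
      · subst hj
        exact key (Or.inr ⟨l, h'⟩)
      · exact g.push_heq_id_of_ne s.1 j hj _ _ _ _ _ ((f j).F_zero l _ h')
  δ_symm s x y z z' h h' χ hχ := by
    refine g.push_symm s.1 _ _ _ _ _ _ _ _ ((MultiLin.prodF f).map χ) ?_ fun j hj => ?_
    · exact (f s.1).δ_symm s.2 _ _ _ _ _ _ _ (isSingle_fiber hχ)
    · have hne : ∀ l, (⟨j, l⟩ : Σ i, κ i) ≠ s := fun l h => hj (by rw [← h])
      exact MultiLin.prodF_map_heq_id f χ j (fun l => (hχ.2.2.2 _ (hne l)).1)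
        fun l => (hχ.2.2.2 _ (hne l)).2
  δ_assoc s x y z xy yz w h₁ h₂ h₃ h₄ :=
    g.push_assoc s.1 _ _ _ _ _ _ _ _ _ _ _ _ _ _ ((f s.1).δ_assoc s.2 _ _ _ _ _ _ _ _ _ _)
  δ_exch s s' hs a b c d ab cd ac bd t h₁ h₂ h₃ h₄ h₅ h₆ := by
    obtain ⟨i, k⟩ := s
    obtain ⟨j, l⟩ := s'
    by_cases hij : i = j
    · subst hij
      exact g.push_exch_same i _ _ _ _ _ _ _ _ _ _ _ _ _ _ _ _ _ _ _ _ _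
        ((f i).δ_exch k l (fun h => hs (by rw [h])) _ _ _ _ _ _ _ _ _ _ _ _ _ _ _)
    · have hne : ∀ k', (⟨i, k'⟩ : Σ i, κ i) ≠ ⟨j, l⟩ := fun k' h => hij (Sigma.mk.inj h).1
      have hne' : ∀ l', (⟨j, l'⟩ : Σ i, κ i) ≠ ⟨i, k⟩ := fun k' h => hij (Sigma.mk.inj h).1.symm
      refine g.push_exch_diff i j hij _ _ _ _ _ _ _ _ _ _ _ _ _ _ _ _ _ _ _ _ _ ?_ ?_ ?_ ?_
      · exact (f i).δ_heq rfl (funext fun m => (h₄.2 _ (hne m)).1) (funext fun m =>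
          (h₅.2 _ (hne m)).1) (funext fun m => (h₃.2 _ (hne m)).1) _ _
      · exact (f i).δ_heq rfl (funext fun m => (h₄.2 _ (hne m)).2) (funext fun m =>
          (h₅.2 _ (hne m)).2) (funext fun m => (h₃.2 _ (hne m)).2) _ _
      · exact (f j).δ_heq rfl (funext fun m => (h₁.2 _ (hne' m)).2.symm) (funext fun m =>
          (h₂.2 _ (hne' m)).2.symm) (funext fun m => (h₆.2 _ (hne' m)).2.symm) _ _
      · exact (f j).δ_heq rfl (funext fun m => (h₁.2 _ (hne' m)).1.trans (h₁.2 _ (hne' m)).2.symm)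
          (funext fun m => (h₂.2 _ (hne' m)).1.trans (h₂.2 _ (hne' m)).2.symm) (funext fun m =>
          (h₆.2 _ (hne' m)).1.trans (h₆.2 _ (hne' m)).2.symm) _ _

theorem MultiLin.comp_push (g : MultiLin D E) (i : ι) (k : κ i)
    (x y z : ∀ s : Σ i, κ i, C s.1 s.2)
    (h : Agree (D := fun s : Σ i, κ i => C s.1 s.2) ⟨i, k⟩ x y z)
    (r : x ⟨i, k⟩ ⊗ y ⟨i, k⟩ ⟶ z ⟨i, k⟩) :
    (MultiLin.comp f g).push ⟨i, k⟩ x y z h r =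
      g.push i _ _ _ (agree_prodF f h) ((f i).push k (fun k => x ⟨i, k⟩) (fun k => y ⟨i, k⟩)
        (fun k => z ⟨i, k⟩) (agree_fiber h) r) := by
  classical
  have hu := isSum_update (D := fun s : Σ i, κ i => C s.1 s.2) ⟨i, k⟩ x y z h
  obtain ⟨m, hm⟩ := exists_isSingle (D := fun s : Σ i, κ i => C s.1 s.2) ⟨i, k⟩ x y z _ h hu r
  rw [(MultiLin.comp f g).push_eq ⟨i, k⟩ x y z _ h r hu m hm,
    (f i).push_eq k _ _ _ _ (agree_fiber h) r (isSum_fiber hu) _ (isSingle_fiber hm)]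
  refine (g.push_comp i _ _ _ _ (agree_prodF f hu.2) _ _ ((MultiLin.prodF f).map m)
    fun j hj => ?_).symm
  have hne : ∀ l, (⟨j, l⟩ : Σ i, κ i) ≠ ⟨i, k⟩ := fun l h => hj (Sigma.mk.inj h).1
  exact MultiLin.prodF_map_heq_id f m j (fun l => (hm.2.2.2 _ (hne l)).1)
    fun l => (hm.2.2.2 _ (hne l)).2

end comp

section MultiLin

variable {ι κ : Type} {C : ι → PermCat.{u}} {D : PermCat.{u}}

/-- The action of bijections on morphisms of multilinear functors. -/
def MultiLin.actMap (e : κ ≃ ι) {f g : MultiLin C D} (φ : f ⟶ g) : f.act e ⟶ g.act e :=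
  MultiLin.Hom.mk (f := f.act e) (g := g.act e) (Functor.whiskerLeft (reindex e fun i => C i) φ.nat)
    (fun k x h => φ.zero (e k) _ ((reindex_obj_apply e (fun i => C i) x k).trans h))
    (fun k _ _ _ h => φ.comm (e k) _ _ _ (isSum_reindex e h))

end MultiLin

section comp

variable {ι : Type} {κ : ι → Type} {C : ∀ i, κ i → PermCat.{u}} {D : ι → PermCat.{u}}
  {E : PermCat.{u}}

/-- The product of natural transformations, applied to tuples. -/
def MultiLin.prodNat {f f' : ∀ i, MultiLin (C i) (D i)} (φ : ∀ i, f i ⟶ f' i) :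
    MultiLin.prodF f ⟶ MultiLin.prodF f' where
  app x i := (φ i).nat.app (fun k => x ⟨i, k⟩)
  naturality _ _ _ := funext fun i => (φ i).nat.naturality _

/-- The multiproduct of morphisms of multilinear functors. -/
def MultiLin.compMap {f f' : ∀ i, MultiLin (C i) (D i)} {g g' : MultiLin D E} (γ : g ⟶ g')
    (φ : ∀ i, f i ⟶ f' i) : MultiLin.comp f g ⟶ MultiLin.comp f' g' :=
  MultiLin.Hom.mk (f := MultiLin.comp f g) (g := MultiLin.comp f' g')
    (Functor.whiskerRight (MultiLin.prodNat φ) g.F ≫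
      Functor.whiskerLeft (MultiLin.prodF f') γ.nat)
    (fun s x h => by
      have h₁ := (f s.1).F_zero s.2 (fun k => x ⟨s.1, k⟩) h
      have h₂ := (f' s.1).F_zero s.2 (fun k => x ⟨s.1, k⟩) h
      have e₁ := g.F_map_zero s.1 ((MultiLin.prodF f).obj x) ((MultiLin.prodF f').obj x)
        (fun i => (φ i).nat.app (fun k => x ⟨i, k⟩)) h₁ h₂ ((φ s.1).zero s.2 _ h)
      exact (heq_id_comp e₁ (g.F_zero s.1 _ h₁) (g.F_zero s.1 _ h₂)).trans (γ.zero s.1 _ h₂))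
    (fun s x y z h => by
      change g.push s.1 _ _ _ (agree_prodF f h.2) _ ≫ g.F.map ((MultiLin.prodNat φ).app z) ≫
          γ.nat.app ((MultiLin.prodF f').obj z) =
        ((g.F.map ((MultiLin.prodNat φ).app x) ≫ γ.nat.app ((MultiLin.prodF f').obj x)) ⊗ₘ
          (g.F.map ((MultiLin.prodNat φ).app y) ≫ γ.nat.app ((MultiLin.prodF f').obj y))) ≫
          g'.push s.1 _ _ _ (agree_prodF f' h.2) _
      rw [← MonoidalCategory.tensorHom_comp_tensorHom, Category.assoc]
      refine Eq.trans ?_ (congrArg (_ ≫ ·) (γ.comm_push s.1 _ _ _ (agree_prodF f' h.2)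
        ((f' s.1).δ s.2 _ _ _ (isSum_fiber h))))
      refine Eq.trans ?_ (Category.assoc _ _ _)
      refine (Category.assoc _ _ _).symm.trans (congrArg (· ≫ _) ?_)
      refine (g.push_nat s.1 _ _ _ _ _ _ (agree_prodF f h.2) (agree_prodF f' h.2)
          ((f s.1).δ s.2 _ _ _ (isSum_fiber h)) _ _ _ _ ((φ s.1).comm s.2 _ _ _ _).symm
          fun j hj => ?_).symm
      have hne : ∀ l, (⟨j, l⟩ : Σ i, κ i) ≠ s := fun l h => hj (by rw [← h])
      exact ⟨natTrans_app_heq (φ j).nat (funext fun l => (h.2 _ (hne l)).1),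
        natTrans_app_heq (φ j).nat (funext fun l => (h.2 _ (hne l)).2)⟩)

end comp

theorem exists_reindex {ι κ : Type} (e : κ ≃ ι) (C : ι → Type v) [∀ i, Category.{w} (C i)]
    (x : ∀ k, C (e k)) : ∃ w : ∀ i, C i, x = fun k => w (e k) :=
  ⟨(reindex e C).obj x, funext fun k => (reindex_obj_apply e C x k).symm⟩

theorem MultiLin.actMap_app {ι κ : Type} {C : ι → PermCat.{u}} {D : PermCat.{u}} (e : κ ≃ ι)
    {f g : MultiLin C D} (φ : f ⟶ g) (x : ∀ i, C i) :
    HEq ((MultiLin.actMap e φ).nat.app (fun k => x (e k))) (φ.nat.app x) :=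
  natTrans_app_heq φ.nat (reindex_obj_eq e (fun i => C i) _ x fun _ => rfl)

theorem hom_apply_heq {ι : Type} {C : ι → Type v} [∀ i, Category.{w} (C i)]
    {x y x' y' : ∀ j, C j} (hx : x' = x) (hy : y' = y) {χ : x ⟶ y} {χ' : x' ⟶ y'}
    (h : HEq χ χ') (j : ι) : HEq (χ j) (χ' j) := by
  subst hx hy
  rw [eq_of_heq h]

section laws

variable {ι κ : Type} {C : ι → PermCat.{u}} {D : PermCat.{u}}

theorem MultiLin.act_refl (f : MultiLin C D) : f.act (Equiv.refl ι) = f := by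
  have h : ∀ x : ∀ i, C i, (reindex (Equiv.refl ι) fun i => C i).obj x = x := fun x =>
    reindex_obj_eq (Equiv.refl ι) (fun i => C i) x x fun _ => rfl
  exact MultiLin.ext_heq (fun x => congrArg f.F.obj (h x)) (fun x y φ => functor_map_heq f.F (h x)
    (h y) (reindex_map_heq (Equiv.refl ι) (fun i => C i) (fun _ => rfl) (fun _ => rfl) φ φ
      fun _ => HEq.rfl)) fun i x y z _ => f.δ_heq rfl (h x) (h y) (h z) _ _

theorem MultiLin.act_trans {μ : Type} (d : μ ≃ κ) (e : κ ≃ ι) (f : MultiLin C D) :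
    f.act (d.trans e) = (f.act e).act d := by
  have h : ∀ x : ∀ m, C (e (d m)), (reindex (d.trans e) fun i => C i).obj x =
      (reindex e fun i => C i).obj ((reindex d fun k => C (e k)).obj x) := fun x =>
    reindex_obj_eq (d.trans e) (fun i => C i) x _ fun m =>
      (reindex_obj_apply e (fun i => C i) _ (d m)).trans
        (reindex_obj_apply d (fun k => C (e k)) _ m)
  exact MultiLin.ext_heq (fun x => congrArg f.F.obj (h x)) (fun x y φ => functor_map_heq f.F (h x)
    (h y) (reindex_map_heq (d.trans e) (fun i => C i) (fun m =>
      (reindex_obj_apply e (fun i => C i) _ (d m)).trans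
        (reindex_obj_apply d (fun k => C (e k)) _ m)) (fun m =>
      (reindex_obj_apply e (fun i => C i) _ (d m)).trans
        (reindex_obj_apply d (fun k => C (e k)) _ m)) φ _ fun m =>
      (reindex_map_apply e (fun i => C i) _ (d m)).trans
        (reindex_map_apply d (fun k => C (e k)) _ m)))
    fun i x y z _ => f.δ_heq rfl (h x) (h y) (h z) _ _

theorem MultiLin.eq_act (e : κ ≃ ι) (f : MultiLin C D) (f' : MultiLin (fun k => C (e k)) D)
    (hobj : ∀ x : ∀ i, C i, f'.F.obj (fun k => x (e k)) = f.F.obj x)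
    (hmap : ∀ (x y : ∀ i, C i) (φ : x ⟶ y), HEq (f'.F.map (X := fun k => x (e k))
      (Y := fun k => y (e k)) (fun k => φ (e k))) (f.F.map φ))
    (hδ : ∀ (k : κ) (x y z : ∀ i, C i) (h : IsSum (e k) x y z)
      (h' : IsSum (C := fun k => C (e k)) k (fun k => x (e k)) (fun k => y (e k))
        (fun k => z (e k))), HEq (f'.δ k _ _ _ h') (f.δ (e k) x y z h)) : f' = f.act e := by
  refine MultiLin.ext_heq (fun x => ?_) (fun x y φ => ?_) fun k x y z h => ?_
  · obtain ⟨w, rfl⟩ := exists_reindex e (fun i => C i) x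
    exact (hobj w).trans (congrArg f.F.obj (reindex_obj_eq e (fun i => C i) _ w fun _ => rfl).symm)
  · obtain ⟨w, rfl⟩ := exists_reindex e (fun i => C i) x
    obtain ⟨w', rfl⟩ := exists_reindex e (fun i => C i) y
    have hw := reindex_obj_eq e (fun i => C i) _ w fun _ => rfl
    have hw' := reindex_obj_eq e (fun i => C i) _ w' fun _ => rfl
    let ψ : w ⟶ w' := eqToHom hw.symm ≫ (reindex e fun i => C i).map φ ≫ eqToHom hw'
    have hψ : HEq ((reindex e fun i => C i).map φ) ψ :=
      ((eqToHom_comp_heq _ _).trans (comp_eqToHom_heq _ _)).symm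
    have hψ' : (fun k => ψ (e k)) = φ := funext fun k => eq_of_heq
      (HEq.trans (hom_apply_heq (C := fun i => C i) hw hw' hψ.symm (e k)) (reindex_map_apply e (fun i => C i) φ k))
    have := hmap w w' ψ
    rw [hψ'] at this
    exact this.trans (functor_map_heq f.F hw.symm hw'.symm hψ.symm)
  · have h₁ := isSum_reindex e h
    obtain ⟨x, rfl⟩ := exists_reindex e (fun i => C i) x
    obtain ⟨y, rfl⟩ := exists_reindex e (fun i => C i) y
    obtain ⟨z, rfl⟩ := exists_reindex e (fun i => C i) z
    have hx := reindex_obj_eq e (fun i => C i) _ x fun _ => rfl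
    have hy := reindex_obj_eq e (fun i => C i) _ y fun _ => rfl
    have hz := reindex_obj_eq e (fun i => C i) _ z fun _ => rfl
    exact (hδ k x y z (by rwa [hx, hy, hz] at h₁) h).trans (f.δ_heq rfl hx.symm hy.symm hz.symm _ _)

theorem MultiLin.comp_one (f : MultiLin C D) :
    MultiLin.comp (fun i => MultiLin.one (C i)) f =
      f.act (Equiv.sigmaUnique ι (fun _ => Unit)) :=
  MultiLin.eq_act (Equiv.sigmaUnique ι (fun _ => Unit)) f
    (MultiLin.comp (fun i => MultiLin.one (C i)) f) (fun _ => rfl) (fun _ _ _ => HEq.rfl) fun s _ _ _ h _ =>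
    heq_of_eq (f.push_id_eq s.1 _ _ _ h)

theorem MultiLin.one_comp (f : MultiLin C D) :
    MultiLin.comp (fun _ => f) (MultiLin.one D) =
      f.act (Equiv.uniqueSigma (fun _ : Unit => ι)) :=
  MultiLin.eq_act (Equiv.uniqueSigma (fun _ : Unit => ι)) f
    (MultiLin.comp (fun _ => f) (MultiLin.one D)) (fun _ => rfl) (fun _ _ _ => HEq.rfl) fun _ _ _ _ _ h' =>
    MultiLin.one_push D _ _ _ (agree_prodF (fun _ => f) h'.2) _

end laws

section assoc

variable {ι : Type} {κ : ι → Type} {C : ∀ i, κ i → PermCat.{u}} {D : ι → PermCat.{u}}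
  {E : PermCat.{u}}

theorem MultiLin.comp_assoc {μ : ∀ i, κ i → Type} {B : ∀ i k, μ i k → PermCat.{u}}
    (g : MultiLin D E) (f : ∀ i, MultiLin (C i) (D i)) (h : ∀ i k, MultiLin (B i k) (C i k)) :
    MultiLin.comp (fun s : Σ i, κ i => h s.1 s.2) (MultiLin.comp f g) =
      (MultiLin.comp (fun i => MultiLin.comp (h i) (f i)) g).act (Equiv.sigmaAssoc μ) :=
  MultiLin.eq_act (C := fun s : Σ i, Σ k, μ i k => B s.1 s.2.1 s.2.2) (Equiv.sigmaAssoc μ)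
    (MultiLin.comp (fun i => MultiLin.comp (h i) (f i)) g)
    (MultiLin.comp (fun s : Σ i, κ i => h s.1 s.2) (MultiLin.comp f g)) (fun _ => rfl)
    (fun _ _ _ => HEq.rfl) fun s _ _ _ _ h' =>
      heq_of_eq (MultiLin.comp_push f g s.1.1 s.1.2 _ _ _
        (agree_prodF (fun s : Σ i, κ i => h s.1 s.2) h'.2) _)

theorem MultiLin.act_comp {ι' : Type} (e : ι' ≃ ι) (g : MultiLin D E)
    (f : ∀ i, MultiLin (C i) (D i)) :
    MultiLin.comp (fun i => f (e i)) (g.act e) =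
      (MultiLin.comp f g).act (Equiv.sigmaCongrLeft (β := κ) e) := by
  have o : ∀ w : ∀ s : Σ i, κ i, C s.1 s.2, (reindex e fun i => D i).obj
      ((MultiLin.prodF fun i => f (e i)).obj fun s => w ⟨e s.1, s.2⟩) =
      (MultiLin.prodF f).obj w := fun w => reindex_obj_eq e (fun i => D i) _ _ fun _ => rfl
  exact MultiLin.eq_act (C := fun s : Σ i, κ i => C s.1 s.2) (Equiv.sigmaCongrLeft (β := κ) e)
    (MultiLin.comp f g) (MultiLin.comp (fun i => f (e i)) (g.act e))
    (fun x => congrArg g.F.obj (o x))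
    (fun x y φ => functor_map_heq g.F (o x) (o y) (reindex_map_heq e (fun i => D i)
      (y := (MultiLin.prodF f).obj x) (y' := (MultiLin.prodF f).obj y)
      (fun _ => rfl) (fun _ => rfl) _ ((MultiLin.prodF f).map φ) fun _ => HEq.rfl))
    fun s x y z h h' => g.act_push e s.1 _ _ _ (agree_prodF (fun i => f (e i)) h'.2) _ _ _
      (agree_prodF f (i := e s.1) (k := s.2) h.2)
      (o x) (o y) (o z) _ _ HEq.rfl

theorem MultiLin.comp_act {κ' : ι → Type} (e : ∀ i, κ' i ≃ κ i) (g : MultiLin D E)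
    (f : ∀ i, MultiLin (C i) (D i)) :
    MultiLin.comp (fun i => (f i).act (e i)) g =
      (MultiLin.comp f g).act (Equiv.sigmaCongrRight e) := by
  have o : ∀ (w : ∀ s : Σ i, κ i, C s.1 s.2) i, (reindex (e i) fun k => C i k).obj
      (fun k => w ⟨i, e i k⟩) = fun k => w ⟨i, k⟩ :=
    fun w i => reindex_obj_eq (e i) (fun k => C i k) _ _ fun _ => rfl
  have o' : ∀ w : ∀ s : Σ i, κ i, C s.1 s.2, (MultiLin.prodF fun i => (f i).act (e i)).obj
      (fun s => w ⟨s.1, e s.1 s.2⟩) = (MultiLin.prodF f).obj w := fun w =>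
    funext fun i => congrArg (f i).F.obj (o w i)
  exact MultiLin.eq_act (C := fun s : Σ i, κ i => C s.1 s.2) (Equiv.sigmaCongrRight e)
    (MultiLin.comp f g) (MultiLin.comp (fun i => (f i).act (e i)) g)
    (fun x => congrArg g.F.obj (o' x))
    (fun x y φ => functor_map_heq g.F (o' x) (o' y) (hom_heq_of (o' x) (o' y) _ _ fun i =>
      functor_map_heq (f i).F (o x i) (o y i) (reindex_map_heq (e i) (fun k => C i k)
      (y := fun k => x ⟨i, k⟩) (y' := fun k => y ⟨i, k⟩)
      (fun _ => rfl) (fun _ => rfl) _ (fun k => φ ⟨i, k⟩) fun _ => HEq.rfl)))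
    fun s x y z h h' => g.push_heq s.1 (o' x) (o' y) (o' z)
      (agree_prodF (fun i => (f i).act (e i)) h'.2) (agree_prodF f (i := s.1) (k := e s.1 s.2) h.2)
      ((f s.1).δ_heq rfl (o x s.1) (o y s.1) (o z s.1) _ _)

end assoc

/-- The multicategory of permutative categories. -/
def permMulticat : CatMulticat permGraph.{u} where
  act e _ _ f := f.act e
  one C := MultiLin.one C
  comp g f := MultiLin.comp f g
  act_refl f := f.act_refl
  act_trans d e _ _ f := f.act_trans d e
  assoc g f h := g.comp_assoc f h
  comp_one f := f.comp_one
  one_comp f := f.one_comp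
  act_comp e _ _ _ _ _ g f := g.act_comp e f
  comp_act e _ _ _ g f := g.comp_act e f
  actMap e _ _ _ _ φ := MultiLin.actMap e φ
  compMap γ φ := MultiLin.compMap γ φ
  actMap_id _ _ _ _ := rfl
  actMap_comp _ _ _ _ _ _ _ _ := rfl
  compMap_id g f := MultiLin.Hom.ext (NatTrans.ext (funext fun x =>
    (Category.comp_id _).trans (g.F.map_id _)))
  compMap_comp {_ _ _ _ _ _ _ g g' g'' f f' f''} γ γ' φ φ' :=
    MultiLin.Hom.ext (NatTrans.ext (funext fun x => by
      change g.F.map _ ≫ γ.nat.app _ ≫ γ'.nat.app _ =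
        (g.F.map _ ≫ γ.nat.app _) ≫ g'.F.map _ ≫ γ'.nat.app _
      rw [Category.assoc, ← γ.nat.naturality_assoc, ← Functor.map_comp_assoc]
      rfl))
  actMap_refl {_ _ _ _ f g} φ := MultiLin.Hom.heq f.act_refl g.act_refl _ _ fun x =>
    MultiLin.actMap_app (Equiv.refl _) φ x
  actMap_trans {_ _ _ _ _ _} d e {a _ f g} φ :=
    MultiLin.Hom.heq (f.act_trans d e) (g.act_trans d e) _ _ fun x => by
      obtain ⟨w, rfl⟩ := exists_reindex (d.trans e) (fun i => a i) x
      exact (MultiLin.actMap_app (d.trans e) φ w).trans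
        ((MultiLin.actMap_app e φ w).symm.trans
          (MultiLin.actMap_app d (MultiLin.actMap e φ) fun k => w (e k)).symm)
  assocMap {_ _ _ _ μ _ a _ _ _ g g' f f' h h'} γ φ χ :=
    MultiLin.Hom.heq (g.comp_assoc f h) (g'.comp_assoc f' h') _ _ fun x => by
      obtain ⟨w, rfl⟩ := exists_reindex (Equiv.sigmaAssoc μ) (fun s => a s.1 s.2.1 s.2.2) x
      refine HEq.trans ?_ (MultiLin.actMap_app (Equiv.sigmaAssoc μ)
        (MultiLin.compMap γ fun i => MultiLin.compMap (φ i) (χ i)) w).symm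
      refine heq_of_eq ((Functor.map_comp_assoc g.F _ _ _).symm.trans ?_)
      rfl
  compMap_one {_ _ a _ f g} φ := MultiLin.Hom.heq f.comp_one g.comp_one _ _ fun x => by
    obtain ⟨w, rfl⟩ := exists_reindex (Equiv.sigmaUnique _ (fun _ => Unit)) (fun i => a i) x
    refine HEq.trans ?_ (MultiLin.actMap_app (Equiv.sigmaUnique _ (fun _ => Unit)) φ w).symm
    exact heq_of_eq ((congrArg (· ≫ φ.nat.app w) (f.F.map_id w)).trans (Category.id_comp _))
  one_compMap {ι _ a _ f g} φ := MultiLin.Hom.heq f.one_comp g.one_comp _ _ fun x => by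
    obtain ⟨w, rfl⟩ := exists_reindex (Equiv.uniqueSigma (fun _ : Unit => ι)) (fun i => a i) x
    refine HEq.trans ?_ (MultiLin.actMap_app (Equiv.uniqueSigma (fun _ : Unit => ι)) φ w).symm
    exact heq_of_eq (Category.comp_id (φ.nat.app w))
  actMap_compMap {_ _ _ _} e {κ} _ {a b _ g g' f f'} γ φ :=
    MultiLin.Hom.heq (g.act_comp e f) (g'.act_comp e f') _ _ fun x => by
      obtain ⟨w, rfl⟩ := exists_reindex (Equiv.sigmaCongrLeft (β := κ) e) (fun s => a s.1 s.2) x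
      refine HEq.trans ?_ (MultiLin.actMap_app (Equiv.sigmaCongrLeft (β := κ) e)
        (MultiLin.compMap γ φ) w).symm
      have o : ∀ f : ∀ i, MultiLin (a i) (b i), (reindex e fun i => b i).obj
          ((MultiLin.prodF fun i => f (e i)).obj fun s => w ⟨e s.1, s.2⟩) =
          (MultiLin.prodF f).obj w := fun f => reindex_obj_eq e (fun i => b i) _ _ fun _ => rfl
      exact comp_heq (congrArg g.F.obj (o f)) (congrArg g.F.obj (o f')) (congrArg g'.F.obj (o f'))
        (functor_map_heq g.F (o f) (o f') (reindex_map_heq e (fun i => b i) (fun _ => rfl)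
          (fun _ => rfl) _ ((MultiLin.prodNat φ).app w) fun _ => HEq.rfl))
        (natTrans_app_heq γ.nat (o f'))
  compMap_actMap {_ _ _ _ _ _} e {a b _ g g' f f'} γ φ :=
    MultiLin.Hom.heq (g.comp_act e f) (g'.comp_act e f') _ _ fun x => by
      obtain ⟨w, rfl⟩ := exists_reindex (Equiv.sigmaCongrRight e) (fun s => a s.1 s.2) x
      refine HEq.trans ?_ (MultiLin.actMap_app (Equiv.sigmaCongrRight e)
        (MultiLin.compMap γ φ) w).symm
      have o : ∀ i, (reindex (e i) fun k => a i k).obj (fun k => w ⟨i, e i k⟩) =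
          fun k => w ⟨i, k⟩ := fun i => reindex_obj_eq (e i) (fun k => a i k) _ _ fun _ => rfl
      have o' : ∀ f : ∀ i, MultiLin (a i) (b i), (MultiLin.prodF fun i => (f i).act (e i)).obj
          (fun s => w ⟨s.1, e s.1 s.2⟩) = (MultiLin.prodF f).obj w := fun f =>
        funext fun i => congrArg (f i).F.obj (o i)
      exact comp_heq (congrArg g.F.obj (o' f)) (congrArg g.F.obj (o' f'))
        (congrArg g'.F.obj (o' f')) (functor_map_heq g.F (o' f) (o' f') (hom_heq_of (o' f) (o' f')
          _ _ fun i => natTrans_app_heq (φ i).nat (o i))) (natTrans_app_heq γ.nat (o' f'))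

theorem isPermMulticat : IsPermMulticat permMulticat.{u} where
  act_obj e _ _ f x := congrArg f.F.obj (reindex_obj_eq e _ _ x fun _ => rfl)
  act_map e C _ f x y φ := functor_map_heq f.F (reindex_obj_eq e (fun i => C i) _ x fun _ => rfl)
    (reindex_obj_eq e (fun i => C i) _ y fun _ => rfl) (reindex_map_heq e _ (fun _ => rfl)
      (fun _ => rfl) _ φ fun _ => HEq.rfl)
  act_δ e _ _ f _ x y z _ _ := f.δ_heq rfl (reindex_obj_eq e _ _ x fun _ => rfl)
    (reindex_obj_eq e _ _ y fun _ => rfl) (reindex_obj_eq e _ _ z fun _ => rfl) _ _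
  actMap_app e C _ _ _ φ x :=
    natTrans_app_heq φ.nat (reindex_obj_eq e (fun i => C i) _ x fun _ => rfl)
  one_obj _ _ := rfl
  one_map _ _ _ _ := HEq.rfl
  one_δ _ _ _ _ h := eqToHom_heq_id_cod _ _ h.1.symm
  comp_obj _ _ _ := rfl
  comp_map _ _ _ _ _ := HEq.rfl
  comp_δ g f i k _ _ _ h h' w hw χ hχ := heq_of_eq (g.push_eq i _ _ _ w (agree_prodF f h.2)
    ((f i).δ k _ _ _ h') hw χ hχ)
  compMap_app _ _ _ := HEq.rfl

/-! ### Permutations of the natural numbers and sequences of based sets -/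

/-- Two injections into the natural numbers differ by a permutation on any finite set. -/
theorem exists_perm {α : Type} (S : Set α) (hS : S.Finite) (β β' : α ↪ ℕ) :
    ∃ θ : Equiv.Perm ℕ, ∀ a ∈ S, θ (β a) = β' a := by
  classical
  have := hS.fintype
  let ε := (Fintype.equivFin S).symm
  let x : Fin (Fintype.card S) ↪ ℕ := ε.toEmbedding.trans ((Function.Embedding.subtype _).trans β)
  let y : Fin (Fintype.card S) ↪ ℕ := ε.toEmbedding.trans ((Function.Embedding.subtype _).trans β')
  have := Equiv.Perm.isMultiplyPretransitive ℕ (Fintype.card S)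
  obtain ⟨θ, hθ⟩ := MulAction.exists_smul_eq (Equiv.Perm ℕ) x y
  refine ⟨θ, fun a ha => ?_⟩
  have := congrArg (fun f => f (ε.symm ⟨a, ha⟩)) hθ
  simpa [x, y] using this

section push

variable {ι : Type}

theorem finite_entries [Finite ι] (n : ι → Finfty) : {p : ι × ℕ | (n p.1).n p.2 ≠ 1}.Finite :=
  (Set.finite_iUnion fun i => (n i).fin.image (Prod.mk i)).subset fun p hp =>
    Set.mem_iUnion.2 ⟨p.1, p.2, hp, rfl⟩

theorem finite_entries_hom [Finite ι] {n n' : ι → Finfty} (φ : ∀ i, n i ⟶ n' i) :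
    {p : ι × ℕ | (φ p.1).f p.2 ≠ idOn 1}.Finite :=
  (Set.finite_iUnion fun i => (φ i).fin.image (Prod.mk i)).subset fun p hp =>
    Set.mem_iUnion.2 ⟨p.1, p.2, hp, rfl⟩

theorem exists_embedding [Finite ι] : Nonempty (ι × ℕ ↪ ℕ) :=
  nonempty_embedding_nat (ι × ℕ)

theorem IsPush.ne_one {β : ι × ℕ ↪ ℕ} {n : ι → Finfty} {m : Finfty} (h : IsPush β n m) {s : ℕ}
    (hs : m.n s ≠ 1) : ∃ i j, (n i).n j ≠ 1 ∧ β (i, j) = s := by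
  by_cases hr : s ∈ Set.range β
  · obtain ⟨⟨i, j⟩, rfl⟩ := hr
    exact ⟨i, j, by rwa [← h.1], rfl⟩
  · exact absurd (h.2 s hr) hs

theorem IsPush.unique {β : ι × ℕ ↪ ℕ} {n : ι → Finfty} {m m' : Finfty} (h : IsPush β n m)
    (h' : IsPush β n m') : m = m' := by
  ext s
  by_cases hr : s ∈ Set.range β
  · obtain ⟨⟨i, j⟩, rfl⟩ := hr
    rw [h.1, h'.1]
  · rw [h.2 s hr, h'.2 s hr]

open Classical in
/-- The sequence with the entry `n i j` at the place `β (i, j)`, and `1` elsewhere. -/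
def pushObj [Finite ι] (β : ι × ℕ ↪ ℕ) (n : ι → Finfty) : Finfty where
  n s := if h : ∃ p, β p = s then (n h.choose.1).n h.choose.2 else 1
  fin := ((finite_entries n).image β).subset fun s hs => by
    by_cases h : ∃ p, β p = s
    · exact ⟨h.choose, by simpa only [Set.mem_ofPred_eq, dif_pos h] using hs, h.choose_spec⟩
    · exact absurd (dif_neg h) hs

theorem isPush_pushObj [Finite ι] (β : ι × ℕ ↪ ℕ) (n : ι → Finfty) : IsPush β n (pushObj β n) := by
  classical
  refine ⟨fun i j => ?_, fun s hs => dif_neg fun h => hs h⟩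
  have h : ∃ p, β p = β (i, j) := ⟨_, rfl⟩
  have e : h.choose = (i, j) := β.injective h.choose_spec
  change (if h : ∃ p, β p = β (i, j) then (n h.choose.1).n h.choose.2 else 1) = _
  rw [dif_pos h, e]

open Classical in
theorem exists_pushHom [Finite ι] (β : ι × ℕ ↪ ℕ) {n n' : ι → Finfty} {m m' : Finfty}
    (h : IsPush β n m) (h' : IsPush β n' m') (φ : ∀ i, n i ⟶ n' i) :
    ∃ ψ : m ⟶ m', IsPushHom β φ ψ := by
  let f : ℕ → ℕ → ℕ := fun s => if h : ∃ p, β p = s then (φ h.choose.1).f h.choose.2 else idOn 1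
  have h₁ : ∀ i j, f (β (i, j)) = (φ i).f j := fun i j => by
    have h : ∃ p, β p = β (i, j) := ⟨_, rfl⟩
    have e : h.choose = (i, j) := β.injective h.choose_spec
    change (if h : ∃ p, β p = β (i, j) then (φ h.choose.1).f h.choose.2 else idOn 1) = _
    rw [dif_pos h, e]
  have h₂ : ∀ s, s ∉ Set.range β → f s = idOn 1 := fun s hs => dif_neg fun h => hs h
  refine ⟨Finfty.Hom.mk f (fun s => ?_) (fun s x => ?_) (fun s x hx => ?_)
    (((finite_entries_hom φ).image β).subset fun s hs => ?_), h₁, h₂⟩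
  · by_cases hr : s ∈ Set.range β
    · obtain ⟨⟨i, j⟩, rfl⟩ := hr
      rw [h₁, (φ i).f_zero]
    · rw [h₂ s hr]
      rfl
  · by_cases hr : s ∈ Set.range β
    · obtain ⟨⟨i, j⟩, rfl⟩ := hr
      rw [h₁, h'.1]
      exact (φ i).f_le j x
    · rw [h₂ s hr, h'.2 s hr]
      unfold idOn
      split_ifs <;> omega
  · by_cases hr : s ∈ Set.range β
    · obtain ⟨⟨i, j⟩, rfl⟩ := hr
      rw [h₁]
      exact (φ i).f_of_lt j x (by rwa [← h.1])
    · rw [h₂ s hr]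
      rw [h.2 s hr] at hx
      exact if_neg (not_le.2 hx)
  · by_cases hr : s ∈ Set.range β
    · obtain ⟨⟨i, j⟩, rfl⟩ := hr
      exact ⟨(i, j), by rw [Set.mem_ofPred_eq, ← h₁]; exact hs, rfl⟩
    · exact absurd (h₂ s hr) hs

/-- Permutation of the entries of a sequence. -/
def Finfty.perm (θ : Equiv.Perm ℕ) (m : Finfty) : Finfty where
  n s := m.n (θ s)
  fin := (m.fin.image θ.symm).subset fun s hs => ⟨θ s, hs, θ.symm_apply_apply s⟩

/-- Permutation of the entries of a sequence of based maps. -/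
def Finfty.Hom.perm (θ : Equiv.Perm ℕ) {m m' : Finfty} (ψ : m ⟶ m') : m.perm θ ⟶ m'.perm θ :=
  Finfty.Hom.mk (fun s => ψ.f (θ s)) (fun s => ψ.f_zero (θ s)) (fun s => ψ.f_le (θ s))
    (fun s => ψ.f_of_lt (θ s))
    ((ψ.fin.image θ.symm).subset fun s hs => ⟨θ s, hs, θ.symm_apply_apply s⟩)

theorem IsPush.perm {β β' : ι × ℕ ↪ ℕ} {n : ι → Finfty} {m : Finfty} (h : IsPush β n m)
    {θ : Equiv.Perm ℕ} (hθ : ∀ i j, (n i).n j ≠ 1 → θ (β' (i, j)) = β (i, j)) :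
    IsPush β' n (m.perm θ) := by
  have key : ∀ s, m.n (θ s) ≠ 1 → ∃ i j, (n i).n j ≠ 1 ∧ β' (i, j) = s := fun s hs => by
    obtain ⟨i, j, hij, e⟩ := h.ne_one hs
    exact ⟨i, j, hij, θ.injective ((hθ i j hij).trans e)⟩
  refine ⟨fun i j => ?_, fun s hs => ?_⟩
  · by_cases hij : (n i).n j = 1
    · rw [hij]
      by_contra hne
      obtain ⟨i', j', h', e⟩ := key _ hne
      obtain ⟨rfl, rfl⟩ := Prod.mk.inj (β'.injective e)
      exact h' hij
    · change m.n (θ (β' (i, j))) = _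
      rw [hθ i j hij, h.1]
  · by_contra hne
    obtain ⟨i', j', -, e⟩ := key s hne
    exact hs ⟨_, e⟩

theorem IsPushHom.perm {β β' : ι × ℕ ↪ ℕ} {n n' : ι → Finfty} {m m' : Finfty}
    {φ : ∀ i, n i ⟶ n' i} {ψ : m ⟶ m'} (h : IsPushHom β φ ψ)
    {θ : Equiv.Perm ℕ} (hθ : ∀ i j, (φ i).f j ≠ idOn 1 → θ (β' (i, j)) = β (i, j)) :
    IsPushHom β' φ (Finfty.Hom.perm θ ψ) := by
  have key : ∀ s, ψ.f (θ s) ≠ idOn 1 → ∃ i j, (φ i).f j ≠ idOn 1 ∧ β' (i, j) = s := fun s hs => by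
    by_cases hr : θ s ∈ Set.range β
    · obtain ⟨⟨i, j⟩, e⟩ := hr
      have hij : (φ i).f j ≠ idOn 1 := by rwa [← h.1, e]
      exact ⟨i, j, hij, θ.injective ((hθ i j hij).trans e)⟩
    · exact absurd (h.2 _ hr) hs
  refine ⟨fun i j => ?_, fun s hs => ?_⟩
  · by_cases hij : (φ i).f j = idOn 1
    · rw [hij]
      by_contra hne
      obtain ⟨i', j', h', e⟩ := key _ hne
      obtain ⟨rfl, rfl⟩ := Prod.mk.inj (β'.injective e)
      exact h' hij
    · change ψ.f (θ (β' (i, j))) = _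
      rw [hθ i j hij, h.1]
  · by_contra hne
    obtain ⟨i', j', -, e⟩ := key s hne
    exact hs ⟨_, e⟩

end push

/-! ### Whiskering and products of functors -/

section whisker

variable {A B C : Type*} [Category A] [Category B] [Category C]

theorem app_heq_of_heq {F G F' G' : A ⥤ B} (hF : F = F') (hG : G = G') {p : F ⟶ G}
    {p' : F' ⟶ G'} (h : HEq p p') (x : A) : HEq (p.app x) (p'.app x) := by
  subst hF hG
  rw [eq_of_heq h]

theorem whiskerRight_heq {F G F' G' : A ⥤ B} (hF : F = F') (hG : G = G') {p : F ⟶ G}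
    {p' : F' ⟶ G'} (h : HEq p p') {H H' : B ⥤ C} (hH : H = H') :
    HEq (Functor.whiskerRight p H) (Functor.whiskerRight p' H') := by
  subst hF hG hH
  rw [eq_of_heq h]

theorem whiskerLeft_heq {F G F' G' : B ⥤ C} (hF : F = F') (hG : G = G') {p : F ⟶ G}
    {p' : F' ⟶ G'} (h : HEq p p') {H H' : A ⥤ B} (hH : H = H') :
    HEq (Functor.whiskerLeft H p) (Functor.whiskerLeft H' p') := by
  subst hF hG hH
  rw [eq_of_heq h]

theorem functor_hext_iff {F G : A ⥤ B} (h : F = G) {x y : A} (φ : x ⟶ y) :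
    HEq (F.map φ) (G.map φ) := by
  subst h
  rfl

variable {ι : Type} {κ : ι → Type} {X : ∀ i, κ i → Type v} [∀ i k, Category.{w} (X i k)]
  {Y : ι → Type v} [∀ i, Category.{w} (Y i)]

/-- The product of functors on tuples, applied to tuples indexed by a disjoint union. -/
def sigmaPi (f : ∀ i, (∀ k, X i k) ⥤ Y i) : (∀ s : Σ i, κ i, X s.1 s.2) ⥤ (∀ i, Y i) where
  obj x i := (f i).obj fun k => x ⟨i, k⟩
  map {x y} φ i := (f i).map (X := fun k => x ⟨i, k⟩) (Y := fun k => y ⟨i, k⟩) fun k => φ ⟨i, k⟩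
  map_id _ := funext fun i => (f i).map_id _
  map_comp _ _ := funext fun i => (f i).map_comp _ _

/-- The product of natural transformations. -/
def sigmaPiNat {f g : ∀ i, (∀ k, X i k) ⥤ Y i} (p : ∀ i, f i ⟶ g i) : sigmaPi f ⟶ sigmaPi g where
  app x i := (p i).app fun k => x ⟨i, k⟩
  naturality _ _ _ := funext fun i => (p i).naturality _

theorem sigmaPiNat_heq {f g f' g' : ∀ i, (∀ k, X i k) ⥤ Y i} (hf : f = f') (hg : g = g')
    {p : ∀ i, f i ⟶ g i} {p' : ∀ i, f' i ⟶ g' i} (h : ∀ i, HEq (p i) (p' i)) :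
    HEq (sigmaPiNat p) (sigmaPiNat p') := by
  subst hf hg
  exact heq_of_eq (congrArg sigmaPiNat (funext fun i => eq_of_heq (h i)))

end whisker

/-! ### Symmetric functors -/

theorem SymFun.bang_congr (G : SymFun.{u}) (θ θ' : Equiv.Perm ℕ) (m n : Finfty)
    (h : ∀ i, m.n i = n.n (θ i)) (h' : ∀ i, m.n i = n.n (θ' i))
    (hθ : ∀ s, m.n s ≠ 1 → θ s = θ' s) : G.bang θ m n h = G.bang θ' m n h' := by
  have e : θ' = θ * (θ⁻¹ * θ') := by group
  have h₂ : ∀ i, m.n i = m.n ((θ⁻¹ * θ') i) := fun i => by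
    rw [h' i, h]
    simp
  have h₃ : ∀ i, m.n i = n.n ((θ * (θ⁻¹ * θ')) i) := fun i => by
    rw [← e]
    exact h' i
  have : G.bang θ' m n h' = G.bang (θ * (θ⁻¹ * θ')) m n h₃ := by
    congr 1
  rw [this, G.bang_mul θ (θ⁻¹ * θ') m m n h h₂ h₃, G.bang_id (θ⁻¹ * θ') m h₂ fun i hi => ?_,
    Category.id_comp]
  by_contra hne
  apply hi
  rw [Equiv.Perm.mul_apply, ← hθ i hne]
  exact θ.symm_apply_apply i

theorem SymFun.bang_comp (G : SymFun.{u}) (θ₁ θ₂ θ : Equiv.Perm ℕ) (k m n : Finfty)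
    (h₁ : ∀ i, m.n i = n.n (θ₁ i)) (h₂ : ∀ i, k.n i = m.n (θ₂ i)) (h : ∀ i, k.n i = n.n (θ i))
    (hθ : ∀ s, k.n s ≠ 1 → θ₁ (θ₂ s) = θ s) :
    (G.bang θ₂ k m h₂).toFunctor ⋙ (G.bang θ₁ m n h₁).toFunctor = (G.bang θ k n h).toFunctor := by
  rw [← G.bang_congr (θ₁ * θ₂) θ k n (fun i => (h₂ i).trans (h₁ _)) h hθ,
    G.bang_mul θ₁ θ₂ k m n h₁ h₂]
  rfl

section SymFunHom

variable {ι : Type} {F : ι → SymFun.{u}} {G : SymFun.{u}}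

/-- The action of a permutation on pairs given by permutations in each fibre. -/
def sigmaPerm (θ : ι → Equiv.Perm ℕ) : Equiv.Perm (ι × ℕ) where
  toFun p := (p.1, θ p.1 p.2)
  invFun p := (p.1, (θ p.1).symm p.2)
  left_inv p := by simp
  right_inv p := by simp

theorem exists_perm_extend (β : ι × ℕ ↪ ℕ) (θ : ι → Equiv.Perm ℕ) :
    ∃ θ' : Equiv.Perm ℕ, (∀ i j, θ' (β (i, j)) = β (i, θ i j)) ∧
      ∀ s, s ∉ Set.range β → θ' s = s := by
  classical
  exact ⟨(sigmaPerm θ).viaEmbedding β, fun i j => Equiv.Perm.viaEmbedding_apply _ _ _,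
    fun s hs => Equiv.Perm.viaEmbedding_apply_of_notMem _ _ _ hs⟩

theorem IsPush.perm_source {β : ι × ℕ ↪ ℕ} {k n : ι → Finfty} {m : Finfty} (h : IsPush β n m)
    {θ : ι → Equiv.Perm ℕ} {θ' : Equiv.Perm ℕ} (hθ : ∀ i j, θ' (β (i, j)) = β (i, θ i j))
    (hθ' : ∀ s, s ∉ Set.range β → θ' s = s) (hk : ∀ i j, (k i).n j = (n i).n (θ i j)) :
    IsPush β k (m.perm θ') := by
  refine ⟨fun i j => ?_, fun s hs => ?_⟩
  · change m.n (θ' (β (i, j))) = _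
    rw [hθ, h.1, hk]
  · change m.n (θ' s) = 1
    rw [hθ' s hs, h.2 s hs]

/-- The general compatibility of multimorphisms with permutations of the sources, of the target,
and with changes of the injection. -/
theorem SymFunHom.app_bang (f : SymFunHom F G) (β β' : ι × ℕ ↪ ℕ) (θ : ι → Equiv.Perm ℕ)
    (θ' : Equiv.Perm ℕ) (k n : ι → Finfty) (l m : Finfty) (h : IsPush β n m) (h' : IsPush β' k l)
    (hn : ∀ i j, (k i).n j = (n i).n (θ i j)) (hm : ∀ s, l.n s = m.n (θ' s))
    (hθ : ∀ i j, (k i).n j ≠ 1 → θ' (β' (i, j)) = β (i, θ i j)) :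
    Functor.pi (fun i => ((F i).bang (θ i) (k i) (n i) (hn i)).toFunctor) ⋙ f.app β n m h =
      f.app β' k l h' ⋙ (G.bang θ' l m hm).toFunctor := by
  obtain ⟨ω, hω, hω'⟩ := exists_perm_extend β θ
  have h₁ := h.perm_source hω hω' hn
  rw [f.equivariant β θ ω hω k n _ m h h₁ hn (fun _ => rfl)]
  have h₂ : ∀ s, l.n s = (m.perm ω).n ((ω⁻¹ * θ') s) := fun s => by
    rw [hm]
    change _ = m.n (ω (ω⁻¹ (θ' s)))
    rw [show ω (ω⁻¹ (θ' s)) = θ' s from ω.apply_symm_apply _]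
  rw [← f.change_β β' β (ω⁻¹ * θ') k l _ h' h₁ h₂ fun i j hij => ?_, Functor.assoc,
    G.bang_comp ω (ω⁻¹ * θ') θ' l _ m (fun _ => rfl) h₂ hm fun s _ => by simp]
  rw [Equiv.Perm.mul_apply, hθ i j hij, ← hω]
  exact ω.symm_apply_apply _

theorem SymFunHom.Hom.app_bang {f g : SymFunHom F G} (p : f ⟶ g) (β β' : ι × ℕ ↪ ℕ)
    (θ : ι → Equiv.Perm ℕ)
    (θ' : Equiv.Perm ℕ) (k n : ι → Finfty) (l m : Finfty) (h : IsPush β n m) (h' : IsPush β' k l)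
    (hn : ∀ i j, (k i).n j = (n i).n (θ i j)) (hm : ∀ s, l.n s = m.n (θ' s))
    (hθ : ∀ i j, (k i).n j ≠ 1 → θ' (β' (i, j)) = β (i, θ i j)) :
    HEq (Functor.whiskerLeft
        (Functor.pi (fun i => ((F i).bang (θ i) (k i) (n i) (hn i)).toFunctor))
        (SymFunHom.Hom.app p β n m h))
      (Functor.whiskerRight (SymFunHom.Hom.app p β' k l h') (G.bang θ' l m hm).toFunctor) := by
  obtain ⟨ω, hω, hω'⟩ := exists_perm_extend β θ
  have h₁ := h.perm_source hω hω' hn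
  refine (p.equivariant β θ ω hω k n _ m h h₁ hn (fun _ => rfl)).trans ?_
  have h₂ : ∀ s, l.n s = (m.perm ω).n ((ω⁻¹ * θ') s) := fun s => by
    rw [hm]
    change _ = m.n (ω (ω⁻¹ (θ' s)))
    rw [show ω (ω⁻¹ (θ' s)) = θ' s from ω.apply_symm_apply _]
  have h₃ : ∀ i j, (k i).n j ≠ 1 → (ω⁻¹ * θ') (β' (i, j)) = β (i, j) := fun i j hij => by
    rw [Equiv.Perm.mul_apply, hθ i j hij, ← hω]
    exact ω.symm_apply_apply _
  refine (whiskerRight_heq (f.change_β β' β (ω⁻¹ * θ') k l _ h' h₁ h₂ h₃).symm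
    (g.change_β β' β (ω⁻¹ * θ') k l _ h' h₁ h₂ h₃).symm
    (p.change_β β' β (ω⁻¹ * θ') k l _ h' h₁ h₂ h₃).symm rfl).trans ?_
  rw [← G.bang_comp ω (ω⁻¹ * θ') θ' l _ m (fun _ => rfl) h₂ hm fun s _ => by simp]
  rfl

/-- The permutation `η` carries `β₀` to `β` at the places with entries different from `1`. -/
def Moves (β₀ β : ι × ℕ ↪ ℕ) (n : ι → Finfty) (η : Equiv.Perm ℕ) : Prop :=
  ∀ i j, (n i).n j ≠ 1 → η (β₀ (i, j)) = β (i, j)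

theorem exists_moves [Finite ι] (β₀ β : ι × ℕ ↪ ℕ) (n : ι → Finfty) : ∃ η, Moves β₀ β n η := by
  obtain ⟨η, hη⟩ := exists_perm _ (finite_entries n) β₀ β
  exact ⟨η, fun i j hij => hη (i, j) hij⟩

/-- A multimorphism is determined by its values for one injection `β₀`. -/
theorem SymFunHom.ext_of [Finite ι] (β₀ : ι × ℕ ↪ ℕ) {f g : SymFunHom F G}
    (h : ∀ n m hm, f.app β₀ n m hm = g.app β₀ n m hm) : f = g := by
  refine SymFunHom.ext (funext fun β => funext fun n => funext fun m => funext fun hm => ?_)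
  obtain ⟨η, hη⟩ := exists_moves β₀ β n
  rw [← f.change_β β₀ β η n _ m (hm.perm hη) hm (fun _ => rfl) hη,
    ← g.change_β β₀ β η n _ m (hm.perm hη) hm (fun _ => rfl) hη, h]

theorem SymFunHom.Hom.heq_of [Finite ι] (β₀ : ι × ℕ ↪ ℕ) {f g f' g' : SymFunHom F G} (hf : f = f')
    (hg : g = g') (p : f ⟶ g) (p' : f' ⟶ g')
    (h : ∀ n m hm, HEq (SymFunHom.Hom.app p β₀ n m hm) (SymFunHom.Hom.app p' β₀ n m hm)) :
    HEq p p' := by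
  subst hf hg
  refine heq_of_eq (SymFunHom.Hom.ext (funext fun β => funext fun n => funext fun m =>
    funext fun hm => eq_of_heq ?_))
  obtain ⟨η, hη⟩ := exists_moves β₀ β n
  refine (p.change_β β₀ β η n _ m (hm.perm hη) hm (fun _ => rfl) hη).symm.trans
    (HEq.trans ?_ (p'.change_β β₀ β η n _ m (hm.perm hη) hm (fun _ => rfl) hη))
  rw [eq_of_heq (h n _ _)]

variable (β₀ : ι × ℕ ↪ ℕ)

/-- The part of a multimorphism which belongs to a fixed injection `β₀`. -/
structure SymFunHom.Core (F : ι → SymFun.{u}) (G : SymFun.{u}) where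
  app : ∀ (n : ι → Finfty) (m : Finfty), IsPush β₀ n m → ((∀ i, (F i).F.obj (n i)) ⥤ G.F.obj m)
  nat : ∀ (n n' : ι → Finfty) (m m' : Finfty) (h : IsPush β₀ n m)
    (h' : IsPush β₀ n' m') (φ : ∀ i, n i ⟶ n' i) (ψ : m ⟶ m'), IsPushHom β₀ φ ψ →
    Functor.pi (fun i => ((F i).F.map (φ i)).toFunctor) ⋙ app n' m' h' =
      app n m h ⋙ (G.F.map ψ).toFunctor
  equivariant : ∀ (θ : ι → Equiv.Perm ℕ) (θ' : Equiv.Perm ℕ) (k n : ι → Finfty) (l m : Finfty)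
    (h : IsPush β₀ n m) (h' : IsPush β₀ k l) (hn : ∀ i j, (k i).n j = (n i).n (θ i j))
    (hm : ∀ s, l.n s = m.n (θ' s)),
    (∀ i j, (k i).n j ≠ 1 → θ' (β₀ (i, j)) = β₀ (i, θ i j)) →
    Functor.pi (fun i => ((F i).bang (θ i) (k i) (n i) (hn i)).toFunctor) ⋙ app n m h =
      app k l h' ⋙ (G.bang θ' l m hm).toFunctor

variable {β₀}

namespace SymFunHom.Core

variable (c : SymFunHom.Core β₀ F G)

theorem app_bang_eq (β : ι × ℕ ↪ ℕ) (n : ι → Finfty) (l l' m : Finfty)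
    (η η' : Equiv.Perm ℕ) (hη : Moves β₀ β n η) (hη' : Moves β₀ β n η') (h : IsPush β₀ n l)
    (h' : IsPush β₀ n l') (hl : ∀ s, l.n s = m.n (η s)) (hl' : ∀ s, l'.n s = m.n (η' s)) :
    c.app n l h ⋙ (G.bang η l m hl).toFunctor = c.app n l' h' ⋙ (G.bang η' l' m hl').toFunctor := by
  obtain rfl := h.unique h'
  rw [G.bang_congr η' η _ m hl' hl fun s hs => ?_]
  obtain ⟨i, j, hij, rfl⟩ := h'.ne_one hs
  rw [hη i j hij, hη' i j hij]

variable [Finite ι]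

/-- The value of the multimorphism at an arbitrary injection. -/
def val (β : ι × ℕ ↪ ℕ) (n : ι → Finfty) (m : Finfty) (h : IsPush β n m) :
    (∀ i, (F i).F.obj (n i)) ⥤ G.F.obj m :=
  c.app n _ (h.perm (exists_moves β₀ β n).choose_spec) ⋙
    (G.bang (exists_moves β₀ β n).choose _ m fun _ => rfl).toFunctor

theorem val_eq (β : ι × ℕ ↪ ℕ) (n : ι → Finfty) (l m : Finfty) (h : IsPush β n m)
    (η : Equiv.Perm ℕ) (hη : Moves β₀ β n η) (h' : IsPush β₀ n l) (hl : ∀ s, l.n s = m.n (η s)) :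
    c.val β n m h = c.app n l h' ⋙ (G.bang η l m hl).toFunctor :=
  c.app_bang_eq β n _ l m _ η (exists_moves β₀ β n).choose_spec hη _ h' _ hl

/-- The multimorphism determined by its values for `β₀`. -/
def toHom : SymFunHom F G where
  app := c.val
  nat β n n' m m' h h' φ ψ hψ := by
    obtain ⟨η, hη⟩ := exists_perm _ ((finite_entries n).union ((finite_entries n').union
      (finite_entries_hom φ))) β₀ β
    have h₁ : Moves β₀ β n η := fun i j hij => hη (i, j) (Or.inl hij)
    have h₂ : Moves β₀ β n' η := fun i j hij => hη (i, j) (Or.inr (Or.inl hij))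
    rw [c.val_eq β n _ m h η h₁ (h.perm h₁) fun _ => rfl,
      c.val_eq β n' _ m' h' η h₂ (h'.perm h₂) fun _ => rfl, ← Functor.assoc,
      c.nat n n' _ _ (h.perm h₁) (h'.perm h₂) φ (Finfty.Hom.perm η ψ)
        (hψ.perm fun i j hij => hη (i, j) (Or.inr (Or.inr hij))), Functor.assoc, Functor.assoc]
    exact congrArg (c.app n _ _ ⋙ ·) (congrArg Cat.Hom.toFunctor
      (G.bang_nat η _ _ _ _ (fun _ => rfl) (fun _ => rfl) ψ _ fun _ => rfl))
  equivariant β θ θ' hθ k n l m h h' hn hm := by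
    obtain ⟨η, hη⟩ := exists_perm _ ((finite_entries n).union (finite_entries k)) β₀ β
    have h₁ : Moves β₀ β n η := fun i j hij => hη (i, j) (Or.inl hij)
    have h₂ : Moves β₀ β k η := fun i j hij => hη (i, j) (Or.inr hij)
    have h₃ : ∀ i j, (k i).n j ≠ 1 → (η⁻¹ * θ' * η) (β₀ (i, j)) = β₀ (i, θ i j) := fun i j hij => by
      rw [Equiv.Perm.mul_apply, Equiv.Perm.mul_apply, h₂ i j hij, hθ,
        ← h₁ i (θ i j) (by rwa [← hn])]
      exact η.symm_apply_apply _
    have h₄ : ∀ s, (l.perm η).n s = (m.perm η).n ((η⁻¹ * θ' * η) s) := fun s => by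
      change l.n (η s) = m.n (η (η⁻¹ (θ' (η s))))
      rw [show η (η⁻¹ (θ' (η s))) = θ' (η s) from η.apply_symm_apply _, hm]
    rw [c.val_eq β n _ m h η h₁ (h.perm h₁) fun _ => rfl,
      c.val_eq β k _ l h' η h₂ (h'.perm h₂) fun _ => rfl, ← Functor.assoc,
      c.equivariant θ (η⁻¹ * θ' * η) k n _ _ (h.perm h₁) (h'.perm h₂) hn h₄ h₃,
      Functor.assoc, Functor.assoc, G.bang_comp η (η⁻¹ * θ' * η) (θ' * η) _ _ _ (fun _ => rfl) h₄
        (fun s => hm _) fun s _ => by simp, G.bang_comp θ' η (θ' * η) _ _ _ hm (fun _ => rfl)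
        (fun s => hm _) fun s _ => rfl]
  change_β β β' θ n l m h h' hm hθ := by
    obtain ⟨η, hη⟩ := exists_moves β₀ β n
    have h₁ : Moves β₀ β' n (θ * η) := fun i j hij => by
      rw [Equiv.Perm.mul_apply, hη i j hij, hθ i j hij]
    rw [c.val_eq β n _ l h η hη (h.perm hη) fun _ => rfl,
      c.val_eq β' n (l.perm η) m h' (θ * η) h₁ (h.perm hη) fun s => hm _, Functor.assoc,
      G.bang_comp θ η (θ * η) _ _ _ hm (fun _ => rfl) (fun s => hm _) fun s _ => rfl]

theorem toHom_app (n : ι → Finfty) (m : Finfty) (h : IsPush β₀ n m) :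
    c.toHom.app β₀ n m h = c.app n m h := by
  refine (c.val_eq β₀ n m m h 1 (fun _ _ _ => rfl) h fun _ => rfl).trans ?_
  exact congrArg (fun t => c.app n m h ⋙ Cat.Hom.toFunctor t) (G.bang_one m fun _ => rfl)

end SymFunHom.Core

end SymFunHom

section core

variable {ι : Type} {F : ι → SymFun.{u}} {G : SymFun.{u}}

theorem SymFunHom.app_eq_bang (f : SymFunHom F G) {β₀ β : ι × ℕ ↪ ℕ} {n : ι → Finfty}
    {η : Equiv.Perm ℕ} (hη : Moves β₀ β n η) (l m : Finfty) (h : IsPush β₀ n l) (h' : IsPush β n m)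
    (hl : ∀ s, l.n s = m.n (η s)) :
    f.app β n m h' = f.app β₀ n l h ⋙ (G.bang η l m hl).toFunctor :=
  (f.change_β β₀ β η n l m h h' hl hη).symm

variable (β₀ : ι × ℕ ↪ ℕ) (f g : SymFunHom F G)

/-- The part of a morphism of multimorphisms which belongs to a fixed injection `β₀`. -/
structure SymFunHom.HomCore where
  app : ∀ (n : ι → Finfty) (m : Finfty) (h : IsPush β₀ n m), f.app β₀ n m h ⟶ g.app β₀ n m h
  nat : ∀ (n n' : ι → Finfty) (m m' : Finfty) (h : IsPush β₀ n m)
    (h' : IsPush β₀ n' m') (φ : ∀ i, n i ⟶ n' i) (ψ : m ⟶ m'), IsPushHom β₀ φ ψ →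
    HEq (Functor.whiskerLeft
        (Functor.pi (fun i => ((F i).F.map (φ i)).toFunctor)) (app n' m' h'))
      (Functor.whiskerRight (app n m h) (G.F.map ψ).toFunctor)
  equivariant : ∀ (θ : ι → Equiv.Perm ℕ) (θ' : Equiv.Perm ℕ) (k n : ι → Finfty) (l m : Finfty)
    (h : IsPush β₀ n m) (h' : IsPush β₀ k l) (hn : ∀ i j, (k i).n j = (n i).n (θ i j))
    (hm : ∀ s, l.n s = m.n (θ' s)),
    (∀ i j, (k i).n j ≠ 1 → θ' (β₀ (i, j)) = β₀ (i, θ i j)) →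
    HEq (Functor.whiskerLeft
        (Functor.pi (fun i => ((F i).bang (θ i) (k i) (n i) (hn i)).toFunctor)) (app n m h))
      (Functor.whiskerRight (app k l h') (G.bang θ' l m hm).toFunctor)

namespace SymFunHom.HomCore

variable {β₀ f g} (c : SymFunHom.HomCore β₀ f g)

theorem exists_val [Finite ι] (β : ι × ℕ ↪ ℕ) (n : ι → Finfty) (m : Finfty) (h : IsPush β n m) :
    ∃ t : f.app β n m h ⟶ g.app β n m h, ∀ (η : Equiv.Perm ℕ) (l : Finfty), Moves β₀ β n η →
      ∀ (h' : IsPush β₀ n l) (hl : ∀ s, l.n s = m.n (η s)),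
        HEq t (Functor.whiskerRight (c.app n l h') (G.bang η l m hl).toFunctor) := by
  obtain ⟨η, hη⟩ := exists_moves β₀ β n
  refine ⟨cast ?_ (Functor.whiskerRight (c.app n _ (h.perm hη)) (G.bang η _ m fun _ => rfl).toFunctor),
    fun η' l hη' h' hl => (cast_heq _ _).trans ?_⟩
  · rw [f.app_eq_bang hη _ m (h.perm hη) h fun _ => rfl,
      g.app_eq_bang hη _ m (h.perm hη) h fun _ => rfl]
  · obtain rfl := (h.perm hη).unique h'
    rw [G.bang_congr η' η _ m hl (fun _ => rfl) fun s hs => ?_]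
    obtain ⟨i, j, hij, rfl⟩ := h'.ne_one hs
    rw [hη i j hij, hη' i j hij]

variable [Finite ι]

/-- The value of the morphism at an arbitrary injection. -/
def val (β : ι × ℕ ↪ ℕ) (n : ι → Finfty) (m : Finfty) (h : IsPush β n m) :
    f.app β n m h ⟶ g.app β n m h := (c.exists_val β n m h).choose

theorem val_heq {β : ι × ℕ ↪ ℕ} {n : ι → Finfty} {η : Equiv.Perm ℕ} (hη : Moves β₀ β n η)
    (l m : Finfty) (h' : IsPush β₀ n l) (h : IsPush β n m) (hl : ∀ s, l.n s = m.n (η s)) :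
    HEq (c.val β n m h) (Functor.whiskerRight (c.app n l h') (G.bang η l m hl).toFunctor) :=
  (c.exists_val β n m h).choose_spec η l hη h' hl

/-- The morphism of multimorphisms determined by its part for `β₀`. -/
def toHom : f ⟶ g := SymFunHom.Hom.mk (f := f) (g := g) c.val
  (fun β n n' m m' h h' φ ψ hψ => by
    obtain ⟨η, hη⟩ := exists_perm _ ((finite_entries n).union ((finite_entries n').union
      (finite_entries_hom φ))) β₀ β
    have h₁ : Moves β₀ β n η := fun i j hij => hη (i, j) (Or.inl hij)
    have h₂ : Moves β₀ β n' η := fun i j hij => hη (i, j) (Or.inr (Or.inl hij))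
    have hψ' := hψ.perm (θ := η) fun i j hij => hη (i, j) (Or.inr (Or.inr hij))
    have hn : G.F.map (Finfty.Hom.perm η ψ) ≫ G.bang η _ m' (fun _ => rfl) =
      G.bang η _ m (fun _ => rfl) ≫ G.F.map ψ := G.bang_nat η _ _ _ _ _ _ ψ _ fun _ => rfl
    refine (whiskerLeft_heq (f.app_eq_bang h₂ _ m' (h'.perm h₂) h' fun _ => rfl)
      (g.app_eq_bang h₂ _ m' (h'.perm h₂) h' fun _ => rfl)
      (c.val_heq h₂ _ m' (h'.perm h₂) h' fun _ => rfl) rfl).trans ?_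
    refine HEq.trans ?_ (whiskerRight_heq (f.app_eq_bang h₁ _ m (h.perm h₁) h fun _ => rfl)
      (g.app_eq_bang h₁ _ m (h.perm h₁) h fun _ => rfl)
      (c.val_heq h₁ _ m (h.perm h₁) h fun _ => rfl) rfl).symm
    refine (whiskerRight_heq (f.nat β₀ n n' _ _ (h.perm h₁) (h'.perm h₂) φ _ hψ')
      (g.nat β₀ n n' _ _ (h.perm h₁) (h'.perm h₂) φ _ hψ')
      (c.nat n n' _ _ (h.perm h₁) (h'.perm h₂) φ _ hψ') rfl).trans ?_
    change HEq (Functor.whiskerRight (c.app n _ _) (G.F.map (Finfty.Hom.perm η ψ) ≫ G.bang η _ m' (fun _ => rfl)).toFunctor) (Functor.whiskerRight (c.app n _ _) (G.bang η _ m (fun _ => rfl) ≫ G.F.map ψ).toFunctor)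
    rw [hn])
  (fun β θ θ' hθ k n l m h h' hn hm => by
    obtain ⟨η, hη⟩ := exists_perm _ ((finite_entries n).union (finite_entries k)) β₀ β
    have h₁ : Moves β₀ β n η := fun i j hij => hη (i, j) (Or.inl hij)
    have h₂ : Moves β₀ β k η := fun i j hij => hη (i, j) (Or.inr hij)
    have h₃ : ∀ i j, (k i).n j ≠ 1 → (η⁻¹ * θ' * η) (β₀ (i, j)) = β₀ (i, θ i j) := fun i j hij => by
      rw [Equiv.Perm.mul_apply, Equiv.Perm.mul_apply, h₂ i j hij, hθ,
        ← h₁ i (θ i j) (by rwa [← hn])]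
      exact η.symm_apply_apply _
    have h₄ : ∀ s, (l.perm η).n s = (m.perm η).n ((η⁻¹ * θ' * η) s) := fun s => by
      change l.n (η s) = m.n (η (η⁻¹ (θ' (η s))))
      rw [show η (η⁻¹ (θ' (η s))) = θ' (η s) from η.apply_symm_apply _, hm]
    have e := (G.bang_comp η (η⁻¹ * θ' * η) (θ' * η) _ _ _ (fun _ => rfl) h₄
        (fun s => hm _) fun s _ => by simp).trans (G.bang_comp θ' η (θ' * η) _ _ _ hm (fun _ => rfl)
        (fun s => hm _) fun s _ => rfl).symm
    refine (whiskerLeft_heq (f.app_eq_bang h₁ _ m (h.perm h₁) h fun _ => rfl)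
      (g.app_eq_bang h₁ _ m (h.perm h₁) h fun _ => rfl)
      (c.val_heq h₁ _ m (h.perm h₁) h fun _ => rfl) rfl).trans ?_
    refine HEq.trans ?_ (whiskerRight_heq (f.app_eq_bang h₂ _ l (h'.perm h₂) h' fun _ => rfl)
      (g.app_eq_bang h₂ _ l (h'.perm h₂) h' fun _ => rfl)
      (c.val_heq h₂ _ l (h'.perm h₂) h' fun _ => rfl) rfl).symm
    refine (whiskerRight_heq
      (f.app_bang β₀ β₀ θ _ k n _ _ (h.perm h₁) (h'.perm h₂) hn h₄ h₃)
      (g.app_bang β₀ β₀ θ _ k n _ _ (h.perm h₁) (h'.perm h₂) hn h₄ h₃)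
      (c.equivariant θ _ k n _ _ (h.perm h₁) (h'.perm h₂) hn h₄ h₃) rfl).trans ?_
    exact whiskerRight_heq rfl rfl (HEq.refl (c.app k _ (h'.perm h₂))) e)
  (fun β β' θ n l m h h' hm hθ => by
    obtain ⟨η, hη⟩ := exists_moves β₀ β n
    have h₁ : Moves β₀ β' n (θ * η) := fun i j hij => by
      rw [Equiv.Perm.mul_apply, hη i j hij, hθ i j hij]
    refine (whiskerRight_heq (f.app_eq_bang hη _ l (h.perm hη) h fun _ => rfl)
      (g.app_eq_bang hη _ l (h.perm hη) h fun _ => rfl)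
      (c.val_heq hη _ l (h.perm hη) h fun _ => rfl) rfl).trans ?_
    refine HEq.trans ?_ (c.val_heq h₁ (l.perm η) m (h.perm hη) h' fun s => hm _).symm
    exact whiskerRight_heq rfl rfl (HEq.refl (c.app n _ (h.perm hη)))
      (G.bang_comp θ η (θ * η) _ _ _ hm (fun _ => rfl) (fun s => hm _) fun s _ => rfl))

theorem toHom_app (n : ι → Finfty) (m : Finfty) (h : IsPush β₀ n m) :
    SymFunHom.Hom.app c.toHom β₀ n m h = c.app n m h := by
  refine eq_of_heq ((c.val_heq (η := 1) (fun _ _ _ => rfl) m m h h fun _ => rfl).trans ?_)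
  exact (whiskerRight_heq rfl rfl (HEq.refl (c.app n m h))
    (congrArg Cat.Hom.toFunctor (G.bang_one m fun _ => rfl))).trans HEq.rfl

end SymFunHom.HomCore

end core

/-! ### Actions of bijections on multimorphisms of symmetric functors -/

section act

variable {ι κ : Type} (e : κ ≃ ι)

/-- Reindexing of injections. -/
def preEmb (β : ι × ℕ ↪ ℕ) : κ × ℕ ↪ ℕ where
  toFun p := β (e p.1, p.2)
  inj' p q h := by
    have := β.injective h
    exact Prod.ext (e.injective (Prod.mk.inj this).1) (Prod.mk.inj this).2

theorem preEmb_injective {β β' : ι × ℕ ↪ ℕ} (h : preEmb e β = preEmb e β') : β = β' := by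
  ext p
  have : β (e (e.symm p.1), p.2) = β' (e (e.symm p.1), p.2) :=
    DFunLike.congr_fun h (e.symm p.1, p.2)
  simpa using this

theorem exists_preEmb (β : κ × ℕ ↪ ℕ) : ∃ β', preEmb e β' = β :=
  ⟨preEmb e.symm β, by
    ext p
    change β (e.symm (e p.1), p.2) = β p
    simp⟩

theorem exists_pi {Z : ι → Sort*} (x : ∀ k, Z (e k)) : ∃ w : ∀ i, Z i, (fun k => w (e k)) = x := by
  obtain ⟨w, hw⟩ := (e.piCongrLeft Z).symm.surjective x
  exact ⟨w, hw⟩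

theorem pi_injective {Z : ι → Sort*} {x y : ∀ i, Z i} (h : (fun k => x (e k)) = fun k => y (e k)) :
    x = y := by
  funext i
  obtain ⟨k, rfl⟩ := e.surjective i
  exact congrFun h k

variable {e}

theorem isPush_preEmb {β : ι × ℕ ↪ ℕ} {n : ι → Finfty} {m : Finfty} :
    IsPush (preEmb e β) (fun k => n (e k)) m ↔ IsPush β n m := by
  have : Set.range (preEmb e β) = Set.range β :=
    (e.prodCongr (Equiv.refl ℕ)).surjective.range_comp β
  refine and_congr ⟨fun h i j => ?_, fun h k j => h (e k) j⟩ (by rw [this])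
  obtain ⟨k, rfl⟩ := e.surjective i
  exact h k j

theorem isPushHom_preEmb {β : ι × ℕ ↪ ℕ} {n n' : ι → Finfty} {m m' : Finfty}
    {φ : ∀ i, n i ⟶ n' i} {ψ : m ⟶ m'} :
    IsPushHom (preEmb e β) (fun k => φ (e k)) ψ ↔ IsPushHom β φ ψ := by
  have : Set.range (preEmb e β) = Set.range β :=
    (e.prodCongr (Equiv.refl ℕ)).surjective.range_comp β
  refine and_congr ⟨fun h i j => ?_, fun h k j => h (e k) j⟩ (by rw [this])
  obtain ⟨k, rfl⟩ := e.surjective i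
  exact h k j

variable (e)

/-- The functor which restricts tuples along a bijection. -/
def comapF (X : ι → Type v) [∀ i, Category.{w} (X i)] : (∀ i, X i) ⥤ (∀ k, X (e k)) where
  obj x k := x (e k)
  map φ k := φ (e k)

theorem reindex_comapF (X : ι → Type v) [∀ i, Category.{w} (X i)] :
    reindex e X ⋙ comapF e X = 𝟭 _ :=
  Functor.hext (fun x => funext fun k => reindex_obj_apply e X x k) fun x y φ =>
    hom_heq_of (funext fun k => reindex_obj_apply e X x k)
      (funext fun k => reindex_obj_apply e X y k) _ _ fun k => reindex_map_apply e X φ k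

theorem comapF_reindex (X : ι → Type v) [∀ i, Category.{w} (X i)] :
    comapF e X ⋙ reindex e X = 𝟭 _ :=
  Functor.hext (fun x => reindex_obj_eq e X _ x fun _ => rfl) fun _ _ φ =>
    reindex_map_heq e X (fun _ => rfl) (fun _ => rfl) _ φ fun _ => HEq.rfl

variable {e}

theorem comapF_cancel {X : ι → Type v} [∀ i, Category.{w} (X i)] {B : Type*} [Category B]
    {P Q : (∀ k, X (e k)) ⥤ B} (h : comapF e X ⋙ P = comapF e X ⋙ Q) : P = Q := by
  have := congrArg (reindex e X ⋙ ·) h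
  simp only [← Functor.assoc, reindex_comapF] at this
  exact this

theorem comapF_cancel_heq {X : ι → Type v} [∀ i, Category.{w} (X i)] {B : Type*} [Category B]
    {P Q P' Q' : (∀ k, X (e k)) ⥤ B} (hP : P = P') (hQ : Q = Q') {t : P ⟶ Q} {t' : P' ⟶ Q'}
    (h : HEq (Functor.whiskerLeft (comapF e X) t) (Functor.whiskerLeft (comapF e X) t')) :
    HEq t t' := by
  subst hP hQ
  refine heq_of_eq (NatTrans.ext (funext fun x => ?_))
  obtain ⟨w, rfl⟩ := exists_pi e x
  exact NatTrans.congr_app (eq_of_heq h) w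

variable {F : ι → SymFun.{u}} {G : SymFun.{u}} (f : SymFunHom F G)

theorem SymFunHom.exists_actApp (β : κ × ℕ ↪ ℕ) (n : κ → Finfty) (m : Finfty) (h : IsPush β n m) :
    ∃ P : (∀ k, (F (e k)).F.obj (n k)) ⥤ G.F.obj m, ∀ (β' : ι × ℕ ↪ ℕ) (n' : ι → Finfty)
      (h' : IsPush β' n' m), preEmb e β' = β → (fun k => n' (e k)) = n →
      HEq P (reindex e (fun i => (F i).F.obj (n' i)) ⋙ f.app β' n' m h') := by
  obtain ⟨β, rfl⟩ := exists_preEmb e β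
  obtain ⟨n, rfl⟩ := exists_pi e (Z := fun _ => Finfty) n
  refine ⟨reindex e (fun i => (F i).F.obj (n i)) ⋙ f.app β n m (isPush_preEmb.1 h),
    fun β' n' h' hβ hn => ?_⟩
  obtain rfl := preEmb_injective e hβ
  obtain rfl := pi_injective e hn
  rfl

variable (e)

/-- The values of the multimorphism with permuted sources. -/
def SymFunHom.actApp (β : κ × ℕ ↪ ℕ) (n : κ → Finfty) (m : Finfty) (h : IsPush β n m) :
    (∀ k, (F (e k)).F.obj (n k)) ⥤ G.F.obj m := (f.exists_actApp β n m h).choose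

theorem SymFunHom.actApp_eq (β : ι × ℕ ↪ ℕ) (n : ι → Finfty) (m : Finfty)
    (h : IsPush (preEmb e β) (fun k => n (e k)) m) (h' : IsPush β n m) :
    f.actApp e (preEmb e β) (fun k => n (e k)) m h =
      reindex e (fun i => (F i).F.obj (n i)) ⋙ f.app β n m h' :=
  eq_of_heq ((f.exists_actApp _ _ m h).choose_spec β n h' rfl rfl)

theorem SymFunHom.comapF_actApp (β : ι × ℕ ↪ ℕ) (n : ι → Finfty) (m : Finfty)
    (h : IsPush (preEmb e β) (fun k => n (e k)) m) (h' : IsPush β n m) :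
    comapF e (fun i => (F i).F.obj (n i)) ⋙ f.actApp e (preEmb e β) (fun k => n (e k)) m h =
      f.app β n m h' := by
  rw [f.actApp_eq e β n m h h', ← Functor.assoc, comapF_reindex]
  rfl

/-- The action of bijections on multimorphisms. -/
def SymFunHom.act : SymFunHom (fun k => F (e k)) G where
  app := f.actApp e
  nat β n n' m m' h h' φ ψ hψ := by
    obtain ⟨β, rfl⟩ := exists_preEmb e β
    obtain ⟨n, rfl⟩ := exists_pi e (Z := fun _ => Finfty) n
    obtain ⟨n', rfl⟩ := exists_pi e (Z := fun _ => Finfty) n'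
    obtain ⟨φ, rfl⟩ := exists_pi e (Z := fun i => n i ⟶ n' i) φ
    refine comapF_cancel (X := fun i => (F i).F.obj (n i)) ?_
    exact (congrArg (Functor.pi (fun i => ((F i).F.map (φ i)).toFunctor) ⋙ ·)
      (f.comapF_actApp e β n' m' h' (isPush_preEmb.1 h'))).trans
      ((f.nat β n n' m m' (isPush_preEmb.1 h) (isPush_preEmb.1 h') φ ψ
        (isPushHom_preEmb.1 hψ)).trans (congrArg (· ⋙ (G.F.map ψ).toFunctor)
          (f.comapF_actApp e β n m h (isPush_preEmb.1 h)).symm))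
  equivariant β θ θ' hθ k n l m h h' hn hm := by
    obtain ⟨β, rfl⟩ := exists_preEmb e β
    obtain ⟨n, rfl⟩ := exists_pi e (Z := fun _ => Finfty) n
    obtain ⟨k, rfl⟩ := exists_pi e (Z := fun _ => Finfty) k
    obtain ⟨θ, rfl⟩ := exists_pi e (Z := fun _ => Equiv.Perm ℕ) θ
    refine comapF_cancel (X := fun i => (F i).F.obj (k i)) ?_
    have hθ₁ : ∀ i j, θ' (β (i, j)) = β (i, θ i j) := fun i j => by
      obtain ⟨i, rfl⟩ := e.surjective i
      exact hθ i j
    have hn₁ : ∀ i j, (k i).n j = (n i).n (θ i j) := fun i j => by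
      obtain ⟨i, rfl⟩ := e.surjective i
      exact hn i j
    exact (congrArg (Functor.pi (fun i => ((F i).bang (θ i) (k i) (n i) (hn₁ i)).toFunctor) ⋙ ·)
      (f.comapF_actApp e β n m h (isPush_preEmb.1 h))).trans
      ((f.equivariant β θ θ' hθ₁ k n l m (isPush_preEmb.1 h) (isPush_preEmb.1 h') hn₁ hm).trans
        (congrArg (· ⋙ (G.bang θ' l m hm).toFunctor)
          (f.comapF_actApp e β k l h' (isPush_preEmb.1 h')).symm))
  change_β β β' θ n l m h h' hm hθ := by
    obtain ⟨β, rfl⟩ := exists_preEmb e β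
    obtain ⟨β', rfl⟩ := exists_preEmb e β'
    obtain ⟨n, rfl⟩ := exists_pi e (Z := fun _ => Finfty) n
    refine comapF_cancel (X := fun i => (F i).F.obj (n i)) ?_
    rw [← Functor.assoc, f.comapF_actApp e β n l h (isPush_preEmb.1 h),
      f.comapF_actApp e β' n m h' (isPush_preEmb.1 h')]
    refine f.change_β β β' θ n l m _ _ hm fun i j hij => ?_
    obtain ⟨i, rfl⟩ := e.surjective i
    exact hθ i j hij

variable {f}

theorem SymFunHom.eq_act [Finite ι] [Finite κ] (β : ι × ℕ ↪ ℕ)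
    (f' : SymFunHom (fun k => F (e k)) G)
    (h : ∀ (n : ι → Finfty) (m : Finfty) (h : IsPush (preEmb e β) (fun k => n (e k)) m)
      (h' : IsPush β n m), comapF e (fun i => (F i).F.obj (n i)) ⋙ f'.app _ _ m h =
        f.app β n m h') : f' = f.act e := by
  refine SymFunHom.ext_of (preEmb e β) fun n m hm => ?_
  obtain ⟨n, rfl⟩ := exists_pi e (Z := fun _ => Finfty) n
  refine comapF_cancel (X := fun i => (F i).F.obj (n i)) ?_
  rw [h n m hm (isPush_preEmb.1 hm)]
  exact (f.comapF_actApp e β n m hm _).symm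

variable {g : SymFunHom F G} (p : f ⟶ g)

theorem SymFunHom.exists_actMap (β : κ × ℕ ↪ ℕ) (n : κ → Finfty) (m : Finfty) (h : IsPush β n m) :
    ∃ t : (f.act e).app β n m h ⟶ (g.act e).app β n m h, ∀ (β' : ι × ℕ ↪ ℕ) (n' : ι → Finfty)
      (h' : IsPush β' n' m), preEmb e β' = β → (fun k => n' (e k)) = n →
      HEq t (Functor.whiskerLeft (reindex e (fun i => (F i).F.obj (n' i)))
        (SymFunHom.Hom.app p β' n' m h')) := by
  obtain ⟨β, rfl⟩ := exists_preEmb e β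
  obtain ⟨n, rfl⟩ := exists_pi e (Z := fun _ => Finfty) n
  refine ⟨cast ?_ (Functor.whiskerLeft (reindex e (fun i => (F i).F.obj (n i)))
    (SymFunHom.Hom.app p β n m (isPush_preEmb.1 h))),
    fun β' n' h' hβ hn => (cast_heq _ _).trans ?_⟩
  · exact congrArg₂ _ (f.actApp_eq e β n m h _).symm (g.actApp_eq e β n m h _).symm
  · obtain rfl := preEmb_injective e hβ
    obtain rfl := pi_injective e hn
    rfl

/-- The values of the action of bijections on morphisms of multimorphisms. -/
def SymFunHom.actMapApp (β : κ × ℕ ↪ ℕ) (n : κ → Finfty) (m : Finfty) (h : IsPush β n m) :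
    (f.act e).app β n m h ⟶ (g.act e).app β n m h := (SymFunHom.exists_actMap e p β n m h).choose

theorem SymFunHom.comapF_actMapApp (β : ι × ℕ ↪ ℕ) (n : ι → Finfty) (m : Finfty)
    (h : IsPush (preEmb e β) (fun k => n (e k)) m) (h' : IsPush β n m) :
    HEq (Functor.whiskerLeft (comapF e (fun i => (F i).F.obj (n i)))
      (SymFunHom.actMapApp e p (preEmb e β) (fun k => n (e k)) m h))
      (SymFunHom.Hom.app p β n m h') := by
  refine (whiskerLeft_heq (f.actApp_eq e β n m h h') (g.actApp_eq e β n m h h')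
    ((SymFunHom.exists_actMap e p _ _ m h).choose_spec β n h' rfl rfl) rfl).trans ?_
  exact whiskerLeft_heq rfl rfl (HEq.refl (SymFunHom.Hom.app p β n m h'))
    (comapF_reindex e fun i => (F i).F.obj (n i))

/-- The action of bijections on morphisms of multimorphisms. -/
def SymFunHom.actMap : f.act e ⟶ g.act e :=
  SymFunHom.Hom.mk (f := f.act e) (g := g.act e) (SymFunHom.actMapApp e p)
  (fun β n n' m m' h h' φ ψ hψ => by
    have e₁ := (f.act e).nat β n n' m m' h h' φ ψ hψ
    have e₂ := (g.act e).nat β n n' m m' h h' φ ψ hψ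
    obtain ⟨β, rfl⟩ := exists_preEmb e β
    obtain ⟨n, rfl⟩ := exists_pi e (Z := fun _ => Finfty) n
    obtain ⟨n', rfl⟩ := exists_pi e (Z := fun _ => Finfty) n'
    obtain ⟨φ, rfl⟩ := exists_pi e (Z := fun i => n i ⟶ n' i) φ
    refine comapF_cancel_heq (X := fun i => (F i).F.obj (n i)) e₁ e₂ ?_
    refine HEq.trans ?_ (whiskerRight_heq (f.comapF_actApp e β n m h (isPush_preEmb.1 h))
      (g.comapF_actApp e β n m h (isPush_preEmb.1 h))
      (SymFunHom.comapF_actMapApp e p β n m h (isPush_preEmb.1 h)) rfl).symm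
    refine HEq.trans ?_ (SymFunHom.Hom.nat p β n n' m m' (isPush_preEmb.1 h) (isPush_preEmb.1 h') φ ψ (isPushHom_preEmb.1 hψ))
    exact whiskerLeft_heq (f.comapF_actApp e β n' m' h' (isPush_preEmb.1 h'))
      (g.comapF_actApp e β n' m' h' (isPush_preEmb.1 h'))
      (SymFunHom.comapF_actMapApp e p β n' m' h' (isPush_preEmb.1 h'))
      (Eq.refl (Functor.pi (fun i => ((F i).F.map (φ i)).toFunctor))))
  (fun β θ θ' hθ k n l m h h' hn hm => by
    have e₁ := (f.act e).equivariant β θ θ' hθ k n l m h h' hn hm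
    have e₂ := (g.act e).equivariant β θ θ' hθ k n l m h h' hn hm
    obtain ⟨β, rfl⟩ := exists_preEmb e β
    obtain ⟨n, rfl⟩ := exists_pi e (Z := fun _ => Finfty) n
    obtain ⟨k, rfl⟩ := exists_pi e (Z := fun _ => Finfty) k
    obtain ⟨θ, rfl⟩ := exists_pi e (Z := fun _ => Equiv.Perm ℕ) θ
    refine comapF_cancel_heq (X := fun i => (F i).F.obj (k i)) e₁ e₂ ?_
    have hθ₁ : ∀ i j, θ' (β (i, j)) = β (i, θ i j) := fun i j => by
      obtain ⟨i, rfl⟩ := e.surjective i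
      exact hθ i j
    have hn₁ : ∀ i j, (k i).n j = (n i).n (θ i j) := fun i j => by
      obtain ⟨i, rfl⟩ := e.surjective i
      exact hn i j
    refine HEq.trans ?_ (whiskerRight_heq (f.comapF_actApp e β k l h' (isPush_preEmb.1 h'))
      (g.comapF_actApp e β k l h' (isPush_preEmb.1 h'))
      (SymFunHom.comapF_actMapApp e p β k l h' (isPush_preEmb.1 h')) rfl).symm
    refine HEq.trans ?_ (SymFunHom.Hom.equivariant p β θ θ' hθ₁ k n l m (isPush_preEmb.1 h) (isPush_preEmb.1 h') hn₁ hm)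
    exact whiskerLeft_heq (f.comapF_actApp e β n m h (isPush_preEmb.1 h))
      (g.comapF_actApp e β n m h (isPush_preEmb.1 h))
      (SymFunHom.comapF_actMapApp e p β n m h (isPush_preEmb.1 h))
      (Eq.refl (Functor.pi (fun i => ((F i).bang (θ i) (k i) (n i) (hn₁ i)).toFunctor))))
  (fun β β' θ n l m h h' hm hθ => by
    have e₁ := (f.act e).change_β β β' θ n l m h h' hm hθ
    have e₂ := (g.act e).change_β β β' θ n l m h h' hm hθ
    obtain ⟨β, rfl⟩ := exists_preEmb e β
    obtain ⟨β', rfl⟩ := exists_preEmb e β'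
    obtain ⟨n, rfl⟩ := exists_pi e (Z := fun _ => Finfty) n
    refine comapF_cancel_heq (X := fun i => (F i).F.obj (n i)) e₁ e₂ ?_
    refine HEq.trans ?_ (SymFunHom.comapF_actMapApp e p β' n m h' (isPush_preEmb.1 h')).symm
    refine (whiskerRight_heq (f.comapF_actApp e β n l h (isPush_preEmb.1 h))
      (g.comapF_actApp e β n l h (isPush_preEmb.1 h))
      (SymFunHom.comapF_actMapApp e p β n l h (isPush_preEmb.1 h)) rfl).trans ?_
    refine SymFunHom.Hom.change_β p β β' θ n l m _ _ hm fun i j hij => ?_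
    obtain ⟨i, rfl⟩ := e.surjective i
    exact hθ i j hij)

variable {p}

theorem SymFunHom.heq_actMap [Finite ι] [Finite κ] (β : ι × ℕ ↪ ℕ)
    {f' g' : SymFunHom (fun k => F (e k)) G} (hf : f' = f.act e) (hg : g' = g.act e) (q : f' ⟶ g')
    (h : ∀ (n : ι → Finfty) (m : Finfty) (h : IsPush (preEmb e β) (fun k => n (e k)) m)
      (h' : IsPush β n m), HEq (Functor.whiskerLeft (comapF e (fun i => (F i).F.obj (n i)))
        (SymFunHom.Hom.app q _ _ m h)) (SymFunHom.Hom.app p β n m h')) :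
    HEq q (SymFunHom.actMap e p) := by
  refine SymFunHom.Hom.heq_of (preEmb e β) hf hg _ _ fun n m hm => ?_
  obtain ⟨n, rfl⟩ := exists_pi e (Z := fun _ => Finfty) n
  refine comapF_cancel_heq (X := fun i => (F i).F.obj (n i)) (by rw [hf]) (by rw [hg]) ?_
  exact (h n m hm (isPush_preEmb.1 hm)).trans
    (SymFunHom.comapF_actMapApp e p β n m hm (isPush_preEmb.1 hm)).symm

end act

/-! ### Units and multiproducts of symmetric functors -/

section one

/-- The injection `j ↦ j`. -/
def unitEmb : Unit × ℕ ↪ ℕ where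
  toFun p := p.2
  inj' _ _ h := Prod.ext rfl h

variable (F : SymFun.{u})

/-- The evaluation of tuples with one entry. -/
def evalUnit (X : Unit → Type v) [∀ i, Category.{w} (X i)] : (∀ i, X i) ⥤ X () where
  obj x := x ()
  map φ := φ ()

/-- The values of the unit. -/
def SymFunHom.oneCore : SymFunHom.Core unitEmb (fun _ => F) F where
  app n m h := evalUnit (fun i => F.F.obj (n i)) ⋙ (F.bang 1 (n ()) m fun j => (h.1 () j).symm).toFunctor
  nat n n' m m' h h' φ ψ hψ := congrArg (fun t => evalUnit (fun i => F.F.obj (n i)) ⋙ Cat.Hom.toFunctor t)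
    (F.bang_nat 1 (n ()) m (n' ()) m' (fun j => (h.1 () j).symm) (fun j => (h'.1 () j).symm) ψ (φ ()) fun j => (hψ.1 () j).symm)
  equivariant θ θ' k n l m h h' hn hm hθ := by
    have hkm : ∀ j, (k ()).n j = m.n (θ () j) := fun j => (hn () j).trans (h.1 () _).symm
    exact congrArg (fun t => evalUnit (fun i => F.F.obj (k i)) ⋙ t)
      ((F.bang_comp 1 (θ ()) (θ ()) _ _ _ (fun j => (h.1 () j).symm) (hn ()) hkm fun _ _ => rfl).trans
        (F.bang_comp θ' 1 (θ ()) _ _ _ hm (fun j => (h'.1 () j).symm) hkm (hθ ())).symm)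

/-- The unit of a symmetric functor. -/
def SymFunHom.one : SymFunHom (fun _ : Unit => F) F := (SymFunHom.oneCore F).toHom

theorem SymFunHom.one_app (n : Finfty) (h : IsPush unitEmb (fun _ => n) n) :
    (SymFunHom.one F).app unitEmb (fun _ => n) n h = evalUnit fun _ => F.F.obj n :=
  ((SymFunHom.oneCore F).toHom_app _ n h).trans
    (congrArg (fun t => evalUnit (fun _ => F.F.obj n) ⋙ Cat.Hom.toFunctor t) (F.bang_one n fun _ => rfl))

theorem isPush_unitEmb (n : Finfty) : IsPush unitEmb (fun _ => n) n :=
  ⟨fun _ _ => rfl, fun s hs => absurd ⟨((), s), rfl⟩ hs⟩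

end one

section comp

variable {ι : Type} {κ : ι → Type}

/-- The composite of injections. -/
def sigmaEmb (β : ι × ℕ ↪ ℕ) (α : ∀ i, κ i × ℕ ↪ ℕ) : (Σ i, κ i) × ℕ ↪ ℕ where
  toFun p := β (p.1.1, α p.1.1 (p.1.2, p.2))
  inj' := by
    rintro ⟨⟨i, k⟩, j⟩ ⟨⟨i', k'⟩, j'⟩ h
    have h₁ := β.injective h
    obtain rfl : i = i' := (Prod.mk.inj h₁).1
    have h₂ := (α i).injective (Prod.mk.inj h₁).2
    obtain ⟨rfl, rfl⟩ := Prod.mk.inj h₂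
    rfl

variable {β : ι × ℕ ↪ ℕ} {α : ∀ i, κ i × ℕ ↪ ℕ}

theorem isPush_of_sigmaEmb {n : (Σ i, κ i) → Finfty} {l : ι → Finfty} {m : Finfty}
    (h : IsPush (sigmaEmb β α) n m) (h₁ : ∀ i, IsPush (α i) (fun k => n ⟨i, k⟩) (l i)) :
    IsPush β l m := by
  refine ⟨fun i j => ?_, fun s hs => h.2 s fun ⟨p, hp⟩ => hs ⟨_, hp⟩⟩
  by_cases hj : j ∈ Set.range (α i)
  · obtain ⟨⟨k, j⟩, rfl⟩ := hj
    rw [(h₁ i).1]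
    exact h.1 ⟨i, k⟩ j
  · rw [(h₁ i).2 j hj, h.2]
    rintro ⟨⟨⟨i', k⟩, j'⟩, e⟩
    obtain ⟨rfl, rfl⟩ := Prod.mk.inj (β.injective e)
    exact hj ⟨_, rfl⟩

theorem isPush_sigmaEmb {n : (Σ i, κ i) → Finfty} {l : ι → Finfty} {m : Finfty}
    (h₁ : ∀ i, IsPush (α i) (fun k => n ⟨i, k⟩) (l i)) (h : IsPush β l m) :
    IsPush (sigmaEmb β α) n m := by
  refine ⟨fun s j => (h.1 _ _).trans ((h₁ s.1).1 s.2 j), fun s hs => ?_⟩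
  by_contra hne
  obtain ⟨i, j, hij, rfl⟩ := h.ne_one hne
  obtain ⟨k, j', -, rfl⟩ := (h₁ i).ne_one hij
  exact hs ⟨(⟨i, k⟩, j'), rfl⟩

theorem isPushHom_of_sigmaEmb {n n' : (Σ i, κ i) → Finfty} {l l' : ι → Finfty} {m m' : Finfty}
    {φ : ∀ s, n s ⟶ n' s} {χ : ∀ i, l i ⟶ l' i} {ψ : m ⟶ m'} (h : IsPushHom (sigmaEmb β α) φ ψ)
    (h₁ : ∀ i, IsPushHom (α i) (fun k => φ ⟨i, k⟩) (χ i)) : IsPushHom β χ ψ := by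
  refine ⟨fun i j => ?_, fun s hs => h.2 s fun ⟨p, hp⟩ => hs ⟨_, hp⟩⟩
  by_cases hj : j ∈ Set.range (α i)
  · obtain ⟨⟨k, j⟩, rfl⟩ := hj
    rw [(h₁ i).1]
    exact h.1 ⟨i, k⟩ j
  · rw [(h₁ i).2 j hj, h.2]
    rintro ⟨⟨⟨i', k⟩, j'⟩, e⟩
    obtain ⟨rfl, rfl⟩ := Prod.mk.inj (β.injective e)
    exact hj ⟨_, rfl⟩

/-- The sequences of the intermediate objects of a multiproduct. -/
def midObj [∀ i, Finite (κ i)] (α : ∀ i, κ i × ℕ ↪ ℕ) (n : (Σ i, κ i) → Finfty) (i : ι) : Finfty :=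
  pushObj (α i) fun k => n ⟨i, k⟩

theorem isPush_midObj [∀ i, Finite (κ i)] (α : ∀ i, κ i × ℕ ↪ ℕ) (n : (Σ i, κ i) → Finfty) (i : ι) :
    IsPush (α i) (fun k => n ⟨i, k⟩) (midObj α n i) := isPush_pushObj _ _

variable {F : ∀ i, κ i → SymFun.{u}} {G : ι → SymFun.{u}} {H : SymFun.{u}}

section values

variable (g : SymFunHom G H) (f : ∀ i, SymFunHom (F i) (G i))

/-- The values of a multiproduct. -/
def SymFunHom.compApp (β : ι × ℕ ↪ ℕ) (α : ∀ i, κ i × ℕ ↪ ℕ) (n : (Σ i, κ i) → Finfty)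
    (l : ι → Finfty) (m : Finfty) (h₁ : ∀ i, IsPush (α i) (fun k => n ⟨i, k⟩) (l i))
    (h₂ : IsPush β l m) : (∀ s : Σ i, κ i, (F s.1 s.2).F.obj (n s)) ⥤ H.F.obj m :=
  sigmaPi (X := fun i k => (F i k).F.obj (n ⟨i, k⟩))
    (fun i => (f i).app (α i) (fun k => n ⟨i, k⟩) (l i) (h₁ i)) ⋙ g.app β l m h₂

theorem SymFunHom.compApp_bang (β β' : ι × ℕ ↪ ℕ) (α α' : ∀ i, κ i × ℕ ↪ ℕ)
    (θ : (Σ i, κ i) → Equiv.Perm ℕ) (ω : ι → Equiv.Perm ℕ) (θ' : Equiv.Perm ℕ)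
    (n n' : (Σ i, κ i) → Finfty) (l l' : ι → Finfty) (m m' : Finfty)
    (h₁ : ∀ i, IsPush (α i) (fun k => n ⟨i, k⟩) (l i)) (h₂ : IsPush β l m)
    (h₁' : ∀ i, IsPush (α' i) (fun k => n' ⟨i, k⟩) (l' i)) (h₂' : IsPush β' l' m')
    (hn : ∀ s j, (n' s).n j = (n s).n (θ s j)) (hl : ∀ i j, (l' i).n j = (l i).n (ω i j))
    (hm : ∀ s, m'.n s = m.n (θ' s))
    (hθ : ∀ i k j, (n' ⟨i, k⟩).n j ≠ 1 → ω i (α' i (k, j)) = α i (k, θ ⟨i, k⟩ j))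
    (hω : ∀ i j, (l' i).n j ≠ 1 → θ' (β' (i, j)) = β (i, ω i j)) :
    Functor.pi (fun s : Σ i, κ i =>
        ((F s.1 s.2).bang (θ s) (n' s) (n s) (hn s)).toFunctor) ⋙
      SymFunHom.compApp g f β α n l m h₁ h₂ =
    SymFunHom.compApp g f β' α' n' l' m' h₁' h₂' ⋙ (H.bang θ' m' m hm).toFunctor := by
  have e₁ := fun i => (f i).app_bang (α i) (α' i) (fun k => θ ⟨i, k⟩) (ω i) (fun k => n' ⟨i, k⟩)
    (fun k => n ⟨i, k⟩) (l' i) (l i) (h₁ i) (h₁' i) (fun k => hn ⟨i, k⟩) (hl i) (hθ i)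
  have e₂ := g.app_bang β β' ω θ' l' l m' m h₂ h₂' hl hm hω
  refine (congrArg (fun t => sigmaPi (X := fun i k => (F i k).F.obj (n' ⟨i, k⟩)) t ⋙
    g.app β l m h₂) (funext e₁)).trans ?_
  exact congrArg (fun t => sigmaPi (X := fun i k => (F i k).F.obj (n' ⟨i, k⟩))
    (fun i => (f i).app (α' i) (fun k => n' ⟨i, k⟩) (l' i) (h₁' i)) ⋙ t) e₂

theorem SymFunHom.compApp_nat (β : ι × ℕ ↪ ℕ) (α : ∀ i, κ i × ℕ ↪ ℕ)
    (n n' : (Σ i, κ i) → Finfty) (l l' : ι → Finfty) (m m' : Finfty)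
    (h₁ : ∀ i, IsPush (α i) (fun k => n ⟨i, k⟩) (l i)) (h₂ : IsPush β l m)
    (h₁' : ∀ i, IsPush (α i) (fun k => n' ⟨i, k⟩) (l' i)) (h₂' : IsPush β l' m')
    (φ : ∀ s, n s ⟶ n' s) (χ : ∀ i, l i ⟶ l' i) (ψ : m ⟶ m')
    (hχ : ∀ i, IsPushHom (α i) (fun k => φ ⟨i, k⟩) (χ i)) (hψ : IsPushHom β χ ψ) :
    Functor.pi (fun s : Σ i, κ i => ((F s.1 s.2).F.map (φ s)).toFunctor) ⋙
      SymFunHom.compApp g f β α n' l' m' h₁' h₂' =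
    SymFunHom.compApp g f β α n l m h₁ h₂ ⋙ (H.F.map ψ).toFunctor := by
  have e₁ := fun i => (f i).nat (α i) (fun k => n ⟨i, k⟩)
    (fun k => n' ⟨i, k⟩) (l i) (l' i) (h₁ i) (h₁' i) (fun k => φ ⟨i, k⟩) (χ i) (hχ i)
  have e₂ := g.nat β l l' m m' h₂ h₂' χ ψ hψ
  refine (congrArg (fun t => sigmaPi (X := fun i k => (F i k).F.obj (n ⟨i, k⟩)) t ⋙
    g.app β l' m' h₂') (funext e₁)).trans ?_
  exact congrArg (fun t => sigmaPi (X := fun i k => (F i k).F.obj (n ⟨i, k⟩))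
    (fun i => (f i).app (α i) (fun k => n ⟨i, k⟩) (l i) (h₁ i)) ⋙ t) e₂

end values

theorem exists_mid_perm [∀ i, Finite (κ i)] (β : ι × ℕ ↪ ℕ) (α : ∀ i, κ i × ℕ ↪ ℕ)
    (θ : (Σ i, κ i) → Equiv.Perm ℕ) (θ' : Equiv.Perm ℕ) (k n : (Σ i, κ i) → Finfty)
    (hn : ∀ s j, (k s).n j = (n s).n (θ s j))
    (hθ : ∀ s j, (k s).n j ≠ 1 → θ' (sigmaEmb β α (s, j)) = sigmaEmb β α (s, θ s j)) :
    ∃ ω : ι → Equiv.Perm ℕ, (∀ i j, (midObj α k i).n j = (midObj α n i).n (ω i j)) ∧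
      (∀ i l j, ω i (α i (l, j)) = α i (l, θ ⟨i, l⟩ j)) ∧
      ∀ i j, (midObj α k i).n j ≠ 1 → θ' (β (i, j)) = β (i, ω i j) := by
  choose ω hω hω' using fun i => exists_perm_extend (α i) fun l => θ ⟨i, l⟩
  refine ⟨ω, fun i j => ?_, hω, fun i j hij => ?_⟩
  · rw [(isPush_midObj α k i).unique ((isPush_midObj α n i).perm_source (hω i) (hω' i)
      fun l => hn ⟨i, l⟩)]
    rfl
  · obtain ⟨l, j', hl, rfl⟩ := (isPush_midObj α k i).ne_one hij
    rw [hω]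
    exact hθ ⟨i, l⟩ j' hl

theorem exists_mid_moves [∀ i, Finite (κ i)] {β β' : ι × ℕ ↪ ℕ} {α α' : ∀ i, κ i × ℕ ↪ ℕ}
    {n : (Σ i, κ i) → Finfty} {η : Equiv.Perm ℕ} (hη : Moves (sigmaEmb β α) (sigmaEmb β' α') n η)
    (l : ι → Finfty) (h₁ : ∀ i, IsPush (α' i) (fun k => n ⟨i, k⟩) (l i)) :
    ∃ ω : ι → Equiv.Perm ℕ, (∀ i j, (midObj α n i).n j = (l i).n (ω i j)) ∧
      (∀ i, Moves (α i) (α' i) (fun k => n ⟨i, k⟩) (ω i)) ∧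
      ∀ i j, (midObj α n i).n j ≠ 1 → η (β (i, j)) = β' (i, ω i j) := by
  choose ω hω using fun i => exists_moves (α i) (α' i) fun k => n ⟨i, k⟩
  refine ⟨ω, fun i j => ?_, hω, fun i j hij => ?_⟩
  · rw [(isPush_midObj α n i).unique ((h₁ i).perm (hω i))]
    rfl
  · obtain ⟨k, j', hk, rfl⟩ := (isPush_midObj α n i).ne_one hij
    rw [hω i k j' hk]
    exact hη ⟨i, k⟩ j' hk

variable [∀ i, Finite (κ i)] (g : SymFunHom G H) (f : ∀ i, SymFunHom (F i) (G i))

/-- The values of the multiproduct at a composite injection. -/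
def SymFunHom.compCore (β : ι × ℕ ↪ ℕ) (α : ∀ i, κ i × ℕ ↪ ℕ) :
    SymFunHom.Core (sigmaEmb β α) (fun s : Σ i, κ i => F s.1 s.2) H where
  app n m h := SymFunHom.compApp g f β α n (midObj α n) m (isPush_midObj α n)
    (isPush_of_sigmaEmb h (isPush_midObj α n))
  nat n n' m m' h h' φ ψ hψ := by
    choose χ hχ using fun i => exists_pushHom (α i) (isPush_midObj α n i) (isPush_midObj α n' i)
      fun k => φ ⟨i, k⟩
    exact SymFunHom.compApp_nat g f β α n n' _ _ m m' _ _ _ _ φ χ ψ hχ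
      (isPushHom_of_sigmaEmb hψ hχ)
  equivariant θ θ' k n l m h h' hn hm hθ := by
    obtain ⟨ω, hl, hω, hω'⟩ := exists_mid_perm β α θ θ' k n hn hθ
    exact SymFunHom.compApp_bang g f β β α α θ ω θ' n k _ _ m l _ _ _ _ hn hl hm
      (fun i k j _ => hω i k j) hω'

variable [Finite ι]

/-- The multiproduct of multimorphisms of symmetric functors. -/
def SymFunHom.comp : SymFunHom (fun s : Σ i, κ i => F s.1 s.2) H :=
  (SymFunHom.compCore g f exists_embedding.some fun _ => exists_embedding.some).toHom

theorem SymFunHom.comp_app (β : ι × ℕ ↪ ℕ) (α : ∀ i, κ i × ℕ ↪ ℕ) (n : (Σ i, κ i) → Finfty)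
    (l : ι → Finfty) (m : Finfty) (h : IsPush (sigmaEmb β α) n m)
    (h₁ : ∀ i, IsPush (α i) (fun k => n ⟨i, k⟩) (l i))
    (h₂ : IsPush β l m) : (SymFunHom.comp g f).app (sigmaEmb β α) n m h =
      SymFunHom.compApp g f β α n l m h₁ h₂ := by
  let β₀ : ι × ℕ ↪ ℕ := exists_embedding.some
  let α₀ : ∀ i, κ i × ℕ ↪ ℕ := fun _ => exists_embedding.some
  obtain ⟨η, hη⟩ := exists_moves (sigmaEmb β₀ α₀) (sigmaEmb β α) n
  obtain ⟨ω, hl, hω, hω'⟩ := exists_mid_moves hη l h₁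
  rw [SymFunHom.app_eq_bang _ hη _ m (h.perm hη) h fun _ => rfl]
  refine (congrArg (· ⋙ (H.bang η _ m _).toFunctor)
    ((SymFunHom.compCore g f β₀ α₀).toHom_app _ _ (h.perm hη))).trans ?_
  refine (SymFunHom.compApp_bang g f β β₀ α α₀ (fun _ => 1) ω η n n l _ m _ h₁ h₂ _ _
    (fun _ _ => rfl) hl (fun _ => rfl) (fun i k j hj => hω i k j hj) hω').symm.trans ?_
  refine (congrArg (· ⋙ SymFunHom.compApp g f β α n l m h₁ h₂) ?_).trans (Functor.id_comp _)
  exact congrArg Functor.pi (funext fun s : Σ i, κ i => congrArg Cat.Hom.toFunctor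
    ((F s.1 s.2).bang_one (n s) fun _ => rfl))

section valuesMap

variable {g g' : SymFunHom G H} {f f' : ∀ i, SymFunHom (F i) (G i)} (q : g ⟶ g')
  (p : ∀ i, f i ⟶ f' i)

/-- The values of a multiproduct of morphisms. -/
def SymFunHom.compMapApp (β : ι × ℕ ↪ ℕ) (α : ∀ i, κ i × ℕ ↪ ℕ) (n : (Σ i, κ i) → Finfty)
    (l : ι → Finfty) (m : Finfty) (h₁ : ∀ i, IsPush (α i) (fun k => n ⟨i, k⟩) (l i))
    (h₂ : IsPush β l m) :
    SymFunHom.compApp g f β α n l m h₁ h₂ ⟶ SymFunHom.compApp g' f' β α n l m h₁ h₂ :=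
  Functor.whiskerRight (sigmaPiNat (X := fun i k => (F i k).F.obj (n ⟨i, k⟩))
      fun i => SymFunHom.Hom.app (p i) (α i) (fun k => n ⟨i, k⟩) (l i) (h₁ i)) (g.app β l m h₂) ≫
    Functor.whiskerLeft (sigmaPi (X := fun i k => (F i k).F.obj (n ⟨i, k⟩))
      fun i => (f' i).app (α i) (fun k => n ⟨i, k⟩) (l i) (h₁ i)) (SymFunHom.Hom.app q β l m h₂)

omit [∀ i, Finite (κ i)] [Finite ι] in
theorem SymFunHom.compMapApp_bang (β β' : ι × ℕ ↪ ℕ) (α α' : ∀ i, κ i × ℕ ↪ ℕ)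
    (θ : (Σ i, κ i) → Equiv.Perm ℕ) (ω : ι → Equiv.Perm ℕ) (θ' : Equiv.Perm ℕ)
    (n n' : (Σ i, κ i) → Finfty) (l l' : ι → Finfty) (m m' : Finfty)
    (h₁ : ∀ i, IsPush (α i) (fun k => n ⟨i, k⟩) (l i)) (h₂ : IsPush β l m)
    (h₁' : ∀ i, IsPush (α' i) (fun k => n' ⟨i, k⟩) (l' i)) (h₂' : IsPush β' l' m')
    (hn : ∀ s j, (n' s).n j = (n s).n (θ s j)) (hl : ∀ i j, (l' i).n j = (l i).n (ω i j))
    (hm : ∀ s, m'.n s = m.n (θ' s))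
    (hθ : ∀ i k j, (n' ⟨i, k⟩).n j ≠ 1 → ω i (α' i (k, j)) = α i (k, θ ⟨i, k⟩ j))
    (hω : ∀ i j, (l' i).n j ≠ 1 → θ' (β' (i, j)) = β (i, ω i j)) :
    HEq (Functor.whiskerLeft (Functor.pi (fun s : Σ i, κ i =>
        ((F s.1 s.2).bang (θ s) (n' s) (n s) (hn s)).toFunctor))
      (SymFunHom.compMapApp q p β α n l m h₁ h₂))
    (Functor.whiskerRight (SymFunHom.compMapApp q p β' α' n' l' m' h₁' h₂')
      (H.bang θ' m' m hm).toFunctor) := by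
  have e := fun (f : ∀ i, SymFunHom (F i) (G i)) i => (f i).app_bang (α i) (α' i)
    (fun k => θ ⟨i, k⟩) (ω i) (fun k => n' ⟨i, k⟩)
    (fun k => n ⟨i, k⟩) (l' i) (l i) (h₁ i) (h₁' i) (fun k => hn ⟨i, k⟩) (hl i) (hθ i)
  have e' := fun i => (p i).app_bang (α i) (α' i)
    (fun k => θ ⟨i, k⟩) (ω i) (fun k => n' ⟨i, k⟩)
    (fun k => n ⟨i, k⟩) (l' i) (l i) (h₁ i) (h₁' i) (fun k => hn ⟨i, k⟩) (hl i) (hθ i)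
  have d := fun (g : SymFunHom G H) => g.app_bang β β' ω θ' l' l m' m h₂ h₂' hl hm hω
  have a := sigmaPiNat_heq (X := fun i k => (F i k).F.obj (n' ⟨i, k⟩)) (funext (e f))
    (funext (e f')) e'
  refine HEq.trans ?_ (heq_of_eq (Functor.whiskerRight_comp _ _ _).symm)
  refine (heq_of_eq (Functor.whiskerLeft_comp _ _ _)).trans ?_
  refine comp_heq (SymFunHom.compApp_bang g f β β' α α' θ ω θ' n n' l l' m m' h₁ h₂ h₁' h₂' hn hl hm
    hθ hω) (SymFunHom.compApp_bang g f' β β' α α' θ ω θ' n n' l l' m m' h₁ h₂ h₁' h₂' hn hl hm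
    hθ hω) (SymFunHom.compApp_bang g' f' β β' α α' θ ω θ' n n' l l' m m' h₁ h₂ h₁' h₂' hn hl hm
    hθ hω) ?_ ?_
  · exact (whiskerRight_heq (congrArg sigmaPi (funext (e f))) (congrArg sigmaPi (funext (e f'))) a
      (Eq.refl (g.app β l m h₂))).trans (whiskerRight_heq rfl rfl (HEq.refl
        (sigmaPiNat (X := fun i k => (F i k).F.obj (n' ⟨i, k⟩)) fun i =>
          SymFunHom.Hom.app (p i) (α' i) (fun k => n' ⟨i, k⟩) (l' i) (h₁' i))) (d g))
  · exact (whiskerLeft_heq rfl rfl (HEq.refl (SymFunHom.Hom.app q β l m h₂))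
      (congrArg (sigmaPi (X := fun i k => (F i k).F.obj (n' ⟨i, k⟩))) (funext (e f')))).trans
      (whiskerLeft_heq (d g) (d g') (q.app_bang β β' ω θ' l' l m' m h₂ h₂' hl hm hω)
        (Eq.refl (sigmaPi (X := fun i k => (F i k).F.obj (n' ⟨i, k⟩)) fun i =>
          (f' i).app (α' i) (fun k => n' ⟨i, k⟩) (l' i) (h₁' i))))

omit [∀ i, Finite (κ i)] [Finite ι] in
theorem SymFunHom.compMapApp_nat (β : ι × ℕ ↪ ℕ) (α : ∀ i, κ i × ℕ ↪ ℕ)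
    (n n' : (Σ i, κ i) → Finfty) (l l' : ι → Finfty) (m m' : Finfty)
    (h₁ : ∀ i, IsPush (α i) (fun k => n ⟨i, k⟩) (l i)) (h₂ : IsPush β l m)
    (h₁' : ∀ i, IsPush (α i) (fun k => n' ⟨i, k⟩) (l' i)) (h₂' : IsPush β l' m')
    (φ : ∀ s, n s ⟶ n' s) (χ : ∀ i, l i ⟶ l' i) (ψ : m ⟶ m')
    (hχ : ∀ i, IsPushHom (α i) (fun k => φ ⟨i, k⟩) (χ i)) (hψ : IsPushHom β χ ψ) :
    HEq (Functor.whiskerLeft (Functor.pi (fun s : Σ i, κ i => ((F s.1 s.2).F.map (φ s)).toFunctor))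
      (SymFunHom.compMapApp q p β α n' l' m' h₁' h₂'))
    (Functor.whiskerRight (SymFunHom.compMapApp q p β α n l m h₁ h₂) (H.F.map ψ).toFunctor) := by
  have e := fun (f : ∀ i, SymFunHom (F i) (G i)) i => (f i).nat (α i) (fun k => n ⟨i, k⟩)
    (fun k => n' ⟨i, k⟩) (l i) (l' i) (h₁ i) (h₁' i) (fun k => φ ⟨i, k⟩) (χ i) (hχ i)
  have e' := fun i => SymFunHom.Hom.nat (p i) (α i) (fun k => n ⟨i, k⟩)
    (fun k => n' ⟨i, k⟩) (l i) (l' i) (h₁ i) (h₁' i) (fun k => φ ⟨i, k⟩) (χ i) (hχ i)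
  have d := fun (g : SymFunHom G H) => g.nat β l l' m m' h₂ h₂' χ ψ hψ
  have a := sigmaPiNat_heq (X := fun i k => (F i k).F.obj (n ⟨i, k⟩)) (funext (e f))
    (funext (e f')) e'
  refine HEq.trans ?_ (heq_of_eq (Functor.whiskerRight_comp _ _ _).symm)
  refine (heq_of_eq (Functor.whiskerLeft_comp _ _ _)).trans ?_
  refine comp_heq (SymFunHom.compApp_nat g f β α n n' l l' m m' h₁ h₂ h₁' h₂' φ χ ψ hχ hψ)
    (SymFunHom.compApp_nat g f' β α n n' l l' m m' h₁ h₂ h₁' h₂' φ χ ψ hχ hψ)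
    (SymFunHom.compApp_nat g' f' β α n n' l l' m m' h₁ h₂ h₁' h₂' φ χ ψ hχ hψ) ?_ ?_
  · exact (whiskerRight_heq (congrArg sigmaPi (funext (e f))) (congrArg sigmaPi (funext (e f'))) a
      (Eq.refl (g.app β l' m' h₂'))).trans (whiskerRight_heq rfl rfl (HEq.refl
        (sigmaPiNat (X := fun i k => (F i k).F.obj (n ⟨i, k⟩)) fun i =>
          SymFunHom.Hom.app (p i) (α i) (fun k => n ⟨i, k⟩) (l i) (h₁ i))) (d g))
  · exact (whiskerLeft_heq rfl rfl (HEq.refl (SymFunHom.Hom.app q β l' m' h₂'))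
      (congrArg (sigmaPi (X := fun i k => (F i k).F.obj (n ⟨i, k⟩))) (funext (e f')))).trans
      (whiskerLeft_heq (d g) (d g') (SymFunHom.Hom.nat q β l l' m m' h₂ h₂' χ ψ hψ)
        (Eq.refl (sigmaPi (X := fun i k => (F i k).F.obj (n ⟨i, k⟩)) fun i =>
          (f' i).app (α i) (fun k => n ⟨i, k⟩) (l i) (h₁ i))))

/-- The multiproduct of morphisms of multimorphisms. -/
def SymFunHom.compMap : SymFunHom.comp g f ⟶ SymFunHom.comp g' f' :=
  SymFunHom.HomCore.toHom (β₀ := sigmaEmb exists_embedding.some fun _ => exists_embedding.some)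
  { app n m h := eqToHom (SymFunHom.comp_app g f _ _ n (midObj _ n) m h (isPush_midObj _ n)
        (isPush_of_sigmaEmb h (isPush_midObj _ n))) ≫
      SymFunHom.compMapApp q p exists_embedding.some (fun _ => exists_embedding.some) n
        (midObj _ n) m (isPush_midObj _ n) (isPush_of_sigmaEmb h (isPush_midObj _ n)) ≫
      eqToHom (SymFunHom.comp_app g' f' _ _ n (midObj _ n) m h (isPush_midObj _ n)
        (isPush_of_sigmaEmb h (isPush_midObj _ n))).symm
    nat n n' m m' h h' φ ψ hψ := by
      choose χ hχ using fun i => exists_pushHom exists_embedding.some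
        (isPush_midObj (fun _ => exists_embedding.some) n i)
        (isPush_midObj (fun _ => exists_embedding.some) n' i) fun k => φ ⟨i, k⟩
      have := SymFunHom.compMapApp_nat q p exists_embedding.some (fun _ => exists_embedding.some)
        n n' _ _ m m' (isPush_midObj _ n) (isPush_of_sigmaEmb h (isPush_midObj _ n))
        (isPush_midObj _ n') (isPush_of_sigmaEmb h' (isPush_midObj _ n')) φ χ ψ hχ
        (isPushHom_of_sigmaEmb hψ hχ)
      refine (whiskerLeft_heq (SymFunHom.comp_app ..) (SymFunHom.comp_app ..)
        ((eqToHom_comp_heq _ _).trans (comp_eqToHom_heq _ _)) rfl).trans (this.trans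
          (whiskerRight_heq (SymFunHom.comp_app ..) (SymFunHom.comp_app ..)
        ((eqToHom_comp_heq _ _).trans (comp_eqToHom_heq _ _)) rfl).symm)
    equivariant θ θ' k n l m h h' hn hm hθ := by
      obtain ⟨ω, hl, hω, hω'⟩ := exists_mid_perm _ _ θ θ' k n hn hθ
      have := SymFunHom.compMapApp_bang q p exists_embedding.some exists_embedding.some
        (fun _ => exists_embedding.some) (fun _ => exists_embedding.some) θ ω θ' n k _ _ m l
        (isPush_midObj _ n) (isPush_of_sigmaEmb h (isPush_midObj _ n))
        (isPush_midObj _ k) (isPush_of_sigmaEmb h' (isPush_midObj _ k)) hn hl hm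
        (fun i k j _ => hω i k j) hω'
      refine (whiskerLeft_heq (SymFunHom.comp_app ..) (SymFunHom.comp_app ..)
        ((eqToHom_comp_heq _ _).trans (comp_eqToHom_heq _ _)) rfl).trans (this.trans
          (whiskerRight_heq (SymFunHom.comp_app ..) (SymFunHom.comp_app ..)
        ((eqToHom_comp_heq _ _).trans (comp_eqToHom_heq _ _)) rfl).symm) }

theorem SymFunHom.compMap_app (β : ι × ℕ ↪ ℕ) (α : ∀ i, κ i × ℕ ↪ ℕ) (n : (Σ i, κ i) → Finfty)
    (l : ι → Finfty) (m : Finfty) (h : IsPush (sigmaEmb β α) n m)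
    (h₁ : ∀ i, IsPush (α i) (fun k => n ⟨i, k⟩) (l i))
    (h₂ : IsPush β l m) : HEq (SymFunHom.Hom.app (SymFunHom.compMap q p) (sigmaEmb β α) n m h)
      (SymFunHom.compMapApp q p β α n l m h₁ h₂) := by
  let β₀ : ι × ℕ ↪ ℕ := exists_embedding.some
  let α₀ : ∀ i, κ i × ℕ ↪ ℕ := fun _ => exists_embedding.some
  obtain ⟨η, hη⟩ := exists_moves (sigmaEmb β₀ α₀) (sigmaEmb β α) n
  obtain ⟨ω, hl, hω, hω'⟩ := exists_mid_moves hη l h₁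
  have b := SymFunHom.compMapApp_bang q p β β₀ α α₀ (fun _ => 1) ω η n n l _ m _ h₁ h₂
    (isPush_midObj _ n) (isPush_of_sigmaEmb (h.perm hη) (isPush_midObj _ n))
    (fun _ _ => rfl) hl (fun _ => rfl) (fun i k j hj => hω i k j hj) hω'
  have b' : HEq (SymFunHom.compMapApp q p β α n l m h₁ h₂) _ := HEq.trans (whiskerLeft_heq rfl rfl
    (HEq.refl (SymFunHom.compMapApp q p β α n l m h₁ h₂)) (congrArg Functor.pi
      (funext fun s : Σ i, κ i => congrArg Cat.Hom.toFunctor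
        ((F s.1 s.2).bang_one (n s) fun _ => rfl)).symm)) b
  refine (SymFunHom.Hom.change_β (SymFunHom.compMap q p) (sigmaEmb β₀ α₀) _ η n _ m (h.perm hη)
    h (fun _ => rfl) hη).symm.trans (HEq.trans ?_ b'.symm)
  exact whiskerRight_heq (SymFunHom.comp_app ..) (SymFunHom.comp_app ..)
    ((heq_of_eq (SymFunHom.HomCore.toHom_app _ _ _ _)).trans
      ((eqToHom_comp_heq _ _).trans (comp_eqToHom_heq _ _))) rfl

end valuesMap

end comp

/-! ### The multicategory of symmetric functors -/

section laws

variable {ι : Type} [Finite ι] {F : ι → SymFun.{u}} {G : SymFun.{u}}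

theorem SymFunHom.act_refl (f : SymFunHom F G) : f.act (Equiv.refl ι) = f :=
  (SymFunHom.eq_act (Equiv.refl ι) exists_embedding.some f fun _ _ _ _ => rfl).symm

theorem SymFunHom.act_trans {κ μ : Type} [Finite μ] (d : μ ≃ κ) (e : κ ≃ ι) (f : SymFunHom F G) :
    f.act (d.trans e) = (f.act e).act d :=
  (SymFunHom.eq_act (d.trans e) exists_embedding.some ((f.act e).act d) fun n m h h' =>
    (congrArg (comapF e (fun i => (F i).F.obj (n i)) ⋙ ·) ((f.act e).comapF_actApp d
      (preEmb e exists_embedding.some) (fun k => n (e k)) m h (isPush_preEmb.2 h'))).trans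
      (f.comapF_actApp e _ n m (isPush_preEmb.2 h') h')).symm

theorem SymFunHom.comp_one (f : SymFunHom F G) :
    SymFunHom.comp f (fun i => SymFunHom.one (F i)) =
      f.act (Equiv.sigmaUnique ι (fun _ => Unit)) := by
  let β : ι × ℕ ↪ ℕ := exists_embedding.some
  refine SymFunHom.eq_act (Equiv.sigmaUnique ι (fun _ => Unit)) β _ fun n m h h' => ?_
  refine (congrArg (comapF (Equiv.sigmaUnique ι (fun _ => Unit)) (fun i => (F i).F.obj (n i)) ⋙ ·)
    (SymFunHom.comp_app f (fun i => SymFunHom.one (F i)) β (fun _ => unitEmb) (fun s => n s.1)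
      n m h (fun i => isPush_unitEmb (n i)) h')).trans ?_
  exact congrArg (fun t => comapF (Equiv.sigmaUnique ι (fun _ => Unit)) (fun i => (F i).F.obj (n i)) ⋙
    sigmaPi (X := fun i _ => (F i).F.obj (n i)) t ⋙ f.app β n m h')
    (funext fun i => SymFunHom.one_app (F i) (n i) (isPush_unitEmb (n i)))

theorem SymFunHom.one_comp (f : SymFunHom F G) :
    SymFunHom.comp (SymFunHom.one G) (fun _ => f) =
      f.act (Equiv.uniqueSigma (fun _ : Unit => ι)) := by
  let β : ι × ℕ ↪ ℕ := exists_embedding.some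
  refine SymFunHom.eq_act (Equiv.uniqueSigma (fun _ : Unit => ι)) β _ fun n m h h' => ?_
  refine (congrArg (comapF (Equiv.uniqueSigma (fun _ : Unit => ι)) (fun i => (F i).F.obj (n i)) ⋙ ·)
    (SymFunHom.comp_app (SymFunHom.one G) (fun _ => f) unitEmb (fun _ => β) (fun s => n s.2)
      (fun _ => m) m h (fun i => h') (isPush_unitEmb m))).trans ?_
  exact congrArg (fun t => comapF (Equiv.uniqueSigma (fun _ : Unit => ι)) (fun i => (F i).F.obj (n i)) ⋙
    sigmaPi (X := fun (_ : Unit) i => (F i).F.obj (n i)) (fun _ => f.app β n m h') ⋙ t)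
    (SymFunHom.one_app G m (isPush_unitEmb m))

end laws

section assoc

variable {ι : Type} [Finite ι] {κ : ι → Type} [∀ i, Finite (κ i)] {F : ∀ i, κ i → SymFun.{u}}
  {G : ι → SymFun.{u}} {H : SymFun.{u}}

theorem SymFunHom.comp_assoc {μ : ∀ i, κ i → Type} [∀ i k, Finite (μ i k)]
    {E : ∀ i k, μ i k → SymFun.{u}}
    (g : SymFunHom G H) (f : ∀ i, SymFunHom (F i) (G i)) (h : ∀ i k, SymFunHom (E i k) (F i k)) :
    SymFunHom.comp (SymFunHom.comp g f) (fun s : Σ i, κ i => h s.1 s.2) =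
      (SymFunHom.comp g (fun i => SymFunHom.comp (f i) (h i))).act (Equiv.sigmaAssoc μ) := by
  let β : ι × ℕ ↪ ℕ := exists_embedding.some
  let α : ∀ i, κ i × ℕ ↪ ℕ := fun _ => exists_embedding.some
  let γ : ∀ i k, μ i k × ℕ ↪ ℕ := fun _ _ => exists_embedding.some
  refine SymFunHom.eq_act (F := fun s : Σ i, Σ k, μ i k => E s.1 s.2.1 s.2.2) (Equiv.sigmaAssoc μ)
    (sigmaEmb β fun i => sigmaEmb (α i) (γ i)) _ fun n m h₁ h₂ => ?_
  let l : (Σ i, κ i) → Finfty := fun s => midObj (γ s.1) (fun t => n ⟨s.1, t⟩) s.2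
  let k : ι → Finfty := midObj α l
  have hl : ∀ s : Σ i, κ i, IsPush (γ s.1 s.2) (fun t => n ⟨s.1, s.2, t⟩) (l s) := fun s =>
    isPush_midObj (γ s.1) (fun t => n ⟨s.1, t⟩) s.2
  have hk : ∀ i, IsPush (α i) (fun k => l ⟨i, k⟩) (k i) := isPush_midObj α l
  have hk' := fun i => isPush_sigmaEmb (κ := μ i) (β := α i) (α := γ i) (n := fun t => n ⟨i, t⟩) (fun k => hl ⟨i, k⟩) (hk i)
  have hm : IsPush β k m := isPush_of_sigmaEmb h₂ hk'
  have e₁ := SymFunHom.comp_app (SymFunHom.comp g f) (fun s : Σ i, κ i => h s.1 s.2)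
    (sigmaEmb β α) (fun s => γ s.1 s.2) (fun t => n ⟨t.1.1, t.1.2, t.2⟩) l m h₁ hl
    (isPush_sigmaEmb hk hm)
  have e₂ := SymFunHom.comp_app g f β α l k m (isPush_sigmaEmb hk hm) hk hm
  have e₃ := SymFunHom.comp_app g (fun i => SymFunHom.comp (f i) (h i)) β
    (fun i => sigmaEmb (α i) (γ i)) n k m h₂ hk' hm
  have e₄ := fun i => SymFunHom.comp_app (f i) (h i) (α i) (γ i) (fun t => n ⟨i, t⟩)
    (fun k => l ⟨i, k⟩) (k i) (hk' i) (fun k => hl ⟨i, k⟩) (hk i)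
  refine Eq.trans ?_ (e₃.trans (congrArg (fun t => sigmaPi (X := fun i (s : Σ k, μ i k) =>
    (E i s.1 s.2).F.obj (n ⟨i, s⟩)) t ⋙ g.app β k m hm) (funext e₄))).symm
  refine (congrArg (comapF (Equiv.sigmaAssoc μ) (fun s : Σ i, Σ k, μ i k =>
    (E s.1 s.2.1 s.2.2).F.obj (n s)) ⋙ ·) e₁).trans ?_
  exact congrArg (fun t => comapF (Equiv.sigmaAssoc μ) (fun s : Σ i, Σ k, μ i k =>
    (E s.1 s.2.1 s.2.2).F.obj (n s)) ⋙ sigmaPi (X := fun (s : Σ i, κ i) (k : μ s.1 s.2) =>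
      (E s.1 s.2 k).F.obj (n ⟨s.1, s.2, k⟩)) (fun s => (h s.1 s.2).app (γ s.1 s.2) _ _ (hl s)) ⋙ t) e₂

theorem SymFunHom.act_comp {ι' : Type} [Finite ι'] (e : ι' ≃ ι) (g : SymFunHom G H)
    (f : ∀ i, SymFunHom (F i) (G i)) :
    SymFunHom.comp (g.act e) (fun i => f (e i)) =
      (SymFunHom.comp g f).act (Equiv.sigmaCongrLeft (β := κ) e) := by
  let β : ι × ℕ ↪ ℕ := exists_embedding.some
  let α : ∀ i, κ i × ℕ ↪ ℕ := fun _ => exists_embedding.some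
  refine SymFunHom.eq_act (F := fun s : Σ i, κ i => F s.1 s.2) (Equiv.sigmaCongrLeft (β := κ) e)
    (sigmaEmb β α) _ fun n m h₁ h₂ => ?_
  have hl := isPush_midObj α n
  have hm := isPush_of_sigmaEmb h₂ hl
  refine Eq.trans ?_ (SymFunHom.comp_app g f β α n _ m h₂ hl hm).symm
  refine (congrArg (comapF (Equiv.sigmaCongrLeft (β := κ) e) (fun s : Σ i, κ i =>
    (F s.1 s.2).F.obj (n s)) ⋙ ·) (SymFunHom.comp_app (g.act e) (fun i => f (e i)) (preEmb e β)
      (fun i => α (e i)) (fun s => n ⟨e s.1, s.2⟩) (fun i => midObj α n (e i)) m h₁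
      (fun i => hl (e i)) (isPush_preEmb.2 hm))).trans ?_
  exact congrArg (fun t => sigmaPi (X := fun i k => (F i k).F.obj (n ⟨i, k⟩)) (fun i => (f i).app (α i) _ _ (hl i)) ⋙ t)
    (g.comapF_actApp e β (midObj α n) m (isPush_preEmb.2 hm) hm)

theorem SymFunHom.comp_act {κ' : ι → Type} [∀ i, Finite (κ' i)] (e : ∀ i, κ' i ≃ κ i)
    (g : SymFunHom G H) (f : ∀ i, SymFunHom (F i) (G i)) :
    SymFunHom.comp g (fun i => (f i).act (e i)) =
      (SymFunHom.comp g f).act (Equiv.sigmaCongrRight e) := by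
  let β : ι × ℕ ↪ ℕ := exists_embedding.some
  let α : ∀ i, κ i × ℕ ↪ ℕ := fun _ => exists_embedding.some
  refine SymFunHom.eq_act (F := fun s : Σ i, κ i => F s.1 s.2) (Equiv.sigmaCongrRight e)
    (sigmaEmb β α) _ fun n m h₁ h₂ => ?_
  have hl := isPush_midObj α n
  have hm := isPush_of_sigmaEmb h₂ hl
  refine Eq.trans ?_ (SymFunHom.comp_app g f β α n _ m h₂ hl hm).symm
  refine (congrArg (comapF (Equiv.sigmaCongrRight e) (fun s : Σ i, κ i =>
    (F s.1 s.2).F.obj (n s)) ⋙ ·) (SymFunHom.comp_app g (fun i => (f i).act (e i)) β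
      (fun i => preEmb (e i) (α i)) (fun s => n ⟨s.1, e s.1 s.2⟩) (midObj α n) m h₁
      (fun i => isPush_preEmb.2 (hl i)) hm)).trans ?_
  exact congrArg (fun t => sigmaPi (X := fun i k => (F i k).F.obj (n ⟨i, k⟩)) t ⋙ g.app β _ m hm)
    (funext fun i => (f i).comapF_actApp (e i) (α i) (fun k => n ⟨i, k⟩) _ (isPush_preEmb.2 (hl i))
      (hl i))

end assoc

/-- The multicategory of symmetric functors. -/
def symFunMulticat : CatMulticat symFunGraph.{u} where
  act e _ _ f := f.act e
  one F := SymFunHom.one F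
  comp g f := SymFunHom.comp g f
  act_refl f := f.act_refl
  act_trans d e _ _ f := f.act_trans d e
  assoc g f h := g.comp_assoc f h
  comp_one f := f.comp_one
  one_comp f := f.one_comp
  act_comp e _ _ _ _ _ g f := g.act_comp e f
  comp_act e _ _ _ g f := g.comp_act e f
  actMap e _ _ _ _ φ := SymFunHom.actMap e φ
  compMap γ φ := SymFunHom.compMap γ φ
  actMap_id {_ _ _ _} e {_ _} f := (eq_of_heq (SymFunHom.heq_actMap e exists_embedding.some rfl rfl (𝟙 (f.act e))
    fun n m h h' => by
      have := f.comapF_actApp e _ n m h h'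
      change HEq (Functor.whiskerLeft _ (𝟙 _)) (𝟙 (f.app _ n m h'))
      rw [Functor.whiskerLeft_id', ← this]
      rfl)).symm
  actMap_comp {_ _ _ _} e {_ _ f g h} φ ψ := (eq_of_heq (SymFunHom.heq_actMap e
    exists_embedding.some rfl rfl (SymFunHom.actMap e φ ≫ SymFunHom.actMap e ψ) (p := φ ≫ ψ) fun n m k k' =>
      comp_heq (f.comapF_actApp e _ n m k k') (g.comapF_actApp e _ n m k k')
        (h.comapF_actApp e _ n m k k') (SymFunHom.comapF_actMapApp e φ _ n m k k')
        (SymFunHom.comapF_actMapApp e ψ _ n m k k'))).symm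
  compMap_id {ι _ κ _ _ _ _} g f := eq_of_heq (by
    let β : ι × ℕ ↪ ℕ := exists_embedding.some
    let α : ∀ i, κ i × ℕ ↪ ℕ := fun _ => exists_embedding.some
    refine SymFunHom.Hom.heq_of (sigmaEmb β α) rfl rfl _ _ fun n m h => ?_
    have h₁ := isPush_midObj α n
    have h₂ := isPush_of_sigmaEmb h h₁
    refine (SymFunHom.compMap_app (𝟙 g) (fun i => 𝟙 (f i)) β α n _ m h h₁ h₂).trans ?_
    change HEq _ (𝟙 ((SymFunHom.comp g f).app (sigmaEmb β α) n m h))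
    rw [SymFunHom.comp_app g f β α n _ m h h₁ h₂]
    exact heq_of_eq (NatTrans.ext (funext fun x =>
      (Category.comp_id _).trans ((g.app β _ m h₂).map_id _))))
  compMap_comp {ι _ κ _ _ _ _ g g' g'' f f' f''} γ γ' φ φ' := eq_of_heq (by
    let β : ι × ℕ ↪ ℕ := exists_embedding.some
    let α : ∀ i, κ i × ℕ ↪ ℕ := fun _ => exists_embedding.some
    refine SymFunHom.Hom.heq_of (sigmaEmb β α) rfl rfl _ _ fun n m h => ?_
    have h₁ := isPush_midObj α n
    have h₂ := isPush_of_sigmaEmb h h₁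
    refine (SymFunHom.compMap_app (γ ≫ γ') (fun i => φ i ≫ φ' i) β α n _ m h h₁ h₂).trans ?_
    refine HEq.trans ?_ (comp_heq (SymFunHom.comp_app g f β α n _ m h h₁ h₂)
      (SymFunHom.comp_app g' f' β α n _ m h h₁ h₂) (SymFunHom.comp_app g'' f'' β α n _ m h h₁ h₂)
      (SymFunHom.compMap_app γ φ β α n _ m h h₁ h₂)
      (SymFunHom.compMap_app γ' φ' β α n _ m h h₁ h₂)).symm
    refine heq_of_eq (NatTrans.ext (funext fun x => ?_))
    refine Eq.trans ?_ (Category.assoc _ _ _).symm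
    refine (congrArg (· ≫ _) ((g.app β _ m h₂).map_comp _ _)).trans ?_
    refine (Category.assoc _ _ _).trans (congrArg (_ ≫ ·) ?_)
    refine Eq.trans ?_ (Category.assoc _ _ _)
    refine Eq.trans (Category.assoc _ _ _).symm (congrArg (· ≫ _) ?_)
    exact (SymFunHom.Hom.app γ β _ m h₂).naturality _)
  actMap_refl {_ _ _ _ f g} φ := (SymFunHom.heq_actMap (Equiv.refl _) exists_embedding.some
    (f' := f) (g' := g) f.act_refl.symm g.act_refl.symm φ fun _ _ _ _ => HEq.rfl).symm
  actMap_trans {_ _ _ _ _ _} d e {F _ f g} φ := (SymFunHom.heq_actMap (d.trans e)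
    exists_embedding.some (f.act_trans d e).symm (g.act_trans d e).symm
      (SymFunHom.actMap d (SymFunHom.actMap e φ)) fun n m h h' =>
      (whiskerLeft_heq
        ((f.act e).comapF_actApp d (preEmb e _) (fun k => n (e k)) m h (isPush_preEmb.2 h'))
        ((g.act e).comapF_actApp d (preEmb e _) (fun k => n (e k)) m h (isPush_preEmb.2 h'))
        (SymFunHom.comapF_actMapApp d (SymFunHom.actMap e φ) (preEmb e _) (fun k => n (e k)) m h
          (isPush_preEmb.2 h')) (Eq.refl (comapF e (fun i => (F i).F.obj (n i))))).trans
      (SymFunHom.comapF_actMapApp e φ _ n m (isPush_preEmb.2 h') h')).symm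
  assocMap {ι _ κ _ μ _ E F G H g g' f f' h h'} γ φ χ := by
    let β : ι × ℕ ↪ ℕ := exists_embedding.some
    let α : ∀ i, κ i × ℕ ↪ ℕ := fun _ => exists_embedding.some
    let ε : ∀ i k, μ i k × ℕ ↪ ℕ := fun _ _ => exists_embedding.some
    refine SymFunHom.heq_actMap (F := fun s : Σ i, Σ k, μ i k => E s.1 s.2.1 s.2.2)
      (Equiv.sigmaAssoc μ) (sigmaEmb β fun i => sigmaEmb (α i) (ε i)) (g.comp_assoc f h)
      (g'.comp_assoc f' h') _ fun n m h₁ h₂ => ?_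
    let l : (Σ i, κ i) → Finfty := fun s => midObj (ε s.1) (fun t => n ⟨s.1, t⟩) s.2
    let k : ι → Finfty := midObj α l
    have hl : ∀ s : Σ i, κ i, IsPush (ε s.1 s.2) (fun t => n ⟨s.1, s.2, t⟩) (l s) := fun s =>
      isPush_midObj (ε s.1) (fun t => n ⟨s.1, t⟩) s.2
    have hk : ∀ i, IsPush (α i) (fun k => l ⟨i, k⟩) (k i) := isPush_midObj α l
    have hk' := fun i => isPush_sigmaEmb (κ := μ i) (β := α i) (α := ε i) (n := fun t => n ⟨i, t⟩)
      (fun k => hl ⟨i, k⟩) (hk i)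
    have hm : IsPush β k m := isPush_of_sigmaEmb h₂ hk'
    have e₁ := fun (g : SymFunHom G H) (f : ∀ i, SymFunHom (F i) (G i))
      (h : ∀ i k, SymFunHom (E i k) (F i k)) => SymFunHom.comp_app (SymFunHom.comp g f)
      (fun s : Σ i, κ i => h s.1 s.2)
      (sigmaEmb β α) (fun s => ε s.1 s.2) (fun t => n ⟨t.1.1, t.1.2, t.2⟩) l m h₁ hl
      (isPush_sigmaEmb hk hm)
    have e₁' := SymFunHom.compMap_app (SymFunHom.compMap γ φ)
      (fun s : Σ i, κ i => χ s.1 s.2)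
      (sigmaEmb β α) (fun s => ε s.1 s.2) (fun t => n ⟨t.1.1, t.1.2, t.2⟩) l m h₁ hl
      (isPush_sigmaEmb hk hm)
    have e₂ := fun (g : SymFunHom G H) (f : ∀ i, SymFunHom (F i) (G i)) =>
      SymFunHom.comp_app g f β α l k m (isPush_sigmaEmb hk hm) hk hm
    have e₂' := SymFunHom.compMap_app γ φ β α l k m (isPush_sigmaEmb hk hm) hk hm
    have e₃' := SymFunHom.compMap_app γ (fun i => SymFunHom.compMap (φ i) (χ i)) β
      (fun i => sigmaEmb (α i) (ε i)) n k m h₂ hk' hm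
    have e₄ := fun (f : ∀ i, SymFunHom (F i) (G i)) (h : ∀ i k, SymFunHom (E i k) (F i k)) i =>
      SymFunHom.comp_app (f i) (h i) (α i) (ε i) (fun t => n ⟨i, t⟩)
        (fun k => l ⟨i, k⟩) (k i) (hk' i) (fun k => hl ⟨i, k⟩) (hk i)
    have e₄' := fun i =>
      SymFunHom.compMap_app (φ i) (χ i) (α i) (ε i) (fun t => n ⟨i, t⟩)
        (fun k => l ⟨i, k⟩) (k i) (hk' i) (fun k => hl ⟨i, k⟩) (hk i)
    let h₀ := fun s : Σ i, κ i => (h s.1 s.2).app (ε s.1 s.2) _ _ (hl s)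
    let h₀' := fun s : Σ i, κ i => (h' s.1 s.2).app (ε s.1 s.2) _ _ (hl s)
    let χ₀ : ∀ s : Σ i, κ i, h₀ s ⟶ h₀' s := fun s =>
      SymFunHom.Hom.app (χ s.1 s.2) (ε s.1 s.2) _ _ (hl s)
    let c := comapF (Equiv.sigmaAssoc μ) (fun s : Σ i, Σ k, μ i k =>
        (E s.1 s.2.1 s.2.2).F.obj (n s))
    have k₁ : HEq (SymFunHom.Hom.app (SymFunHom.compMap (SymFunHom.compMap γ φ)
        (fun s : Σ i, κ i => χ s.1 s.2)) (sigmaEmb (sigmaEmb β α) (fun s => ε s.1 s.2))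
        (fun t => n ⟨t.1.1, t.1.2, t.2⟩) m h₁) (Functor.whiskerRight (sigmaPiNat (X := fun (s : Σ i, κ i) (k : μ s.1 s.2) => (E s.1 s.2 k).F.obj (n ⟨s.1, s.2, k⟩)) χ₀)
        (SymFunHom.compApp g f β α l k m hk hm) ≫
      Functor.whiskerLeft (sigmaPi (X := fun (s : Σ i, κ i) (k : μ s.1 s.2) => (E s.1 s.2 k).F.obj (n ⟨s.1, s.2, k⟩)) h₀') (SymFunHom.compMapApp γ φ β α l k m hk hm)) := by
      refine e₁'.trans (comp_heq (congrArg (sigmaPi (X := fun (s : Σ i, κ i) (k : μ s.1 s.2) => (E s.1 s.2 k).F.obj (n ⟨s.1, s.2, k⟩)) h₀ ⋙ ·) (e₂ g f))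
        (congrArg (sigmaPi (X := fun (s : Σ i, κ i) (k : μ s.1 s.2) => (E s.1 s.2 k).F.obj (n ⟨s.1, s.2, k⟩)) h₀' ⋙ ·) (e₂ g f)) (congrArg (sigmaPi (X := fun (s : Σ i, κ i) (k : μ s.1 s.2) => (E s.1 s.2 k).F.obj (n ⟨s.1, s.2, k⟩)) h₀' ⋙ ·) (e₂ g' f')) ?_ ?_)
      · exact whiskerRight_heq rfl rfl (HEq.refl (sigmaPiNat (X := fun (s : Σ i, κ i) (k : μ s.1 s.2) => (E s.1 s.2 k).F.obj (n ⟨s.1, s.2, k⟩)) χ₀)) (e₂ g f)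
      · exact whiskerLeft_heq (e₂ g f) (e₂ g' f') e₂' (Eq.refl (sigmaPi (X := fun (s : Σ i, κ i) (k : μ s.1 s.2) => (E s.1 s.2 k).F.obj (n ⟨s.1, s.2, k⟩)) h₀'))
    refine HEq.trans (b := Functor.whiskerLeft c (Functor.whiskerRight (sigmaPiNat (X := fun (s : Σ i, κ i) (k : μ s.1 s.2) => (E s.1 s.2 k).F.obj (n ⟨s.1, s.2, k⟩)) χ₀)
        (SymFunHom.compApp g f β α l k m hk hm) ≫
      Functor.whiskerLeft (sigmaPi (X := fun (s : Σ i, κ i) (k : μ s.1 s.2) => (E s.1 s.2 k).F.obj (n ⟨s.1, s.2, k⟩)) h₀') (SymFunHom.compMapApp γ φ β α l k m hk hm))) ?_ ?_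
    · exact whiskerLeft_heq ((e₁ g f h).trans (congrArg (sigmaPi (X := fun (s : Σ i, κ i) (k : μ s.1 s.2) => (E s.1 s.2 k).F.obj (n ⟨s.1, s.2, k⟩)) h₀ ⋙ ·) (e₂ g f)))
        ((e₁ g' f' h').trans (congrArg (sigmaPi (X := fun (s : Σ i, κ i) (k : μ s.1 s.2) => (E s.1 s.2 k).F.obj (n ⟨s.1, s.2, k⟩)) h₀' ⋙ ·) (e₂ g' f'))) k₁ (Eq.refl c)
    · refine HEq.trans ?_ e₃'.symm
      refine HEq.trans ?_ (comp_heq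
        (congrArg (fun t => sigmaPi (X := fun i (s : Σ k, μ i k) => (E i s.1 s.2).F.obj (n ⟨i, s⟩)) t ⋙ g.app β k m hm) (funext (e₄ f h)).symm)
        (congrArg (fun t => sigmaPi (X := fun i (s : Σ k, μ i k) => (E i s.1 s.2).F.obj (n ⟨i, s⟩)) t ⋙ g.app β k m hm) (funext (e₄ f' h')).symm)
        (congrArg (fun t => sigmaPi (X := fun i (s : Σ k, μ i k) => (E i s.1 s.2).F.obj (n ⟨i, s⟩)) t ⋙ g'.app β k m hm) (funext (e₄ f' h')).symm)
        (whiskerRight_heq (congrArg (sigmaPi (X := fun i (s : Σ k, μ i k) => (E i s.1 s.2).F.obj (n ⟨i, s⟩))) (funext (e₄ f h)).symm)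
          (congrArg (sigmaPi (X := fun i (s : Σ k, μ i k) => (E i s.1 s.2).F.obj (n ⟨i, s⟩))) (funext (e₄ f' h')).symm)
          (sigmaPiNat_heq (X := fun i (s : Σ k, μ i k) => (E i s.1 s.2).F.obj (n ⟨i, s⟩)) (funext (e₄ f h)).symm (funext (e₄ f' h')).symm fun i => (e₄' i).symm)
          (Eq.refl (g.app β k m hm)))
        (whiskerLeft_heq rfl rfl (HEq.refl (SymFunHom.Hom.app γ β k m hm))
          (congrArg (sigmaPi (X := fun i (s : Σ k, μ i k) => (E i s.1 s.2).F.obj (n ⟨i, s⟩))) (funext (e₄ f' h')).symm)))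
      refine heq_of_eq (NatTrans.ext (funext fun x => ?_))
      refine (Category.assoc _ _ _).symm.trans (congrArg (· ≫ _) ?_)
      exact ((g.app β k m hm).map_comp _ _).symm
  compMap_one {ι _ F G f g} φ := by
    let β : ι × ℕ ↪ ℕ := exists_embedding.some
    refine SymFunHom.heq_actMap (Equiv.sigmaUnique ι (fun _ => Unit)) β f.comp_one g.comp_one _
      fun n m h h' => ?_
    have e : ∀ f : SymFunHom F G, (SymFunHom.comp f (fun i => SymFunHom.one (F i))).app
        (sigmaEmb β fun _ => unitEmb) (fun s => n s.1) m h =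
        sigmaPi (X := fun i (_ : Unit) => (F i).F.obj (n i)) (fun i => evalUnit fun _ => (F i).F.obj (n i)) ⋙ f.app β n m h' := fun f =>
      (SymFunHom.comp_app f (fun i => SymFunHom.one (F i)) β (fun _ => unitEmb) (fun s => n s.1)
        n m h (fun i => isPush_unitEmb (n i)) h').trans (congrArg (fun t => sigmaPi (X := fun i (_ : Unit) => (F i).F.obj (n i)) t ⋙
          f.app β n m h') (funext fun i => SymFunHom.one_app (F i) (n i) (isPush_unitEmb (n i))))
    have e' := SymFunHom.compMap_app φ (fun i => 𝟙 (SymFunHom.one (F i))) β (fun _ => unitEmb)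
      (fun s => n s.1) n m h (fun i => isPush_unitEmb (n i)) h'
    have k : HEq (SymFunHom.Hom.app (SymFunHom.compMap φ (fun i => 𝟙 (SymFunHom.one (F i))))
        (sigmaEmb β fun _ => unitEmb) (fun s => n s.1) m h) (Functor.whiskerLeft (sigmaPi (X := (fun i (_ : Unit) => (F i).F.obj (n i)))
        fun i => evalUnit fun _ => (F i).F.obj (n i)) (SymFunHom.Hom.app φ β n m h')) := by
      refine e'.trans (HEq.trans (heq_of_eq ?_) (whiskerLeft_heq rfl rfl
        (HEq.refl (SymFunHom.Hom.app φ β n m h')) (congrArg (sigmaPi (X := (fun i (_ : Unit) => (F i).F.obj (n i))))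
          (funext fun i => SymFunHom.one_app (F i) (n i) (isPush_unitEmb (n i))))))
      refine NatTrans.ext (funext fun x => ?_)
      exact (congrArg (· ≫ _) ((f.app β n m h').map_id _)).trans (Category.id_comp _)
    exact whiskerLeft_heq (e f) (e g) k
      (Eq.refl (comapF (Equiv.sigmaUnique ι (fun _ => Unit)) (fun i => (F i).F.obj (n i))))
  one_compMap {ι _ F G f g} φ := by
    let β : ι × ℕ ↪ ℕ := exists_embedding.some
    refine SymFunHom.heq_actMap (Equiv.uniqueSigma (fun _ : Unit => ι)) β f.one_comp g.one_comp _
      fun n m h h' => ?_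
    have e₀ := SymFunHom.one_app G m (isPush_unitEmb m)
    have e : ∀ f : SymFunHom F G, (SymFunHom.comp (SymFunHom.one G) (fun _ => f)).app
        (sigmaEmb unitEmb fun _ => β) (fun s => n s.2) m h =
        sigmaPi (X := fun (_ : Unit) i => (F i).F.obj (n i)) (fun _ => f.app β n m h') ⋙ evalUnit fun _ => G.F.obj m := fun f =>
      (SymFunHom.comp_app (SymFunHom.one G) (fun _ => f) unitEmb (fun _ => β) (fun s => n s.2)
        (fun _ => m) m h (fun i => h') (isPush_unitEmb m)).trans (congrArg (sigmaPi (X := fun (_ : Unit) i => (F i).F.obj (n i))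
          (fun _ => f.app β n m h') ⋙ ·) e₀)
    have e' := SymFunHom.compMap_app (𝟙 (SymFunHom.one G)) (fun _ => φ) unitEmb (fun _ => β)
      (fun s => n s.2) (fun _ => m) m h (fun i => h') (isPush_unitEmb m)
    have k : HEq (SymFunHom.Hom.app (SymFunHom.compMap (𝟙 (SymFunHom.one G)) (fun _ => φ))
        (sigmaEmb unitEmb fun _ => β) (fun s => n s.2) m h) (Functor.whiskerRight
        (sigmaPiNat (X := (fun (_ : Unit) i => (F i).F.obj (n i))) fun _ => SymFunHom.Hom.app φ β n m h') (evalUnit fun _ => G.F.obj m)) := by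
      refine e'.trans (HEq.trans (heq_of_eq ?_) (whiskerRight_heq rfl rfl
        (HEq.refl (sigmaPiNat (X := (fun (_ : Unit) i => (F i).F.obj (n i))) fun _ => SymFunHom.Hom.app φ β n m h')) e₀))
      exact NatTrans.ext (funext fun x => Category.comp_id _)
    exact whiskerLeft_heq (e f) (e g) k
      (Eq.refl (comapF (Equiv.uniqueSigma (fun _ : Unit => ι)) (fun i => (F i).F.obj (n i))))
  actMap_compMap {ι _ _ _} e {κ} _ {F G H g g' f f'} γ φ := by
    let β : ι × ℕ ↪ ℕ := exists_embedding.some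
    let α : ∀ i, κ i × ℕ ↪ ℕ := fun _ => exists_embedding.some
    refine SymFunHom.heq_actMap (F := fun s : Σ i, κ i => F s.1 s.2)
      (Equiv.sigmaCongrLeft (β := κ) e) (sigmaEmb β α) (g.act_comp e f) (g'.act_comp e f') _
      fun n m h₁ h₂ => ?_
    have hl := isPush_midObj α n
    have hm := isPush_of_sigmaEmb h₂ hl
    refine HEq.trans ?_ (SymFunHom.compMap_app γ φ β α n _ m h₂ hl hm).symm
    have e₁ := fun (g : SymFunHom G H) (f : ∀ i, SymFunHom (F i) (G i)) =>
      SymFunHom.comp_app (g.act e) (fun i => f (e i)) (preEmb e β)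
      (fun i => α (e i)) (fun s => n ⟨e s.1, s.2⟩) (fun i => midObj α n (e i)) m h₁
      (fun i => hl (e i)) (isPush_preEmb.2 hm)
    have e₂ := fun g : SymFunHom G H =>
      g.comapF_actApp e β (midObj α n) m (isPush_preEmb.2 hm) hm
    refine (whiskerLeft_heq (e₁ g f) (e₁ g' f') (SymFunHom.compMap_app (SymFunHom.actMap e γ)
      (fun i => φ (e i)) (preEmb e β)
      (fun i => α (e i)) (fun s => n ⟨e s.1, s.2⟩) (fun i => midObj α n (e i)) m h₁
      (fun i => hl (e i)) (isPush_preEmb.2 hm)) (Eq.refl (comapF (Equiv.sigmaCongrLeft (β := κ) e)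
      (fun s : Σ i, κ i => (F s.1 s.2).F.obj (n s))))).trans ?_
    let f₀ := fun (f : ∀ i, SymFunHom (F i) (G i)) i => (f i).app (α i) _ _ (hl i)
    exact comp_heq (congrArg (sigmaPi (X := fun i k => (F i k).F.obj (n ⟨i, k⟩)) (f₀ f) ⋙ ·) (e₂ g))
      (congrArg (sigmaPi (X := fun i k => (F i k).F.obj (n ⟨i, k⟩)) (f₀ f') ⋙ ·) (e₂ g))
      (congrArg (sigmaPi (X := fun i k => (F i k).F.obj (n ⟨i, k⟩)) (f₀ f') ⋙ ·) (e₂ g'))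
      (whiskerRight_heq rfl rfl (HEq.refl (sigmaPiNat (X := fun i k => (F i k).F.obj (n ⟨i, k⟩)) fun i =>
        SymFunHom.Hom.app (φ i) (α i) _ _ (hl i))) (e₂ g))
      (whiskerLeft_heq (e₂ g) (e₂ g') (SymFunHom.comapF_actMapApp e γ β (midObj α n) m
        (isPush_preEmb.2 hm) hm) (Eq.refl (sigmaPi (X := fun i k => (F i k).F.obj (n ⟨i, k⟩)) (f₀ f'))))
  compMap_actMap {ι _ κ _ _ _} e {F G H g g' f f'} γ φ := by
    let β : ι × ℕ ↪ ℕ := exists_embedding.some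
    let α : ∀ i, κ i × ℕ ↪ ℕ := fun _ => exists_embedding.some
    refine SymFunHom.heq_actMap (F := fun s : Σ i, κ i => F s.1 s.2)
      (Equiv.sigmaCongrRight e) (sigmaEmb β α) (g.comp_act e f) (g'.comp_act e f') _
      fun n m h₁ h₂ => ?_
    have hl := isPush_midObj α n
    have hm := isPush_of_sigmaEmb h₂ hl
    refine HEq.trans ?_ (SymFunHom.compMap_app γ φ β α n _ m h₂ hl hm).symm
    have e₁ := fun (g : SymFunHom G H) (f : ∀ i, SymFunHom (F i) (G i)) =>
      SymFunHom.comp_app g (fun i => (f i).act (e i)) β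
      (fun i => preEmb (e i) (α i)) (fun s => n ⟨s.1, e s.1 s.2⟩) (midObj α n) m h₁
      (fun i => isPush_preEmb.2 (hl i)) hm
    have e₂ := fun (f : ∀ i, SymFunHom (F i) (G i)) i =>
      (f i).comapF_actApp (e i) (α i) (fun k => n ⟨i, k⟩) _ (isPush_preEmb.2 (hl i)) (hl i)
    have e₃ := fun i => SymFunHom.comapF_actMapApp (e i) (φ i) (α i) (fun k => n ⟨i, k⟩) _
      (isPush_preEmb.2 (hl i)) (hl i)
    refine (whiskerLeft_heq (e₁ g f) (e₁ g' f') (SymFunHom.compMap_app γ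
      (fun i => SymFunHom.actMap (e i) (φ i)) β
      (fun i => preEmb (e i) (α i)) (fun s => n ⟨s.1, e s.1 s.2⟩) (midObj α n) m h₁
      (fun i => isPush_preEmb.2 (hl i)) hm) (Eq.refl (comapF (Equiv.sigmaCongrRight e)
      (fun s : Σ i, κ i => (F s.1 s.2).F.obj (n s))))).trans ?_
    exact comp_heq (congrArg (fun t => sigmaPi (X := fun i k => (F i k).F.obj (n ⟨i, k⟩)) t ⋙ g.app β _ m hm) (funext (e₂ f)))
      (congrArg (fun t => sigmaPi (X := fun i k => (F i k).F.obj (n ⟨i, k⟩)) t ⋙ g.app β _ m hm) (funext (e₂ f')))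
      (congrArg (fun t => sigmaPi (X := fun i k => (F i k).F.obj (n ⟨i, k⟩)) t ⋙ g'.app β _ m hm) (funext (e₂ f')))
      (whiskerRight_heq (congrArg (sigmaPi (X := fun i k => (F i k).F.obj (n ⟨i, k⟩))) (funext (e₂ f)))
        (congrArg (sigmaPi (X := fun i k => (F i k).F.obj (n ⟨i, k⟩))) (funext (e₂ f')))
        (sigmaPiNat_heq (X := fun i k => (F i k).F.obj (n ⟨i, k⟩)) (funext (e₂ f)) (funext (e₂ f')) e₃) (Eq.refl (g.app β _ m hm)))
      (whiskerLeft_heq rfl rfl (HEq.refl (SymFunHom.Hom.app γ β _ m hm))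
        (congrArg (sigmaPi (X := fun i k => (F i k).F.obj (n ⟨i, k⟩))) (funext (e₂ f'))))

theorem obj_eq_of_functor_eq {A B : Type*} [Category A] [Category B] {P Q : A ⥤ B} (h : P = Q)
    (x : A) : P.obj x = Q.obj x := by rw [h]

theorem isSymFunMulticat : IsSymFunMulticat symFunMulticat.{u} where
  act_obj e F G f β β' hβ n m h h' x := by
    obtain rfl : β = preEmb e β' := DFunLike.ext _ _ fun p => hβ p.1 p.2
    exact obj_eq_of_functor_eq (f.comapF_actApp e β' n m h h') x
  act_map e F G f β β' hβ n m h h' x y φ := by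
    obtain rfl : β = preEmb e β' := DFunLike.ext _ _ fun p => hβ p.1 p.2
    exact functor_hext_iff (f.comapF_actApp e β' n m h h') φ
  actMap_app e F G f g p β β' hβ n m h h' x := by
    obtain rfl : β = preEmb e β' := DFunLike.ext _ _ fun p => hβ p.1 p.2
    exact app_heq_of_heq (f.comapF_actApp e β' n m h h') (g.comapF_actApp e β' n m h h')
      (SymFunHom.comapF_actMapApp e p β' n m h h') x
  one_obj F β hβ n h x := by
    obtain rfl : β = unitEmb := DFunLike.ext _ _ fun p => hβ p.2
    exact obj_eq_of_functor_eq (SymFunHom.one_app F n h) x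
  one_map F β hβ n h x y φ := by
    obtain rfl : β = unitEmb := DFunLike.ext _ _ fun p => hβ p.2
    exact functor_hext_iff (SymFunHom.one_app F n h) φ
  comp_obj {ι _ κ _ F G H} g f δ β α hδ n l m h h₁ h₂ x := by
    obtain rfl : δ = sigmaEmb β α := DFunLike.ext _ _ fun p => hδ p.1.1 p.1.2 p.2
    exact obj_eq_of_functor_eq (SymFunHom.comp_app g f β α n l m h h₁ h₂) x
  comp_map {ι _ κ _ F G H} g f δ β α hδ n l m h h₁ h₂ x y φ := by
    obtain rfl : δ = sigmaEmb β α := DFunLike.ext _ _ fun p => hδ p.1.1 p.1.2 p.2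
    exact functor_hext_iff (SymFunHom.comp_app g f β α n l m h h₁ h₂) φ
  compMap_app {ι _ κ _ F G H g g' f f'} q p δ β α hδ n l m h h₁ h₂ x := by
    obtain rfl : δ = sigmaEmb β α := DFunLike.ext _ _ fun p => hδ p.1.1 p.1.2 p.2
    exact app_heq_of_heq (SymFunHom.comp_app g f β α n l m h h₁ h₂)
      (SymFunHom.comp_app g' f' β α n l m h h₁ h₂)
      (SymFunHom.compMap_app q p β α n l m h h₁ h₂) x

/-! ### The multicategory of symmetric spectra -/

section SpHom

variable {ι : Type} {X : ι → SymSpec.{u}} {Y : SymSpec.{u}} {b : SimplexCategory}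

theorem val_of_equiv_heq {p p' : ι → ℕ} (hp : p = p') {N N' : ℕ} (hN : N = N')
    {e : (Σ i, Fin (p i)) ≃ Fin N} {e' : (Σ i, Fin (p' i)) ≃ Fin N'} (h : HEq e e') {j : ι}
    {a : Fin (p j)} {a' : Fin (p' j)} (ha : (a : ℕ) = a') : (e ⟨j, a⟩ : ℕ) = e' ⟨j, a'⟩ := by
  subst hp hN
  rw [eq_of_heq h, Fin.ext ha]

theorem exists_equiv_heq {p p' : ι → ℕ} (hp : p = p') {N : ℕ} (e : (Σ i, Fin (p i)) ≃ Fin N) :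
    ∃ e' : (Σ i, Fin (p' i)) ≃ Fin N, HEq e' e := by
  subst hp
  exact ⟨e, HEq.rfl⟩

theorem SpHom.toFun_heq (f : SpHom X Y b) {p p' : ι → ℕ} (hp : p = p') {N N' : ℕ} (hN : N = N')
    {e : (Σ i, Fin (p i)) ≃ Fin N} {e' : (Σ i, Fin (p' i)) ≃ Fin N'} (he : HEq e e')
    {d : SimplexCategoryᵒᵖ} {x : ∀ i, ((X i).X (p i)).obj d} {x' : ∀ i, ((X i).X (p' i)).obj d}
    (hx : ∀ i, HEq (x i) (x' i)) (u : d.unop ⟶ b) :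
    HEq (f.toFun p N e d x u) (f.toFun p' N' e' d x' u) := by
  subst hp hN
  rw [eq_of_heq he, funext fun i => eq_of_heq (hx i)]

/-- `p'` arises from `p` and `e'` from `e` by adding one coordinate, which is the last one in
the `i`-th block and in the target. -/
structure IsSuspEquiv (i : ι) (p p' : ι → ℕ) {N N' : ℕ} (e : (Σ i, Fin (p i)) ≃ Fin N)
    (e' : (Σ i, Fin (p' i)) ≃ Fin N') : Prop where
  source : p' i = p i + 1
  source_ne : ∀ j, j ≠ i → p' j = p j
  target : N' = N + 1
  old : ∀ j (a : Fin (p j)) (a' : Fin (p' j)), (a' : ℕ) = a → (e' ⟨j, a'⟩ : ℕ) = e ⟨j, a⟩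
  new : ∀ a' : Fin (p' i), (a' : ℕ) = p i → (e' ⟨i, a'⟩ : ℕ) = N

theorem SpHom.susp_heq (f : SpHom X Y b) {i : ι} {p p' : ι → ℕ} {N N' : ℕ}
    {e : (Σ i, Fin (p i)) ≃ Fin N} {e' : (Σ i, Fin (p' i)) ≃ Fin N'} (h : IsSuspEquiv i p p' e e')
    {d : SimplexCategoryᵒᵖ} {x : ∀ i, ((X i).X (p i)).obj d}
    {x' : ∀ i, ((X i).X (p' i)).obj d} {s : Fin (d.unop.len + 1)} (u : d.unop ⟶ b)
    (h₁ : HEq (x' i) ((X i).susp d (p i) s (x i))) (h₂ : ∀ j, j ≠ i → HEq (x' j) (x j)) :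
    HEq (f.toFun p' N' e' d x' u) (Y.susp d N s (f.toFun p N e d x u)) := by
  obtain ⟨hs, hs', rfl, ho, hn⟩ := h
  exact heq_of_eq (f.susp i p p' hs hs' N e e' ho hn d x x' s u h₁ h₂)

theorem exists_isSuspEquiv (i : ι) (p p' : ι → ℕ) (h : p' i = p i + 1)
    (h' : ∀ j, j ≠ i → p' j = p j) {N : ℕ} (e : (Σ i, Fin (p i)) ≃ Fin N) :
    ∃ e' : (Σ i, Fin (p' i)) ≃ Fin (N + 1), IsSuspEquiv i p p' e e' := by
  let f : (Σ i, Fin (p' i)) → Fin (N + 1) := fun s =>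
    if hs : (s.2 : ℕ) < p s.1 then (e ⟨s.1, ⟨s.2, hs⟩⟩).castSucc else Fin.last N
  have key : ∀ s : Σ i, Fin (p' i), ¬ (s.2 : ℕ) < p s.1 → s = ⟨i, ⟨p i, by omega⟩⟩ := by
    rintro ⟨j, a⟩ hs
    by_cases hj : j = i
    · subst hj
      have := a.2
      refine Sigma.ext rfl (heq_of_eq (Fin.ext ?_))
      change (a : ℕ) = p j
      dsimp only at hs
      omega
    · have := a.2
      have := h' j hj
      dsimp only at hs
      omega
  have inj : Function.Injective f := by
    intro s t hst
    by_cases hs : (s.2 : ℕ) < p s.1 <;> by_cases ht : (t.2 : ℕ) < p t.1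
    · simp only [f, dif_pos hs, dif_pos ht, Fin.castSucc_inj, EmbeddingLike.apply_eq_iff_eq] at hst
      obtain ⟨j, a⟩ := s
      obtain ⟨k, c⟩ := t
      obtain ⟨rfl, hst⟩ := Sigma.mk.inj hst
      have := congrArg Fin.val (eq_of_heq hst)
      congr
      exact Fin.ext this
    · simp only [f, dif_pos hs, dif_neg ht] at hst
      exact absurd (congrArg Fin.val hst) (by simpa using (e ⟨s.1, ⟨s.2, hs⟩⟩).2.ne)
    · simp only [f, dif_neg hs, dif_pos ht] at hst
      exact absurd (congrArg Fin.val hst).symm (by simpa using (e ⟨t.1, ⟨t.2, ht⟩⟩).2.ne)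
    · rw [key s hs, key t ht]
  have surj : Function.Surjective f := by
    intro a
    by_cases ha : (a : ℕ) < N
    · obtain ⟨⟨j, c⟩, hc⟩ := e.surjective ⟨a, ha⟩
      have hj : p j ≤ p' j := by
        by_cases hj : j = i
        · rw [hj]
          omega
        · rw [h' j hj]
      refine ⟨⟨j, ⟨c, c.2.trans_le hj⟩⟩, ?_⟩
      simp only [f, c.2, dif_pos, Fin.eta, hc]
      rfl
    · refine ⟨⟨i, ⟨p i, by omega⟩⟩, ?_⟩
      have := a.2
      simp only [f, lt_irrefl, dif_neg, not_false_eq_true]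
      exact Fin.ext (by rw [Fin.val_last]; omega)
  refine ⟨Equiv.ofBijective f ⟨inj, surj⟩, h, h', rfl, fun j a a' ha => ?_, fun a' ha => ?_⟩
  · have hs : (a' : ℕ) < p j := ha ▸ a.2
    change ((f ⟨j, a'⟩ : Fin (N + 1)) : ℕ) = _
    simp only [f, dif_pos hs, Fin.val_castSucc]
    congr
  · change ((f ⟨i, a'⟩ : Fin (N + 1)) : ℕ) = _
    simp only [f, ha, lt_irrefl, dif_neg, not_false_eq_true, Fin.val_last]

theorem IsSuspEquiv.unique {i : ι} {p p' : ι → ℕ} {N N' : ℕ}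
    {e : (Σ i, Fin (p i)) ≃ Fin N} {e' e'' : (Σ i, Fin (p' i)) ≃ Fin N'} (h : IsSuspEquiv i p p' e e')
    (h' : IsSuspEquiv i p p' e e'') : e' = e'' := by
  refine Equiv.ext fun ⟨j, a⟩ => Fin.ext ?_
  by_cases ha : (a : ℕ) < p j
  · rw [h.old j ⟨a, ha⟩ a rfl, h'.old j ⟨a, ha⟩ a rfl]
  · have := a.2
    by_cases hj : j = i
    · subst hj
      have := h.source
      rw [h.new a (by omega), h'.new a (by omega)]
    · have := h.source_ne j hj
      omega

end SpHom

/-! #### Actions of bijections -/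

section act

variable {ι κ : Type} (ε : κ ≃ ι) {X : ι → SymSpec.{u}} {Y : SymSpec.{u}} {b : SimplexCategory}

/-- Reindexing of the blocks. -/
def preEquiv {p : ι → ℕ} {N : ℕ} (e : (Σ i, Fin (p i)) ≃ Fin N) : (Σ k, Fin (p (ε k))) ≃ Fin N :=
  (Equiv.sigmaCongrLeft (β := fun i => Fin (p i)) ε).trans e

theorem exists_preEquiv {p : ι → ℕ} {N : ℕ} (e : (Σ k, Fin (p (ε k))) ≃ Fin N) :
    ∃ e' : (Σ i, Fin (p i)) ≃ Fin N, preEquiv ε e' = e :=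
  ⟨(Equiv.sigmaCongrLeft (β := fun i => Fin (p i)) ε).symm.trans e, by
    unfold preEquiv
    rw [← Equiv.trans_assoc, Equiv.self_trans_symm, Equiv.refl_trans]⟩

theorem preEquiv_injective {p : ι → ℕ} {N : ℕ} {e e' : (Σ i, Fin (p i)) ≃ Fin N}
    (h : preEquiv ε e = preEquiv ε e') : e = e' := by
  refine Equiv.ext fun ⟨i, a⟩ => ?_
  obtain ⟨k, rfl⟩ := ε.surjective i
  exact DFunLike.congr_fun h ⟨k, a⟩

theorem SpHom.exists_act (f : SpHom X Y b) (p : κ → ℕ) (N : ℕ) (e : (Σ k, Fin (p k)) ≃ Fin N)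
    (d : SimplexCategoryᵒᵖ) (x : ∀ k, ((X (ε k)).X (p k)).obj d) (u : d.unop ⟶ b) :
    ∃ y : (Y.X N).obj d, ∀ (p' : ι → ℕ) (e' : (Σ i, Fin (p' i)) ≃ Fin N)
      (x' : ∀ i, ((X i).X (p' i)).obj d), (fun k => p' (ε k)) = p → HEq (preEquiv ε e') e →
      HEq (fun k => x' (ε k)) x → y = f.toFun p' N e' d x' u := by
  obtain ⟨p, rfl⟩ := exists_pi ε (Z := fun _ => ℕ) p
  obtain ⟨e, rfl⟩ := exists_preEquiv ε e
  obtain ⟨x, rfl⟩ := exists_pi ε (Z := fun i => ((X i).X (p i)).obj d) x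
  refine ⟨f.toFun p N e d x u, fun p' e' x' hp he hx => ?_⟩
  obtain rfl := pi_injective ε hp
  obtain rfl := preEquiv_injective ε (eq_of_heq he)
  obtain rfl := pi_injective ε (eq_of_heq hx)
  rfl

/-- The values of the action of bijections. -/
def SpHom.actFun (f : SpHom X Y b) (p : κ → ℕ) (N : ℕ) (e : (Σ k, Fin (p k)) ≃ Fin N)
    (d : SimplexCategoryᵒᵖ) (x : ∀ k, ((X (ε k)).X (p k)).obj d) (u : d.unop ⟶ b) :
    (Y.X N).obj d := (f.exists_act ε p N e d x u).choose

theorem SpHom.actFun_eq (f : SpHom X Y b) (p : ι → ℕ) (N : ℕ) (e : (Σ i, Fin (p i)) ≃ Fin N)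
    (d : SimplexCategoryᵒᵖ) (x : ∀ i, ((X i).X (p i)).obj d) (u : d.unop ⟶ b) :
    f.actFun ε (fun k => p (ε k)) N (preEquiv ε e) d (fun k => x (ε k)) u = f.toFun p N e d x u :=
  (f.exists_act ε _ N _ d _ u).choose_spec p e x rfl HEq.rfl HEq.rfl

/-- The action of bijections on multimorphisms of symmetric spectra. -/
def SpHom.act (f : SpHom X Y b) : SpHom (fun k => X (ε k)) Y b where
  toFun := f.actFun ε
  nat p N e d d' θ x u := by
    obtain ⟨p, rfl⟩ := exists_pi ε (Z := fun _ => ℕ) p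
    obtain ⟨e, rfl⟩ := exists_preEquiv ε e
    obtain ⟨x, rfl⟩ := exists_pi ε (Z := fun i => ((X i).X (p i)).obj d) x
    rw [f.actFun_eq, f.nat]
    exact (f.actFun_eq ε p N e d' (fun i => ((X i).X (p i)).map θ (x i)) _).symm
  act_target p N e σ d x u := by
    obtain ⟨p, rfl⟩ := exists_pi ε (Z := fun _ => ℕ) p
    obtain ⟨e, rfl⟩ := exists_preEquiv ε e
    obtain ⟨x, rfl⟩ := exists_pi ε (Z := fun i => ((X i).X (p i)).obj d) x
    rw [f.actFun_eq, ← f.act_target]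
    exact f.actFun_eq ε p N (e.trans σ) d x u
  act_source p N e σ d x u := by
    obtain ⟨p, rfl⟩ := exists_pi ε (Z := fun _ => ℕ) p
    obtain ⟨e, rfl⟩ := exists_preEquiv ε e
    obtain ⟨x, rfl⟩ := exists_pi ε (Z := fun i => ((X i).X (p i)).obj d) x
    obtain ⟨σ, rfl⟩ := exists_pi ε (Z := fun i => Equiv.Perm (Fin (p i))) σ
    have h : (Equiv.sigmaCongrRight fun k => σ (ε k)).trans (preEquiv ε e) =
      preEquiv ε ((Equiv.sigmaCongrRight σ).trans e) := Equiv.ext fun _ => rfl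
    rw [h, f.actFun_eq, ← f.act_source]
    exact f.actFun_eq ε p N e d (fun i => ((X i).act (p i) (σ i)).app d (x i)) u
  base p N e d x u := by
    obtain ⟨p, rfl⟩ := exists_pi ε (Z := fun _ => ℕ) p
    obtain ⟨e, rfl⟩ := exists_preEquiv ε e
    obtain ⟨x, rfl⟩ := exists_pi ε (Z := fun i => ((X i).X (p i)).obj d) x
    rintro ⟨k, hk⟩
    exact (f.actFun_eq ε p N e d x u).trans (f.base p N e d x u ⟨ε k, hk⟩)
  susp i p p' h h' N e e' ho hn d x x' s u h₁ h₂ := by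
    obtain ⟨p, rfl⟩ := exists_pi ε (Z := fun _ => ℕ) p
    obtain ⟨p', rfl⟩ := exists_pi ε (Z := fun _ => ℕ) p'
    obtain ⟨e, rfl⟩ := exists_preEquiv ε e
    obtain ⟨e', rfl⟩ := exists_preEquiv ε e'
    obtain ⟨x, rfl⟩ := exists_pi ε (Z := fun i => ((X i).X (p i)).obj d) x
    obtain ⟨x', rfl⟩ := exists_pi ε (Z := fun i => ((X i).X (p' i)).obj d) x'
    rw [f.actFun_eq, f.actFun_eq]
    refine f.susp (ε i) p p' h (fun j hj => ?_) N e e' (fun j => ?_) hn d x x' s u h₁ fun j hj => ?_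
    all_goals obtain ⟨k, rfl⟩ := ε.surjective j
    · exact h' k fun hk => hj (hk ▸ rfl)
    · exact ho k
    · exact h₂ k fun hk => hj (hk ▸ rfl)

variable {ε}

theorem SpHom.eq_act {f : SpHom X Y b} (f' : SpHom (fun k => X (ε k)) Y b)
    (h : ∀ (p : ι → ℕ) (N : ℕ) (e : (Σ i, Fin (p i)) ≃ Fin N)
      (d : SimplexCategoryᵒᵖ) (x : ∀ i, ((X i).X (p i)).obj d) (u : d.unop ⟶ b),
      f'.toFun (fun k => p (ε k)) N (preEquiv ε e) d (fun k => x (ε k)) u = f.toFun p N e d x u) :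
    f' = f.act ε := by
  refine SpHom.ext ?_
  funext p N e d x u
  obtain ⟨p, rfl⟩ := exists_pi ε (Z := fun _ => ℕ) p
  obtain ⟨e, rfl⟩ := exists_preEquiv ε e
  obtain ⟨x, rfl⟩ := exists_pi ε (Z := fun i => ((X i).X (p i)).obj d) x
  exact (h p N e d x u).trans (f.actFun_eq ε p N e d x u).symm

end act

/-! #### Units -/

section one

variable (X : SymSpec.{u}) (b : SimplexCategory)

theorem SymSpec.act_app_mul (p : ℕ) (σ τ : Equiv.Perm (Fin p)) (d : SimplexCategoryᵒᵖ)
    (x : (X.X p).obj d) : (X.act p (σ * τ)).app d x = (X.act p σ).app d ((X.act p τ).app d x) := by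
  rw [X.act_mul]
  rfl

theorem SymSpec.act_app_one (p : ℕ) (d : SimplexCategoryᵒᵖ) (x : (X.X p).obj d) :
    (X.act p 1).app d x = x := by
  rw [X.act_one]
  rfl

theorem eq_of_equiv_unit {p : Unit → ℕ} {N : ℕ} (e : (Σ k, Fin (p k)) ≃ Fin N) : N = p () := by
  simpa using (Fintype.card_congr ((Equiv.uniqueSigma fun k => Fin (p k)).symm.trans e)).symm

/-- The values of the unit. -/
def SpHom.oneFun (p : Unit → ℕ) (N : ℕ) (e : (Σ k, Fin (p k)) ≃ Fin N)
    (d : SimplexCategoryᵒᵖ) (x : (X.X (p ())).obj d) : (X.X N).obj d :=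
  (X.act N ((finCongr (eq_of_equiv_unit e)).trans
    ((Equiv.uniqueSigma fun k => Fin (p k)).symm.trans e))).app d
    (cast (by rw [eq_of_equiv_unit e]) x)

theorem SpHom.oneFun_eq (p : Unit → ℕ) (e : (Σ k, Fin (p k)) ≃ Fin (p ()))
    (d : SimplexCategoryᵒᵖ) (x : (X.X (p ())).obj d) : SpHom.oneFun X p (p ()) e d x =
      (X.act (p ()) ((Equiv.uniqueSigma fun k => Fin (p k)).symm.trans e)).app d x := rfl

/-- The unit of a symmetric spectrum. -/
def SpHom.one : SpHom (fun _ : Unit => X) X b where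
  toFun p N e d x u := SpHom.oneFun X p N e d (x ())
  nat p N e d d' θ x u := by
    obtain rfl := eq_of_equiv_unit e
    rw [SpHom.oneFun_eq, SpHom.oneFun_eq]
    exact (NatTrans.naturality_apply (X.act (p ()) _) θ (x ())).symm
  act_target p N e σ d x u := by
    obtain rfl := eq_of_equiv_unit e
    rw [SpHom.oneFun_eq, SpHom.oneFun_eq, ← X.act_app_mul]
    rfl
  act_source p N e σ d x u := by
    obtain rfl := eq_of_equiv_unit e
    rw [SpHom.oneFun_eq, SpHom.oneFun_eq, ← X.act_app_mul]
    rfl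
  base p N e d x u := by
    rintro ⟨k, hk⟩
    obtain rfl := eq_of_equiv_unit e
    rw [SpHom.oneFun_eq, hk, X.act_base]
  susp i p p' h h' N e e' ho hn d x x' s u h₁ h₂ := by
    obtain rfl := eq_of_equiv_unit e
    obtain rfl : p' = fun _ => p () + 1 := funext fun _ => h
    have := X.susp_act (p ()) 1 d ((Equiv.uniqueSigma fun k => Fin (p k)).symm.trans e) 1 (fun _ => s) (x ())
    rw [SpHom.oneFun_eq, SpHom.oneFun_eq, eq_of_heq h₁]
    refine Eq.trans ?_ this
    refine congrArg (fun t => (X.act (p () + 1) t).app d (X.susp d (p ()) s (x ())))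
      (Equiv.ext fun a => Fin.ext ?_)
    refine Fin.lastCases ?_ (fun a => ?_) a
    · refine (hn (Fin.last _) rfl).trans ?_
      exact (congrArg Fin.val (blockPerm_natAdd ((Equiv.uniqueSigma fun k => Fin (p k)).symm.trans e)
        (1 : Equiv.Perm (Fin 1)) 0)).symm
    · refine (ho () a a.castSucc rfl).trans ?_
      exact (congrArg Fin.val (blockPerm_castAdd ((Equiv.uniqueSigma fun k => Fin (p k)).symm.trans e)
        (1 : Equiv.Perm (Fin 1)) a)).symm

theorem SpHom.one_toFun (p : ℕ) (d : SimplexCategoryᵒᵖ) (x : (X.X p).obj d) (u : d.unop ⟶ b) :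
    (SpHom.one X b).toFun (fun _ => p) p (Equiv.uniqueSigma (fun _ : Unit => Fin p)) d
      (fun _ => x) u = x := by
  refine (SpHom.oneFun_eq X (fun _ => p) _ d x).trans ?_
  rw [Equiv.symm_trans_self]
  exact X.act_app_one p d x

end one

/-! #### Multiproducts -/

section comp

variable {ι : Type} {κ : ι → Type}

/-- The composite of bijections between coordinates. -/
def sigmaEquiv {p : (Σ i, κ i) → ℕ} {q : ι → ℕ} {N : ℕ} (e : ∀ i, (Σ k, Fin (p ⟨i, k⟩)) ≃ Fin (q i))
    (e' : (Σ i, Fin (q i)) ≃ Fin N) : (Σ s, Fin (p s)) ≃ Fin N :=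
  (Equiv.sigmaAssoc (fun i k => Fin (p ⟨i, k⟩))).trans ((Equiv.sigmaCongrRight e).trans e')

theorem exists_sigmaEquiv {p : (Σ i, κ i) → ℕ} {q : ι → ℕ} {N : ℕ}
    (e : ∀ i, (Σ k, Fin (p ⟨i, k⟩)) ≃ Fin (q i)) (d : (Σ s, Fin (p s)) ≃ Fin N) :
    ∃ e' : (Σ i, Fin (q i)) ≃ Fin N, sigmaEquiv e e' = d :=
  ⟨((Equiv.sigmaAssoc (fun i k => Fin (p ⟨i, k⟩))).trans (Equiv.sigmaCongrRight e)).symm.trans d,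
    Equiv.ext fun s => congrArg d (Equiv.symm_apply_apply ((Equiv.sigmaAssoc
      (fun i k => Fin (p ⟨i, k⟩))).trans (Equiv.sigmaCongrRight e)) s)⟩

variable [∀ i, Finite (κ i)]

theorem exists_fiberEquiv (p : (Σ i, κ i) → ℕ) :
    ∃ (q : ι → ℕ), Nonempty (∀ i, (Σ k, Fin (p ⟨i, k⟩)) ≃ Fin (q i)) :=
  ⟨_, ⟨fun i => Finite.equivFin (Σ k, Fin (p ⟨i, k⟩))⟩⟩

variable {X : ∀ i, κ i → SymSpec.{u}} {Y : ι → SymSpec.{u}} {Z : SymSpec.{u}}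
  {b : SimplexCategory} (g : SpHom Y Z b) (f : ∀ i, SpHom (X i) (Y i) b)

/-- The composite of maps, for given intermediate coordinates. -/
def SpHom.compVal {p : (Σ i, κ i) → ℕ} {q : ι → ℕ} {N : ℕ}
    (e : ∀ i, (Σ k, Fin (p ⟨i, k⟩)) ≃ Fin (q i)) (e' : (Σ i, Fin (q i)) ≃ Fin N)
    (d : SimplexCategoryᵒᵖ) (x : ∀ s : Σ i, κ i, ((X s.1 s.2).X (p s)).obj d) (u : d.unop ⟶ b) :
    (Z.X N).obj d :=
  g.toFun q N e' d
    (fun i => (f i).toFun (fun k => p ⟨i, k⟩) (q i) (e i) d (fun k => x ⟨i, k⟩) u) u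

theorem SpHom.exists_comp (p : (Σ i, κ i) → ℕ) (N : ℕ) (e : (Σ s, Fin (p s)) ≃ Fin N)
    (d : SimplexCategoryᵒᵖ) (x : ∀ s : Σ i, κ i, ((X s.1 s.2).X (p s)).obj d) (u : d.unop ⟶ b) :
    ∃ z : (Z.X N).obj d, ∀ (q : ι → ℕ) (e₁ : ∀ i, (Σ k, Fin (p ⟨i, k⟩)) ≃ Fin (q i))
      (e₂ : (Σ i, Fin (q i)) ≃ Fin N), sigmaEquiv e₁ e₂ = e → z = SpHom.compVal g f e₁ e₂ d x u := by
  obtain ⟨q, ⟨e₁⟩⟩ := exists_fiberEquiv p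
  obtain ⟨e₂, rfl⟩ := exists_sigmaEquiv e₁ e
  refine ⟨SpHom.compVal g f e₁ e₂ d x u, fun q' e₁' e₂' he => ?_⟩
  obtain rfl : q = q' := funext fun i => by
    simpa using Fintype.card_congr ((e₁ i).symm.trans (e₁' i))
  obtain ⟨σ, hσ⟩ : ∃ σ : ∀ i, Equiv.Perm (Fin (q i)), ∀ i, e₁ i = (e₁' i).trans (σ i) :=
    ⟨fun i => (e₁' i).symm.trans (e₁ i), fun i => by
      rw [← Equiv.trans_assoc, Equiv.self_trans_symm, Equiv.refl_trans]⟩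
  have h : (Equiv.sigmaCongrRight σ).trans e₂ = e₂' := Equiv.ext fun ⟨i, a⟩ => by
    obtain ⟨⟨k, c⟩, rfl⟩ := (e₁' i).surjective a
    have := DFunLike.congr_fun he ⟨⟨i, k⟩, c⟩
    change e₂' ⟨i, e₁' i ⟨k, c⟩⟩ = e₂ ⟨i, e₁ i ⟨k, c⟩⟩ at this
    rw [this, hσ]
    rfl
  rw [← h]
  refine Eq.trans ?_ (g.act_source q N e₂ σ d _ u)
  refine congrArg (fun t => g.toFun q N e₂ d t u) (funext fun i => ?_)
  rw [hσ, (f i).act_target]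

/-- The values of the multiproduct. -/
def SpHom.compFun (p : (Σ i, κ i) → ℕ) (N : ℕ) (e : (Σ s, Fin (p s)) ≃ Fin N)
    (d : SimplexCategoryᵒᵖ) (x : ∀ s : Σ i, κ i, ((X s.1 s.2).X (p s)).obj d) (u : d.unop ⟶ b) :
    (Z.X N).obj d := (SpHom.exists_comp g f p N e d x u).choose

theorem SpHom.compFun_eq {p : (Σ i, κ i) → ℕ} {q : ι → ℕ} {N : ℕ}
    (e : ∀ i, (Σ k, Fin (p ⟨i, k⟩)) ≃ Fin (q i)) (e' : (Σ i, Fin (q i)) ≃ Fin N)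
    (d : SimplexCategoryᵒᵖ) (x : ∀ s : Σ i, κ i, ((X s.1 s.2).X (p s)).obj d) (u : d.unop ⟶ b) :
    SpHom.compFun g f p N (sigmaEquiv e e') d x u = SpHom.compVal g f e e' d x u :=
  (SpHom.exists_comp g f p N _ d x u).choose_spec q e e' rfl

omit [∀ i, Finite (κ i)] in
theorem exists_fiberSusp (i : ι) (k : κ i) (p p' : (Σ i, κ i) → ℕ) (h : p' ⟨i, k⟩ = p ⟨i, k⟩ + 1)
    (h' : ∀ s, s ≠ ⟨i, k⟩ → p' s = p s) {q : ι → ℕ} (e : ∀ i, (Σ k, Fin (p ⟨i, k⟩)) ≃ Fin (q i)) :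
    ∃ (q' : ι → ℕ) (e' : ∀ i, (Σ k, Fin (p' ⟨i, k⟩)) ≃ Fin (q' i)),
      IsSuspEquiv k (fun k => p ⟨i, k⟩) (fun k => p' ⟨i, k⟩) (e i) (e' i) ∧
      ∀ j, j ≠ i → (fun k => p' ⟨j, k⟩) = (fun k => p ⟨j, k⟩) ∧ q' j = q j ∧ HEq (e' j) (e j) := by
  have : ∀ j, ∃ (n : ℕ) (e' : (Σ k, Fin (p' ⟨j, k⟩)) ≃ Fin n),
      (∀ hj : j = i, IsSuspEquiv (hj ▸ k) (fun k => p ⟨j, k⟩) (fun k => p' ⟨j, k⟩) (e j) e') ∧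
      (j ≠ i → (fun k => p' ⟨j, k⟩) = (fun k => p ⟨j, k⟩) ∧ n = q j ∧ HEq e' (e j)) := fun j => by
    by_cases hj : j = i
    · subst hj
      obtain ⟨e', he⟩ := exists_isSuspEquiv k (fun k => p ⟨j, k⟩) (fun k => p' ⟨j, k⟩) h
        (fun l hl => h' _ fun hs => hl (eq_of_heq (Sigma.mk.inj hs).2)) (e j)
      exact ⟨_, e', fun _ => he, fun hj => absurd rfl hj⟩
    · have : (fun k => p' ⟨j, k⟩) = fun k => p ⟨j, k⟩ :=
        funext fun l => h' _ fun hs => hj (Sigma.mk.inj hs).1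
      obtain ⟨e', he⟩ := exists_equiv_heq this.symm (e j)
      exact ⟨q j, e', fun h => absurd h hj, fun _ => ⟨this, rfl, he⟩⟩
  choose q' e' h₁ h₂ using this
  exact ⟨q', e', h₁ i rfl, h₂⟩

/-- The multiproduct of multimorphisms of symmetric spectra. -/
def SpHom.comp : SpHom (fun s : Σ i, κ i => X s.1 s.2) Z b where
  toFun := SpHom.compFun g f
  nat p N e d d' θ x u := by
    obtain ⟨q, ⟨e₁⟩⟩ := exists_fiberEquiv p
    obtain ⟨e₂, rfl⟩ := exists_sigmaEquiv e₁ e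
    rw [SpHom.compFun_eq, SpHom.compFun_eq]
    refine (g.nat q N e₂ θ _ u).trans (congrArg (fun t => g.toFun q N e₂ d' t (θ.unop ≫ u))
      (funext fun i => (f i).nat _ _ _ θ _ u))
  act_target p N e σ d x u := by
    obtain ⟨q, ⟨e₁⟩⟩ := exists_fiberEquiv p
    obtain ⟨e₂, rfl⟩ := exists_sigmaEquiv e₁ e
    rw [SpHom.compFun_eq]
    exact (SpHom.compFun_eq g f e₁ (e₂.trans σ) d x u).trans (g.act_target q N e₂ σ d _ u)
  act_source p N e σ d x u := by
    obtain ⟨q, ⟨e₁⟩⟩ := exists_fiberEquiv p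
    obtain ⟨e₂, rfl⟩ := exists_sigmaEquiv e₁ e
    have h : (Equiv.sigmaCongrRight σ).trans (sigmaEquiv e₁ e₂) =
      sigmaEquiv (fun i => (Equiv.sigmaCongrRight fun k => σ ⟨i, k⟩).trans (e₁ i)) e₂ :=
        Equiv.ext fun _ => rfl
    rw [h, SpHom.compFun_eq, SpHom.compFun_eq]
    exact congrArg (fun t => g.toFun q N e₂ d t u) (funext fun i =>
      (f i).act_source (fun k => p ⟨i, k⟩) (q i) (e₁ i) (fun k => σ ⟨i, k⟩) d (fun k => x ⟨i, k⟩) u)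
  base p N e d x u := by
    obtain ⟨q, ⟨e₁⟩⟩ := exists_fiberEquiv p
    obtain ⟨e₂, rfl⟩ := exists_sigmaEquiv e₁ e
    rintro ⟨⟨i, k⟩, hk⟩
    rw [SpHom.compFun_eq]
    exact g.base q N e₂ d _ u ⟨i, (f i).base _ _ _ d _ u ⟨k, hk⟩⟩
  susp := by
    rintro ⟨i, k⟩ p p' h h' N e e' ho hn d x x' s u hx hx'
    obtain ⟨q, ⟨e₁⟩⟩ := exists_fiberEquiv p
    obtain ⟨e₂, rfl⟩ := exists_sigmaEquiv e₁ e
    obtain ⟨q', e₁', h₁, h₁'⟩ := exists_fiberSusp i k p p' h h' e₁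
    obtain ⟨e₂', h₂⟩ := exists_isSuspEquiv i q q' h₁.target (fun j hj => (h₁' j hj).2.1) e₂
    have hne : ∀ j, j ≠ i → ∀ l, (⟨j, l⟩ : Σ i, κ i) ≠ ⟨i, k⟩ := fun j hj l hs =>
      hj (Sigma.mk.inj hs).1
    have h₃ : IsSuspEquiv ⟨i, k⟩ p p' (sigmaEquiv e₁ e₂) (sigmaEquiv e₁' e₂') := by
      refine ⟨h, h', rfl, fun s a a' ha => h₂.old _ _ _ ?_, fun a' ha => h₂.new _ (h₁.new a' ha)⟩
      by_cases hs : s.1 = i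
      · obtain ⟨j, l⟩ := s
        obtain rfl : j = i := hs
        exact h₁.old l a a' ha
      · obtain ⟨j, l⟩ := s
        obtain ⟨hp, hq, he⟩ := h₁' j hs
        exact val_of_equiv_heq hp hq he ha
    obtain rfl := h₃.unique ⟨h, h', rfl, ho, hn⟩
    rw [SpHom.compFun_eq, SpHom.compFun_eq]
    refine eq_of_heq (g.susp_heq h₂ u ?_ fun j hj => ?_)
    · exact (f i).susp_heq h₁ u hx fun l hl => hx' _ fun hs => hl (eq_of_heq (Sigma.mk.inj hs).2)
    · exact (f j).toFun_heq (h₁' j hj).1 (h₁' j hj).2.1 (h₁' j hj).2.2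
        (fun l => hx' _ (hne j hj l)) u

theorem SpHom.comp_toFun {p : (Σ i, κ i) → ℕ} {q : ι → ℕ} {N : ℕ}
    (e : ∀ i, (Σ k, Fin (p ⟨i, k⟩)) ≃ Fin (q i)) (e' : (Σ i, Fin (q i)) ≃ Fin N)
    (d : SimplexCategoryᵒᵖ) (x : ∀ s : Σ i, κ i, ((X s.1 s.2).X (p s)).obj d) (u : d.unop ⟶ b) :
    (SpHom.comp g f).toFun p N (sigmaEquiv e e') d x u = SpHom.compVal g f e e' d x u :=
  SpHom.compFun_eq g f e e' d x u

end comp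

section laws

variable {b : SimplexCategory}

theorem SpHom.act_refl {ι : Type} {X : ι → SymSpec.{u}} {Y : SymSpec.{u}} (f : SpHom X Y b) :
    f.act (Equiv.refl ι) = f :=
  (SpHom.eq_act (ε := Equiv.refl ι) f fun p N _ d x u =>
    congrArg (fun t => f.toFun p N t d x u) (Equiv.ext fun _ => rfl)).symm

theorem SpHom.act_trans {ι κ μ : Type} (δ : μ ≃ κ) (ε : κ ≃ ι) {X : ι → SymSpec.{u}}
    {Y : SymSpec.{u}} (f : SpHom X Y b) : f.act (δ.trans ε) = (f.act ε).act δ :=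
  (SpHom.eq_act (ε := δ.trans ε) ((f.act ε).act δ) fun p N e d x u => by
    have h : preEquiv (δ.trans ε) e = preEquiv δ (preEquiv ε e) := Equiv.ext fun _ => rfl
    rw [h]
    exact ((f.act ε).actFun_eq δ _ N _ d (fun k => x (ε k)) u).trans (f.actFun_eq ε p N e d x u)).symm

theorem SpHom.comp_one {ι : Type} {X : ι → SymSpec.{u}} {Y : SymSpec.{u}} (f : SpHom X Y b) :
    SpHom.comp f (fun i => SpHom.one (X i) b) = f.act (Equiv.sigmaUnique ι (fun _ => Unit)) := by
  refine SpHom.eq_act (ε := Equiv.sigmaUnique ι (fun _ => Unit)) _ fun p N e d x u => ?_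
  have h : preEquiv (Equiv.sigmaUnique ι (fun _ => Unit)) e = sigmaEquiv (p := fun s => p s.1)
    (fun i => Equiv.uniqueSigma (fun _ : Unit => Fin (p i))) e := Equiv.ext fun _ => rfl
  rw [h]
  refine (SpHom.comp_toFun f (fun i => SpHom.one (X i) b) (p := fun s => p s.1) _ e d
    (fun s => x s.1) u).trans ?_
  exact congrArg (fun t => f.toFun p N e d t u) (funext fun i =>
    SpHom.one_toFun (X i) b (p i) d (x i) u)

theorem SpHom.one_comp {ι : Type} [Finite ι] {X : ι → SymSpec.{u}} {Y : SymSpec.{u}}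
    (f : SpHom X Y b) : SpHom.comp (SpHom.one Y b) (fun _ => f) =
      f.act (Equiv.uniqueSigma (fun _ : Unit => ι)) := by
  refine SpHom.eq_act (ε := Equiv.uniqueSigma (fun _ : Unit => ι)) _ fun p N e d x u => ?_
  have h : preEquiv (Equiv.uniqueSigma (fun _ : Unit => ι)) e = sigmaEquiv (ι := Unit) (κ := fun _ => ι)
    (p := fun s => p s.2) (q := fun _ => N) (fun _ => e) (Equiv.uniqueSigma (fun _ : Unit => Fin N)) :=
    Equiv.ext fun _ => rfl
  rw [h]
  refine (SpHom.comp_toFun (SpHom.one Y b) (fun _ => f) (κ := fun _ : Unit => ι)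
    (p := fun s => p s.2) (fun _ => e) (Equiv.uniqueSigma (fun _ : Unit => Fin N)) d
    (fun s => x s.2) u).trans ?_
  exact SpHom.one_toFun Y b N d _ u

variable {ι : Type} {κ : ι → Type} [∀ i, Finite (κ i)] {X : ∀ i, κ i → SymSpec.{u}}
  {Y : ι → SymSpec.{u}} {Z : SymSpec.{u}}

theorem SpHom.comp_assoc [Finite ι] {μ : ∀ i, κ i → Type} [∀ i k, Finite (μ i k)]
    {W : ∀ i k, μ i k → SymSpec.{u}} (g : SpHom Y Z b) (f : ∀ i, SpHom (X i) (Y i) b)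
    (h : ∀ i k, SpHom (W i k) (X i k) b) :
    SpHom.comp (SpHom.comp g f) (fun s : Σ i, κ i => h s.1 s.2) =
      (SpHom.comp g (fun i => SpHom.comp (f i) (h i))).act (Equiv.sigmaAssoc μ) := by
  refine SpHom.eq_act (X := fun s : Σ i, Σ k, μ i k => W s.1 s.2.1 s.2.2)
    (ε := Equiv.sigmaAssoc μ) _ fun p N e d x u => ?_
  choose r hr using fun i => exists_fiberEquiv (κ := μ i) fun s => p ⟨i, s⟩
  let e₁ := fun i => (hr i).some
  obtain ⟨q, ⟨e₂⟩⟩ := exists_fiberEquiv (κ := κ) fun s => r s.1 s.2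
  obtain ⟨e₃, rfl⟩ := exists_sigmaEquiv (fun i => sigmaEquiv (e₁ i) (e₂ i)) e
  have hε : preEquiv (Equiv.sigmaAssoc μ) (sigmaEquiv (fun i => sigmaEquiv (e₁ i) (e₂ i)) e₃) =
    sigmaEquiv (κ := fun s : Σ i, κ i => μ s.1 s.2) (p := fun t => p ⟨t.1.1, t.1.2, t.2⟩)
      (fun s => e₁ s.1 s.2) (sigmaEquiv e₂ e₃) := Equiv.ext fun _ => rfl
  rw [hε, SpHom.comp_toFun]
  refine (SpHom.comp_toFun (SpHom.comp g f) (fun s : Σ i, κ i => h s.1 s.2) (fun s => e₁ s.1 s.2)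
    (sigmaEquiv e₂ e₃) d (fun t => x ⟨t.1.1, t.1.2, t.2⟩) u).trans ?_
  refine (SpHom.comp_toFun g f (p := fun s => r s.1 s.2) e₂ e₃ d _ u).trans ?_
  exact congrArg (fun t => g.toFun q N e₃ d t u) (funext fun i =>
    (SpHom.comp_toFun (f i) (h i) (p := fun s => p ⟨i, s⟩) (e₁ i) (e₂ i) d (fun s => x ⟨i, s⟩) u).symm)

theorem SpHom.act_comp [Finite ι] {ι' : Type} [Finite ι'] (ε : ι' ≃ ι) (g : SpHom Y Z b)
    (f : ∀ i, SpHom (X i) (Y i) b) : SpHom.comp (g.act ε) (fun i => f (ε i)) =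
      (SpHom.comp g f).act (Equiv.sigmaCongrLeft (β := κ) ε) := by
  refine SpHom.eq_act (X := fun s : Σ i, κ i => X s.1 s.2)
    (ε := Equiv.sigmaCongrLeft (β := κ) ε) _ fun p N e d x u => ?_
  obtain ⟨q, ⟨e₁⟩⟩ := exists_fiberEquiv p
  obtain ⟨e₂, rfl⟩ := exists_sigmaEquiv e₁ e
  have hε : preEquiv (Equiv.sigmaCongrLeft (β := κ) ε) (sigmaEquiv e₁ e₂) =
    sigmaEquiv (κ := fun i => κ (ε i)) (p := fun t => p ⟨ε t.1, t.2⟩)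
      (fun i => e₁ (ε i)) (preEquiv ε e₂) := Equiv.ext fun _ => rfl
  rw [hε, SpHom.comp_toFun]
  exact (SpHom.comp_toFun (g.act ε) (fun i => f (ε i)) (κ := fun i => κ (ε i))
    (p := fun t => p ⟨ε t.1, t.2⟩) (fun i => e₁ (ε i)) (preEquiv ε e₂) d
    (fun t => x ⟨ε t.1, t.2⟩) u).trans (g.actFun_eq ε q N e₂ d
      (fun i => (f i).toFun (fun k => p ⟨i, k⟩) (q i) (e₁ i) d (fun k => x ⟨i, k⟩) u) u)

theorem SpHom.comp_act [Finite ι] {κ' : ι → Type} [∀ i, Finite (κ' i)] (ε : ∀ i, κ' i ≃ κ i)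
    (g : SpHom Y Z b) (f : ∀ i, SpHom (X i) (Y i) b) :
    SpHom.comp g (fun i => (f i).act (ε i)) =
      (SpHom.comp g f).act (Equiv.sigmaCongrRight ε) := by
  refine SpHom.eq_act (X := fun s : Σ i, κ i => X s.1 s.2)
    (ε := Equiv.sigmaCongrRight ε) _ fun p N e d x u => ?_
  obtain ⟨q, ⟨e₁⟩⟩ := exists_fiberEquiv p
  obtain ⟨e₂, rfl⟩ := exists_sigmaEquiv e₁ e
  have hε : preEquiv (Equiv.sigmaCongrRight ε) (sigmaEquiv e₁ e₂) =
    sigmaEquiv (κ := κ') (p := fun t => p ⟨t.1, ε t.1 t.2⟩)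
      (fun i => preEquiv (p := fun k => p ⟨i, k⟩) (ε i) (e₁ i)) e₂ := Equiv.ext fun _ => rfl
  rw [hε, SpHom.comp_toFun]
  refine (SpHom.comp_toFun g (fun i => (f i).act (ε i)) _ e₂ d
    (fun t => x ⟨t.1, ε t.1 t.2⟩) u).trans ?_
  exact congrArg (fun t => g.toFun q N e₂ d t u) (funext fun i =>
    (f i).actFun_eq (ε i) (fun k => p ⟨i, k⟩) (q i) (e₁ i) d (fun k => x ⟨i, k⟩) u)

end laws

/-- The multicategory of symmetric spectra. -/
def spMulticat : SMulticat spGraph.{u} where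
  lvl b :=
    { act := fun ε _ _ f => SpHom.act ε f
      one := fun X => SpHom.one X b.unop
      comp := fun g f => SpHom.comp g f
      act_refl := fun f => f.act_refl
      act_trans := fun δ ε _ _ f => f.act_trans δ ε
      assoc := fun g f h => g.comp_assoc f h
      comp_one := fun f => f.comp_one
      one_comp := fun f => f.one_comp
      act_comp := fun ε _ _ _ _ _ g f => g.act_comp ε f
      comp_act := fun ε _ _ _ g f => g.comp_act ε f }
  act_nat {b b'} θ _ _ _ _ ε X Y f := SpHom.eq_act (ε := ε)
    ((SpMap _ Y).map θ (SpHom.act (b := b.unop) ε f)) fun p N e d x u =>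
      SpHom.actFun_eq ε f p N e d x (u ≫ θ.unop)
  one_nat _ _ := rfl
  comp_nat {b b'} θ _ _ _ _ X Y Z g f := by
    refine SpHom.ext ?_
    funext p N e d x u
    obtain ⟨q, ⟨e₁⟩⟩ := exists_fiberEquiv p
    obtain ⟨e₂, rfl⟩ := exists_sigmaEquiv e₁ e
    exact (SpHom.comp_toFun (b := b.unop) g f e₁ e₂ d x (u ≫ θ.unop)).trans
      (SpHom.comp_toFun (b := b'.unop) ((SpMap Y Z).map θ g) (fun i => (SpMap (X i) (Y i)).map θ (f i))
        e₁ e₂ d x u).symm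

theorem isSpMulticat : IsSpMulticat spMulticat.{u} where
  act_toFun _ _ _ _ _ ε _ _ f p N e d x u := SpHom.actFun_eq ε f p N e d x u
  one_toFun b X p d x u := SpHom.one_toFun X b.unop p d x u
  comp_toFun _ _ _ _ _ _ _ _ g f _ _ _ e e' d x u := SpHom.comp_toFun g f e e' d x u

/-! ### Systems determined on tuples of nonempty subsets -/

section degenerate

variable {D : Type u} [Category.{v} D] [MonoidalCategory D]

theorem whiskerRight_heq_id {x y z : D} {f : x ⟶ y} (h : x = y) (hf : HEq f (𝟙 y)) :
    HEq (f ▷ z) (𝟙 (y ⊗ z)) := by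
  subst h
  rw [eq_of_heq hf, id_whiskerRight]

theorem whiskerLeft_heq_id {x y z : D} {f : x ⟶ y} (h : x = y) (hf : HEq f (𝟙 y)) :
    HEq (z ◁ f) (𝟙 (z ⊗ y)) := by
  subst h
  rw [eq_of_heq hf, whiskerLeft_id]

variable [Permutative D]

theorem assoc_of_left {t u v tu uv s : D} {r₁ : t ⊗ u ⟶ tu} {r₂ : tu ⊗ v ⟶ s} {r₃ : u ⊗ v ⟶ uv}
    {r₄ : t ⊗ uv ⟶ s} (ht : t = 𝟙_ D) (htu : u = tu) (huv : uv = s) (h₁ : HEq r₁ (𝟙 tu))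
    (h₄ : HEq r₄ (𝟙 s)) (h : HEq r₂ r₃) :
    (r₁ ▷ v) ≫ r₂ = (α_ t u v).hom ≫ (t ◁ r₃) ≫ r₄ := by
  subst ht htu huv
  refine eq_of_heq ((heq_id_comp (whiskerRight_heq_id (Permutative.unit_left _) h₁) ?_ rfl).trans
    (HEq.trans ?_ (associator_comp_heq _).symm))
  · rw [Permutative.unit_left]
  · refine h.trans (HEq.trans ?_ (heq_comp_id h₄ (Permutative.unit_left _) rfl).symm)
    rw [← MonoidalCategory.id_tensorHom]
    exact (unit_tensor_heq rfl rfl HEq.rfl _).symm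

theorem assoc_of_mid {t u v tu uv s : D} {r₁ : t ⊗ u ⟶ tu} {r₂ : tu ⊗ v ⟶ s} {r₃ : u ⊗ v ⟶ uv}
    {r₄ : t ⊗ uv ⟶ s} (hu : u = 𝟙_ D) (htu : t = tu) (huv : v = uv) (h₁ : HEq r₁ (𝟙 tu))
    (h₃ : HEq r₃ (𝟙 uv)) (h : HEq r₂ r₄) :
    (r₁ ▷ v) ≫ r₂ = (α_ t u v).hom ≫ (t ◁ r₃) ≫ r₄ := by
  subst hu htu huv
  refine eq_of_heq ((heq_id_comp (whiskerRight_heq_id (Permutative.unit_right _) h₁) ?_ rfl).trans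
    (HEq.trans ?_ (associator_comp_heq _).symm))
  · rw [Permutative.unit_right]
  · refine h.trans (heq_id_comp (whiskerLeft_heq_id (Permutative.unit_left _) h₃) ?_ rfl).symm
    rw [Permutative.unit_left]

theorem assoc_of_right {t u v tu uv s : D} {r₁ : t ⊗ u ⟶ tu} {r₂ : tu ⊗ v ⟶ s} {r₃ : u ⊗ v ⟶ uv}
    {r₄ : t ⊗ uv ⟶ s} (hv : v = 𝟙_ D) (htu : tu = s) (huv : u = uv) (h₂ : HEq r₂ (𝟙 s))
    (h₃ : HEq r₃ (𝟙 uv)) (h : HEq r₁ r₄) :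
    (r₁ ▷ v) ≫ r₂ = (α_ t u v).hom ≫ (t ◁ r₃) ≫ r₄ := by
  subst hv htu huv
  refine eq_of_heq ((heq_comp_id h₂ (Permutative.unit_right _) rfl).trans
    (HEq.trans ?_ (associator_comp_heq _).symm))
  rw [← MonoidalCategory.tensorHom_id]
  refine (tensor_unit_heq rfl rfl HEq.rfl _).trans (h.trans
    (heq_id_comp (whiskerLeft_heq_id (Permutative.unit_right _) h₃) ?_ rfl).symm)
  rw [Permutative.unit_right]

variable [SymmetricCategory D]

theorem symm_of_unit {t u s : D} {r : t ⊗ u ⟶ s} {r' : u ⊗ t ⟶ s} (h : t = 𝟙_ D ∨ u = 𝟙_ D)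
    (hs : u ⊗ t = s) (hr : HEq r (𝟙 s)) (hr' : HEq r' (𝟙 s)) : r = (β_ t u).hom ≫ r' :=
  eq_of_heq (hr.trans ((heq_id_comp (braiding_heq_id h) rfl (by
    rcases h with rfl | rfl <;> rw [Permutative.unit_left, Permutative.unit_right])).trans hr').symm)

variable {tv uv tw uw v w t u s : D} {r₁ : tv ⊗ uv ⟶ v} {r₂ : tw ⊗ uw ⟶ w} {r₃ : v ⊗ w ⟶ s}
  {r₄ : tv ⊗ tw ⟶ t} {r₅ : uv ⊗ uw ⟶ u} {r₆ : t ⊗ u ⟶ s}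

theorem exch_of_left (htv : tv = 𝟙_ D) (htw : tw = 𝟙_ D) (ht : t = 𝟙_ D) (hv : uv = v)
    (hw : uw = w) (hu : u = s) (h₁ : HEq r₁ (𝟙 v)) (h₂ : HEq r₂ (𝟙 w)) (h₄ : HEq r₄ (𝟙 t))
    (h₆ : HEq r₆ (𝟙 s)) (h : HEq r₃ r₅) :
    (r₁ ⊗ₘ r₂) ≫ r₃ = tensorμ tv uv tw uw ≫ (r₄ ⊗ₘ r₅) ≫ r₆ := by
  subst htv htw ht hv hw hu
  refine eq_of_heq ((heq_id_comp (tensor_heq_id (Permutative.unit_left _) (Permutative.unit_left _)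
    h₁ h₂) ?_ rfl).trans (h.trans (((heq_id_comp (tensorμ_heq_id (Or.inr rfl)) rfl ?_).trans
      ((heq_comp_id h₆ (Permutative.unit_left _) rfl).trans
        (unit_tensor_heq (Permutative.unit_left _) rfl h₄ _))).symm)))
  · simp only [Permutative.unit_left]
  · simp only [Permutative.unit_left]

theorem exch_of_right (huv : uv = 𝟙_ D) (huw : uw = 𝟙_ D) (hu : u = 𝟙_ D) (hv : tv = v)
    (hw : tw = w) (ht : t = s) (h₁ : HEq r₁ (𝟙 v)) (h₂ : HEq r₂ (𝟙 w)) (h₅ : HEq r₅ (𝟙 u))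
    (h₆ : HEq r₆ (𝟙 s)) (h : HEq r₃ r₄) :
    (r₁ ⊗ₘ r₂) ≫ r₃ = tensorμ tv uv tw uw ≫ (r₄ ⊗ₘ r₅) ≫ r₆ := by
  subst huv huw hu hv hw ht
  refine eq_of_heq ((heq_id_comp (tensor_heq_id (Permutative.unit_right _)
    (Permutative.unit_right _) h₁ h₂) ?_ rfl).trans (h.trans
      (((heq_id_comp (tensorμ_heq_id (Or.inl rfl)) rfl ?_).trans
        ((heq_comp_id h₆ (Permutative.unit_right _) rfl).trans
          (tensor_unit_heq (Permutative.unit_left _) rfl h₅ _))).symm)))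
  · simp only [Permutative.unit_right]
  · simp only [Permutative.unit_right]

theorem exch_of_top (htv : tv = 𝟙_ D) (huv : uv = 𝟙_ D) (hv : v = 𝟙_ D) (ht : tw = t)
    (hu : uw = u) (hw : w = s) (h₁ : HEq r₁ (𝟙 v)) (h₃ : HEq r₃ (𝟙 s)) (h₄ : HEq r₄ (𝟙 t))
    (h₅ : HEq r₅ (𝟙 u)) (h : HEq r₂ r₆) :
    (r₁ ⊗ₘ r₂) ≫ r₃ = tensorμ tv uv tw uw ≫ (r₄ ⊗ₘ r₅) ≫ r₆ := by
  subst htv huv hv ht hu hw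
  refine eq_of_heq (((heq_comp_id h₃ (Permutative.unit_left _) rfl).trans
    (unit_tensor_heq (Permutative.unit_left _) rfl h₁ _)).trans (h.trans
      (((heq_id_comp (tensorμ_heq_id (Or.inl rfl)) rfl ?_).trans
        (heq_id_comp (tensor_heq_id (Permutative.unit_left _) (Permutative.unit_left _) h₄ h₅)
          ?_ rfl)).symm)))
  · simp only [Permutative.unit_left]
  · simp only [Permutative.unit_left]

theorem exch_of_bottom (htw : tw = 𝟙_ D) (huw : uw = 𝟙_ D) (hw : w = 𝟙_ D) (ht : tv = t)
    (hu : uv = u) (hv : v = s) (h₂ : HEq r₂ (𝟙 w)) (h₃ : HEq r₃ (𝟙 s)) (h₄ : HEq r₄ (𝟙 t))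
    (h₅ : HEq r₅ (𝟙 u)) (h : HEq r₁ r₆) :
    (r₁ ⊗ₘ r₂) ≫ r₃ = tensorμ tv uv tw uw ≫ (r₄ ⊗ₘ r₅) ≫ r₆ := by
  subst htw huw hw ht hu hv
  refine eq_of_heq (((heq_comp_id h₃ (Permutative.unit_right _) rfl).trans
    (tensor_unit_heq (Permutative.unit_left _) rfl h₂ _)).trans (h.trans
      (((heq_id_comp (tensorμ_heq_id (Or.inr rfl)) rfl ?_).trans
        (heq_id_comp (tensor_heq_id (Permutative.unit_right _) (Permutative.unit_right _) h₄ h₅)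
          ?_ rfl)).symm)))
  · simp only [Permutative.unit_right]
  · simp only [Permutative.unit_right]

end degenerate

section prebar

variable {I : Type} {X : I → Type} {A : ∀ i, Set (X i)}

theorem IsSplit.eq_right {i : I} {T U S : Tup A} (h : IsSplit i T U S) (hT : T.1 i = ∅) : U = S :=
  Subtype.ext (funext fun j => by
    by_cases hj : j = i
    · subst hj
      rw [← h.1, hT, Set.empty_union]
    · rw [(h.2.2 j hj).1, (h.2.2 j hj).2])

theorem IsSplit.eq_left {i : I} {T U S : Tup A} (h : IsSplit i T U S) (hU : U.1 i = ∅) : T = S :=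
  h.symm.eq_right hU

theorem IsSplit.empty {i : I} {T U S : Tup A} (h : IsSplit i T U S) (hS : S.1 i = ∅) :
    T.1 i = ∅ ∧ U.1 i = ∅ := by
  have := h.1
  rw [hS] at this
  exact Set.union_empty_iff.1 this

/-- A tuple of nonempty subsets. -/
def Tup.NE (S : Tup A) : Prop := ∀ k, S.1 k ≠ ∅

theorem Tup.not_ne {S : Tup A} : ¬ S.NE ↔ ∃ k, S.1 k = ∅ := by
  simp [Tup.NE]

/-- Systems which satisfy the conditions on empty subsets only. -/
structure PreBar (D : PermCat.{u}) (A : ∀ i, Set (X i)) where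
  C : Tup A → D
  ρ : ∀ (i : I) (T U S : Tup A), IsSplit i T U S → (C T ⊗ C U ⟶ C S)
  C_empty : ∀ (k : I) (S : Tup A), S.1 k = ∅ → C S = 𝟙_ D
  ρ_id : ∀ (i : I) (T U S : Tup A) (h : IsSplit i T U S),
    (T.1 i = ∅ ∨ U.1 i = ∅ ∨ ∃ k, S.1 k = ∅) → HEq (ρ i T U S h) (𝟙 (C S))

variable {D : PermCat.{u}} (P : PreBar D A)

theorem PreBar.left {i : I} {T U S : Tup A} (h : IsSplit i T U S) (k : I) (hT : T.1 k = ∅) :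
    P.C T = 𝟙_ D ∧ P.C U = P.C S ∧ HEq (P.ρ i T U S h) (𝟙 (P.C S)) := by
  refine ⟨P.C_empty k T hT, ?_⟩
  by_cases hk : k = i
  · subst hk
    exact ⟨congrArg P.C (h.eq_right hT), P.ρ_id _ _ _ _ _ (Or.inl hT)⟩
  · have hS : S.1 k = ∅ := (h.2.2 k hk).2.trans hT
    exact ⟨(P.C_empty k U ((h.2.2 k hk).1.trans hT)).trans (P.C_empty k S hS).symm,
      P.ρ_id _ _ _ _ _ (Or.inr (Or.inr ⟨k, hS⟩))⟩

theorem PreBar.right {i : I} {T U S : Tup A} (h : IsSplit i T U S) (k : I) (hU : U.1 k = ∅) :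
    P.C U = 𝟙_ D ∧ P.C T = P.C S ∧ HEq (P.ρ i T U S h) (𝟙 (P.C S)) := by
  by_cases hk : k = i
  · subst hk
    exact ⟨P.C_empty k U hU, congrArg P.C (h.eq_left hU), P.ρ_id _ _ _ _ _ (Or.inr (Or.inl hU))⟩
  · have hT : T.1 k = ∅ := (h.2.2 k hk).1.symm.trans hU
    exact ⟨P.C_empty k U hU, (P.C_empty k T hT).trans (P.C_empty k S
      ((h.2.2 k hk).2.trans hT)).symm, (P.left h k hT).2.2⟩

theorem PreBar.heq {i : I} {T U S T' U' S' : Tup A} (h : IsSplit i T U S) (h' : IsSplit i T' U' S')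
    (hh : (T = T' ∧ U = U' ∧ S = S') ∨ ∃ k, S.1 k = ∅ ∧ S'.1 k = ∅) :
    HEq (P.ρ i T U S h) (P.ρ i T' U' S' h') := by
  rcases hh with ⟨rfl, rfl, rfl⟩ | ⟨k, hS, hS'⟩
  · rfl
  · exact Bar.id_heq _ _ (P.ρ_id _ _ _ _ _ (Or.inr (Or.inr ⟨k, hS⟩)))
      (P.ρ_id _ _ _ _ _ (Or.inr (Or.inr ⟨k, hS'⟩))) ((P.C_empty k S hS).trans
        (P.C_empty k S' hS').symm)

/-- A system satisfying the remaining axioms on tuples of nonempty subsets. -/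
def PreBar.toBar
    (symm : ∀ (i : I) (T U S : Tup A) (h : IsSplit i T U S) (h' : IsSplit i U T S),
      T.NE → U.NE → S.NE → P.ρ i T U S h = (β_ (P.C T) (P.C U)).hom ≫ P.ρ i U T S h')
    (assoc : ∀ (i : I) (T U V TU UV S : Tup A) (h₁ : IsSplit i T U TU) (h₂ : IsSplit i TU V S)
      (h₃ : IsSplit i U V UV) (h₄ : IsSplit i T UV S), T.NE → U.NE → V.NE → S.NE →
      (P.ρ i T U TU h₁ ▷ P.C V) ≫ P.ρ i TU V S h₂ =
        (α_ (P.C T) (P.C U) (P.C V)).hom ≫ (P.C T ◁ P.ρ i U V UV h₃) ≫ P.ρ i T UV S h₄)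
    (exch : ∀ (i j : I), i ≠ j → ∀ (TV UV TW UW V W T U S : Tup A)
      (h₁ : IsSplit i TV UV V) (h₂ : IsSplit i TW UW W) (h₃ : IsSplit j V W S)
      (h₄ : IsSplit j TV TW T) (h₅ : IsSplit j UV UW U) (h₆ : IsSplit i T U S),
      TV.NE → UV.NE → TW.NE → UW.NE → S.NE →
      (P.ρ i TV UV V h₁ ⊗ₘ P.ρ i TW UW W h₂) ≫ P.ρ j V W S h₃ =
        tensorμ (P.C TV) (P.C UV) (P.C TW) (P.C UW) ≫
          (P.ρ j TV TW T h₄ ⊗ₘ P.ρ j UV UW U h₅) ≫ P.ρ i T U S h₆) : Bar D A where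
  C := P.C
  ρ := P.ρ
  C_empty := P.C_empty
  ρ_id := P.ρ_id
  ρ_symm i T U S h h' := by
    by_cases hT : T.NE
    · by_cases hU : U.NE
      · refine symm i T U S h h' hT hU fun k hk => ?_
        by_cases hki : k = i
        · subst hki
          exact hT k (h.empty hk).1
        · exact hT k ((h.2.2 k hki).2.symm.trans hk)
      · obtain ⟨k, hk⟩ := Tup.not_ne.1 hU
        have e := P.left h' k hk
        have e' := P.right h k hk
        exact symm_of_unit (Or.inr e.1) (by rw [e.1, e'.2.1, Permutative.unit_left]) e'.2.2 e.2.2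
    · obtain ⟨k, hk⟩ := Tup.not_ne.1 hT
      have e := P.left h k hk
      have e' := P.right h' k hk
      exact symm_of_unit (Or.inl e.1) (by rw [e.1, e'.2.1, Permutative.unit_right]) e.2.2 e'.2.2
  ρ_assoc i T U V TU UV S h₁ h₂ h₃ h₄ := by
    by_cases hT : T.NE
    · by_cases hU : U.NE
      · by_cases hV : V.NE
        · refine assoc i T U V TU UV S h₁ h₂ h₃ h₄ hT hU hV fun k hk => ?_
          by_cases hki : k = i
          · subst hki
            exact hT k (h₄.empty hk).1
          · exact hT k ((h₄.2.2 k hki).2.symm.trans hk)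
        · obtain ⟨k, hk⟩ := Tup.not_ne.1 hV
          have e₂ := P.right h₂ k hk
          have e₃ := P.right h₃ k hk
          refine assoc_of_right e₂.1 e₂.2.1 e₃.2.1 e₂.2.2 e₃.2.2 (P.heq _ _ ?_)
          by_cases hki : k = i
          · subst hki
            exact Or.inl ⟨rfl, h₃.eq_left hk, h₂.eq_left hk⟩
          · have := (h₂.2.2 k hki).1.symm.trans hk
            exact Or.inr ⟨k, this, (h₂.2.2 k hki).2.trans this⟩
      · obtain ⟨k, hk⟩ := Tup.not_ne.1 hU
        have e₁ := P.right h₁ k hk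
        have e₃ := P.left h₃ k hk
        refine assoc_of_mid e₁.1 e₁.2.1 e₃.2.1 e₁.2.2 e₃.2.2 (P.heq _ _ ?_)
        by_cases hki : k = i
        · subst hki
          exact Or.inl ⟨(h₁.eq_left hk).symm, h₃.eq_right hk, rfl⟩
        · have := (h₄.2.2 k hki).2.trans ((h₁.2.2 k hki).1.symm.trans hk)
          exact Or.inr ⟨k, this, this⟩
    · obtain ⟨k, hk⟩ := Tup.not_ne.1 hT
      have e₁ := P.left h₁ k hk
      have e₄ := P.left h₄ k hk
      refine assoc_of_left e₁.1 e₁.2.1 e₄.2.1 e₁.2.2 e₄.2.2 (P.heq _ _ ?_)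
      by_cases hki : k = i
      · subst hki
        exact Or.inl ⟨(h₁.eq_right hk).symm, rfl, (h₄.eq_right hk).symm⟩
      · exact Or.inr ⟨k, (h₄.2.2 k hki).2.trans hk, (h₄.2.2 k hki).1.trans hk⟩
  ρ_exch i j hij TV UV TW UW V W T U S h₁ h₂ h₃ h₄ h₅ h₆ := by
    have cT : ∀ k, k ≠ j → TV.1 k = ∅ → (P.ρ i TV UV V h₁ ⊗ₘ P.ρ i TW UW W h₂) ≫ P.ρ j V W S h₃ =
        tensorμ (P.C TV) (P.C UV) (P.C TW) (P.C UW) ≫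
          (P.ρ j TV TW T h₄ ⊗ₘ P.ρ j UV UW U h₅) ≫ P.ρ i T U S h₆ := fun k hkj hk => by
      have hTW := (h₄.2.2 k hkj).1.trans hk
      have hT := (h₄.2.2 k hkj).2.trans hk
      have e₁ := P.left h₁ k hk
      have e₂ := P.left h₂ k hTW
      have e₆ := P.left h₆ k hT
      refine exch_of_left e₁.1 e₂.1 e₆.1 e₁.2.1 e₂.2.1 e₆.2.1 e₁.2.2 e₂.2.2 (P.left h₄ k hk).2.2
        e₆.2.2 (P.heq _ _ ?_)
      by_cases hki : k = i
      · subst hki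
        exact Or.inl ⟨(h₁.eq_right hk).symm, (h₂.eq_right hTW).symm, (h₆.eq_right hT).symm⟩
      · exact Or.inr ⟨k, (h₆.2.2 k hki).2.trans hT, (h₆.2.2 k hki).1.trans hT⟩
    have cU : ∀ k, k ≠ j → UV.1 k = ∅ → (P.ρ i TV UV V h₁ ⊗ₘ P.ρ i TW UW W h₂) ≫ P.ρ j V W S h₃ =
        tensorμ (P.C TV) (P.C UV) (P.C TW) (P.C UW) ≫
          (P.ρ j TV TW T h₄ ⊗ₘ P.ρ j UV UW U h₅) ≫ P.ρ i T U S h₆ := fun k hkj hk => by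
      have hUW := (h₅.2.2 k hkj).1.trans hk
      have hU := (h₅.2.2 k hkj).2.trans hk
      have e₁ := P.right h₁ k hk
      have e₂ := P.right h₂ k hUW
      have e₆ := P.right h₆ k hU
      refine exch_of_right e₁.1 e₂.1 e₆.1 e₁.2.1 e₂.2.1 e₆.2.1 e₁.2.2 e₂.2.2 (P.left h₅ k hk).2.2
        e₆.2.2 (P.heq _ _ ?_)
      by_cases hki : k = i
      · subst hki
        exact Or.inl ⟨(h₁.eq_left hk).symm, (h₂.eq_left hUW).symm, (h₆.eq_left hU).symm⟩
      · have hT := (h₆.2.2 k hki).1.symm.trans hU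
        exact Or.inr ⟨k, (h₆.2.2 k hki).2.trans hT, hT⟩
    have cV : TV.1 j = ∅ → (P.ρ i TV UV V h₁ ⊗ₘ P.ρ i TW UW W h₂) ≫ P.ρ j V W S h₃ =
        tensorμ (P.C TV) (P.C UV) (P.C TW) (P.C UW) ≫
          (P.ρ j TV TW T h₄ ⊗ₘ P.ρ j UV UW U h₅) ≫ P.ρ i T U S h₆ := fun hk => by
      have hUV := (h₁.2.2 j hij.symm).1.trans hk
      have hV := (h₁.2.2 j hij.symm).2.trans hk
      have e₄ := P.left h₄ j hk
      have e₅ := P.left h₅ j hUV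
      have e₃ := P.left h₃ j hV
      exact exch_of_top e₄.1 e₅.1 e₃.1 e₄.2.1 e₅.2.1 e₃.2.1 (P.left h₁ j hk).2.2 e₃.2.2 e₄.2.2
        e₅.2.2 (P.heq _ _ (Or.inl ⟨h₄.eq_right hk, h₅.eq_right hUV, h₃.eq_right hV⟩))
    have cW : TW.1 j = ∅ → (P.ρ i TV UV V h₁ ⊗ₘ P.ρ i TW UW W h₂) ≫ P.ρ j V W S h₃ =
        tensorμ (P.C TV) (P.C UV) (P.C TW) (P.C UW) ≫
          (P.ρ j TV TW T h₄ ⊗ₘ P.ρ j UV UW U h₅) ≫ P.ρ i T U S h₆ := fun hk => by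
      have hUW := (h₂.2.2 j hij.symm).1.trans hk
      have hW := (h₂.2.2 j hij.symm).2.trans hk
      have e₄ := P.right h₄ j hk
      have e₅ := P.right h₅ j hUW
      have e₃ := P.right h₃ j hW
      exact exch_of_bottom e₄.1 e₅.1 e₃.1 e₄.2.1 e₅.2.1 e₃.2.1 (P.left h₂ j hk).2.2 e₃.2.2 e₄.2.2
        e₅.2.2 (P.heq _ _ (Or.inl ⟨h₄.eq_left hk, h₅.eq_left hUW, h₃.eq_left hW⟩))
    have dead : ∀ R : Tup A, ¬ R.NE → (∀ k, k ≠ j → R.1 k = ∅ → TV.1 k = ∅ ∨ UV.1 k = ∅) →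
        (R.1 j = ∅ → TV.1 j = ∅ ∨ TW.1 j = ∅) →
        (P.ρ i TV UV V h₁ ⊗ₘ P.ρ i TW UW W h₂) ≫ P.ρ j V W S h₃ =
        tensorμ (P.C TV) (P.C UV) (P.C TW) (P.C UW) ≫
          (P.ρ j TV TW T h₄ ⊗ₘ P.ρ j UV UW U h₅) ≫ P.ρ i T U S h₆ := fun R hR a b => by
      obtain ⟨k, hk⟩ := Tup.not_ne.1 hR
      by_cases hkj : k = j
      · subst hkj
        exact (b hk).elim cV cW
      · exact (a k hkj hk).elim (cT k hkj) (cU k hkj)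
    by_cases n₁ : TV.NE
    · by_cases n₂ : UV.NE
      · by_cases n₃ : TW.NE
        · by_cases n₄ : UW.NE
          · refine exch i j hij TV UV TW UW V W T U S h₁ h₂ h₃ h₄ h₅ h₆ n₁ n₂ n₃ n₄ fun k hk => ?_
            by_cases hki : k = i
            · subst hki
              exact n₁ k ((h₄.2.2 k hij).2.symm.trans (h₆.empty hk).1)
            · have hT := (h₆.2.2 k hki).2.symm.trans hk
              by_cases hkj : k = j
              · subst hkj
                exact n₁ k (h₄.empty hT).1
              · exact n₁ k ((h₄.2.2 k hkj).2.symm.trans hT)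
          · exact dead UW n₄ (fun k hk e => Or.inr ((h₅.2.2 k hk).1.symm.trans e))
              fun e => Or.inr ((h₂.2.2 j hij.symm).1.symm.trans e)
        · exact dead TW n₃ (fun k hk e => Or.inl ((h₄.2.2 k hk).1.symm.trans e)) Or.inr
      · exact dead UV n₂ (fun _ _ e => Or.inr e) fun e => Or.inl ((h₁.2.2 j hij.symm).1.symm.trans e)
    · exact dead TV n₁ (fun _ _ e => Or.inl e) Or.inl

theorem IsSplit.deg_or {i : I} {T U S : Tup A} (h : IsSplit i T U S) :
    (T.1 i = ∅ ∨ U.1 i = ∅ ∨ ∃ k, S.1 k = ∅) ∨ (T.NE ∧ U.NE ∧ S.NE) := by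
  by_cases hT : T.1 i = ∅
  · exact Or.inl (Or.inl hT)
  by_cases hU : U.1 i = ∅
  · exact Or.inl (Or.inr (Or.inl hU))
  by_cases hS : S.NE
  · refine Or.inr ⟨fun k => ?_, fun k => ?_, hS⟩ <;> by_cases hk : k = i
    · exact hk ▸ hT
    · exact (h.2.2 k hk).2 ▸ hS k
    · exact hk ▸ hU
    · rw [(h.2.2 k hk).1, ← (h.2.2 k hk).2]
      exact hS k
  · exact Or.inl (Or.inr (Or.inr (Tup.not_ne.1 hS)))

theorem Bar.ext_ne {a b : Bar D A} (hC : ∀ S : Tup A, S.NE → a.C S = b.C S)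
    (hρ : ∀ i T U S h, T.NE → U.NE → S.NE → HEq (a.ρ i T U S h) (b.ρ i T U S h)) : a = b := by
  have hC' : ∀ S, a.C S = b.C S := fun S => by
    by_cases hS : S.NE
    · exact hC S hS
    · obtain ⟨k, hk⟩ := Tup.not_ne.1 hS
      rw [a.C_empty k S hk, b.C_empty k S hk]
  refine Bar.ext_heq hC' fun i T U S h => ?_
  rcases h.deg_or with hd | ⟨hT, hU, hS⟩
  · exact Bar.id_heq _ _ (a.ρ_id i T U S h hd) (b.ρ_id i T U S h hd) (hC' S)
  · exact hρ i T U S h hT hU hS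

theorem Bar.Hom.heq_ne {a b a' b' : Bar D A} (ha : a = a') (hb : b = b')
    (φ : a ⟶ b) (ψ : a' ⟶ b') (h : ∀ S : Tup A, S.NE → HEq (φ.f S) (ψ.f S)) : HEq φ ψ :=
  Bar.Hom.heq ha hb φ ψ fun S => by
    by_cases hS : S.NE
    · exact h S hS
    · obtain ⟨k, hk⟩ := Tup.not_ne.1 hS
      exact (φ.f_empty k S hk).trans (ψ.f_empty k S hk).symm

end prebar

/-! ### The multifunctor from permutative categories to symmetric functors -/

section bar

variable {I : Type} {X : I → Type} {A : ∀ i, Set (X i)} {D : PermCat.{u}}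

/-- A system with its exactness conditions forgotten. -/
def Bar.pre (a : Bar D A) : PreBar D A := ⟨a.C, a.ρ, a.C_empty, a.ρ_id⟩

theorem Bar.left (a : Bar D A) {i : I} {T U S : Tup A} (h : IsSplit i T U S) (k : I)
    (hT : T.1 k = ∅) : a.C T = 𝟙_ D ∧ a.C U = a.C S ∧ HEq (a.ρ i T U S h) (𝟙 (a.C S)) :=
  a.pre.left h k hT

theorem Bar.right (a : Bar D A) {i : I} {T U S : Tup A} (h : IsSplit i T U S) (k : I)
    (hU : U.1 k = ∅) : a.C U = 𝟙_ D ∧ a.C T = a.C S ∧ HEq (a.ρ i T U S h) (𝟙 (a.C S)) :=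
  a.pre.right h k hU

theorem IsSplit.ne {i : I} {T U S : Tup A} (h : IsSplit i T U S) (hT : T.NE) : S.NE := fun k hk => by
  by_cases hki : k = i
  · subst hki
    exact hT k (h.empty hk).1
  · exact hT k ((h.2.2 k hki).2.symm.trans hk)

theorem Bar.comm_left {a b : Bar D A} {i : I} {T U S : Tup A} (h : IsSplit i T U S) (hT : ¬T.NE)
    {p : a.C T ⟶ b.C T} {q : a.C U ⟶ b.C U} {r : a.C S ⟶ b.C S} (hp : HEq p (𝟙 (𝟙_ D)))
    (hr : HEq r q) : a.ρ i T U S h ≫ r = (p ⊗ₘ q) ≫ b.ρ i T U S h := by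
  obtain ⟨k, hk⟩ := Tup.not_ne.1 hT
  have e := a.left h k hk
  have e' := b.left h k hk
  refine eq_of_heq ((heq_id_comp e.2.2 ?_ rfl).trans (hr.trans
    ((heq_comp_id e'.2.2 ?_ rfl).trans (unit_tensor_heq e.1 e'.1 hp q)).symm))
  · rw [e.1, e.2.1, Permutative.unit_left]
  · rw [e'.1, e'.2.1, Permutative.unit_left]

theorem Bar.comm_right {a b : Bar D A} {i : I} {T U S : Tup A} (h : IsSplit i T U S) (hU : ¬U.NE)
    {p : a.C T ⟶ b.C T} {q : a.C U ⟶ b.C U} {r : a.C S ⟶ b.C S} (hq : HEq q (𝟙 (𝟙_ D)))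
    (hr : HEq r p) : a.ρ i T U S h ≫ r = (p ⊗ₘ q) ≫ b.ρ i T U S h := by
  rw [a.ρ_symm i T U S h h.symm, b.ρ_symm i T U S h h.symm, Category.assoc,
    Bar.comm_left h.symm hU hq hr, BraidedCategory.braiding_naturality_assoc]

/-- Morphisms of systems may be checked on tuples of nonempty subsets. -/
def Bar.mkHom {a b : Bar D A} (f : ∀ S : Tup A, a.C S ⟶ b.C S)
    (f_empty : ∀ (k : I) (S : Tup A), S.1 k = ∅ → HEq (f S) (𝟙 (𝟙_ D)))
    (comm : ∀ (i : I) (T U S : Tup A) (h : IsSplit i T U S), T.NE → U.NE → S.NE →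
      a.ρ i T U S h ≫ f S = (f T ⊗ₘ f U) ≫ b.ρ i T U S h) : a ⟶ b :=
  have hf : ∀ {i T U S}, IsSplit i T U S → ¬T.NE →
      HEq (f T) (𝟙 (𝟙_ D)) ∧ HEq (f S) (f U) := fun {i T U S} h hT => by
    obtain ⟨k, hk⟩ := Tup.not_ne.1 hT
    refine ⟨f_empty k T hk, ?_⟩
    by_cases hki : k = i
    · subst hki
      rw [h.eq_right hk]
    · exact (f_empty k S ((h.2.2 k hki).2.trans hk)).trans
        (f_empty k U ((h.2.2 k hki).1.trans hk)).symm
  Bar.Hom.mk (a := a) (b := b) f f_empty fun i T U S h => by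
    by_cases hT : T.NE
    · by_cases hU : U.NE
      · exact comm i T U S h hT hU (h.ne hT)
      · exact Bar.comm_right h hU (hf h.symm hU).1 (hf h.symm hU).2
    · exact Bar.comm_left h hT (hf h hT).1 (hf h hT).2

theorem Bar.functor_ext {E : Type v} [Category.{w} E] {P Q : E ⥤ Bar D A}
    (hC : ∀ x (S : Tup A), S.NE → (P.obj x).C S = (Q.obj x).C S)
    (hρ : ∀ x i T U S h, T.NE → U.NE → S.NE → HEq ((P.obj x).ρ i T U S h) ((Q.obj x).ρ i T U S h))
    (hf : ∀ x y (φ : x ⟶ y) (S : Tup A), S.NE →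
      HEq (Bar.Hom.f (P.map φ) S) (Bar.Hom.f (Q.map φ) S)) : P = Q := by
  have ho : ∀ x, P.obj x = Q.obj x := fun x => Bar.ext_ne (hC x) (hρ x)
  exact Functor.hext ho fun x y φ => Bar.Hom.heq_ne (ho x) (ho y) _ _ (hf x y φ)

theorem Bar.nat_heq {E : Type v} [Category.{w} E] {P Q P' Q' : E ⥤ Bar D A} (hP : P = P')
    (hQ : Q = Q') (t : P ⟶ Q) (t' : P' ⟶ Q') (h : ∀ x (S : Tup A), S.NE →
      HEq (Bar.Hom.f (t.app x) S) (Bar.Hom.f (t'.app x) S)) : HEq t t' := by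
  subst hP hQ
  exact heq_of_eq (NatTrans.ext (funext fun x => eq_of_heq (Bar.Hom.heq_ne rfl rfl _ _ (h x))))

end bar

theorem Finfty.eq_one {n : Finfty} {T : Tup n.set} {s : ℕ} (hs : n.n s = 1) (hT : T.1 s ≠ ∅) :
    T.1 s = {1} := by
  have h₀ : T.1 s ⊆ {1} := fun x hx => by
    have : 1 ≤ x ∧ x ≤ n.n s := T.2 s hx
    rw [hs] at this
    exact le_antisymm this.2 this.1
  exact (Set.subset_singleton_iff_eq.1 h₀).resolve_left hT

theorem Finfty.ne_one_of_split {n : Finfty} {s : ℕ} {T U S : Tup n.set} (h : IsSplit s T U S)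
    (hT : T.1 s ≠ ∅) (hU : U.1 s ≠ ∅) : n.n s ≠ 1 := fun hs => by
  have := h.2.1
  rw [Finfty.eq_one hs hT, Finfty.eq_one hs hU] at this
  simp at this

section J

variable {ι : Type} {C : ι → PermCat.{u}} {D : PermCat.{u}} {β : ι × ℕ ↪ ℕ} {n : ι → Finfty}
  {m : Finfty} (h : IsPush β n m)

/-- The restriction of a tuple to a block. -/
def resTup (T : Tup m.set) (i : ι) : Tup (n i).set :=
  ⟨fun j => T.1 (β (i, j)), fun j => by
    have := T.2 (β (i, j))
    unfold Finfty.set at this ⊢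
    rwa [h.1 i j] at this⟩

/-- All entries outside of the blocks are nonempty. -/
def OutNE (β : ι × ℕ ↪ ℕ) (T : Tup m.set) : Prop := ∀ s, s ∉ Set.range β → T.1 s ≠ ∅

theorem Tup.NE.out {T : Tup m.set} (hT : T.NE) : OutNE β T := fun s _ => hT s

variable {h} in
theorem resTup_split {i : ι} {j : ℕ} {T U S : Tup m.set} (hs : IsSplit (β (i, j)) T U S) :
    IsSplit j (resTup h T i) (resTup h U i) (resTup h S i) :=
  ⟨hs.1, hs.2.1, fun _ hk => hs.2.2 _ fun e => hk (Prod.mk.inj (β.injective e)).2⟩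

theorem resTup_eq {i : ι} {s : ℕ} {T U S : Tup m.set} (hs : IsSplit s T U S)
    (h' : ∀ j, β (i, j) ≠ s) : resTup h U i = resTup h T i ∧ resTup h S i = resTup h T i :=
  ⟨Subtype.ext (funext fun j => (hs.2.2 _ (h' j)).1), Subtype.ext (funext fun j => (hs.2.2 _ (h' j)).2)⟩

theorem emb_ne {i i' : ι} (hi : i' ≠ i) (j j' : ℕ) : β (i', j') ≠ β (i, j) :=
  fun e => hi (Prod.mk.inj (β.injective e)).1

variable (f : MultiLin C D) (A : ∀ i, Bar (C i) (n i).set)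

/-- The tuple of values at the blocks of a tuple of subsets. -/
def resC (T : Tup m.set) (i : ι) : C i := (A i).C (resTup h T i)

theorem agree_res {i : ι} {j : ℕ} {T U S : Tup m.set} (hs : IsSplit (β (i, j)) T U S) :
    Agree i (resC h A T) (resC h A U) (resC h A S) := fun i' hi =>
  have e := resTup_eq h hs fun j' => emb_ne hi j j'
  ⟨congrArg (A i').C e.1, congrArg (A i').C e.2⟩

/-- The structure maps of `f (A)`. -/
def resρ {i : ι} {j : ℕ} {T U S : Tup m.set} (hs : IsSplit (β (i, j)) T U S) :
    f.F.obj (resC h A T) ⊗ f.F.obj (resC h A U) ⟶ f.F.obj (resC h A S) :=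
  f.push i _ _ _ (agree_res h A hs) ((A i).ρ j _ _ _ (resTup_split hs))

theorem OutNE.of_split {i : ι} {j : ℕ} {T U S : Tup m.set} (hs : IsSplit (β (i, j)) T U S) :
    (OutNE β T ↔ OutNE β S) ∧ (OutNE β U ↔ OutNE β S) := by
  have : ∀ s, s ∉ Set.range β → U.1 s = T.1 s ∧ S.1 s = T.1 s := fun s hr =>
    hs.2.2 s fun e => hr ⟨_, e.symm⟩
  exact ⟨forall₂_congr fun s hr => by rw [(this s hr).2], forall₂_congr fun s hr => by
    rw [(this s hr).2, (this s hr).1]⟩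

open Classical in
/-- The objects of `f (A)`. -/
def JC (T : Tup m.set) : D := if OutNE β T then f.F.obj (resC h A T) else 𝟙_ D

variable {h} in
theorem JC_eq {T : Tup m.set} (hT : OutNE β T) : JC h f A T = f.F.obj (resC h A T) := if_pos hT

theorem JC_empty (k : ℕ) (T : Tup m.set) (hk : T.1 k = ∅) : JC h f A T = 𝟙_ D := by
  by_cases hT : OutNE β T
  · rw [JC_eq f A hT]
    obtain ⟨⟨i, j⟩, rfl⟩ := not_not.1 fun hr => hT k hr hk
    exact f.F_zero i _ ((A i).C_empty j _ hk)
  · exact if_neg hT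

theorem exists_JPre : ∃ P : PreBar D m.set, P.C = JC h f A ∧
    ∀ (i : ι) (j : ℕ) (T U S : Tup m.set) (hs : IsSplit (β (i, j)) T U S), OutNE β S →
      HEq (P.ρ (β (i, j)) T U S hs) (resρ h f A hs) := by
  have key : ∀ (s : ℕ) (T U S : Tup m.set) (hs : IsSplit s T U S),
      ∃ r : JC h f A T ⊗ JC h f A U ⟶ JC h f A S,
      (∀ i j (hs' : IsSplit (β (i, j)) T U S), β (i, j) = s → OutNE β S →
        HEq r (resρ h f A hs')) ∧
      (T.1 s = ∅ ∨ U.1 s = ∅ ∨ (∃ k, S.1 k = ∅) → HEq r (𝟙 (JC h f A S))) := by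
    intro s T U S hs
    by_cases hS : OutNE β S ∧ s ∈ Set.range β
    · obtain ⟨hS, ⟨i, j⟩, rfl⟩ := hS
      have hT := (OutNE.of_split hs).1.2 hS
      have hU := (OutNE.of_split hs).2.2 hS
      refine ⟨eqToHom (by rw [JC_eq f A hT, JC_eq f A hU]) ≫ resρ h f A hs ≫
        eqToHom (JC_eq f A hS).symm, fun i' j' hs' e _ => ?_, fun hd => ?_⟩
      · obtain ⟨rfl, rfl⟩ := Prod.mk.inj (β.injective e)
        exact (eqToHom_comp_heq _ _).trans (comp_eqToHom_heq _ _)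
      · refine ((eqToHom_comp_heq _ _).trans (comp_eqToHom_heq _ _)).trans ?_
        rw [JC_eq f A hS]
        have inner : ((resTup h T i).1 j = ∅ ∨ (resTup h U i).1 j = ∅ ∨
            ∃ k, (resTup h S i).1 k = ∅) →
            HEq (resρ h f A hs) (𝟙 (f.F.obj (resC h A S))) := fun hi => by
          have hr := (A i).ρ_id j _ _ _ (resTup_split (h := h) hs) hi
          have hc : (resC h A U i = 𝟙_ (C i) ∧ resC h A T i = resC h A S i) ∨
              (resC h A T i = 𝟙_ (C i) ∧ resC h A U i = resC h A S i) := by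
            rcases hi with hi | hi | ⟨k, hi⟩
            · have := (A i).pre.left (resTup_split (h := h) hs) j hi
              exact Or.inr ⟨this.1, this.2.1⟩
            · have := (A i).pre.right (resTup_split (h := h) hs) j hi
              exact Or.inl ⟨this.1, this.2.1⟩
            · by_cases hk : k = j
              · subst hk
                have := (A i).pre.left (resTup_split (h := h) hs) k
                  ((resTup_split (h := h) hs).empty hi).1
                exact Or.inr ⟨this.1, this.2.1⟩
              · have := (A i).pre.left (resTup_split (h := h) hs) k
                  (((resTup_split (h := h) hs).2.2 k hk).2.symm.trans hi)
                exact Or.inr ⟨this.1, this.2.1⟩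
          refine f.push_heq_id i _ _ _ _ _ hr ?_ (hc.imp (fun e => e.1) fun e => ⟨i, e.1⟩)
          rcases hc with e | e
          · rw [e.1, Permutative.unit_right, e.2]
          · rw [e.1, Permutative.unit_left, e.2]
        rcases hd with hd | hd | ⟨k, hd⟩
        · exact inner (Or.inl hd)
        · exact inner (Or.inr (Or.inl hd))
        · obtain ⟨⟨i', j'⟩, rfl⟩ := not_not.1 fun hr => hS k hr hd
          by_cases hi : i' = i
          · subst hi
            exact inner (Or.inr (Or.inr ⟨j', hd⟩))
          · refine f.push_heq_id_of_ne i i' hi _ _ _ _ _ ((A i').C_empty j' _ ?_)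
            exact (hs.2.2 _ (emb_ne hi j j')).2.symm.trans hd
    · have e : JC h f A T ⊗ JC h f A U = JC h f A S := by
        by_cases hd : S.1 s = ∅
        · rw [JC_empty h f A s T (hs.empty hd).1, JC_empty h f A s U (hs.empty hd).2,
            JC_empty h f A s S hd, Permutative.unit_left]
        by_cases hr : s ∈ Set.range β
        · obtain ⟨k, hk⟩ := not_forall.1 fun hn => hS ⟨hn, hr⟩
          obtain ⟨hkr, hk⟩ := Classical.not_imp.1 hk
          have hk := not_not.1 hk
          have hks : k ≠ s := fun e => hkr (e ▸ hr)
          have hT := (hs.2.2 k hks).2.symm.trans hk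
          rw [JC_empty h f A k T hT, JC_empty h f A k U ((hs.2.2 k hks).1.trans hT),
            JC_empty h f A k S hk, Permutative.unit_left]
        · by_cases hT : T.1 s = ∅
          · rw [JC_empty h f A s T hT, hs.eq_right hT, Permutative.unit_left]
          · have hU : U.1 s = ∅ := by
              by_contra hU
              exact Finfty.ne_one_of_split hs hT hU (h.2 s hr)
            rw [JC_empty h f A s U hU, hs.eq_left hU, Permutative.unit_right]
      exact ⟨eqToHom e, fun i j _ e hn => absurd ⟨hn, _, e⟩ hS, fun _ => eqToHom_heq_id_cod _ _ e⟩
  choose ρ h₁ h₂ using key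
  exact ⟨⟨JC h f A, ρ, JC_empty h f A, h₂⟩, rfl, fun i j T U S hs hS => h₁ _ T U S hs i j hs rfl hS⟩

include h in
theorem mem_range_of_ne_one {s : ℕ} (hs : m.n s ≠ 1) : ∃ i j, β (i, j) = s := by
  obtain ⟨⟨i, j⟩, e⟩ := not_not.1 fun hr => hs (h.2 s hr)
  exact ⟨i, j, e⟩

include h in
theorem IsSplit.mem_range {s : ℕ} {T U S : Tup m.set} (hs : IsSplit s T U S) (hT : T.NE)
    (hU : U.NE) : ∃ i j, β (i, j) = s :=
  mem_range_of_ne_one h (Finfty.ne_one_of_split hs (hT s) (hU s))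

theorem exists_JObj : ∃ a : Bar D m.set, a.C = JC h f A ∧
    ∀ (i : ι) (j : ℕ) (T U S : Tup m.set) (hs : IsSplit (β (i, j)) T U S), OutNE β S →
      HEq (a.ρ (β (i, j)) T U S hs) (resρ h f A hs) := by
  obtain ⟨P, hC, hρ⟩ := exists_JPre h f A
  have hC' : ∀ {T : Tup m.set}, T.NE → P.C T = f.F.obj (resC h A T) := fun {T} hT =>
    (congrFun hC T).trans (JC_eq f A hT.out)
  refine ⟨P.toBar ?_ ?_ ?_, hC, hρ⟩
  · intro s T U S hs hs' hT hU hS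
    obtain ⟨i, j, rfl⟩ := IsSplit.mem_range h hs hT hU
    have key := f.push_symm i _ _ _ _ (agree_res h A hs) (agree_res h A hs')
      ((A i).ρ j _ _ _ (resTup_split hs)) ((A i).ρ j _ _ _ (resTup_split hs')) (𝟙 _)
      ((Category.comp_id _).trans ((A i).ρ_symm j _ _ _ _ _)) fun _ _ => HEq.rfl
    rw [f.F.map_id, Category.comp_id] at key
    have k₁ := hρ i j T U S hs hS.out
    have k₂ := hρ i j U T S hs' hS.out
    revert k₁ k₂
    generalize P.ρ _ _ _ _ hs = r₁
    generalize P.ρ _ _ _ _ hs' = r₂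
    revert r₁ r₂
    rw [hC' hT, hC' hU, hC' hS]
    intro r₁ r₂ k₁ k₂
    obtain rfl := eq_of_heq k₁
    obtain rfl := eq_of_heq k₂
    exact key
  · intro s T U V TU UV S h₁ h₂ h₃ h₄ hT hU hV hS
    obtain ⟨i, j, rfl⟩ := IsSplit.mem_range h h₁ hT hU
    have hTU := h₁.ne hT
    have hUV := h₃.ne hU
    have key := f.push_assoc i _ _ _ _ _ _ (agree_res h A h₁) (agree_res h A h₂) (agree_res h A h₃)
      (agree_res h A h₄) _ _ _ _ ((A i).ρ_assoc j _ _ _ _ _ _ (resTup_split h₁) (resTup_split h₂)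
        (resTup_split h₃) (resTup_split h₄))
    have k₁ := hρ i j T U TU h₁ hTU.out
    have k₂ := hρ i j TU V S h₂ hS.out
    have k₃ := hρ i j U V UV h₃ hUV.out
    have k₄ := hρ i j T UV S h₄ hS.out
    revert k₁ k₂ k₃ k₄
    generalize P.ρ _ _ _ _ h₁ = r₁
    generalize P.ρ _ _ _ _ h₂ = r₂
    generalize P.ρ _ _ _ _ h₃ = r₃
    generalize P.ρ _ _ _ _ h₄ = r₄
    revert r₁ r₂ r₃ r₄
    rw [hC' hT, hC' hU, hC' hV, hC' hTU, hC' hUV, hC' hS]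
    intro r₁ r₂ r₃ r₄ k₁ k₂ k₃ k₄
    obtain rfl := eq_of_heq k₁
    obtain rfl := eq_of_heq k₂
    obtain rfl := eq_of_heq k₃
    obtain rfl := eq_of_heq k₄
    exact key
  · intro s s' hss TV UV TW UW V W T U S h₁ h₂ h₃ h₄ h₅ h₆ hTV hUV hTW hUW hS
    obtain ⟨i, j, rfl⟩ := IsSplit.mem_range h h₁ hTV hUV
    obtain ⟨i', j', rfl⟩ := IsSplit.mem_range h h₄ hTV hTW
    have hV := h₁.ne hTV
    have hW := h₂.ne hTW
    have hT := h₄.ne hTV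
    have hU := h₅.ne hUV
    have key : (resρ h f A h₁ ⊗ₘ resρ h f A h₂) ≫ resρ h f A h₃ =
        tensorμ _ _ _ _ ≫ (resρ h f A h₄ ⊗ₘ resρ h f A h₅) ≫ resρ h f A h₆ := by
      by_cases hi : i = i'
      · subst hi
        exact f.push_exch_same i _ _ _ _ _ _ _ _ _ _ _ _ _ _ _ _ _ _ _ _ _
          ((A i).ρ_exch j j' (fun e => hss (by rw [e])) _ _ _ _ _ _ _ _ _ _ _ _ _ _ _)
      · have e₄ := resTup_eq h h₄ (i := i) fun k => emb_ne hi j' k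
        have e₅ := resTup_eq h h₅ (i := i) fun k => emb_ne hi j' k
        have e₃ := resTup_eq h h₃ (i := i) fun k => emb_ne hi j' k
        have e₁ := resTup_eq h h₁ (i := i') fun k => emb_ne (Ne.symm hi) j k
        have e₂ := resTup_eq h h₂ (i := i') fun k => emb_ne (Ne.symm hi) j k
        have e₆ := resTup_eq h h₆ (i := i') fun k => emb_ne (Ne.symm hi) j k
        exact f.push_exch_diff i i' hi _ _ _ _ _ _ _ _ _ _ _ _ _ _ _ _ _ _ _ _ _
          (Bar.map_heq (A i) rfl e₄.1 e₅.1 e₃.1 _ _)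
          (Bar.map_heq (A i) rfl e₄.2 e₅.2 e₃.2 _ _)
          (Bar.map_heq (A i') rfl e₁.2.symm e₂.2.symm e₆.2.symm _ _)
          (Bar.map_heq (A i') rfl (e₁.1.trans e₁.2.symm) (e₂.1.trans e₂.2.symm)
            (e₆.1.trans e₆.2.symm) _ _)
    have k₁ := hρ i j TV UV V h₁ hV.out
    have k₂ := hρ i j TW UW W h₂ hW.out
    have k₃ := hρ i' j' V W S h₃ hS.out
    have k₄ := hρ i' j' TV TW T h₄ hT.out
    have k₅ := hρ i' j' UV UW U h₅ hU.out
    have k₆ := hρ i j T U S h₆ hS.out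
    revert k₁ k₂ k₃ k₄ k₅ k₆
    generalize P.ρ _ _ _ _ h₁ = r₁
    generalize P.ρ _ _ _ _ h₂ = r₂
    generalize P.ρ _ _ _ _ h₃ = r₃
    generalize P.ρ _ _ _ _ h₄ = r₄
    generalize P.ρ _ _ _ _ h₅ = r₅
    generalize P.ρ _ _ _ _ h₆ = r₆
    revert r₁ r₂ r₃ r₄ r₅ r₆
    rw [hC' hTV, hC' hUV, hC' hTW, hC' hUW, hC' hT, hC' hU, hC' hV, hC' hW, hC' hS]
    intro r₁ r₂ r₃ r₄ r₅ r₆ k₁ k₂ k₃ k₄ k₅ k₆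
    obtain rfl := eq_of_heq k₁
    obtain rfl := eq_of_heq k₂
    obtain rfl := eq_of_heq k₃
    obtain rfl := eq_of_heq k₄
    obtain rfl := eq_of_heq k₅
    obtain rfl := eq_of_heq k₆
    exact key

/-- The system `f (A)`. -/
def JObj : Bar D m.set := (exists_JObj h f A).choose

variable {h} in
theorem JObj_C {T : Tup m.set} (hT : OutNE β T) : (JObj h f A).C T = f.F.obj (resC h A T) :=
  (congrFun (exists_JObj h f A).choose_spec.1 T).trans (JC_eq f A hT)

theorem JObj_ρ {i : ι} {j : ℕ} {T U S : Tup m.set} (hs : IsSplit (β (i, j)) T U S)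
    (hS : OutNE β S) : HEq ((JObj h f A).ρ (β (i, j)) T U S hs) (resρ h f A hs) :=
  (exists_JObj h f A).choose_spec.2 i j T U S hs hS

variable {A} {B : ∀ i, Bar (C i) (n i).set} {f} {g : MultiLin C D}

theorem exists_JHom (r : ∀ T : Tup m.set, f.F.obj (resC h A T) ⟶ g.F.obj (resC h B T))
    (hr₀ : ∀ T i j, T.1 (β (i, j)) = ∅ → HEq (r T) (𝟙 (𝟙_ D)))
    (hr : ∀ i j (T U S : Tup m.set) (hs : IsSplit (β (i, j)) T U S),
      resρ h f A hs ≫ r S = (r T ⊗ₘ r U) ≫ resρ h g B hs) :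
    ∃ φ : JObj h f A ⟶ JObj h g B, ∀ T : Tup m.set, OutNE β T → HEq (Bar.Hom.f φ T) (r T) := by
  have key : ∀ T : Tup m.set, ∃ t : (JObj h f A).C T ⟶ (JObj h g B).C T,
      (OutNE β T → HEq t (r T)) ∧ ∀ k, T.1 k = ∅ → HEq t (𝟙 (𝟙_ D)) := fun T => by
    by_cases hT : OutNE β T
    · refine ⟨eqToHom (JObj_C f A hT) ≫ r T ≫ eqToHom (JObj_C g B hT).symm, fun _ =>
        (eqToHom_comp_heq _ _).trans (comp_eqToHom_heq _ _), fun k hk => ?_⟩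
      obtain ⟨⟨i, j⟩, rfl⟩ := not_not.1 fun hr => hT k hr hk
      exact ((eqToHom_comp_heq _ _).trans (comp_eqToHom_heq _ _)).trans (hr₀ T i j hk)
    · obtain ⟨k, hk⟩ := not_forall.1 hT
      obtain ⟨_, hk⟩ := Classical.not_imp.1 hk
      have e := (JObj h f A).C_empty k T (not_not.1 hk)
      have e' := (JObj h g B).C_empty k T (not_not.1 hk)
      refine ⟨eqToHom (e.trans e'.symm), fun hT' => absurd hT' hT, fun _ _ => (eqToHom_heq_id_cod _ _ _).trans ?_⟩
      rw [e']
  choose t h₁ h₂ using key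
  refine ⟨Bar.mkHom t (fun k T => h₂ T k) fun s T U S hs hT hU hS => ?_, h₁⟩
  obtain ⟨i, j, rfl⟩ := IsSplit.mem_range h hs hT hU
  have c := @JObj_C _ C D β n m h
  refine eq_of_heq ((comp_heq ?_ (c f A hS.out) (c g B hS.out) (JObj_ρ h f A hs hS.out)
    (h₁ S hS.out)).trans ((heq_of_eq (hr i j T U S hs)).trans (comp_heq ?_ ?_ (c g B hS.out)
      (tensor_heq (c f A hT.out) (c g B hT.out) (c f A hU.out) (c g B hU.out) (h₁ T hT.out)
        (h₁ U hU.out)) (JObj_ρ h g B hs hS.out)).symm))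
  · rw [c f A hT.out, c f A hU.out]
  · rw [c f A hT.out, c f A hU.out]
  · rw [c g B hT.out, c g B hU.out]

theorem exists_JMap (φ : A ⟶ B) : ∃ t : JObj h f A ⟶ JObj h f B, ∀ T : Tup m.set, OutNE β T →
    HEq (Bar.Hom.f t T) (f.F.map (X := resC h A T) (Y := resC h B T)
      fun i => Bar.Hom.f (φ i) (resTup h T i)) := by
  refine exists_JHom h (fun T => f.F.map (X := resC h A T) (Y := resC h B T)
    fun i => Bar.Hom.f (φ i) (resTup h T i)) (fun T i j hT => ?_) fun i j T U S hs => ?_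
  · have eA := (A i).C_empty j (resTup h T i) hT
    have eB := (B i).C_empty j (resTup h T i) hT
    refine (f.F_map_zero i _ _ _ eA eB (Bar.Hom.f_empty (φ i) j (resTup h T i) hT)).trans ?_
    rfl
  · refine (f.push_nat i _ _ _ _ _ _ _ _ _ _ _ _ _ ?_ fun i' hi => ?_).symm
    · exact (Bar.Hom.comm (φ i) j _ _ _ (resTup_split hs)).symm
    · have e := resTup_eq h hs fun j' => emb_ne hi j j'
      constructor
      · change HEq (Bar.Hom.f (φ i') (resTup h U i')) (Bar.Hom.f (φ i') (resTup h T i'))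
        rw [e.1]
      · change HEq (Bar.Hom.f (φ i') (resTup h S i')) (Bar.Hom.f (φ i') (resTup h T i'))
        rw [e.2]

variable (f) in
/-- The functor `A ↦ f (A)`. -/
def JApp : (∀ i, Bar (C i) (n i).set) ⥤ Bar D m.set where
  obj A := JObj h f A
  map φ := (exists_JMap h φ).choose
  map_id A := eq_of_heq (Bar.Hom.heq_ne rfl rfl _ _ fun T hT => by
    refine ((exists_JMap h (f := f) (𝟙 A)).choose_spec T hT.out).trans ?_
    change HEq _ (𝟙 ((JObj h f A).C T))
    rw [JObj_C f A hT.out]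
    exact heq_of_eq (f.F.map_id _))
  map_comp {A B E} φ ψ := eq_of_heq (Bar.Hom.heq_ne rfl rfl _ _ fun T hT => by
    refine ((exists_JMap h (f := f) (φ ≫ ψ)).choose_spec T hT.out).trans
      (HEq.trans (heq_of_eq ?_) (comp_heq (JObj_C f A hT.out) (JObj_C f B hT.out)
      (JObj_C f E hT.out) ((exists_JMap h (f := f) φ).choose_spec T hT.out)
      ((exists_JMap h (f := f) ψ).choose_spec T hT.out)).symm)
    exact f.F.map_comp (X := resC h A T) (Y := resC h B T) (Z := resC h E T) _ _)

theorem JApp_map (φ : A ⟶ B) {T : Tup m.set} (hT : OutNE β T) :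
    HEq (Bar.Hom.f ((JApp h f).map φ) T) (f.F.map (X := resC h A T) (Y := resC h B T)
      fun i => Bar.Hom.f (φ i) (resTup h T i)) :=
  (exists_JMap h φ).choose_spec T hT

theorem exists_JNat (p : f ⟶ g) (A : ∀ i, Bar (C i) (n i).set) :
    ∃ t : JObj h f A ⟶ JObj h g A, ∀ T : Tup m.set, OutNE β T →
      HEq (Bar.Hom.f t T) (p.nat.app (resC h A T)) :=
  exists_JHom h (fun T => p.nat.app (resC h A T))
    (fun T i j hT => p.zero i _ ((A i).C_empty j (resTup h T i) hT))
    fun i _ _ _ _ _ => p.comm_push i _ _ _ _ _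

/-- The natural transformation induced by a morphism of multilinear functors. -/
def JNat (p : f ⟶ g) : JApp h f ⟶ JApp h g where
  app A := (exists_JNat h p A).choose
  naturality A B φ := eq_of_heq (Bar.Hom.heq_ne rfl rfl _ _ fun T hT => by
    have c := @JObj_C _ C D β n m h
    refine (comp_heq (c f A hT.out) (c f B hT.out) (c g B hT.out) (JApp_map h φ hT.out)
      ((exists_JNat h p B).choose_spec T hT.out)).trans (HEq.trans (heq_of_eq ?_)
      (comp_heq (c f A hT.out) (c g A hT.out) (c g B hT.out)
        ((exists_JNat h p A).choose_spec T hT.out) (JApp_map h φ hT.out)).symm)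
    exact p.nat.naturality _)

theorem JNat_app (p : f ⟶ g) (A : ∀ i, Bar (C i) (n i).set) {T : Tup m.set} (hT : OutNE β T) :
    HEq (Bar.Hom.f ((JNat h p).app A) T) (p.nat.app (resC h A T)) :=
  (exists_JNat h p A).choose_spec T hT

end J

section pull

variable {ι : Type} {C : ι → PermCat.{u}} {D : PermCat.{u}} {β β' : ι × ℕ ↪ ℕ} {n n' : ι → Finfty}
  {m m' : Finfty} (h : IsPush β n m) (h' : IsPush β' n' m')
  (a : ∀ i, BarMap (n i).set (n' i).set) (b : BarMap m.set m'.set)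

/-- Compatibility of operations on tuples of subsets with blocks. -/
structure Compat : Prop where
  res : ∀ (T : Tup m'.set), T.NE → ∀ i, resTup h (b.Φ T) i = (a i).Φ (resTup h' T i)
  out : ∀ (T : Tup m'.set), T.NE → OutNE β (b.Φ T)
  idx : ∀ i j, m'.n (β' (i, j)) ≠ 1 → b.idx (β' (i, j)) = β (i, (a i).idx j)

variable {h h' a b} (k : Compat h h' a b) {f g : MultiLin C D}
include k

theorem Compat.resC_eq (A : ∀ i, Bar (C i) (n i).set) {T : Tup m'.set} (hT : T.NE) :
    resC h A (b.Φ T) = resC h' (fun i => (Bar.pull (C i) (a i)).obj (A i)) T :=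
  funext fun i => congrArg (A i).C (k.res T hT i)

theorem JApp_pull : Functor.pi (fun i => Bar.pull (C i) (a i)) ⋙ JApp h' f =
    JApp h f ⋙ Bar.pull D b := by
  refine Bar.functor_ext (fun A T hT => ?_) (fun A s T U S hs hT hU hS => ?_) fun A B φ T hT => ?_
  · exact (JObj_C f _ hT.out).trans ((JObj_C f A (k.out T hT)).trans
      (congrArg f.F.obj (k.resC_eq A hT))).symm
  · obtain ⟨i, j, rfl⟩ := IsSplit.mem_range h' hs hT hU
    refine (JObj_ρ h' f _ hs hS.out).trans (HEq.trans ?_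
      ((Bar.map_heq (JObj h f A) (k.idx i j (Finfty.ne_one_of_split hs (hT _) (hU _))) rfl rfl rfl
        (b.split _ _ _ _ hs) ?_).trans (JObj_ρ h f A (i := i) (j := (a i).idx j) ?_ (k.out S hS))).symm)
    · refine f.push_heq i (k.resC_eq A hT).symm (k.resC_eq A hU).symm (k.resC_eq A hS).symm _ _ ?_
      exact Bar.map_heq (A i) rfl (k.res T hT i).symm (k.res U hU i).symm (k.res S hS i).symm _ _
    all_goals
      rw [← k.idx i j (Finfty.ne_one_of_split hs (hT _) (hU _))]
      exact b.split _ _ _ _ hs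
  · refine (JApp_map h' _ hT.out).trans ((JApp_map h φ (k.out T hT)).trans ?_).symm
    refine functor_map_heq f.F (k.resC_eq A hT) (k.resC_eq B hT) (hom_heq_of (k.resC_eq A hT)
      (k.resC_eq B hT) _ _ fun i => ?_)
    change HEq (Bar.Hom.f (φ i) _) (Bar.Hom.f (φ i) _)
    rw [k.res T hT i]

theorem JNat_pull (p : f ⟶ g) :
    HEq (Functor.whiskerLeft (Functor.pi (fun i => Bar.pull (C i) (a i))) (JNat h' p))
      (Functor.whiskerRight (JNat h p) (Bar.pull D b)) := by
  refine Bar.nat_heq (JApp_pull k) (JApp_pull k) _ _ fun A T hT => ?_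
  refine (JNat_app h' p _ hT.out).trans ((JNat_app h p A (k.out T hT)).trans ?_).symm
  exact natTrans_app_heq p.nat (k.resC_eq A hT)

end pull

/-- The identity operation on tuples of subsets. -/
def BarMap.refl {I : Type} {X : I → Type} (A : ∀ i, Set (X i)) : BarMap A A :=
  ⟨id, id, Function.injective_id, fun _ _ _ _ h => h⟩

section compat

variable {ι : Type} {β β' : ι × ℕ ↪ ℕ}

theorem compat_map {n n' : ι → Finfty} {m m' : Finfty} (h : IsPush β n m) (h' : IsPush β n' m')
    (φ : ∀ i, n i ⟶ n' i) (ψ : m ⟶ m') (hψ : IsPushHom β φ ψ) :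
    Compat h h' (fun i => Finfty.Hom.barMap (φ i)) (Finfty.Hom.barMap ψ) where
  res T hT i := Subtype.ext (funext fun j => by
    change Finfty.Hom.f ψ (β (i, j)) ⁻¹' T.1 (β (i, j)) = Finfty.Hom.f (φ i) j ⁻¹' T.1 (β (i, j))
    rw [hψ.1])
  out T hT s hs := by
    change Finfty.Hom.f ψ s ⁻¹' T.1 s ≠ ∅
    rw [hψ.2 s hs, Finfty.eq_one (h'.2 s hs) (hT s)]
    exact Set.nonempty_iff_ne_empty.1 ⟨1, rfl⟩
  idx i j _ := rfl

theorem compat_perm (θ : ι → Equiv.Perm ℕ) (θ' : Equiv.Perm ℕ)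
    (hθ : ∀ i j, θ' (β (i, j)) = β (i, θ i j)) {k n : ι → Finfty} {l m : Finfty} (h : IsPush β n m)
    (h' : IsPush β k l) (hn : ∀ i j, (k i).n j = (n i).n (θ i j)) (hm : ∀ s, l.n s = m.n (θ' s)) :
    Compat h' h (fun i => permBarMap (θ i) (hn i)) (permBarMap θ' hm) where
  res T hT i := Subtype.ext (funext fun j => congrArg T.1 (hθ i j))
  out T hT s _ := hT (θ' s)
  idx i j _ := by
    change θ'.symm (β (i, j)) = β (i, (θ i).symm j)
    rw [Equiv.symm_apply_eq, hθ, Equiv.apply_symm_apply]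

theorem compat_change (θ : Equiv.Perm ℕ) {n : ι → Finfty} {l m : Finfty} (h : IsPush β n l)
    (h' : IsPush β' n m) (hm : ∀ s, l.n s = m.n (θ s))
    (hθ : ∀ i j, (n i).n j ≠ 1 → θ (β (i, j)) = β' (i, j)) :
    Compat h h' (fun i => BarMap.refl (n i).set) (permBarMap θ hm) where
  res T hT i := Subtype.ext (funext fun j => by
    change T.1 (θ (β (i, j))) = T.1 (β' (i, j))
    by_cases hj : (n i).n j = 1
    · rw [Finfty.eq_one ((hm _).symm.trans ((h.1 i j).trans hj)) (hT _),
        Finfty.eq_one ((h'.1 i j).trans hj) (hT _)]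
    · rw [hθ i j hj])
  out T hT s _ := hT (θ s)
  idx i j hj := by
    change θ.symm (β' (i, j)) = β (i, j)
    rw [Equiv.symm_apply_eq, hθ i j fun e => hj ((h'.1 i j).trans e)]

end compat

section hom

variable {ι : Type} {C : ι → PermCat.{u}} {D : PermCat.{u}}

/-- The multimorphism of symmetric functors induced by a multilinear functor. -/
def JHom (f : MultiLin C D) : SymFunHom (fun i => JFun (C i)) (JFun D) where
  app _ _ _ h := JApp h f
  nat _ _ _ _ _ h h' φ ψ hψ := JApp_pull (compat_map h h' φ ψ hψ)
  equivariant _ θ θ' hθ _ _ _ _ h h' hn hm := JApp_pull (compat_perm θ θ' hθ h h' hn hm)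
  change_β _ _ θ _ _ _ h h' hm hθ := (JApp_pull (compat_change θ h h' hm hθ)).symm

variable {f g : MultiLin C D}

/-- The morphism induced by a morphism of multilinear functors. -/
def JMap (p : f ⟶ g) : JHom f ⟶ JHom g := SymFunHom.Hom.mk (f := JHom f) (g := JHom g)
  (fun _ _ _ h => JNat h p)
  (fun _ _ _ _ _ h h' φ ψ hψ => JNat_pull (compat_map h h' φ ψ hψ) p)
  (fun _ θ θ' hθ _ _ _ _ h h' hn hm => JNat_pull (compat_perm θ θ' hθ h h' hn hm) p)
  (fun _ _ θ _ _ _ h h' hm hθ => (JNat_pull (compat_change θ h h' hm hθ) p).symm)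

/-- `J` on the categories of multimorphisms. -/
def JFn (C : ι → PermCat.{u}) (D : PermCat.{u}) :
    MultiLin C D ⥤ SymFunHom (fun i => JFun (C i)) (JFun D) where
  obj f := JHom f
  map p := JMap p
  map_id f := SymFunHom.Hom.ext (funext fun β => funext fun n => funext fun m => funext fun h =>
    eq_of_heq (Bar.nat_heq rfl rfl _ _ fun A T hT => (JNat_app h (𝟙 f) A hT.out).trans (by
      change HEq (𝟙 (f.F.obj (resC h A T))) (𝟙 ((JObj h f A).C T))
      rw [JObj_C f A hT.out])))
  map_comp {f g e} p q := SymFunHom.Hom.ext (funext fun β => funext fun n => funext fun m =>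
    funext fun h => eq_of_heq (Bar.nat_heq rfl rfl _ _ fun A T hT =>
      (JNat_app h (p ≫ q) A hT.out).trans (comp_heq (JObj_C f A hT.out) (JObj_C g A hT.out)
        (JObj_C e A hT.out) (JNat_app h p A hT.out) (JNat_app h q A hT.out)).symm))

end hom

section act

variable {ι κ : Type} (e : κ ≃ ι) {C : ι → PermCat.{u}} {D : PermCat.{u}} (β : ι × ℕ ↪ ℕ)
  {n : ι → Finfty} {m : Finfty} (h : IsPush (preEmb e β) (fun k => n (e k)) m) (h' : IsPush β n m)

theorem reindex_resC (A : ∀ i, Bar (C i) (n i).set) (T : Tup m.set) :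
    (reindex e fun i => C i).obj (resC h (fun k => A (e k)) T) = resC h' A T :=
  reindex_obj_eq e (fun i => C i) _ _ fun _ => rfl

theorem comapF_JApp (f : MultiLin C D) :
    comapF e (fun i => (Bar (C i) (n i).set)) ⋙ JApp h (f.act e) = JApp h' f := by
  have o := fun A T => congrArg f.F.obj (reindex_resC e β h h' A T)
  refine Bar.functor_ext (fun A T hT => ?_) (fun A s T U S hs hT hU hS => ?_) fun A B φ T hT => ?_
  · exact (JObj_C (f.act e) _ hT.out).trans ((o A T).trans (JObj_C f A hT.out).symm)
  · obtain ⟨k, j, rfl⟩ := IsSplit.mem_range h hs hT hU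
    refine (JObj_ρ h (f.act e) _ hs hS.out).trans (HEq.trans ?_
      (JObj_ρ h' f A (i := e k) (j := j) hs hS.out).symm)
    exact f.act_push e k _ _ _ _ _ _ _ (agree_res h' A (i := e k) (j := j) hs)
      (reindex_resC e β h h' A T) (reindex_resC e β h h' A U) (reindex_resC e β h h' A S) _ _ HEq.rfl
  · refine (JApp_map h _ hT.out).trans (HEq.trans ?_ (JApp_map h' φ hT.out).symm)
    exact functor_map_heq f.F (reindex_resC e β h h' A T) (reindex_resC e β h h' B T)
      (reindex_map_heq e (fun i => C i) (fun _ => rfl) (fun _ => rfl) _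
        (fun i => Bar.Hom.f (φ i) (resTup h' T i)) fun _ => HEq.rfl)

theorem comapF_JNat {f g : MultiLin C D} (p : f ⟶ g) :
    HEq (Functor.whiskerLeft (comapF e (fun i => (Bar (C i) (n i).set)))
      (JNat h (MultiLin.actMap e p))) (JNat h' p) := by
  refine Bar.nat_heq (comapF_JApp e β h h' f) (comapF_JApp e β h h' g) _ _ fun A T hT => ?_
  refine (JNat_app h (MultiLin.actMap e p) _ hT.out).trans (HEq.trans ?_ (JNat_app h' p A hT.out).symm)
  exact MultiLin.actMap_app e p (resC h' A T)

theorem JHom_act [Finite ι] [Finite κ] (f : MultiLin C D) : JHom (f.act e) = (JHom f).act e :=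
  SymFunHom.eq_act e (F := fun i => JFun (C i)) exists_embedding.some (f := JHom f)
    (JHom (f.act e)) fun _ _ h h' => comapF_JApp e _ h h' f

end act

section comp

variable {ι : Type} {κ : ι → Type} {C : ∀ i, κ i → PermCat.{u}} {D : ι → PermCat.{u}}
  {E : PermCat.{u}} (β : ι × ℕ ↪ ℕ) (α : ∀ i, κ i × ℕ ↪ ℕ) {n : (Σ i, κ i) → Finfty}
  {l : ι → Finfty} {m : Finfty} (h : IsPush (sigmaEmb β α) n m)
  (h₁ : ∀ i, IsPush (α i) (fun k => n ⟨i, k⟩) (l i)) (h₂ : IsPush β l m)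

theorem resTup_ne {T : Tup m.set} (hT : T.NE) (i : ι) : (resTup h₂ T i).NE := fun j => hT (β (i, j))

theorem resC_comp (f : ∀ i, MultiLin (C i) (D i)) (A : ∀ s : Σ i, κ i, Bar (C s.1 s.2) (n s).set)
    {T : Tup m.set} (hT : T.NE) :
    resC h₂ (fun i => JObj (h₁ i) (f i) fun k => A ⟨i, k⟩) T =
      (MultiLin.prodF f).obj (resC h A T) :=
  funext fun i => JObj_C (f i) (fun k => A ⟨i, k⟩) (resTup_ne β h₂ hT i).out

theorem JApp_comp (g : MultiLin D E) (f : ∀ i, MultiLin (C i) (D i)) :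
    JApp h (MultiLin.comp f g) = sigmaPi (X := fun i k => Bar (C i k) (n ⟨i, k⟩).set)
      (fun i => JApp (h₁ i) (f i)) ⋙ JApp h₂ g := by
  have o := fun A {T} hT => resC_comp β α h h₁ h₂ f A (T := T) hT
  refine Bar.functor_ext (fun A T hT => ?_) (fun A s T U S hs hT hU hS => ?_) fun A B φ T hT => ?_
  · exact (JObj_C (MultiLin.comp f g) A hT.out).trans
      ((JObj_C g _ hT.out).trans (congrArg g.F.obj (o A hT))).symm
  · obtain ⟨⟨i, k⟩, j, rfl⟩ := IsSplit.mem_range h hs hT hU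
    have hs' : IsSplit (β (i, α i (k, j))) T U S := hs
    refine (JObj_ρ h (MultiLin.comp f g) A hs hS.out).trans (HEq.trans (heq_of_eq
      (MultiLin.comp_push f g i k _ _ _ (agree_res h A hs) _)) (HEq.trans ?_
        (JObj_ρ h₂ g (fun i => JObj (h₁ i) (f i) fun k => A ⟨i, k⟩) hs' hS.out).symm))
    exact g.push_heq i (o A hT).symm (o A hU).symm (o A hS).symm _ _
      (JObj_ρ (h₁ i) (f i) (fun k => A ⟨i, k⟩) (i := k) (j := j) (resTup_split hs')
        (resTup_ne β h₂ hS i).out).symm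
  · refine (JApp_map h φ hT.out).trans (HEq.trans ?_ (JApp_map h₂ _ hT.out).symm)
    exact (functor_map_heq g.F (o A hT) (o B hT) (hom_heq_of (o A hT) (o B hT) _ _ fun i =>
      JApp_map (h₁ i) (f := f i) (A := fun k => A ⟨i, k⟩) (B := fun k => B ⟨i, k⟩)
        (fun k => φ ⟨i, k⟩) (resTup_ne β h₂ hT i).out)).symm

theorem JNat_comp {g g' : MultiLin D E} {f f' : ∀ i, MultiLin (C i) (D i)} (γ : g ⟶ g')
    (φ : ∀ i, f i ⟶ f' i) : HEq (JNat h (MultiLin.compMap γ φ))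
      (Functor.whiskerRight (sigmaPiNat (X := fun i k => Bar (C i k) (n ⟨i, k⟩).set)
        fun i => JNat (h₁ i) (φ i)) (JApp h₂ g) ≫
      Functor.whiskerLeft (sigmaPi (X := fun i k => Bar (C i k) (n ⟨i, k⟩).set)
        fun i => JApp (h₁ i) (f' i)) (JNat h₂ γ)) := by
  have o := fun (f : ∀ i, MultiLin (C i) (D i)) A {T} hT => resC_comp β α h h₁ h₂ f A (T := T) hT
  refine Bar.nat_heq (JApp_comp β α h h₁ h₂ g f) (JApp_comp β α h h₁ h₂ g' f') _ _ fun A T hT => ?_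
  refine (JNat_app h (MultiLin.compMap γ φ) A hT.out).trans ?_
  have k₁ := JApp_map h₂ (f := g) (A := fun i => JObj (h₁ i) (f i) fun k => A ⟨i, k⟩)
    (B := fun i => JObj (h₁ i) (f' i) fun k => A ⟨i, k⟩)
    (fun i => (JNat (h₁ i) (φ i)).app fun k => A ⟨i, k⟩) (T := T) hT.out
  have k₂ := JNat_app h₂ γ (fun i => JObj (h₁ i) (f' i) fun k => A ⟨i, k⟩) (T := T) hT.out
  have k₃ := functor_map_heq g.F (o f A hT) (o f' A hT) (hom_heq_of (o f A hT) (o f' A hT) _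
    ((MultiLin.prodNat φ).app (resC h A T)) fun i => JNat_app (h₁ i) (φ i) (fun k => A ⟨i, k⟩)
      (resTup_ne β h₂ hT i).out)
  have k₄ := natTrans_app_heq γ.nat (o f' A hT)
  refine (comp_heq ((JObj_C g _ hT.out).trans (congrArg g.F.obj (o f A hT)))
    ((JObj_C g _ hT.out).trans (congrArg g.F.obj (o f' A hT)))
    ((JObj_C g' _ hT.out).trans (congrArg g'.F.obj (o f' A hT))) (k₁.trans k₃) (k₂.trans k₄)).symm

theorem JHom_comp [Finite ι] [∀ i, Finite (κ i)] (g : MultiLin D E)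
    (f : ∀ i, MultiLin (C i) (D i)) :
    JHom (MultiLin.comp f g) = SymFunHom.comp (JHom g) (fun i => JHom (f i)) :=
  SymFunHom.ext_of (sigmaEmb exists_embedding.some fun _ => exists_embedding.some) fun n m h =>
    (JApp_comp _ _ h (isPush_midObj _ n) (isPush_of_sigmaEmb h (isPush_midObj _ n)) g f).trans
      (SymFunHom.comp_app (JHom g) (fun i => JHom (f i)) _ _ n _ m h (isPush_midObj _ n)
        (isPush_of_sigmaEmb h (isPush_midObj _ n))).symm

end comp

theorem JApp_one (C : PermCat.{u}) (n : Finfty) :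
    JApp (isPush_unitEmb n) (MultiLin.one C) = evalUnit fun _ => Bar C n.set := by
  refine Bar.functor_ext (fun A T hT => ?_) (fun A s T U S hs hT hU hS => ?_) fun A B φ T hT => ?_
  · exact JObj_C (MultiLin.one C) A hT.out
  · exact (JObj_ρ (isPush_unitEmb n) (MultiLin.one C) A (i := ()) (j := s) hs hS.out).trans
      (MultiLin.one_push C _ _ _ _ _)
  · exact JApp_map (isPush_unitEmb n) φ hT.out

/-- The multifunctor `J`. -/
def multifunctorJ : CatMultifunctor permMulticat.{u} symFunMulticat.{u} JFun.{u} where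
  fn C D := JFn C D
  fn_act e _ _ f := JHom_act e f
  fn_actMap e C D f g p := SymFunHom.heq_actMap e (F := fun i => JFun (C i)) exists_embedding.some
    (JHom_act e f) (JHom_act e g) (p := JMap p) (JMap (MultiLin.actMap e p)) fun _ _ h h' =>
      comapF_JNat e _ h h' p
  fn_one C := SymFunHom.ext_of unitEmb fun n m h => by
    obtain rfl : m = n () := h.unique (isPush_unitEmb (n ()))
    exact (JApp_one C (n ())).trans (SymFunHom.one_app (JFun C) (n ()) h).symm
  fn_comp g f := JHom_comp g f
  fn_compMap {_ _ _ _ _ _ _ g g' f f'} γ φ :=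
    SymFunHom.Hom.heq_of (sigmaEmb exists_embedding.some fun _ => exists_embedding.some)
      (JHom_comp g f) (JHom_comp g' f') _ _ fun n m h =>
        (JNat_comp _ _ h (isPush_midObj _ n) (isPush_of_sigmaEmb h (isPush_midObj _ n)) γ φ).trans
          (SymFunHom.compMap_app (JMap γ) (fun i => JMap (φ i)) _ _ n _ m h (isPush_midObj _ n)
            (isPush_of_sigmaEmb h (isPush_midObj _ n))).symm

theorem isJ : IsJ multifunctorJ.{u} where
  fn_C f _ _ _ h A T S hS hT := (JObj_C f A hT).trans (congrArg f.F.obj (funext fun i =>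
    congrArg (A i).C (Subtype.ext (funext fun j => (hS i j).symm))))
  fn_ρ f _ _ _ h A i j U V T hT U' V' T' hU hV hT' ho hs w hw χ hχ := by
    obtain rfl : U' = resTup h U := funext fun i => Subtype.ext (funext fun j => hU i j)
    obtain rfl : V' = resTup h V := funext fun i => Subtype.ext (funext fun j => hV i j)
    obtain rfl : T' = resTup h T := funext fun i => Subtype.ext (funext fun j => hT' i j)
    exact (JObj_ρ h f A hT ho).trans (heq_of_eq (f.push_eq i _ _ _ w (agree_res h A hT) _ hw χ hχ))
  fn_map f _ _ _ h A B φ T S hS hT := by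
    obtain rfl : S = resTup h T := funext fun i => Subtype.ext (funext fun j => hS i j)
    exact JApp_map h φ hT
  map_app p _ _ _ h A T S hS hT := by
    obtain rfl : S = resTup h T := funext fun i => Subtype.ext (funext fun j => hS i j)
    exact JNat_app h p A hT

/-! ### The multifunctor from symmetric functors to symmetric spectra -/

section evalF

variable {ι κ : Type} {F : ι → SymFun.{u}} {F' : κ → SymFun.{u}} {G G' : SymFun.{u}}

/-- An equality between values of multimorphisms of symmetric functors implies the corresponding
equality for diagrams. -/
theorem SymFunHom.evalF_congr {β : ι × ℕ ↪ ℕ} {n : ι → Finfty} {m : Finfty} {h : IsPush β n m}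
    {β' : κ × ℕ ↪ ℕ} {n' : κ → Finfty} {m' : Finfty} {h' : IsPush β' n' m'} {E : Type}
    [SmallCategory E] {A : Type u} [Category.{u} A] {C : Type u} [Category.{u} C]
    {x : E ⥤ SymFunHom F G} {x' : E ⥤ SymFunHom F' G'}
    (z : E ⥤ A) (Q : A ⥤ ∀ i, (F i).F.obj (n i)) (Q' : A ⥤ ∀ k, (F' k).F.obj (n' k))
    (H : G.F.obj m ⥤ C) (H' : G'.F.obj m' ⥤ C)
    (h₁ : ∀ t, Q ⋙ (x.obj t).app β n m h ⋙ H = Q' ⋙ (x'.obj t).app β' n' m' h' ⋙ H')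
    (h₂ : ∀ {t t' : E} (s : t ⟶ t'),
      HEq (Functor.whiskerLeft Q (Functor.whiskerRight (SymFunHom.Hom.app (x.map s) β n m h) H))
      (Functor.whiskerLeft Q'
        (Functor.whiskerRight (SymFunHom.Hom.app (x'.map s) β' n' m' h') H'))) :
    SymFunHom.evalF β n m h x (fun i => z ⋙ Q ⋙ Pi.eval _ i) ⋙ H =
      SymFunHom.evalF β' n' m' h' x' (fun k => z ⋙ Q' ⋙ Pi.eval _ k) ⋙ H' := by
  refine CategoryTheory.Functor.hext (fun t => Functor.congr_obj (h₁ t) (z.obj t))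
    fun t t' s => ?_
  refine (heq_of_eq (H.map_comp _ _)).trans (HEq.trans ?_ (heq_of_eq (H'.map_comp _ _)).symm)
  exact comp_heq (Functor.congr_obj (h₁ t) (z.obj t)) (Functor.congr_obj (h₁ t) (z.obj t'))
    (Functor.congr_obj (h₁ t') (z.obj t')) (functor_hext_iff (h₁ t) (z.map s))
    (app_heq_of_heq (h₁ t) (h₁ t') (h₂ s) (z.obj t'))

theorem SymFunHom.evalF_nat {β : ι × ℕ ↪ ℕ} {n n' : ι → Finfty} {m m' : Finfty}
    (h : IsPush β n m) (h' : IsPush β n' m') (φ : ∀ i, n i ⟶ n' i) (ψ : m ⟶ m')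
    (hψ : IsPushHom β φ ψ) {E : Type} [SmallCategory E] (x : E ⥤ SymFunHom F G)
    (y : ∀ i, E ⥤ (F i).F.obj (n i)) :
    SymFunHom.evalF β n' m' h' x (fun i => y i ⋙ ((F i).F.map (φ i)).toFunctor) =
      SymFunHom.evalF β n m h x y ⋙ (G.F.map ψ).toFunctor :=
  SymFunHom.evalF_congr (x := x) (x' := x) (h := h') (h' := h) (Functor.pi' y)
    (Functor.pi fun i => ((F i).F.map (φ i)).toFunctor) (𝟭 _) (𝟭 _) (G.F.map ψ).toFunctor
    (fun t => (x.obj t).nat β n n' m m' h h' φ ψ hψ)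
    (fun s => SymFunHom.Hom.nat (x.map s) β n n' m m' h h' φ ψ hψ)

theorem SymFunHom.evalF_bang (β β' : ι × ℕ ↪ ℕ) (θ : ι → Equiv.Perm ℕ)
    (θ' : Equiv.Perm ℕ) (k n : ι → Finfty) (l m : Finfty) (h : IsPush β n m) (h' : IsPush β' k l)
    (hn : ∀ i j, (k i).n j = (n i).n (θ i j)) (hm : ∀ s, l.n s = m.n (θ' s))
    (hθ : ∀ i j, (k i).n j ≠ 1 → θ' (β' (i, j)) = β (i, θ i j)) {E : Type} [SmallCategory E]
    (x : E ⥤ SymFunHom F G) (y : ∀ i, E ⥤ (F i).F.obj (k i)) :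
    SymFunHom.evalF β n m h x
        (fun i => y i ⋙ ((F i).bang (θ i) (k i) (n i) (hn i)).toFunctor) =
      SymFunHom.evalF β' k l h' x y ⋙ (G.bang θ' l m hm).toFunctor :=
  SymFunHom.evalF_congr (x := x) (x' := x) (h := h) (h' := h') (Functor.pi' y)
    (Functor.pi fun i => ((F i).bang (θ i) (k i) (n i) (hn i)).toFunctor) (𝟭 _) (𝟭 _)
    (G.bang θ' l m hm).toFunctor
    (fun t => (x.obj t).app_bang β β' θ θ' k n l m h h' hn hm hθ)
    (fun s => SymFunHom.Hom.app_bang (x.map s) β β' θ θ' k n l m h h' hn hm hθ)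

theorem SymFun.comp_bang_one (F : SymFun.{u}) {n : Finfty} (h : ∀ i, n.n i = n.n i) {E : Type}
    [SmallCategory E] (y : E ⥤ F.F.obj n) : y ⋙ (F.bang 1 n n h).toFunctor = y :=
  congrArg (fun t => y ⋙ Cat.Hom.toFunctor t) (F.bang_one n h)

theorem SymFunHom.evalF_base (β : ι × ℕ ↪ ℕ) (n : ι → Finfty) (m : Finfty) (h : IsPush β n m)
    {E : Type} [SmallCategory E] (x : E ⥤ SymFunHom F G) (y : ∀ i, E ⥤ (F i).F.obj (n i)) (i : ι)
    (hy : y i = (Functor.const _).obj ((F i).base (n i))) :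
    SymFunHom.evalF β n m h x y = (Functor.const _).obj (G.base m) := by
  classical
  let φ : ∀ j, n j ⟶ n j := fun j =>
    if j = i then Finfty.Hom.kill (𝟙 (n j)) 0 (n' := n j) (fun _ _ => rfl) else 𝟙 _
  let ψ : m ⟶ m := Finfty.Hom.kill (𝟙 m) (β (i, 0)) (n' := m) (fun _ _ => rfl)
  have hψ : IsPushHom β φ ψ := by
    refine ⟨fun j a => funext fun z => ?_, fun s hs => funext fun z => ?_⟩
    · change (if β (j, a) = β (i, 0) then 0 else idOn (m.n (β (j, a))) z) = _
      rw [h.1]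
      by_cases hj : j = i
      · subst hj
        simp only [φ, if_true]
        change _ = if a = 0 then 0 else idOn ((n j).n a) z
        by_cases ha : a = 0
        · rw [if_pos (by rw [ha]), if_pos ha]
        · rw [if_neg (fun e => ha (Prod.mk.inj (β.injective e)).2), if_neg ha]
      · simp only [φ, if_neg hj]
        rw [if_neg fun e => hj (Prod.mk.inj (β.injective e)).1]
        rfl
    · change (if s = β (i, 0) then 0 else idOn (m.n s) z) = _
      rw [if_neg (fun e => hs ⟨_, e.symm⟩), h.2 s hs]
  have key := SymFunHom.evalF_nat h h φ ψ hψ x y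
  rw [G.map_zero ψ (β (i, 0)) fun z => if_pos rfl] at key
  have hy' : (fun j => y j ⋙ ((F j).F.map (φ j)).toFunctor) = y := funext fun j => by
    by_cases hj : j = i
    · subst hj
      rw [(F j).map_zero (φ j) 0 fun z => by
        simp only [φ, if_true]
        rfl, hy]
      rfl
    · simp only [φ, if_neg hj]
      rw [(F j).F.map_id]
      rfl
  rw [hy'] at key
  exact key

end evalF

section ISp

variable {ι : Type} {F : ι → SymFun.{u}} {G : SymFun.{u}} {b : SimplexCategory}

/-- The injection `β` extends the bijection `e`. -/
def Extends {p : ι → ℕ} {N : ℕ} (β : ι × ℕ ↪ ℕ) (e : (Σ i, Fin (p i)) ≃ Fin N) : Prop :=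
  ∀ i (a : Fin (p i)), β (i, a) = e ⟨i, a⟩

theorem exists_extends [Finite ι] {p : ι → ℕ} {N : ℕ} (e : (Σ i, Fin (p i)) ≃ Fin N) :
    ∃ β : ι × ℕ ↪ ℕ, Extends β e := by
  let β₀ : ι × ℕ ↪ ℕ := exists_embedding.some
  let f : (Σ i, Fin (p i)) ↪ ℕ :=
    ⟨fun s => β₀ (s.1, s.2), fun s t h => by
      obtain ⟨h₁, h₂⟩ := Prod.mk.inj (β₀.injective h)
      obtain ⟨i, a⟩ := s
      obtain ⟨j, c⟩ := t
      obtain rfl : i = j := h₁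
      obtain rfl : a = c := Fin.ext h₂
      rfl⟩
  obtain ⟨θ, hθ⟩ := exists_perm Set.univ Set.finite_univ f (e.toEmbedding.trans Fin.valEmbedding)
  exact ⟨β₀.trans θ.toEmbedding, fun i a => hθ ⟨i, a⟩ trivial⟩

variable {p : ι → ℕ} {N : ℕ} {β : ι × ℕ ↪ ℕ} {e : (Σ i, Fin (p i)) ≃ Fin N}

theorem Extends.of_lt (hβ : Extends β e) {s : ℕ} (hs : s < N) :
    ∃ i, ∃ a : Fin (p i), s = β (i, a) ∧ e ⟨i, a⟩ = ⟨s, hs⟩ := by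
  obtain ⟨⟨i, a⟩, h⟩ := e.surjective ⟨s, hs⟩
  refine ⟨i, a, ?_, h⟩
  rw [hβ, h]

theorem Extends.lt_iff (hβ : Extends β e) (i : ι) (j : ℕ) : β (i, j) < N ↔ j < p i := by
  constructor
  · intro h
    obtain ⟨i', a, ha, -⟩ := hβ.of_lt h
    obtain ⟨rfl, rfl⟩ := Prod.mk.inj (β.injective ha)
    exact a.2
  · intro h
    rw [hβ i ⟨j, h⟩]
    exact (e _).2

theorem Extends.not_lt (hβ : Extends β e) {s : ℕ} (hs : s ∉ Set.range β) : ¬ s < N := fun h => by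
  obtain ⟨i, a, rfl, -⟩ := hβ.of_lt h
  exact hs ⟨_, rfl⟩

theorem Extends.isPush (hβ : Extends β e) (k : ℕ) :
    IsPush β (fun i => diagObj (p i) k) (diagObj N k) :=
  ⟨fun i j => if_congr (hβ.lt_iff i j) rfl rfl, fun _ hs => if_neg (hβ.not_lt hs)⟩

theorem lt_of_diagObj {p k j : ℕ} (h : (diagObj p k).n j ≠ 1) : j < p := by
  by_contra hj
  exact h (if_neg hj)

theorem SymFunHom.evalF_extends {β' : ι × ℕ ↪ ℕ} (hβ : Extends β e) (hβ' : Extends β' e) (k : ℕ)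
    {E : Type} [SmallCategory E] (x : E ⥤ SymFunHom F G)
    (y : ∀ i, E ⥤ (F i).F.obj (diagObj (p i) k)) :
    SymFunHom.evalF β _ _ (hβ.isPush k) x y = SymFunHom.evalF β' _ _ (hβ'.isPush k) x y := by
  have := SymFunHom.evalF_bang β β' (fun _ => 1) 1 _ _ _ _ (hβ.isPush k) (hβ'.isPush k)
    (fun _ _ => rfl) (fun _ => rfl) (fun i j hj =>
      (hβ' i ⟨j, lt_of_diagObj hj⟩).trans (hβ i ⟨j, lt_of_diagObj hj⟩).symm) x y
  exact (congrArg (SymFunHom.evalF β _ _ (hβ.isPush k) x) (funext fun i =>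
    ((F i).comp_bang_one _ (y i)).symm)).trans (this.trans (G.comp_bang_one _ _))

variable [Finite ι]

/-- The values of the multimorphism of symmetric spectra given by a diagram of multimorphisms
of symmetric functors. -/
def SymFunHom.spFun (x : Fin (b.len + 1) ⥤ SymFunHom F G) {p : ι → ℕ} {N : ℕ}
    (e : (Σ i, Fin (p i)) ≃ Fin N) (d : SimplexCategoryᵒᵖ)
    (y : ∀ i, Fin (d.unop.len + 1) ⥤ (F i).F.obj (diagObj (p i) d.unop.len)) (u : d.unop ⟶ b) :
    Fin (d.unop.len + 1) ⥤ G.F.obj (diagObj N d.unop.len) :=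
  SymFunHom.evalF (exists_extends e).choose _ _ ((exists_extends e).choose_spec.isPush _)
    (vertexFun u ⋙ x) y

theorem SymFunHom.spFun_eq (x : Fin (b.len + 1) ⥤ SymFunHom F G) (hβ : Extends β e)
    (d : SimplexCategoryᵒᵖ)
    (y : ∀ i, Fin (d.unop.len + 1) ⥤ (F i).F.obj (diagObj (p i) d.unop.len)) (u : d.unop ⟶ b) :
    SymFunHom.spFun x e d y u = SymFunHom.evalF β _ _ (hβ.isPush _) (vertexFun u ⋙ x) y :=
  SymFunHom.evalF_extends (exists_extends e).choose_spec hβ _ _ y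

open Classical in
omit [Finite ι] in
theorem exists_suspHom {p' : ι → ℕ} (i : ι) (k : ℕ) (s : Fin (k + 1)) (hi : p' i = p i + 1)
    (hj : ∀ j, j ≠ i → p' j = p j) :
    ∃ φ : ∀ j, diagObj (p j) k ⟶ diagObj (p' j) k,
      HEq (φ i) (insertS (p i) 1 k fun _ => s) ∧ (∀ j, j ≠ i → HEq (φ j) (𝟙 (diagObj (p j) k))) ∧
      ∀ j a z, Finfty.Hom.f (φ j) a z = if j = i ∧ a = p i then (if z = 1 then (s : ℕ) else 0)
        else idOn ((diagObj (p j) k).n a) z := by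
  have : ∀ j, ∃ φ : diagObj (p j) k ⟶ diagObj (p' j) k,
      (j = i → HEq φ (insertS (p j) 1 k fun _ => s)) ∧ (j ≠ i → HEq φ (𝟙 (diagObj (p j) k))) ∧
      ∀ a z, Finfty.Hom.f φ a z = if j = i ∧ a = p i then (if z = 1 then (s : ℕ) else 0)
        else idOn ((diagObj (p j) k).n a) z := fun j => by
    by_cases h : j = i
    · subst h
      rw [hi]
      refine ⟨insertS (p j) 1 k fun _ => s, fun _ => HEq.rfl, fun h => absurd rfl h,
        fun a z => ?_⟩
      change (if a < p j then idOn k z else if h : p j ≤ a ∧ a < p j + 1 then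
        (if z = 1 then (s : ℕ) else 0) else idOn 1 z) = if j = j ∧ a = p j then _ else
          idOn (if a < p j then k else 1) z
      split_ifs <;> first | rfl | omega | grind
    · rw [hj j h]
      refine ⟨𝟙 _, fun h' => absurd h' h, fun _ => HEq.rfl, fun a z => ?_⟩
      rw [if_neg fun h' => h h'.1]
      rfl
  choose φ h₁ h₂ h₃ using this
  exact ⟨φ, h₁ i rfl, h₂, h₃⟩

/-- The multimorphism of symmetric spectra given by a diagram of multimorphisms of symmetric
functors. -/
def SymFunHom.sp (x : Fin (b.len + 1) ⥤ SymFunHom F G) :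
    SpHom (fun i => (IObj (F i)).nerve) (IObj G).nerve b where
  toFun p N e d y u := SymFunHom.spFun x e d y u
  nat p N e d d' θ y u := by
    obtain ⟨β, hβ⟩ := exists_extends e
    refine Eq.trans (congrArg (fun t => vertexFun θ.unop ⋙ t ⋙ (((IObj G).X N).map θ).toFunctor)
      (SymFunHom.spFun_eq x hβ d y u)) (Eq.trans ?_ (SymFunHom.spFun_eq x hβ d' _ _).symm)
    refine (SymFunHom.evalF_nat (hβ.isPush _) (hβ.isPush _) (fun i => (diagS (p i)).map θ)
      ((diagS N).map θ) ⟨fun i j => if_congr (hβ.lt_iff i j) rfl rfl,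
        fun s hs => if_neg (hβ.not_lt hs)⟩ (vertexFun θ.unop ⋙ vertexFun u ⋙ x)
        fun i => vertexFun θ.unop ⋙ y i).symm
  act_target p N e σ d y u := by
    obtain ⟨β, hβ⟩ := exists_extends e
    obtain ⟨β', hβ'⟩ := exists_extends (e.trans σ)
    refine (SymFunHom.spFun_eq x hβ' d y u).trans (Eq.trans ?_ (congrArg (fun t =>
      t ⋙ (((IObj G).act N σ).app d).toFunctor) (SymFunHom.spFun_eq x hβ d y u)).symm)
    refine Eq.trans (congrArg (SymFunHom.evalF β' _ _ (hβ'.isPush _) _) (funext fun i =>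
      ((F i).comp_bang_one (fun _ => rfl) (y i)).symm)) (SymFunHom.evalF_bang β' β (fun _ => 1) (extPerm σ) _ _ _ _ (hβ'.isPush _) (hβ.isPush _)
        (fun _ _ => rfl) (diagObj_perm σ N _ rfl) (fun i j hj => ?_) _ y)
    have h := lt_of_diagObj hj
    exact ((congrArg _ (hβ i ⟨j, h⟩)).trans (extPerm_of_lt σ _)).trans (hβ' i ⟨j, h⟩).symm
  act_source p N e σ d y u := by
    obtain ⟨β, hβ⟩ := exists_extends e
    obtain ⟨β', hβ'⟩ := exists_extends ((Equiv.sigmaCongrRight σ).trans e)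
    refine (SymFunHom.spFun_eq x hβ d _ u).trans (Eq.trans ?_
      (SymFunHom.spFun_eq x hβ' d y u).symm)
    refine (SymFunHom.evalF_bang β β' (fun i => extPerm (σ i)) 1 _ _ _ _ (hβ.isPush _)
      (hβ'.isPush _) (fun i => diagObj_perm (σ i) (p i) _ rfl) (fun _ => rfl) (fun i j hj => ?_)
      _ y).trans (G.comp_bang_one _ _)
    have h := lt_of_diagObj hj
    exact (hβ' i ⟨j, h⟩).trans ((hβ i _).symm.trans
      (congrArg (fun t => β (i, t)) (extPerm_of_lt (σ i) ⟨j, h⟩).symm))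
  base p N e d y u h := by
    obtain ⟨i, hi⟩ := h
    obtain ⟨β, hβ⟩ := exists_extends e
    exact (SymFunHom.spFun_eq x hβ d y u).trans (SymFunHom.evalF_base _ _ _ (hβ.isPush _) _ y i hi)
  susp i p p' hi hj N e e' ho hn d y y' s u h₁ h₂ := by
    classical
    obtain ⟨β, hβ'⟩ := exists_extends e'
    have hβ : Extends β e := fun j a => by
      have : p j ≤ p' j := by
        by_cases h : j = i
        · subst h
          omega
        · rw [hj j h]
      exact (hβ' j ⟨a, a.2.trans_le this⟩).trans (ho j a _ rfl)
    have hN : β (i, p i) = N := (hβ' i ⟨p i, by omega⟩).trans (hn _ rfl)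
    refine (SymFunHom.spFun_eq x hβ' d y' u).trans (Eq.trans ?_ (congrArg (fun t =>
      t ⋙ (IObj G).susp d N s) (SymFunHom.spFun_eq x hβ d y u)).symm)
    obtain ⟨φ, hφ₁, hφ₂, hφ⟩ := exists_suspHom i d.unop.len s hi hj
    refine Eq.trans (congrArg (SymFunHom.evalF β _ _ (hβ'.isPush _) _) (funext fun j => ?_))
      (SymFunHom.evalF_nat (hβ.isPush _) (hβ'.isPush _) φ
        (insertS N 1 d.unop.len fun _ => s) ⟨fun j a => funext fun z => ?_,
          fun t ht => funext fun z => ?_⟩ _ y)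
    · by_cases h : j = i
      · subst h
        have : p' j = p j + 1 := hi
        generalize φ j = ψ at hφ₁
        revert ψ
        generalize y' j = w at h₁
        revert w
        rw [this]
        intro w hw ψ hψ
        obtain rfl := eq_of_heq hψ
        exact eq_of_heq hw
      · have := h₂ j h
        have h₃ := hφ₂ j h
        generalize φ j = ψ at h₃
        revert ψ
        generalize y' j = w at this
        revert w
        rw [hj j h]
        intro w hw ψ hψ
        obtain rfl := eq_of_heq hψ
        refine (eq_of_heq hw).trans ?_
        rw [(F j).F.map_id]
        rfl
    · rw [hφ]
      have h₃ := hβ.lt_iff j a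
      have h₄ : β (j, a) = N ↔ j = i ∧ a = p i := by
        rw [← hN, β.injective.eq_iff, Prod.mk.injEq]
      refine Eq.trans ?_ (if_congr h₄ rfl rfl)
      change (if β (j, a) < N then idOn d.unop.len z else if h : N ≤ β (j, a) ∧ β (j, a) < N + 1 then
        (if z = 1 then (s : ℕ) else 0) else idOn 1 z) = if _ then _ else
          idOn (if a < p j then d.unop.len else 1) z
      split_ifs <;> first | rfl | omega
    · have h₃ := hβ'.not_lt ht
      change (if t < N then idOn d.unop.len z else if h : N ≤ t ∧ t < N + 1 then
        (if z = 1 then (s : ℕ) else 0) else idOn 1 z) = _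
      rw [if_neg (by omega), dif_neg (by omega)]

end ISp

theorem extends_preEmb {ι κ : Type} (ε : κ ≃ ι) {p : ι → ℕ} {N : ℕ} {β : ι × ℕ ↪ ℕ}
    {e : (Σ i, Fin (p i)) ≃ Fin N} (hβ : Extends β e) : Extends (preEmb ε β) (preEquiv ε e) :=
  fun k a => hβ (ε k) a

theorem extends_sigmaEmb {ι : Type} {κ : ι → Type} {p : (Σ i, κ i) → ℕ} {q : ι → ℕ} {N : ℕ}
    {e : ∀ i, (Σ k, Fin (p ⟨i, k⟩)) ≃ Fin (q i)} {e' : (Σ i, Fin (q i)) ≃ Fin N}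
    {α : ∀ i, κ i × ℕ ↪ ℕ} {β : ι × ℕ ↪ ℕ} (hα : ∀ i, Extends (α i) (e i)) (hβ : Extends β e') :
    Extends (sigmaEmb β α) (sigmaEquiv e e') :=
  fun s a => (congrArg (fun t => β (s.1, t)) (hα s.1 s.2 a)).trans (hβ s.1 _)

theorem SymFunHom.sp_one (F : SymFun.{u}) (b : SimplexCategory) :
    SymFunHom.sp ((Functor.const (Fin (b.len + 1))).obj (SymFunHom.one F)) =
      SpHom.one (IObj F).nerve b := by
  refine SpHom.ext ?_
  funext p N e d y u
  obtain rfl := eq_of_equiv_unit e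
  obtain ⟨σ, rfl⟩ : ∃ σ : Equiv.Perm (Fin (p ())), e =
      (Equiv.uniqueSigma (fun k => Fin (p k))).trans σ :=
    ⟨(Equiv.uniqueSigma fun k => Fin (p k)).symm.trans e, by
      rw [← Equiv.trans_assoc, Equiv.self_trans_symm, Equiv.refl_trans]⟩
  rw [SpHom.act_target, SpHom.act_target]
  refine congrArg _ (Eq.trans ?_ (SpHom.one_toFun (IObj F).nerve b (p ()) d (y ()) u).symm)
  have hβ : Extends unitEmb (Equiv.uniqueSigma (fun k : Unit => Fin (p k))) := fun _ _ => rfl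
  refine (SymFunHom.spFun_eq _ hβ d y u).trans ?_
  have e₁ := SymFunHom.one_app F (diagObj (p ()) d.unop.len) (isPush_unitEmb _)
  refine CategoryTheory.Functor.hext (fun t => Functor.congr_obj e₁ fun k => (y k).obj t)
    fun t t' s => (heq_of_eq (Category.comp_id _)).trans
      (functor_hext_iff e₁ (x := fun k => (y k).obj t) (y := fun k => (y k).obj t')
        fun k => (y k).map s)

/-- The multifunctor from symmetric functors to symmetric spectra. -/
def multifunctorI :
    SMultifunctor symFunMulticat.{u}.nerve spMulticat (fun F : SymFun.{u} => (IObj F).nerve) where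
  fn a c := { app := fun b => ↾fun x => SymFunHom.sp (F := a) (G := c) (b := b.unop) x }
  fn_act b ι κ _ _ ε a c x := by
    refine SpHom.eq_act (ε := ε) (X := fun i => (IObj (a i)).nerve) _ fun p N e d y u => ?_
    obtain ⟨β, hβ⟩ := exists_extends e
    refine (SymFunHom.spFun_eq _ (extends_preEmb ε hβ) d (fun k => y (ε k)) u).trans (Eq.trans ?_
      (SymFunHom.spFun_eq (F := a) (b := b.unop) x hβ d y u).symm)
    exact SymFunHom.evalF_congr (h := (extends_preEmb ε hβ).isPush _) (h' := hβ.isPush _)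
      (x := vertexFun u ⋙ x ⋙ symFunMulticat.actF ε a c) (x' := vertexFun u ⋙ x)
      (Functor.pi' y) (comapF ε fun i => (a i).F.obj (diagObj (p i) d.unop.len)) (𝟭 _) (𝟭 _) (𝟭 _)
      (fun t => ((vertexFun u ⋙ x).obj t).comapF_actApp ε β (fun i => diagObj (p i) d.unop.len) _
        ((extends_preEmb ε hβ).isPush _) (hβ.isPush _))
      (fun s => SymFunHom.comapF_actMapApp ε ((vertexFun u ⋙ x).map s) β
        (fun i => diagObj (p i) d.unop.len) _ ((extends_preEmb ε hβ).isPush _) (hβ.isPush _))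
  fn_one b F := SymFunHom.sp_one F b.unop
  fn_comp b ι _ κ _ F G H g f := by
    refine SpHom.ext ?_
    funext p N e d y u
    obtain ⟨q, ⟨e₁⟩⟩ := exists_fiberEquiv p
    obtain ⟨e₂, rfl⟩ := exists_sigmaEquiv e₁ e
    obtain ⟨β, hβ⟩ := exists_extends e₂
    choose α hα using fun i => exists_extends (e₁ i)
    refine (SymFunHom.spFun_eq _ (extends_sigmaEmb hα hβ) d y u).trans (Eq.trans ?_
      (SpHom.comp_toFun (X := fun i k => (IObj (F i k)).nerve) (Y := fun i => (IObj (G i)).nerve)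
        (SymFunHom.sp (b := b.unop) g) (fun i => SymFunHom.sp (b := b.unop) (f i))
        e₁ e₂ d y u).symm)
    refine Eq.trans ?_ ((SymFunHom.spFun_eq g hβ d _ u).trans (congrArg (SymFunHom.evalF β _ _
      (hβ.isPush _) _) (funext fun i => SymFunHom.spFun_eq (f i) (hα i) d _ u))).symm
    have hc := fun (g : SymFunHom G H) (f : ∀ i, SymFunHom (F i) (G i)) => isSymFunMulticat.comp_obj
      g f (sigmaEmb β α) β α (fun _ _ _ => rfl)
      (fun s => diagObj (p s) d.unop.len) (fun i => diagObj (q i) d.unop.len) _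
      ((extends_sigmaEmb hα hβ).isPush _) (fun i => (hα i).isPush _) (hβ.isPush _)
    refine CategoryTheory.Functor.hext (fun t => hc _ _ _) fun t t' s => ?_
    refine (comp_heq (hc _ _ _) (hc _ _ _) (hc _ _ _)
      (isSymFunMulticat.comp_map _ _ (sigmaEmb β α) β α (fun _ _ _ => rfl) _
        (fun i => diagObj (q i) d.unop.len) _ _ (fun i => (hα i).isPush _) (hβ.isPush _) _ _ _)
      (isSymFunMulticat.compMap_app _ _ (sigmaEmb β α) β α (fun _ _ _ => rfl) _
        (fun i => diagObj (q i) d.unop.len) _ _ (fun i => (hα i).isPush _) (hβ.isPush _) _)).trans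
      (heq_of_eq ?_)
    refine (Category.assoc _ _ _).symm.trans (congrArg (· ≫ _) ?_)
    exact (Functor.map_comp _ _ _).symm

theorem isI : IsI multifunctorI.{u} :=
  fun _ _ _ x _ _ _ _ hβ d _ y u => SymFunHom.spFun_eq x hβ d y u

/-! ### The comparison with Segal's construction -/

section Collect

variable {I J : Type} {X : I → Type} {Y : J → Type} {A : ∀ i, Set (X i)} {B : ∀ j, Set (Y j)}
  {D : PermCat.{u}}

/-- The union of two tuples of subsets. -/
def Tup.union (T U : Tup A) : Tup A :=
  ⟨fun k => T.1 k ∪ U.1 k, fun k => Set.union_subset (T.2 k) (U.2 k)⟩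

theorem IsSplit.union {i : I} {T U : Tup A} (h : Disjoint (T.1 i) (U.1 i))
    (h' : ∀ k, k ≠ i → U.1 k = T.1 k) : IsSplit i T U (T.union U) :=
  ⟨rfl, h, fun k hk => ⟨h' k hk, by
    change T.1 k ∪ U.1 k = T.1 k
    rw [h' k hk, Set.union_self]⟩⟩

/-- The exchange of two splittings at the same place. -/
theorem Bar.exch_same (a : Bar D A) (i : I) {TV UV TW UW V W T U S : Tup A}
    (h₁ : IsSplit i TV UV V) (h₂ : IsSplit i TW UW W) (h₃ : IsSplit i V W S)
    (h₄ : IsSplit i TV TW T) (h₅ : IsSplit i UV UW U) (h₆ : IsSplit i T U S) :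
    (a.ρ i TV UV V h₁ ⊗ₘ a.ρ i TW UW W h₂) ≫ a.ρ i V W S h₃ =
      tensorμ (a.C TV) (a.C UV) (a.C TW) (a.C UW) ≫
        (a.ρ i TV TW T h₄ ⊗ₘ a.ρ i UV UW U h₅) ≫ a.ρ i T U S h₆ := by
  have hd := h₃.2.1
  simp only [← h₁.1, ← h₂.1, Set.disjoint_union_left, Set.disjoint_union_right] at hd
  have e₁ := h₁.1
  have e₂ := h₂.1
  have e₃ := h₃.1
  have e₅ := h₅.1
  have k₁ := fun k hk => (h₁.2.2 k hk).1
  have k₂ := fun k hk => (h₂.2.2 k hk).1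
  have k₄ := fun k hk => (h₄.2.2 k hk).1
  have k₁' := fun k hk => (h₁.2.2 k hk).2
  have k₂' := fun k hk => (h₂.2.2 k hk).2
  have k₃' := fun k hk => (h₃.2.2 k hk).2
  have k₅' := fun k hk => (h₅.2.2 k hk).2
  have m₁ : IsSplit i UV TW (UV.union TW) := IsSplit.union hd.1.2 fun k hk => by
    rw [k₄ k hk, k₁ k hk]
  have m₂ : IsSplit i UV W (UV.union W) := IsSplit.union (by
    rw [← e₂]
    exact Set.disjoint_union_right.2 ⟨hd.1.2, hd.2.2⟩) fun k hk => by
      rw [k₂' k hk, k₄ k hk, k₁ k hk]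
  have m₃ : IsSplit i (UV.union TW) UW (UV.union W) := by
    refine ⟨?_, Set.disjoint_union_left.2 ⟨hd.2.2, h₂.2.1⟩, fun k hk => ⟨?_, ?_⟩⟩
    · change UV.1 i ∪ TW.1 i ∪ UW.1 i = UV.1 i ∪ W.1 i
      rw [← e₂, Set.union_assoc]
    · rw [(m₁.2.2 k hk).2, k₂ k hk, k₄ k hk, k₁ k hk]
    · rw [(m₁.2.2 k hk).2, (m₂.2.2 k hk).2]
  have m₄ : IsSplit i TW U (UV.union W) := by
    refine ⟨?_, ?_, fun k hk => ⟨?_, ?_⟩⟩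
    · change TW.1 i ∪ U.1 i = UV.1 i ∪ W.1 i
      rw [← e₂, ← e₅, Set.union_left_comm]
    · rw [← e₅]
      exact Set.disjoint_union_right.2 ⟨hd.1.2.symm, h₂.2.1⟩
    · rw [k₅' k hk, k₁ k hk, k₄ k hk]
    · rw [(m₂.2.2 k hk).2, k₁ k hk, k₄ k hk]
  have m₅ : IsSplit i TV (UV.union W) S := by
    refine ⟨?_, Set.disjoint_union_right.2 ⟨h₁.2.1, ?_⟩, fun k hk => ⟨?_, ?_⟩⟩
    · change TV.1 i ∪ (UV.1 i ∪ W.1 i) = S.1 i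
      rw [← e₃, ← e₁, Set.union_assoc]
    · rw [← e₂]
      exact Set.disjoint_union_right.2 ⟨hd.1.1, hd.2.1⟩
    · rw [(m₂.2.2 k hk).2, k₁ k hk]
    · rw [k₃' k hk, k₁' k hk]
  exact tensorμ_comp _ _ _ _ _ _ (a.ρ i _ _ _ m₁) (a.ρ i _ _ _ m₁.symm) (a.ρ i _ _ _ m₃)
    (a.ρ i _ _ _ m₂) (a.ρ i _ _ _ m₄) (a.ρ i _ _ _ m₅)
    (a.ρ_assoc ..) (a.ρ_assoc ..) (a.ρ_assoc ..) (a.ρ_assoc ..) (a.ρ_symm ..)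

/-- An operation which turns tuples of subsets into single subsets and preserves splittings in
each variable. -/
structure Collect {X₀ : Type} (A₀ : Set X₀) (B : ∀ j, Set (Y j)) where
  Φ : Tup B → Tup (fun _ : Unit => A₀)
  empty : ∀ (j : J) (S : Tup B), S.1 j = ∅ → (Φ S).1 () = ∅
  split : ∀ (j : J) (T U S : Tup B), IsSplit j T U S → IsSplit () (Φ T) (Φ U) (Φ S)

variable {X₀ : Type} {A₀ : Set X₀}

/-- Reindexing of systems with one index. -/
def Collect.functor (m : Collect A₀ B) : SegBar D A₀ ⥤ Bar D B where
  obj a :=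
    { C := fun S => a.1.C (m.Φ S)
      ρ := fun j T U S h => a.1.ρ () (m.Φ T) (m.Φ U) (m.Φ S) (m.split j T U S h)
      C_empty := fun k S h => a.1.C_empty () (m.Φ S) (m.empty k S h)
      ρ_id := fun j T U S h h' => a.1.ρ_id _ _ _ _ _ (by
        rcases h' with h' | h' | ⟨k, h'⟩
        · exact Or.inl (m.empty j T h')
        · exact Or.inr (Or.inl (m.empty j U h'))
        · exact Or.inr (Or.inr ⟨_, m.empty k S h'⟩))
      ρ_symm := fun j T U S h h' => a.1.ρ_symm _ _ _ _ _ _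
      ρ_assoc := fun j T U V TU UV S h₁ h₂ h₃ h₄ => a.1.ρ_assoc _ _ _ _ _ _ _ _ _ _ _
      ρ_exch := fun i j hij TV UV TW UW V W T U S h₁ h₂ h₃ h₄ h₅ h₆ => a.1.exch_same () _ _ _ _ _ _ }
  map {a b} φ := Bar.Hom.mk (fun S => Bar.Hom.f (a := a.1) (b := b.1) φ (m.Φ S))
    (fun k S h => Bar.Hom.f_empty (a := a.1) (b := b.1) φ () (m.Φ S) (m.empty k S h))
    fun j T U S h => Bar.Hom.comm (a := a.1) (b := b.1) φ _ _ _ _ _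
  map_id _ := rfl
  map_comp _ _ := rfl

theorem Collect.functor_congr (m m' : Collect A₀ B) (h : ∀ S, (m.Φ S).1 () = (m'.Φ S).1 ()) :
    m.functor (D := D) = m'.functor := by
  have : m.Φ = m'.Φ := funext fun S => Subtype.ext (funext fun _ => h S)
  cases m
  cases m'
  cases this
  rfl

variable {J' : Type} {Y' : J' → Type} {B' : ∀ j, Set (Y' j)} {X₁ : Type} {A₁ : Set X₁}

theorem Collect.pull_comm (m : Collect A₀ B) (m' : Collect A₁ B') (g : X₀ → X₁)
    (hg : ∀ x, g x ∈ A₁ → x ∈ A₀) (t : BarMap B B')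
    (h : ∀ S x, g x ∈ (m'.Φ S).1 () ↔ x ∈ (m.Φ (t.Φ S)).1 ()) :
    SegBar.pull D g hg ⋙ m'.functor = m.functor ⋙ Bar.pull D t :=
  Collect.functor_congr
    { Φ := fun S => (BarMap.ofFun (fun _ : Unit => g) fun _ => hg).Φ (m'.Φ S)
      empty := fun j S hS => congrArg (g ⁻¹' ·) (m'.empty j S hS)
      split := fun j T U S hS => BarMap.split _ _ _ _ _ (m'.split j T U S hS) }
    { Φ := fun S => m.Φ (t.Φ S)
      empty := fun j S hS => m.empty _ _ (t.empty j S hS)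
      split := fun j T U S hS => m.split _ _ _ _ (t.split j T U S hS) } fun S => Set.ext (h S)

end Collect

section Segal

/-- The extension of a tuple of elements of the circle by the element `1` of the other factors. -/
def extOne {p : ℕ} (x : Fin p → ℕ) (s : ℕ) : ℕ := if h : s < p then x ⟨s, h⟩ else 1

/-- Products of subsets. -/
def smashCollect (p k : ℕ) : Collect (smashSet p k) (diagObj p k).set where
  Φ S := ⟨fun _ => {x | ∀ s, extOne x s ∈ S.1 s}, fun _ x hx i => by
    have h : (if h : (i : ℕ) < p then x ⟨i, h⟩ else 1) ∈ Set.Icc 1 (if (i : ℕ) < p then k else 1) :=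
      S.2 i (hx i)
    rwa [dif_pos i.2, if_pos i.2] at h⟩
  empty j S h := Set.eq_empty_iff_forall_notMem.2 fun x hx => by
    have := hx j
    rw [h] at this
    exact this
  split j T U S h := by
    refine ⟨Set.ext fun x => ⟨fun hx => ?_, fun hx => ?_⟩, Set.disjoint_left.2 fun x hT hU =>
      Set.disjoint_left.1 h.2.1 (hT j) (hU j), fun k hk => absurd rfl hk⟩
    · intro s
      by_cases hs : s = j
      · subst hs
        rw [← h.1]
        exact hx.imp (fun t => t s) fun t => t s
      · rw [(h.2.2 s hs).2]
        exact hx.elim (fun t => t s) fun t => (h.2.2 s hs).1 ▸ t s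
    · have hj := hx j
      rw [← h.1] at hj
      refine hj.imp (fun t s => ?_) fun t s => ?_ <;> by_cases hs : s = j
      · exact hs ▸ t
      · rw [← (h.2.2 s hs).2]
        exact hx s
      · exact hs ▸ t
      · rw [(h.2.2 s hs).1, ← (h.2.2 s hs).2]
        exact hx s

variable (C : PermCat.{u})

/-- The comparison functors from Segal's construction. -/
def segF (p k : ℕ) : SegBar C (smashSet p k) ⥤ (JFun C).F.obj (diagObj p k) :=
  (smashCollect p k).functor

theorem segF_map (p : ℕ) {d d' : SimplexCategoryᵒᵖ} (θ : d ⟶ d') :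
    KSegMap C p θ.unop ⋙ segF C p d'.unop.len =
      segF C p d.unop.len ⋙ ((JFun C).F.map ((diagS p).map θ)).toFunctor :=
  Collect.pull_comm _ _ _ _ _ fun S x => forall_congr' fun s => by
    change (if h : s < p then circMap θ.unop (x ⟨s, h⟩) else 1) ∈ S.1 s ↔
      (if s < p then circMap θ.unop else idOn 1) (if h : s < p then x ⟨s, h⟩ else 1) ∈ S.1 s
    split_ifs <;> rfl

theorem segF_perm (p k : ℕ) (σ : Equiv.Perm (Fin p)) :
    KSegPerm C p k σ ⋙ segF C p k = segF C p k ⋙ ((JFun C).bang (extPerm σ) (diagObj p k)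
      (diagObj p k) (diagObj_perm σ p _ rfl)).toFunctor :=
  Collect.pull_comm _ _ _ _ _ fun S x => by
    have key : ∀ s, extOne (fun i => x (σ.symm i)) (extPerm σ s) = extOne x s := fun s => by
      unfold extOne
      by_cases hs : s < p
      · have e := extPerm_of_lt σ ⟨s, hs⟩
        simp only at e
        rw [dif_pos hs, dif_pos ((extPerm_lt_iff σ s).2 hs)]
        exact congrArg x ((Equiv.symm_apply_eq σ).2 (Fin.ext e))
      · rw [dif_neg hs, dif_neg (mt (extPerm_lt_iff σ s).1 hs)]
    exact (extPerm σ).surjective.forall.trans (forall_congr' fun s => by rw [key]; rfl)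

theorem segF_susp (p k : ℕ) (s : Fin (k + 1)) :
    KSegSusp C p k s ⋙ segF C (p + 1) k =
      segF C p k ⋙ ((JFun C).F.map (insertS p 1 k fun _ => s)).toFunctor :=
  Collect.pull_comm _ _ _ _ _ fun S x => forall_congr' fun t => by
    change (if h : t < p + 1 then (Fin.snoc (α := fun _ => ℕ) x (s : ℕ) : Fin (p + 1) → ℕ) ⟨t, h⟩
      else 1) ∈ S.1 t ↔ (fun x => if t < p then idOn k x else if h : p ≤ t ∧ t < p + 1 then
        (if x = 1 then (s : ℕ) else 0) else idOn 1 x) (if h : t < p then x ⟨t, h⟩ else 1) ∈ S.1 t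
    dsimp only
    by_cases h₁ : t < p
    · rw [dif_pos (by omega), dif_pos h₁, if_pos h₁]
      have e : (⟨t, by omega⟩ : Fin (p + 1)) = Fin.castSucc ⟨t, h₁⟩ := rfl
      rw [e, Fin.snoc_castSucc]
      have hS := S.2 t
      have hk : (diagObj (p + 1) k).set t = Set.Icc 1 k :=
        congrArg (Set.Icc 1) (if_pos (by omega))
      rw [hk] at hS
      unfold idOn
      split_ifs with h₂
      · rfl
      · exact iff_of_false (fun h => h₂ (hS h).2) fun h => absurd (hS h).1 (by omega)
    · rw [dif_neg h₁, if_neg h₁]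
      by_cases h₂ : t < p + 1
      · obtain rfl : t = p := by omega
        rw [dif_pos h₂, dif_pos ⟨le_rfl, h₂⟩, if_pos rfl]
        exact iff_of_eq (congrArg (· ∈ S.1 t) (Fin.snoc_last (α := fun _ => ℕ) _ _))
      · rw [dif_neg h₂, dif_neg fun h => h₂ h.2]
        rfl

theorem JFun_base (n : Finfty) : (JFun C).base n = Bar.zero C n.set := by
  obtain ⟨h⟩ := (JFun C).term Finfty.nul ⟨0, rfl⟩
  unfold SymFun.base
  rw [terminal_obj_ext h (JFun C).pt (Bar.zero C _)]
  rfl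

/-- The comparison maps in each level, before taking nerves. -/
def segNat (p : ℕ) : KSegX C p ⟶ (IObj (JFun C)).X p where
  app d := (segF C p d.unop.len).toCatHom
  naturality _ _ θ := Cat.ext (segF_map C p θ)

/-- The comparison map from Segal's construction. -/
def segHom : SymSpec.Hom (KSeg C) (IObj (JFun C)).nerve where
  app p := diagNerveMap (segNat C p)
  act p σ := by
    ext d x
    exact congrArg (fun P => toArrows x ⋙ P) (segF_perm C p d.unop.len σ)
  base p d := CategoryTheory.Functor.hext (fun _ => (JFun_base C _).symm) fun _ _ _ => by
    change HEq (𝟙 (Bar.zero C (diagObj p d.unop.len).set)) (𝟙 ((JFun C).base (diagObj p d.unop.len)))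
    rw [JFun_base]
    rfl
  susp p d s x := congrArg (fun P => toArrows x ⋙ P) (segF_susp C p d.unop.len s)

variable {C}

theorem segF_lin {D : PermCat.{u}} (f : MultiLin (fun _ : Unit => C) D) (hf : IsStrong f) (p k : ℕ)
    (h : IsPush unitEmb (fun _ => diagObj p k) (diagObj p k)) :
    SegBar.lin f hf (smashSet p k) ⋙ segF D p k =
      Functor.pi' (fun _ => segF C p k) ⋙ JApp h f := by
  refine Bar.functor_ext (fun a S hS =>
    (JObj_C (h := h) f (fun _ => (segF C p k).obj a) hS.out).symm) (fun a i T U S hs _ _ hS =>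
    HEq.symm ?_) fun a b φ S hS => (JApp_map h (f := f)
      ((Functor.pi' fun _ => segF C p k).map φ) hS.out).symm
  refine (JObj_ρ (i := ()) (j := i) h f (fun _ => (segF C p k).obj a) hs hS.out).trans (heq_of_eq ?_)
  let b : Bar C (diagObj p k).set := (segF C p k).obj a
  exact f.push_eq () (fun _ => b.C T) (fun _ => b.C U) (fun _ => b.C S)
    (fun _ => b.C T ⊗ b.C U) (fun _ hj => absurd rfl hj) (b.ρ i T U S hs) (isSum_unit _ _)
    (fun _ => b.ρ i T U S hs) ⟨rfl, rfl, HEq.rfl, fun _ hj => absurd rfl hj⟩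

theorem segHom_lin {D : PermCat.{u}} (f : MultiLin (fun _ : Unit => C) D) (hf : IsStrong f) (p : ℕ)
    (d : SimplexCategoryᵒᵖ) (x : ((KSeg C).X p).obj d) (u : d.unop ⟶ SimplexCategory.mk 0) :
    ((segHom D).app p).app d ((KSegLin f hf p).app d x) =
      SpHom.toFun (((multifunctorJ.nerve.comp multifunctorI).fn (fun _ : Unit => C) D).app
          (Opposite.op (SimplexCategory.mk 0)) (ComposableArrows.mk₀ f))
        (fun _ => p) p (Equiv.uniqueSigma (fun _ : Unit => Fin p)) d
        (fun _ => ((segHom C).app p).app d x) u := by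
  have h := isPush_unitEmb (diagObj p d.unop.len)
  refine Eq.trans ?_ (SymFunHom.spFun_eq (F := fun _ : Unit => JFun C) (b := SimplexCategory.mk 0)
    ((multifunctorJ.nerve.fn (fun _ : Unit => C) D).app (op (SimplexCategory.mk 0))
      (ComposableArrows.mk₀ f)) (β := unitEmb)
    (e := Equiv.uniqueSigma (fun _ : Unit => Fin p)) (fun _ _ => rfl) d
    (fun _ => ((segHom C).app p).app d x) u).symm
  refine (congrArg (fun P => toArrows x ⋙ P) (segF_lin f hf p d.unop.len h)).trans
    (CategoryTheory.Functor.hext (fun t => rfl) fun t t' s => heq_of_eq ?_)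
  refine Eq.symm (Eq.trans (congrArg (_ ≫ ·) ?_) (Category.comp_id _))
  change (SymFunHom.Hom.app ((JFn (fun _ : Unit => C) D).map (𝟙 f)) _ _ _ _).app _ = _
  rw [(JFn (fun _ : Unit => C) D).map_id]
  rfl

end Segal

/-! ### Homomorphisms of systems are determined by their values on singletons -/

section Single

variable {I : Type} {X : I → Type} {A : ∀ i, Set (X i)} {D : PermCat.{u}}

/-- Tuples of sets with at most one element. -/
def Tup.Single (S : Tup A) : Prop := ∀ i, (S.1 i).Subsingleton

/-- Finiteness of a family of sets. -/
def Bounded (A : ∀ i, Set (X i)) : Prop :=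
  (∀ i, (A i).Finite) ∧ ∃ t : Finset I, ∀ i, i ∉ t → (A i).Subsingleton

theorem IsSplit.subset {i : I} {T U S : Tup A} (h : IsSplit i T U S) (k : I) : T.1 k ⊆ S.1 k := by
  by_cases hj : k = i
  · subst hj
    exact h.1 ▸ Set.subset_union_left
  · exact (h.2.2 k hj).2.ge

theorem IsSplit.not_subsingleton {i : I} {T U S : Tup A} (h : IsSplit i T U S) (hT : T.1 i ≠ ∅)
    (hU : U.1 i ≠ ∅) : ¬(S.1 i).Subsingleton := fun hs => by
  obtain ⟨x, hx⟩ := Set.nonempty_iff_ne_empty.2 hT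
  obtain ⟨y, hy⟩ := Set.nonempty_iff_ne_empty.2 hU
  obtain rfl : x = y := hs (h.subset i hx) (h.symm.subset i hy)
  exact Set.disjoint_left.1 h.2.1 hx hy

theorem Bounded.exists_size (hA : Bounded A) : ∃ size : Tup A → ℕ, ∀ (i : I) (T U S : Tup A),
    IsSplit i T U S → T.1 i ≠ ∅ → U.1 i ≠ ∅ → size T < size S := by
  obtain ⟨hf, t, ht⟩ := hA
  refine ⟨fun S => ∑ i ∈ t, (S.1 i).ncard, fun i T U S h hT hU => ?_⟩
  have hi : i ∈ t := by
    by_contra hi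
    exact h.not_subsingleton hT hU ((ht i hi).anti (S.2 i))
  refine Finset.sum_lt_sum
    (fun j _ => Set.ncard_le_ncard (h.subset j) ((hf j).subset (S.2 j))) ⟨i, hi, ?_⟩
  · refine Set.ncard_lt_ncard ((h.subset i).lt_of_ne fun e => hU ?_) ((hf i).subset (S.2 i))
    exact h.2.1.symm.eq_bot_of_le (by rw [e, ← h.1]; exact Set.subset_union_right)

theorem Tup.exists_split {S : Tup A} (hS : S.NE) (hs : ¬S.Single) :
    ∃ i T U, IsSplit i T U S ∧ T.NE ∧ U.NE := by
  classical
  obtain ⟨i, hi⟩ := not_forall.1 hs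
  obtain ⟨x, hx, y, hy, hxy⟩ := Set.not_subsingleton_iff.1 hi
  have up : ∀ R : Set (X i), R ⊆ S.1 i → ∃ T : Tup A, T.1 = Function.update S.1 i R := fun R hR =>
    have h : ∀ k, Function.update S.1 i R k ⊆ A k := fun k => by
      by_cases hk : k = i
      · subst hk
        rw [Function.update_self]
        exact hR.trans (S.2 k)
      · rw [Function.update_of_ne hk]
        exact S.2 k
    ⟨⟨_, h⟩, rfl⟩
  have ne : ∀ R : Set (X i), R.Nonempty → ∀ T : Tup A, T.1 = Function.update S.1 i R → T.NE := by
    intro R hR T hT k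
    rw [hT]
    by_cases hk : k = i
    · subst hk
      rw [Function.update_self]
      exact hR.ne_empty
    · rw [Function.update_of_ne hk]
      exact hS k
  obtain ⟨T, hT⟩ := up ({x} : Set (X i)) (Set.singleton_subset_iff.2 hx)
  obtain ⟨U, hU⟩ := up (S.1 i \ {x}) Set.sdiff_subset
  refine ⟨i, T, U, ⟨?_, ?_, fun k hk => ?_⟩, ne {x} ⟨x, rfl⟩ T hT, ne (S.1 i \ {x}) ⟨y, hy, Ne.symm hxy⟩ U hU⟩
  · rw [hT, hU, Function.update_self, Function.update_self]
    exact Set.union_sdiff_cancel (Set.singleton_subset_iff.2 hx)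
  · rw [hT, hU, Function.update_self, Function.update_self]
    exact Set.disjoint_sdiff_right
  · rw [hT, hU]
    simp only [Function.update_of_ne hk, and_self]

/-- The intersection of two tuples of subsets. -/
def Tup.inter (T U : Tup A) : Tup A :=
  ⟨fun k => T.1 k ∩ U.1 k, fun k => Set.inter_subset_left.trans (T.2 k)⟩

theorem IsSplit.inter {i : I} {T U S : Tup A} (h : IsSplit i T U S) {V : Tup A}
    (hV : ∀ k, V.1 k ⊆ S.1 k) : IsSplit i (T.inter V) (U.inter V) V := by
  refine ⟨?_, h.2.1.mono Set.inter_subset_left Set.inter_subset_left, fun k hk => ⟨?_, ?_⟩⟩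
  · change T.1 i ∩ V.1 i ∪ U.1 i ∩ V.1 i = V.1 i
    rw [← Set.union_inter_distrib_right, h.1, Set.inter_eq_right.2 (hV i)]
  · exact congrArg (· ∩ V.1 k) (h.2.2 k hk).1
  · refine (Set.inter_eq_right.2 ?_).symm
    rw [← (h.2.2 k hk).2]
    exact hV k

theorem IsSplit.inter' {i : I} {T U S : Tup A} (h : IsSplit i T U S) {V : Tup A}
    (hV : ∀ k, V.1 k ⊆ S.1 k) : IsSplit i (V.inter T) (V.inter U) V := by
  have e : ∀ T, Tup.inter T V = Tup.inter V T := fun T =>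
    Subtype.ext (funext fun k => Set.inter_comm _ _)
  have := h.inter hV
  rwa [e, e] at this

theorem Bar.exch (a : Bar D A) (i j : I) {TV UV TW UW V W T U S : Tup A}
    (h₁ : IsSplit i TV UV V) (h₂ : IsSplit i TW UW W) (h₃ : IsSplit j V W S)
    (h₄ : IsSplit j TV TW T) (h₅ : IsSplit j UV UW U) (h₆ : IsSplit i T U S) :
    (a.ρ i TV UV V h₁ ⊗ₘ a.ρ i TW UW W h₂) ≫ a.ρ j V W S h₃ =
      tensorμ (a.C TV) (a.C UV) (a.C TW) (a.C UW) ≫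
        (a.ρ j TV TW T h₄ ⊗ₘ a.ρ j UV UW U h₅) ≫ a.ρ i T U S h₆ := by
  by_cases h : i = j
  · subst h
    exact a.exch_same i h₁ h₂ h₃ h₄ h₅ h₆
  · exact a.ρ_exch i j h ..

variable {a b : Bar D A}

/-- The values of the homomorphism with given values on singletons. -/
inductive Val (g : ∀ S : Tup A, S.NE → S.Single → (a.C S ⟶ b.C S)) :
    ∀ S : Tup A, (a.C S ⟶ b.C S) → Prop
  | deg (S) (h : ¬S.NE) (φ) (hφ : HEq φ (𝟙 (𝟙_ D))) : Val g S φ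
  | single (S) (h : S.NE) (h' : S.Single) : Val g S (g S h h')
  | split (i T U S) (h : IsSplit i T U S) (hT : T.NE) (hU : U.NE) (φ ψ χ) (hφ : Val g T φ)
      (hψ : Val g U ψ) (hχ : a.ρ i T U S h ≫ χ = (φ ⊗ₘ ψ) ≫ b.ρ i T U S h) : Val g S χ

theorem Val.heq_id {g : ∀ S : Tup A, S.NE → S.Single → (a.C S ⟶ b.C S)} {S : Tup A}
    {φ : a.C S ⟶ b.C S} (h : Val g S φ) (hS : ¬S.NE) : HEq φ (𝟙 (𝟙_ D)) := by
  cases h with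
  | deg S h φ hφ => exact hφ
  | single S h h' => exact absurd h hS
  | split i T U S h hT hU φ ψ χ hφ hψ hχ => exact absurd (h.ne hT) hS

variable (hA : Bounded A) (ha : ∀ i T U S h, IsIso (a.ρ i T U S h))
include hA ha

theorem Val.exists (g : ∀ S : Tup A, S.NE → S.Single → (a.C S ⟶ b.C S)) (S : Tup A) :
    ∃ φ, Val g S φ := by
  obtain ⟨size, hsize⟩ := hA.exists_size
  induction hn : size S using Nat.strong_induction_on generalizing S with
  | _ n ih =>
    subst hn
    by_cases hS : S.NE
    · by_cases hs : S.Single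
      · exact ⟨_, Val.single S hS hs⟩
      · obtain ⟨i, T, U, h, hT, hU⟩ := Tup.exists_split hS hs
        obtain ⟨φ, hφ⟩ := ih _ (hsize i T U S h (hT i) (hU i)) T rfl
        obtain ⟨ψ, hψ⟩ := ih _ (hsize i U T S h.symm (hU i) (hT i)) U rfl
        have := ha i T U S h
        exact ⟨inv (a.ρ i T U S h) ≫ (φ ⊗ₘ ψ) ≫ b.ρ i T U S h,
          Val.split i T U S h hT hU φ ψ _ hφ hψ (by simp)⟩
    · obtain ⟨k, hk⟩ := Tup.not_ne.1 hS
      exact ⟨eqToHom ((a.C_empty k S hk).trans (b.C_empty k S hk).symm), Val.deg S hS _ (by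
        exact (eqToHom_heq_id_cod _ _ _).trans (by rw [b.C_empty k S hk]))⟩

theorem Val.unique {g : ∀ S : Tup A, S.NE → S.Single → (a.C S ⟶ b.C S)} (S : Tup A)
    {φ φ' : a.C S ⟶ b.C S} (h : Val g S φ) (h' : Val g S φ') : φ = φ' := by
  obtain ⟨size, hsize⟩ := hA.exists_size
  induction hn : size S using Nat.strong_induction_on generalizing S with
  | _ n ih =>
    subst hn
    cases h with
    | deg S hS φ hφ => exact eq_of_heq (hφ.trans (h'.heq_id hS).symm)
    | single S hS hs =>
      cases h' with
      | deg S hS' φ hφ => exact absurd hS hS'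
      | single S hS hs => rfl
      | split i T U S h hT hU φ ψ χ hφ hψ hχ =>
        exact absurd (hs i) (h.not_subsingleton (hT i) (hU i))
    | split i T U S h hT hU φT φU χ hφT hφU hχ =>
      cases h' with
      | deg S hS' φ hφ => exact absurd (h.ne hT) hS'
      | single S hS hs => exact absurd (hs i) (h.not_subsingleton (hT i) (hU i))
      | split j V W S h' hV hW φV φW χ' hφV hφW hχ' =>
        have key : ∀ (k : I) (P Q R : Tup A) (hs : IsSplit k P Q R) (p q r), size R < size S →
            Val g P p → Val g Q q → Val g R r →
            a.ρ k P Q R hs ≫ r = (p ⊗ₘ q) ≫ b.ρ k P Q R hs := by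
          intro k P Q R hs p q r hR hp hq hr
          by_cases hP : P.NE
          · by_cases hQ : Q.NE
            · have := ha k P Q R hs
              rw [ih _ hR R hr (Val.split k P Q R hs hP hQ p q
                (inv (a.ρ k P Q R hs) ≫ (p ⊗ₘ q) ≫ b.ρ k P Q R hs) hp hq (by simp)) rfl]
              simp
            · refine Bar.comm_right hs hQ (hq.heq_id hQ) ?_
              obtain ⟨l, hl⟩ := Tup.not_ne.1 hQ
              by_cases hlk : l = k
              · subst hlk
                obtain rfl := hs.eq_left hl
                exact heq_of_eq (ih _ hR _ hr hp rfl)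
              · have := (hs.2.2 l hlk).1.symm.trans hl
                exact absurd (Tup.not_ne.2 ⟨l, this⟩) (not_not.2 hP)
          · refine Bar.comm_left hs hP (hp.heq_id hP) ?_
            obtain ⟨l, hl⟩ := Tup.not_ne.1 hP
            by_cases hlk : l = k
            · subst hlk
              obtain rfl := hs.eq_right hl
              exact heq_of_eq (ih _ hR _ hr hq rfl)
            · exact (hr.heq_id (Tup.not_ne.2 ⟨l, (hs.2.2 l hlk).2.trans hl⟩)).trans
                (hq.heq_id (Tup.not_ne.2 ⟨l, (hs.2.2 l hlk).1.trans hl⟩)).symm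
        have hT' := hsize i T U S h (hT i) (hU i)
        have hU' := hsize i U T S h.symm (hU i) (hT i)
        have hV' := hsize j V W S h' (hV j) (hW j)
        have hW' := hsize j W V S h'.symm (hW j) (hV j)
        obtain ⟨p₁, hp₁⟩ := Val.exists hA ha g (T.inter V)
        obtain ⟨p₂, hp₂⟩ := Val.exists hA ha g (U.inter V)
        obtain ⟨p₃, hp₃⟩ := Val.exists hA ha g (T.inter W)
        obtain ⟨p₄, hp₄⟩ := Val.exists hA ha g (U.inter W)
        have s₁ := h.inter h'.subset
        have s₂ := h.inter h'.symm.subset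
        have s₃ := h'.inter' h.subset
        have s₄ := h'.inter' h.symm.subset
        have k₁ := key i _ _ _ s₁ p₁ p₂ φV hV' hp₁ hp₂ hφV
        have k₂ := key i _ _ _ s₂ p₃ p₄ φW hW' hp₃ hp₄ hφW
        have k₃ := key j _ _ _ s₃ p₁ p₃ φT hT' hp₁ hp₃ hφT
        have k₄ := key j _ _ _ s₄ p₂ p₄ φU hU' hp₂ hp₄ hφU
        have i₁ := ha i _ _ _ s₁
        have i₂ := ha i _ _ _ s₂
        have i₃ := ha j _ _ _ h'
        rw [← cancel_epi ((a.ρ i _ _ _ s₁ ⊗ₘ a.ρ i _ _ _ s₂) ≫ a.ρ j V W S h')]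
        rw [Category.assoc, Category.assoc, hχ', ← Category.assoc (_ ⊗ₘ _) (_ ⊗ₘ _),
          tensorHom_comp_tensorHom, k₁, k₂, ← tensorHom_comp_tensorHom, Category.assoc,
          b.exch i j s₁ s₂ h' s₃ s₄ h, ← Category.assoc (a.ρ i _ _ _ s₁ ⊗ₘ a.ρ i _ _ _ s₂),
          a.exch i j s₁ s₂ h' s₃ s₄ h, tensorμ_natural_assoc]
        simp only [Category.assoc, hχ]
        rw [← Category.assoc (_ ⊗ₘ _) (_ ⊗ₘ _), ← Category.assoc (_ ⊗ₘ _) (_ ⊗ₘ _),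
          tensorHom_comp_tensorHom, tensorHom_comp_tensorHom, k₃, k₄]

/-- A homomorphism out of a system with invertible structure maps can be prescribed on
singletons. -/
theorem Bar.exists_hom (g : ∀ S : Tup A, S.NE → S.Single → (a.C S ⟶ b.C S)) :
    ∃ φ : a ⟶ b, ∀ S hS hs, Bar.Hom.f φ S = g S hS hs := by
  choose f hf using Val.exists hA ha g
  refine ⟨Bar.mkHom f (fun k S hk => (hf S).heq_id (Tup.not_ne.2 ⟨k, hk⟩))
    fun i T U S h hT hU _ => ?_, fun S hS hs =>
      Val.unique hA ha S (hf S) (Val.single S hS hs)⟩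
  have := ha i T U S h
  rw [Val.unique hA ha S (hf S) (Val.split i T U S h hT hU _ _
    (inv (a.ρ i T U S h) ≫ (f T ⊗ₘ f U) ≫ b.ρ i T U S h) (hf T) (hf U) (by simp))]
  simp

theorem Bar.hom_ext_single {φ ψ : a ⟶ b}
    (h : ∀ S : Tup A, S.NE → S.Single → Bar.Hom.f φ S = Bar.Hom.f ψ S) : φ = ψ := by
  obtain ⟨size, hsize⟩ := hA.exists_size
  refine Bar.Hom.ext (funext fun S => ?_)
  induction hn : size S using Nat.strong_induction_on generalizing S with
  | _ n ih =>
    subst hn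
    by_cases hS : S.NE
    · by_cases hs : S.Single
      · exact h S hS hs
      · obtain ⟨i, T, U, hs, hT, hU⟩ := Tup.exists_split hS hs
        have := ha i T U S hs
        rw [← cancel_epi (a.ρ i T U S hs), Bar.Hom.comm, Bar.Hom.comm,
          ih _ (hsize i T U S hs (hT i) (hU i)) T rfl,
          ih _ (hsize i U T S hs.symm (hU i) (hT i)) U rfl]
    · obtain ⟨k, hk⟩ := Tup.not_ne.1 hS
      exact eq_of_heq ((Bar.Hom.f_empty φ k S hk).trans (Bar.Hom.f_empty ψ k S hk).symm)

end Single

/-! ### Anodyne extensions of diagonals -/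

section Diag

open SSet Simplicial Limits

theorem anodyne_of_glue {V Y : SSet.{u}} (φ : V ⟶ Y) {S S' : Y.Subcomplex} (hS : S ≤ S')
    (hφ : ∀ d (v : V.obj d), φ.app d v ∈ S'.obj d)
    (hW : anodyneExtensions (S.preimage φ).ι)
    (hsurj : ∀ d, ∀ y ∈ S'.obj d, y ∈ S.obj d ∨ ∃ v, φ.app d v = y)
    (hinj : ∀ d (v v' : V.obj d), φ.app d v ∉ S.obj d → φ.app d v = φ.app d v' → v = v') :
    anodyneExtensions (Subcomplex.homOfLE hS) := by
  have hr : Subcomplex.range φ ≤ S' := by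
    rintro d _ ⟨v, rfl⟩
    exact hφ d v
  suffices IsPushout (S.fromPreimage φ) (S.preimage φ).ι (Subcomplex.homOfLE hS)
      (Subcomplex.lift φ hr) from anodyneExtensions.of_isPushout this hW
  have hpb : ∀ d, IsPullback ((S.fromPreimage φ).app d) ((S.preimage φ).ι.app d)
      ((Subcomplex.homOfLE hS).app d) ((Subcomplex.lift φ hr).app d) := fun d => by
    rw [Types.isPullback_iff]
    refine ⟨rfl, fun x₁ x₂ h => Subtype.ext h.2, fun x y h => ⟨⟨y, ?_⟩, ?_, rfl⟩⟩
    · have e : x.1 = φ.app d y := congrArg Subtype.val h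
      change φ.app d y ∈ S.obj d
      exact e ▸ x.2
    · exact Subtype.ext (congrArg Subtype.val h).symm
  refine ⟨⟨rfl⟩, ⟨evaluationJointlyReflectsColimits _ fun d =>
    (isColimitMapCoconePushoutCoconeEquiv _ _).2 (IsPushout.isColimit ?_)⟩⟩
  refine Types.isPushout_of_isPullback_of_mono' (hpb d) ?_ ?_
  · refine Set.eq_univ_of_forall fun y => ?_
    rcases hsurj d y.1 y.2 with h | ⟨v, hv⟩
    · exact Or.inl ⟨⟨y.1, h⟩, rfl⟩
    · exact Or.inr ⟨v, Subtype.ext hv⟩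
  · intro v v' hv _ h
    exact hinj d v v' (fun hS => hv ⟨⟨v, hS⟩, rfl⟩) (congrArg Subtype.val h)

theorem anodyne_of_filtration {Y : SSet.{u}} (S : ℕ →o Y.Subcomplex) (hS : ⨆ n, S n = ⊤)
    (h : ∀ n : ℕ, anodyneExtensions (Subcomplex.homOfLE (S.monotone n.le_succ))) :
    anodyneExtensions (S 0).ι := by
  refine anodyneExtensions.transfiniteCompositionsOfShape_le ℕ _ ⟨?_⟩
  exact
  { F := S.monotone.functor ⋙ Subcomplex.toSSetFunctor
    isoBot := Iso.refl _
    incl := { app := fun n => (S n).ι }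
    isColimit := IsColimit.ofIsoColimit (isColimitOfPreserves (Subcomplex.toSSetFunctor)
      ((CompleteLattice.colimitCocone (S.monotone.functor)).isColimit))
        (Cocone.ext (Subcomplex.eqToIso hS ≪≫ Subcomplex.topIso Y))
    fac := rfl
    map_mem := fun n _ => h n }

variable (B : SimplexCategoryᵒᵖ ⥤ SSet.{u})

/-- The diagonal of a bisimplicial set. -/
def diagSet : SSet.{u} := Functor.diag _ ⋙ Functor.uncurry.obj B

/-- The rows of a bisimplicial set. -/
def rowSet (d : SimplexCategoryᵒᵖ) : SSet.{u} := B ⋙ (evaluation _ _).obj d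

variable {B}

theorem bi_comm {m m' d d' : SimplexCategoryᵒᵖ} (f : m ⟶ m') (θ : d ⟶ d') (x : (B.obj m).obj d) :
    (B.obj m').map θ ((B.map f).app d x) = (B.map f).app d' ((B.obj m).map θ x) :=
  (NatTrans.naturality_apply (B.map f) θ x).symm

theorem bi_comp {m m' m'' d : SimplexCategoryᵒᵖ} (f : m ⟶ m') (g : m' ⟶ m'')
    (x : (B.obj m).obj d) : (B.map g).app d ((B.map f).app d x) = (B.map (f ≫ g)).app d x := by
  rw [B.map_comp]
  rfl

theorem bi_id {m d : SimplexCategoryᵒᵖ} (x : (B.obj m).obj d) : (B.map (𝟙 m)).app d x = x := by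
  rw [B.map_id]
  rfl

variable (B) in
/-- The simplices which are degenerate in the direction of the columns. -/
def latch (m : ℕ) : (B.obj (op ⦋m⦌)).Subcomplex where
  obj d := {x | ∃ (k : ℕ) (_ : k < m) (f : ⦋m⦌ ⟶ ⦋k⦌) (y : (B.obj (op ⦋k⦌)).obj d),
    (B.map f.op).app d y = x}
  map {d d'} θ := by
    rintro _ ⟨k, hk, f, y, rfl⟩
    exact ⟨k, hk, f, (B.obj _).map θ y, (bi_comm _ _ _).symm⟩

/-- A bisimplicial subset. -/
structure BiSub (B : SimplexCategoryᵒᵖ ⥤ SSet.{u}) where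
  A : ∀ m, (B.obj m).Subcomplex
  map : ∀ {m m' : SimplexCategoryᵒᵖ} (f : m ⟶ m') (d : SimplexCategoryᵒᵖ) (x : (B.obj m).obj d),
    x ∈ (A m).obj d → (B.map f).app d x ∈ (A m').obj d

/-- The filtration of the diagonal relative to a bisimplicial subset. -/
def BiSub.filt (A : BiSub B) : ℕ →o (diagSet B).Subcomplex where
  toFun n :=
    { obj := fun d => {x | x ∈ (A.A d).obj d ∨ ∃ (k : ℕ) (_ : k < n) (f : d.unop ⟶ ⦋k⦌)
        (y : (B.obj (op ⦋k⦌)).obj d), (B.map f.op).app d y = x}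
      map := fun {d d'} θ x hx => by
        rcases hx with hx | ⟨k, hk, f, y, rfl⟩
        · exact Or.inl ((A.A d').map θ (A.map θ d x hx))
        · refine Or.inr ⟨k, hk, θ.unop ≫ f, (B.obj _).map θ y, ?_⟩
          change _ = (B.obj d').map θ ((B.map θ).app d _)
          rw [bi_comp, bi_comm]
          rfl }
  monotone' n n' h d x hx := hx.imp id fun ⟨k, hk, t⟩ => ⟨k, hk.trans_le h, t⟩

theorem BiSub.anodyne (A : BiSub B)
    (h : ∀ m : ℕ, anodyneExtensions (A.A (op ⦋m⦌) ⊔ latch B m).ι) :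
    anodyneExtensions (A.filt 0).ι := by
  refine anodyne_of_filtration A.filt ?_ fun m => ?_
  · refine top_le_iff.1 fun d x _ => ?_
    simp only [Subfunctor.iSup_obj, Set.mem_iUnion]
    exact ⟨d.unop.len + 1, Or.inr ⟨d.unop.len, Nat.lt_succ_self _, 𝟙 _, x, bi_id _⟩⟩
  let φ : B.obj (op ⦋m⦌) ⊗ (Δ[m] : SSet.{u}) ⟶ diagSet B :=
    { app := fun d => ↾fun x => (B.map (stdSimplex.objEquiv x.2).op).app d x.1
      naturality := fun d d' θ => by
        ext ⟨x, f⟩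
        change (B.map _).app d' ((B.obj _).map θ x) =
          (B.obj d').map θ ((B.map θ).app d ((B.map _).app d x))
        rw [bi_comp, bi_comm]
        rfl }
  have hφ : ∀ d (x : (B.obj (op ⦋m⦌)).obj d) (f : d.unop ⟶ ⦋m⦌),
      φ.app d (x, stdSimplex.objEquiv.symm f) = (B.map f.op).app d x := fun d x f => by
    change (B.map (stdSimplex.objEquiv _).op).app d x = _
    rw [Equiv.apply_symm_apply]
  have hsplit : ∀ (d : SimplexCategoryᵒᵖ) (f : d.unop ⟶ ⦋m⦌) [IsSplitEpi f]
      (x : (B.obj (op ⦋m⦌)).obj d), (B.map (section_ f).op).app d ((B.map f.op).app d x) = x := fun d f _ x => by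
    rw [bi_comp, ← op_comp, IsSplitEpi.id, op_id, bi_id]
  have hmem : ∀ (d : SimplexCategoryᵒᵖ) (f : d.unop ⟶ ⦋m⦌) (x : (B.obj (op ⦋m⦌)).obj d),
      (B.map f.op).app d x ∈ (A.filt m).obj d ↔
        ¬Epi f ∨ x ∈ (A.A (op ⦋m⦌) ⊔ latch B m).obj d := by
    intro d f x
    refine ⟨fun hx => or_iff_not_imp_left.2 fun hf => ?_, fun hx => ?_⟩
    · have := not_not.1 hf
      have := isSplitEpi_of_epi f
      rw [← hsplit d f x]
      rcases hx with hx | ⟨k, hk, g, y, hy⟩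
      · exact Or.inl (A.map _ _ _ hx)
      · refine Or.inr ⟨k, hk, section_ f ≫ g, y, ?_⟩
        rw [← hy, bi_comp]
        rfl
    · by_cases hf : Epi f
      · rcases hx.resolve_left (not_not.2 hf) with hx | ⟨k, hk, g, y, rfl⟩
        · exact Or.inl (A.map _ _ _ hx)
        · exact Or.inr ⟨k, hk, f ≫ g, y, (bi_comp _ _ _).symm⟩
      · rw [SimplexCategory.epi_iff_surjective] at hf
        cases m with
        | zero => exact absurd (fun y => ⟨0, Subsingleton.elim (α := Fin 1) _ _⟩) hf
        | succ k =>
          obtain ⟨i, g, rfl⟩ := SimplexCategory.eq_comp_δ_of_not_surjective f hf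
          exact Or.inr ⟨k, k.lt_succ_self, g, _, bi_comp _ _ _⟩
  refine anodyne_of_glue φ _ ?_ ?_ ?_ ?_
  · rintro d ⟨x, f⟩
    exact Or.inr ⟨m, m.lt_succ_self, _, x, rfl⟩
  · have : (A.filt m).preimage φ = (A.A (op ⦋m⦌) ⊔ latch B m).unionProd ∂Δ[m] := by
      ext d ⟨x, f⟩
      refine (hmem d (stdSimplex.objEquiv f) x).trans (Iff.trans ?_
        (Subcomplex.mem_unionProd_iff _ _ _).symm)
      rw [SimplexCategory.epi_iff_surjective]
      rfl
    rw [this]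
    exact anodyneExtensions_unionProd_ι' _ _ (h m)
  · rintro d y (hy | ⟨k, hk, f, x, rfl⟩)
    · exact Or.inl (Or.inl hy)
    · rcases Nat.lt_succ_iff_lt_or_eq.1 hk with hk | rfl
      · exact Or.inl (Or.inr ⟨k, hk, f, x, rfl⟩)
      · exact Or.inr ⟨(x, stdSimplex.objEquiv.symm f), hφ d x f⟩
  · rintro d ⟨x, f⟩ ⟨x', f'⟩ hx e
    have hx' := e ▸ hx
    obtain ⟨f, rfl⟩ := stdSimplex.objEquiv.symm.surjective f
    obtain ⟨f', rfl⟩ := stdSimplex.objEquiv.symm.surjective f'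
    rw [hφ] at hx hx'
    replace hx := not_or.1 ((hmem d f x).not.1 hx)
    replace hx' := not_or.1 ((hmem d f' x').not.1 hx')
    rw [hφ, hφ] at e
    have nd : ∀ x : (B.obj (op ⦋m⦌)).obj d, x ∉ (A.A (op ⦋m⦌) ⊔ latch B m).obj d →
        x ∈ (rowSet B d).nonDegenerate m := fun x hx ⟨k, hk, g, y, hy⟩ =>
      hx (Or.inr ⟨k, hk, g, y, hy⟩)
    have := not_not.1 hx.1
    have h₁ := (rowSet B d).unique_nonDegenerate_simplex (n := d.unop.len) _ f ⟨x, nd x hx.2⟩ rfl f'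
      ⟨x', nd x' hx'.2⟩ e
    obtain rfl : x = x' := congrArg Subtype.val h₁
    rw [(rowSet B d).unique_nonDegenerate_map (n := d.unop.len) _ f ⟨x, nd x hx.2⟩ rfl f'
      ⟨x, nd x hx'.2⟩ e]

end Diag

/-! ### Cylinders of functors -/

section Cyl

variable {𝒜 ℬ 𝒜' ℬ' 𝒜'' ℬ'' : Type u} [Category.{u} 𝒜] [Category.{u} ℬ] [Category.{u} 𝒜']
  [Category.{u} ℬ'] [Category.{u} 𝒜''] [Category.{u} ℬ'']

/-- The cylinder of a functor: objects of the target with an optional preimage. -/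
@[ext]
structure Cyl (F : 𝒜 ⥤ ℬ) where
  pt : ℬ
  lab : Option 𝒜
  h : ∀ a, lab = some a → F.obj a = pt

instance (F : 𝒜 ⥤ ℬ) : Category.{u} (Cyl F) where
  Hom x y := x.pt ⟶ y.pt
  id x := 𝟙 x.pt
  comp f g := CategoryStruct.comp (obj := ℬ) f g
  id_comp f := Category.id_comp (obj := ℬ) f
  comp_id f := Category.comp_id (obj := ℬ) f
  assoc f g h := Category.assoc (obj := ℬ) f g h

variable {F : 𝒜 ⥤ ℬ} {F' : 𝒜' ⥤ ℬ'} {F'' : 𝒜'' ⥤ ℬ''}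

/-- Functoriality of the cylinder. -/
def Cyl.map (p : 𝒜 ⥤ 𝒜') (q : ℬ ⥤ ℬ') (h : F ⋙ q = p ⋙ F') : Cyl F ⥤ Cyl F' where
  obj x := ⟨q.obj x.pt, x.lab.map p.obj, fun a ha => by
    obtain ⟨b, hb, rfl⟩ := Option.map_eq_some_iff.1 ha
    rw [← x.h b hb]
    exact (Functor.congr_obj h b).symm⟩
  map f := q.map f
  map_id _ := q.map_id _
  map_comp f g := q.map_comp f g

theorem Cyl.map_congr {p p' : 𝒜 ⥤ 𝒜'} {q q' : ℬ ⥤ ℬ'} {h : F ⋙ q = p ⋙ F'}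
    (hp : p' = p) (hq : q' = q) :
    Cyl.map p' q' (by rw [hp, hq, h]) = Cyl.map p q h := by
  subst hp hq
  rfl

theorem Cyl.map_id : Cyl.map (𝟭 𝒜) (𝟭 ℬ) (F := F) (F' := F) rfl = 𝟭 _ :=
  CategoryTheory.Functor.hext (fun _ => Cyl.ext rfl (Option.map_id_apply)) fun _ _ _ => HEq.rfl

theorem Cyl.map_comp {p : 𝒜 ⥤ 𝒜'} {q : ℬ ⥤ ℬ'} (h : F ⋙ q = p ⋙ F') {p' : 𝒜' ⥤ 𝒜''}
    {q' : ℬ' ⥤ ℬ''} (h' : F' ⋙ q' = p' ⋙ F'') :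
    Cyl.map (p ⋙ p') (q ⋙ q') (by rw [← Functor.assoc, h, Functor.assoc, h', Functor.assoc]) =
      Cyl.map p q h ⋙ Cyl.map p' q' h' :=
  CategoryTheory.Functor.hext (fun x => Cyl.ext rfl (by
    change Option.map _ _ = Option.map _ (Option.map _ _)
    rw [Option.map_map]
    rfl)) fun _ _ _ => HEq.rfl

/-- The inclusion of the source. -/
def Cyl.inc (F : 𝒜 ⥤ ℬ) : 𝒜 ⥤ Cyl F where
  obj a := ⟨F.obj a, some a, fun b hb => by cases hb; rfl⟩
  map f := F.map f
  map_id a := F.map_id a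
  map_comp f g := F.map_comp f g

/-- The projection to the target. -/
def Cyl.proj (F : 𝒜 ⥤ ℬ) : Cyl F ⥤ ℬ where
  obj x := x.pt
  map f := f

/-- The section of the projection. -/
def Cyl.sec (F : 𝒜 ⥤ ℬ) : ℬ ⥤ Cyl F where
  obj x := ⟨x, none, nofun⟩
  map f := f

/-- The deformation of the cylinder to the image of the section. -/
def Cyl.erase (F : 𝒜 ⥤ ℬ) : Cyl F × Fin 2 ⥤ Cyl F where
  obj x := if x.2 = 0 then ⟨x.1.pt, none, nofun⟩ else x.1
  map {x y} f := eqToHom (C := ℬ) (by split_ifs <;> rfl) ≫ f.1 ≫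
    eqToHom (C := ℬ) (by split_ifs <;> rfl)
  map_id x := by
    change eqToHom (C := ℬ) _ ≫ (𝟙 x.1.pt) ≫ eqToHom (C := ℬ) _ = 𝟙 _
    simp
  map_comp f g := by
    change eqToHom (C := ℬ) _ ≫ (CategoryStruct.comp (obj := ℬ) f.1 g.1) ≫ eqToHom (C := ℬ) _ =
      CategoryStruct.comp (obj := ℬ) (eqToHom (C := ℬ) _ ≫ f.1 ≫ eqToHom (C := ℬ) _)
        (eqToHom (C := ℬ) _ ≫ g.1 ≫ eqToHom (C := ℬ) _)
    simp

/-- A choice of coreflections. -/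
structure Coref (F : 𝒜 ⥤ ℬ) where
  r : ℬ → 𝒜
  ε : ∀ b, F.obj (r b) ⟶ b
  univ : ∀ b a (g : F.obj a ⟶ b), ∃! g' : F.obj a ⟶ F.obj (r b), g' ≫ ε b = g

namespace Coref

variable (R : Coref F) (R' : Coref F')

/-- The coreflection of an object, or the object itself. -/
def obj (x : Cyl F) : Fin 2 → Cyl F
  | 0 => (Cyl.inc F).obj (R.r x.pt)
  | 1 => x

/-- The counit, or the identity. -/
def counit (x : Cyl F) : ∀ t, (R.obj x t).pt ⟶ x.pt
  | 0 => R.ε x.pt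
  | 1 => 𝟙 x.pt

theorem exists_map {x y : Cyl F} (f : x.pt ⟶ y.pt) : ∀ {t t' : Fin 2}, t ≤ t' →
    ∃! g : (R.obj x t).pt ⟶ (R.obj y t').pt, g ≫ R.counit y t' = R.counit x t ≫ f
  | 0, 0, _ => R.univ _ _ _
  | 1, 0, h => absurd h (by decide)
  | 0, 1, _ | 1, 1, _ => ⟨R.counit x _ ≫ f, Category.comp_id _, fun g hg => (Category.comp_id g).symm.trans hg⟩

/-- The deformation of the cylinder to the image of the source. -/
def mix : Cyl F × Fin 2 ⥤ Cyl F where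
  obj x := R.obj x.1 x.2
  map f := (R.exists_map f.1 (leOfHom f.2)).choose
  map_id x := ((R.exists_map (𝟙 x.1.pt) le_rfl).choose_spec.2 (𝟙 _) (by simp)).symm
  map_comp {x y z} f g := ((R.exists_map (CategoryStruct.comp (obj := ℬ) f.1 g.1)
    (leOfHom (f.2 ≫ g.2))).choose_spec.2 _ (by
      change CategoryStruct.comp (obj := ℬ) (CategoryStruct.comp (obj := ℬ) _ _) _ = _
      rw [Category.assoc, (R.exists_map g.1 (leOfHom g.2)).choose_spec.1, ← Category.assoc,
        (R.exists_map f.1 (leOfHom f.2)).choose_spec.1, Category.assoc])).symm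

theorem heq_mix_map {x y : Cyl F × Fin 2} (f : x ⟶ y) {X Y : Cyl F} (hX : X = R.obj x.1 x.2)
    (hY : Y = R.obj y.1 y.2) {p : X.pt ⟶ x.1.pt} {q : Y.pt ⟶ y.1.pt}
    (hp : HEq p (R.counit x.1 x.2)) (hq : HEq q (R.counit y.1 y.2)) (g : X ⟶ Y)
    (hg : CategoryStruct.comp (obj := ℬ) g q = p ≫ f.1) : HEq g (R.mix.map f) := by
  subst hX hY
  obtain rfl := eq_of_heq hp
  obtain rfl := eq_of_heq hq
  exact heq_of_eq ((R.exists_map f.1 (leOfHom f.2)).choose_spec.2 g hg)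

theorem mix_one {E : Type v} [Category.{w} E] (c : E ⥤ Cyl F) (s : E ⥤ Fin 2)
    (hs : ∀ e, s.obj e = 1) : c.prod' s ⋙ R.mix = c := by
  have key : ∀ x t, t = 1 → x = R.obj x t ∧ HEq (𝟙 x.pt) (R.counit x t) := fun x t ht => by
    subst ht
    exact ⟨rfl, HEq.rfl⟩
  refine CategoryTheory.Functor.hext (fun x => (key _ _ (hs x)).1.symm) fun x y f =>
    (R.heq_mix_map ((c.prod' s).map f) (key _ _ (hs x)).1 (key _ _ (hs y)).1 (key _ _ (hs x)).2
      (key _ _ (hs y)).2 (c.map f) ?_).symm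
  exact (Category.comp_id (obj := ℬ) _).trans (Category.id_comp (obj := ℬ) _).symm

theorem mix_comm {R : Coref F} {R' : Coref F'} {p : 𝒜 ⥤ 𝒜'} {q : ℬ ⥤ ℬ'} (h : F ⋙ q = p ⋙ F')
    (hr : ∀ b, R'.r (q.obj b) = p.obj (R.r b))
    (hε : ∀ b, HEq (R'.ε (q.obj b)) (q.map (R.ε b))) :
    (Cyl.map p q h).prod (𝟭 _) ⋙ R'.mix = R.mix ⋙ Cyl.map p q h := by
  have hF : ∀ a, F'.obj (p.obj a) = q.obj (F.obj a) := fun a => (Functor.congr_obj h a).symm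
  have ho : ∀ x t, (Cyl.map p q h).obj (R.obj x t) = R'.obj ((Cyl.map p q h).obj x) t := by
    intro x t
    fin_cases t
    · refine Cyl.ext ?_ (congrArg some (hr x.pt)).symm
      exact (hF _).symm.trans (congrArg F'.obj (hr x.pt)).symm
    · rfl
  have hc : ∀ x t, HEq (q.map (R.counit x t)) (R'.counit ((Cyl.map p q h).obj x) t) := by
    intro x t
    fin_cases t
    · exact (hε _).symm
    · exact heq_of_eq (q.map_id _)
  refine CategoryTheory.Functor.hext (fun x => (ho x.1 x.2).symm) fun x y f =>
    (R'.heq_mix_map (((Cyl.map p q h).prod (𝟭 _)).map f) (ho _ _) (ho _ _) (hc _ _) (hc _ _)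
      ((Cyl.map p q h).map (R.mix.map f)) ?_).symm
  exact (q.map_comp _ _).symm.trans ((congrArg q.map
    (R.exists_map f.1 (leOfHom f.2)).choose_spec.1).trans (q.map_comp _ _))

end Coref

end Cyl

section Deformation

open SSet Simplicial Limits

theorem stdSimplex_one_ext {d : SimplexCategoryᵒᵖ} {s t : (Δ[1] : SSet.{u}).obj d}
    (h : ∀ i, stdSimplex.asOrderHom s i = stdSimplex.asOrderHom t i) : s = t :=
  stdSimplex.objEquiv.injective (SimplexCategory.Hom.ext _ _ (OrderHom.ext _ _ (funext h)))

theorem anodyne_of_deformation {X : SSet.{u}} (K : X.Subcomplex) (H : X ⊗ (Δ[1] : SSet.{u}) ⟶ X)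
    (h₁ : SSet.ι₁ ≫ H = 𝟙 X) (h₀ : ∀ d x, H.app d (SSet.ι₀.app d x) ∈ K.obj d)
    (hK : ∀ d x s, x ∈ K.obj d → H.app d (x, s) ∈ K.obj d) : anodyneExtensions K.ι := by
  let T := K.unionProd Λ[1, 0]
  have hr : Subcomplex.range (T.ι ≫ H) ≤ K := by
    rintro d _ ⟨⟨⟨x, s⟩, hx⟩, rfl⟩
    rcases (Subcomplex.mem_unionProd_iff _ _ _).1 hx with hs | hx'
    · have : s = (SSet.ι₀.app d x).2 := stdSimplex_one_ext fun i => by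
        by_contra hi
        refine hs (Set.eq_univ_of_forall fun j => ?_)
        refine Fin.cases (Or.inr rfl) (fun j => ?_) j
        refine Or.inl ⟨i, ?_⟩
        have : ∀ k : Fin 2, k ≠ 0 → k = 1 := by decide
        exact (this _ hi).trans (this _ (Fin.succ_ne_zero j)).symm
      subst this
      exact h₀ d x
    · exact hK d x s hx'
  have hi : Subcomplex.range (K.ι ≫ SSet.ι₁) ≤ T := by
    rintro d _ ⟨x, rfl⟩
    exact Or.inr ⟨x.2, trivial⟩
  refine anodyneExtensions.of_retract (g := T.ι)
    { i := Arrow.homMk (Subcomplex.lift (K.ι ≫ SSet.ι₁) hi) SSet.ι₁ rfl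
      r := Arrow.homMk (Subcomplex.lift (T.ι ≫ H) hr) H rfl
      retract := ?_ } (anodyneExtensions_unionProd_ι _ _ (anodyneExtensions.horn_ι 0))
  refine Arrow.hom_ext _ _ ?_ h₁
  rw [← cancel_mono K.ι]
  exact congrArg (K.ι ≫ ·) h₁

/-- The homotopy between maps of nerves given by a functor. -/
def nerveMix {C : Cat.{u, u}} (K : C × Fin 2 ⥤ C) : nerve C ⊗ (Δ[1] : SSet.{u}) ⟶ nerve C where
  app _ := ↾fun x => Functor.prod' (C := Fin 2) x.1 (stdSimplex.asOrderHom x.2).monotone.functor ⋙ K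
  naturality _ _ _ := rfl

/-- The homotopy between maps of nerves of simplicial categories given by functors. -/
def diagMix {C D : SimplexCategoryᵒᵖ ⥤ Cat.{u, u}} (K : ∀ d, C.obj d × Fin 2 ⥤ D.obj d)
    (hK : ∀ {d d'} (θ : d ⟶ d'), (C.map θ).toFunctor.prod (𝟭 (Fin 2)) ⋙ K d' =
      K d ⋙ (D.map θ).toFunctor) : diagNerve C ⊗ (Δ[1] : SSet.{u}) ⟶ diagNerve D where
  app d := ↾fun x => ofArrows
    (Functor.prod' (C := Fin 2) (toArrows x.1) (stdSimplex.asOrderHom x.2).monotone.functor ⋙ K d)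
  naturality d d' θ := by
    ext x
    exact congrArg (fun P => Functor.prod' (C := Fin 2) (vertexFun θ.unop ⋙ toArrows x.1)
      (vertexFun θ.unop ⋙ (stdSimplex.asOrderHom x.2).monotone.functor) ⋙ P) (hK θ)

variable {A B : SimplexCategoryᵒᵖ ⥤ Cat.{u, u}} (F : A ⟶ B)

theorem levelwise_comm {m m' : SimplexCategoryᵒᵖ} (θ : m ⟶ m') :
    (F.app m).toFunctor ⋙ (B.map θ).toFunctor = (A.map θ).toFunctor ⋙ (F.app m').toFunctor :=
  congrArg Cat.Hom.toFunctor (F.naturality θ).symm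

/-- The levelwise cylinder of a map of simplicial categories. -/
def cylX : SimplexCategoryᵒᵖ ⥤ Cat.{u, u} where
  obj m := Cat.of (Cyl (F.app m).toFunctor)
  map θ := (Cyl.map (A.map θ).toFunctor (B.map θ).toFunctor (levelwise_comm F θ)).toCatHom
  map_id m := Cat.ext ((Cyl.map_congr (F := (F.app m).toFunctor)
    (F' := (F.app m).toFunctor) (p := 𝟭 _) (q := 𝟭 _) (h := rfl) (congrArg Cat.Hom.toFunctor (A.map_id m))
    (congrArg Cat.Hom.toFunctor (B.map_id m))).trans Cyl.map_id)
  map_comp θ θ' := Cat.ext ((Cyl.map_congr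
    (congrArg Cat.Hom.toFunctor (A.map_comp θ θ'))
    (congrArg Cat.Hom.toFunctor (B.map_comp θ θ'))).trans
      (Cyl.map_comp (levelwise_comm F θ) (levelwise_comm F θ')))

/-- The inclusion of the source. -/
def cylInc : A ⟶ cylX F where
  app m := (Cyl.inc (F.app m).toFunctor).toCatHom
  naturality _ _ θ := Cat.ext (CategoryTheory.Functor.hext
    (fun a => Cyl.ext (Functor.congr_obj (levelwise_comm F θ) a).symm rfl)
    fun _ _ f => (functor_hext_iff (levelwise_comm F θ) f).symm)

/-- The projection to the target. -/
def cylProj : cylX F ⟶ B where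
  app m := (Cyl.proj (F.app m).toFunctor).toCatHom

/-- The section of the projection. -/
def cylSec : B ⟶ cylX F where
  app m := (Cyl.sec (F.app m).toFunctor).toCatHom

/-- The simplices of the cylinder all of whose vertices lie in the source. -/
def cylSub : BiSub (cylX F ⋙ nerveFunctor) where
  A m :=
    { obj := fun d =>
        {c | ∀ i, ((c : Fin (d.unop.len + 1) ⥤ Cyl (F.app m).toFunctor).obj i).lab.isSome}
      map := fun θ c hc i => hc (θ.unop.toOrderHom i) }
  map f d c hc i := by
    change (Option.map _ _).isSome = true
    rw [Option.isSome_map]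
    exact hc i

variable (R : ∀ m, Coref (F.app m).toFunctor)

theorem cylSub_anodyne
    (hR : ∀ {m k : ℕ} (f : ⦋m⦌ ⟶ ⦋k⦌) [Epi f] (b : B.obj (op ⦋k⦌)),
      (R (op ⦋m⦌)).r ((B.map f.op).toFunctor.obj b) =
        (A.map f.op).toFunctor.obj ((R (op ⦋k⦌)).r b) ∧
      HEq ((R (op ⦋m⦌)).ε ((B.map f.op).toFunctor.obj b))
        ((B.map f.op).toFunctor.map ((R (op ⦋k⦌)).ε b))) :
    anodyneExtensions ((cylSub F).filt 0).ι := by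
  refine (cylSub F).anodyne fun m => ?_
  refine anodyne_of_deformation _ (nerveMix (C := (cylX F).obj (op ⦋m⦌)) (R _).mix) ?_ ?_ ?_
  · ext d c
    exact (R (op ⦋m⦌)).mix_one _ _ fun _ => rfl
  · intro d c
    exact Or.inl fun i => rfl
  · rintro d c s (hc | hc)
    · refine Or.inl fun i => ?_
      change ((R _).obj _ (stdSimplex.asOrderHom s i)).lab.isSome
      generalize stdSimplex.asOrderHom s i = t
      fin_cases t
      · rfl
      · exact hc i
    · obtain ⟨k, hk, f, hf, y, rfl⟩ := ((rowSet (cylX F ⋙ nerveFunctor) d).mem_degenerate_iff _).1 hc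
      refine Or.inr ⟨k, hk, f, (nerveMix (C := (cylX F).obj (op ⦋k⦌)) (R _).mix).app d (y, s), ?_⟩
      exact congrArg (fun P => Functor.prod' (C := Fin 2) (A := Fin (d.unop.len + 1)) y
        (stdSimplex.asOrderHom s).monotone.functor ⋙ P) (Coref.mix_comm (R := R (op ⦋k⦌))
          (R' := R (op ⦋m⦌)) (levelwise_comm F f.op) (fun b => (hR f b).1) fun b => (hR f b).2).symm

end Deformation

/-! ### Weak equivalences from levelwise coreflections -/

section WeakEq

open SSet Simplicial Limits HomotopicalAlgebra modelCategoryQuillen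

theorem exists_extension {X Y Z : SSet.{u}} [KanComplex Z] {j : X ⟶ Y} (hj : anodyneExtensions j)
    (g : X ⟶ Z) : ∃ h : Y ⟶ Z, j ≫ h = g := by
  have := hj (terminal.from Z) ((fibration_iff _).1 inferInstance)
  have sq : CommSq g j (terminal.from Z) (terminal.from Y) := ⟨by simp⟩
  exact ⟨sq.lift, sq.fac_left⟩

theorem homotopy_of {X Y : SSet.{u}} {f g : X ⟶ Y} (h : X ⊗ (Δ[1] : SSet.{u}) ⟶ Y)
    (h₀ : SSet.ι₀ ≫ h = f) (h₁ : SSet.ι₁ ≫ h = g) : Nonempty (Homotopy f g) :=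
  ⟨{ h := h
     h₀ := h₀
     h₁ := h₁
     rel := by
      ext d x
      exact x.1.2.elim }⟩

theorem anodyne_of_range {X Y : SSet.{u}} (j : X ⟶ Y) (hj : ∀ d, Function.Injective (j.app d))
    (T : Y.Subcomplex) (hT : anodyneExtensions T.ι) (h : Subcomplex.range j = T) :
    Mono j ∧ anodyneExtensions j := by
  have : Mono j := by
    have := fun d => (mono_iff_injective (j.app d)).2 (hj d)
    exact NatTrans.mono_of_mono_app j
  subst h
  exact ⟨this, (anodyneExtensions.comp_mem _ _ (.of_isIso (Subcomplex.toRange j)) hT :)⟩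

theorem exists_homotopy {X Y Z : SSet.{u}} [KanComplex Z] {j : X ⟶ Y} [Mono j]
    (hj : anodyneExtensions j) {g g' : Y ⟶ Z} (K : Homotopy (j ≫ g) (j ≫ g')) :
    Nonempty (Homotopy g g') := by
  let T := Subcomplex.range j
  have hT : anodyneExtensions T.ι := by
    have : T.ι = inv (Subcomplex.toRange j) ≫ j := by
      rw [IsIso.eq_inv_comp]
      rfl
    rw [this]
    exact anodyneExtensions.comp_mem _ _ (.of_isIso _) hj
  have hb : ∀ {d} (s : (∂Δ[1] : SSet.{u}).obj d) i k,
      stdSimplex.asOrderHom s.1 i = stdSimplex.asOrderHom s.1 k := by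
    intro d s i k
    by_contra hik
    refine s.2 fun t => ?_
    have : ∀ a b c : Fin 2, a ≠ b → a = c ∨ b = c := by decide
    exact (this _ _ t hik).elim (fun h => ⟨i, h⟩) fun h => ⟨k, h⟩
  let b : Y ⊗ (∂Δ[1] : SSet.{u}) ⟶ Z :=
    { app := fun d => ↾fun x =>
        if stdSimplex.asOrderHom x.2.1 0 = 0 then g.app d x.1 else g'.app d x.1
      naturality := fun d d' θ => by
        ext ⟨x, s⟩
        change (if stdSimplex.asOrderHom s.1 (θ.unop.toOrderHom 0) = 0 then g.app d' (Y.map θ x)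
          else g'.app d' (Y.map θ x)) = Z.map θ (if _ then _ else _)
        rw [hb s _ 0]
        split_ifs
        · exact NatTrans.naturality_apply g θ x
        · exact NatTrans.naturality_apply g' θ x }
  let K' : (T : SSet.{u}) ⊗ (Δ[1] : SSet.{u}) ⟶ Z := inv (Subcomplex.toRange j) ▷ _ ≫ K.h
  have hK₀ : SSet.ι₀ ≫ K' = T.ι ≫ g := by
    rw [SSet.ι₀_comp_assoc, K.h₀, IsIso.inv_comp_eq]
    rfl
  have hK₁ : SSet.ι₁ ≫ K' = T.ι ≫ g' := by
    rw [SSet.ι₁_comp_assoc, K.h₁, IsIso.inv_comp_eq]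
    rfl
  have hc₀ : ∀ {X : SSet.{u}} {d} (x : X.obj d) (s : (Δ[1] : SSet.{u}).obj d),
      (∀ i, stdSimplex.asOrderHom s i = 0) → (x, s) = SSet.ι₀.app d x := fun x s h =>
    Prod.ext rfl (stdSimplex_one_ext fun i => (h i).trans rfl)
  have hc₁ : ∀ {X : SSet.{u}} {d} (x : X.obj d) (s : (Δ[1] : SSet.{u}).obj d),
      (∀ i, stdSimplex.asOrderHom s i = 1) → (x, s) = SSet.ι₁.app d x := fun x s h =>
    Prod.ext rfl (stdSimplex_one_ext fun i => (h i).trans rfl)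
  obtain ⟨L, hL⟩ := exists_extension (anodyneExtensions_unionProd_ι' T ∂Δ[1] hT)
    ((Subcomplex.unionProd.isPushout T ∂Δ[1]).desc b K' (by
      ext d ⟨x, s⟩
      change (if _ then _ else _) = K'.app d (x, s.1)
      split_ifs with h
      · rw [hc₀ x s.1 fun i => (hb s i 0).trans h]
        exact (congrArg (fun P => P.app d x) hK₀).symm
      · have : ∀ a : Fin 2, a ≠ 0 → a = 1 := by decide
        rw [hc₁ x s.1 fun i => (hb s i 0).trans (this _ h)]
        exact (congrArg (fun P => P.app d x) hK₁).symm))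
  have hL' : ∀ d (y : Y.obj d) (s : (∂Δ[1] : SSet.{u}).obj d), L.app d (y, s.1) = b.app d (y, s) := by
    intro d y s
    have := congrArg (fun P => Subcomplex.unionProd.ι₁ T ∂Δ[1] ≫ P) hL
    simp only [IsPushout.inl_desc] at this
    exact congrArg (fun P => P.app d (y, s)) this
  refine homotopy_of L ?_ ?_
  · ext d y
    refine (hL' d y ⟨(SSet.ι₀.app d y).2, fun h => ?_⟩).trans (if_pos (c := (0 : Fin 2) = 0) (e := g'.app d y) rfl)
    obtain ⟨i, hi⟩ := h 1
    exact absurd hi (by simp : (0 : Fin 2) ≠ 1)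
  · ext d y
    refine (hL' d y ⟨(SSet.ι₁.app d y).2, fun h => ?_⟩).trans (if_neg (c := (1 : Fin 2) = 0) (t := g.app d y) (by simp))
    obtain ⟨i, hi⟩ := h 0
    exact absurd hi (by simp : (1 : Fin 2) ≠ 0)

theorem isWeakEq_of_cylinder {X Y C : SSet.{u}} (j : X ⟶ C) [Mono j] (hj : anodyneExtensions j)
    (p : C ⟶ Y) (s : Y ⟶ C) (hs : s ≫ p = 𝟙 Y) (H : C ⊗ (Δ[1] : SSet.{u}) ⟶ C)
    (h₀ : SSet.ι₀ ≫ H = p ≫ s) (h₁ : SSet.ι₁ ≫ H = 𝟙 C) : IsWeakEq (j ≫ p) := by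
  refine fun Z _ => ⟨fun g => ?_, fun h h' ⟨K⟩ => ?_⟩
  · obtain ⟨G, rfl⟩ := exists_extension hj g
    refine ⟨s ≫ G, homotopy_of (j ▷ _ ≫ H ≫ G) ?_ ?_⟩
    · rw [SSet.ι₀_comp_assoc, ← Category.assoc SSet.ι₀, h₀]
      simp
    · rw [SSet.ι₁_comp_assoc, ← Category.assoc SSet.ι₁, h₁, Category.id_comp]
  · rw [Category.assoc, Category.assoc] at K
    obtain ⟨L⟩ := exists_homotopy hj K
    refine homotopy_of (s ▷ _ ≫ L.h) ?_ ?_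
    · rw [SSet.ι₀_comp_assoc, L.h₀, ← Category.assoc, hs, Category.id_comp]
    · rw [SSet.ι₁_comp_assoc, L.h₁, ← Category.assoc, hs, Category.id_comp]

theorem functor_comp_inj {E 𝒜 ℬ : Type*} [Category* E] [Category* 𝒜] [Category* ℬ] (F : 𝒜 ⥤ ℬ)
    [F.Faithful] {c c' : E ⥤ 𝒜} (ho : ∀ e, c.obj e = c'.obj e) (h : c ⋙ F = c' ⋙ F) : c = c' := by
  refine CategoryTheory.Functor.hext ho fun x y f => ?_
  have := functor_hext_iff h f
  change HEq (F.map (c.map f)) (F.map (c'.map f)) at this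
  revert this
  generalize c.map f = p
  generalize c'.map f = q
  revert p q
  rw [ho x, ho y]
  intro p q h
  exact heq_of_eq (F.map_injective (eq_of_heq h))

theorem functor_comp_surj {E 𝒜 ℬ : Type*} [Category* E] [Category* 𝒜] [Category* ℬ] {F : 𝒜 ⥤ ℬ}
    (hF : F.FullyFaithful) (c : E ⥤ ℬ) (a : E → 𝒜) (ha : ∀ e, F.obj (a e) = c.obj e) :
    ∃ c' : E ⥤ 𝒜, c' ⋙ F = c :=
  ⟨{ obj := a
     map := fun {x y} f => hF.preimage (eqToHom (ha x) ≫ c.map f ≫ eqToHom (ha y).symm)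
     map_id := fun x => hF.map_injective (by simp)
     map_comp := fun f g => hF.map_injective (by simp) },
   CategoryTheory.Functor.hext ha fun x y f => by
    change HEq (F.map (hF.preimage _)) _
    rw [hF.map_preimage]
    exact (conj_eqToHom_iff_heq' _ _ _ _).1 rfl⟩

theorem Cyl.erase_pt {𝒜 ℬ : Type u} [Category.{u} 𝒜] [Category.{u} ℬ] {F : 𝒜 ⥤ ℬ}
    (x : Cyl F × Fin 2) : ((Cyl.erase F).obj x).pt = x.1.pt := by
  change (if x.2 = 0 then (⟨x.1.pt, none, nofun⟩ : Cyl F) else x.1).pt = x.1.pt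
  split_ifs <;> rfl

theorem Cyl.heq_erase_map {𝒜 ℬ : Type u} [Category.{u} 𝒜] [Category.{u} ℬ] {F : 𝒜 ⥤ ℬ}
    {x y : Cyl F × Fin 2} (f : x ⟶ y) {X Y : Cyl F} (hX : X = (Cyl.erase F).obj x)
    (hY : Y = (Cyl.erase F).obj y) (g : X ⟶ Y)
    (hg : HEq (α := X.pt ⟶ Y.pt) g (β := x.1.pt ⟶ y.1.pt) f.1) : HEq g ((Cyl.erase F).map f) := by
  subst hX hY
  exact heq_of_eq ((conj_eqToHom_iff_heq' (C := ℬ) _ _ (Cyl.erase_pt x) (Cyl.erase_pt y).symm).2 hg)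

theorem Cyl.erase_comm {𝒜 ℬ 𝒜' ℬ' : Type u} [Category.{u} 𝒜] [Category.{u} ℬ] [Category.{u} 𝒜']
    [Category.{u} ℬ'] {F : 𝒜 ⥤ ℬ} {F' : 𝒜' ⥤ ℬ'} {p : 𝒜 ⥤ 𝒜'} {q : ℬ ⥤ ℬ'}
    (h : F ⋙ q = p ⋙ F') : (Cyl.map p q h).prod (𝟭 (Fin 2)) ⋙ Cyl.erase F' =
      Cyl.erase F ⋙ Cyl.map p q h := by
  have ho : ∀ x, ((Cyl.map p q h).prod (𝟭 (Fin 2)) ⋙ Cyl.erase F').obj x =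
      (Cyl.erase F ⋙ Cyl.map p q h).obj x := by
    rintro ⟨x, t⟩
    fin_cases t <;> rfl
  refine CategoryTheory.Functor.hext ho fun x y f =>
    (Cyl.heq_erase_map (((Cyl.map p q h).prod (𝟭 (Fin 2))).map f) (ho x).symm (ho y).symm _ ?_).symm
  exact functor_map_heq q (Cyl.erase_pt x) (Cyl.erase_pt y)
    ((conj_eqToHom_iff_heq' (C := ℬ) _ _ _ (Cyl.erase_pt y).symm).1 rfl)

variable {A B : SimplexCategoryᵒᵖ ⥤ Cat.{u, u}} (F : A ⟶ B)

theorem diagNerveMap_isWeakEq (hF : ∀ m, (F.app m).toFunctor.FullyFaithful)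
    (R : ∀ m, Coref (F.app m).toFunctor)
    (hR : ∀ {m k : ℕ} (f : ⦋m⦌ ⟶ ⦋k⦌) [Epi f] (b : B.obj (op ⦋k⦌)),
      (R (op ⦋m⦌)).r ((B.map f.op).toFunctor.obj b) =
        (A.map f.op).toFunctor.obj ((R (op ⦋k⦌)).r b) ∧
      HEq ((R (op ⦋m⦌)).ε ((B.map f.op).toFunctor.obj b))
        ((B.map f.op).toFunctor.map ((R (op ⦋k⦌)).ε b))) :
    IsWeakEq (diagNerveMap F) := by
  obtain ⟨h₁, h₂⟩ := anodyne_of_range (diagNerveMap (cylInc F)) (fun d x y hxy => by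
    have : (F.app d).toFunctor.Faithful := (hF d).faithful
    have hxy : toArrows x ⋙ Cyl.inc (F.app d).toFunctor = toArrows y ⋙ Cyl.inc (F.app d).toFunctor :=
      hxy
    have : (Cyl.inc (F.app d).toFunctor).Faithful := ⟨fun h => (F.app d).toFunctor.map_injective h⟩
    refine functor_comp_inj (Cyl.inc (F.app d).toFunctor) (fun e => ?_) hxy
    exact Option.some_injective _ (congrArg Cyl.lab (Functor.congr_obj hxy e)))
    _ (cylSub_anodyne F R @hR) (by
      ext d y
      constructor
      · rintro ⟨x, rfl⟩
        exact Or.inl fun i => rfl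
      · rintro (hy | ⟨k, hk, _⟩)
        · let c : Fin (d.unop.len + 1) ⥤ Cyl (F.app d).toFunctor := y
          have hy : ∀ i, (c.obj i).lab.isSome := hy
          exact functor_comp_surj (F := Cyl.inc (F.app d).toFunctor)
            ⟨fun f => (hF d).preimage f, fun f => (hF d).map_preimage f,
              fun f => (hF d).preimage_map f⟩ c (fun i => (c.obj i).lab.get (hy i)) fun i =>
                Cyl.ext ((c.obj i).h _ (Option.some_get _).symm) (Option.some_get _)
        · omega)
  refine isWeakEq_of_cylinder (diagNerveMap (cylInc F)) h₂ (diagNerveMap (cylProj F))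
    (diagNerveMap (cylSec F)) rfl (diagMix (fun d => Cyl.erase (F.app d).toFunctor) fun θ => ?_) ?_ ?_
  · exact Cyl.erase_comm (levelwise_comm F θ)
  · ext d c
    refine CategoryTheory.Functor.hext (fun x => rfl) fun x y f => ?_
    exact (Cyl.heq_erase_map _ rfl rfl _ HEq.rfl).symm
  · ext d c
    refine CategoryTheory.Functor.hext (fun x => rfl) fun x y f => ?_
    exact (Cyl.heq_erase_map _ rfl rfl _ HEq.rfl).symm

/-- Coreflections can be chosen compatibly with degeneracies. -/
theorem exists_coref (Cor : ∀ m (a : A.obj m) (b : B.obj m), ((F.app m).toFunctor.obj a ⟶ b) → Prop)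
    (ex : ∀ (m : ℕ) (b : B.obj (op ⦋m⦌)), ∃ a ε, Cor _ a b ε)
    (univ : ∀ m a b ε, Cor m a b ε → ∀ a' (g : (F.app m).toFunctor.obj a' ⟶ b),
      ∃! g' : (F.app m).toFunctor.obj a' ⟶ (F.app m).toFunctor.obj a, g' ≫ ε = g)
    (stab : ∀ {m k : ℕ} (f : ⦋m⦌ ⟶ ⦋k⦌) [Epi f] a b ε, Cor _ a b ε →
      ∀ ε' : (F.app (op ⦋m⦌)).toFunctor.obj ((A.map f.op).toFunctor.obj a) ⟶
        (B.map f.op).toFunctor.obj b, HEq ε' ((B.map f.op).toFunctor.map ε) → Cor _ _ _ ε') :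
    ∃ R : ∀ m, Coref (F.app m).toFunctor, ∀ {m k : ℕ} (f : ⦋m⦌ ⟶ ⦋k⦌) [Epi f] (b : B.obj (op ⦋k⦌)),
      (R (op ⦋m⦌)).r ((B.map f.op).toFunctor.obj b) =
        (A.map f.op).toFunctor.obj ((R (op ⦋k⦌)).r b) ∧
      HEq ((R (op ⦋m⦌)).ε ((B.map f.op).toFunctor.obj b))
        ((B.map f.op).toFunctor.map ((R (op ⦋k⦌)).ε b)) := by
  choose a₀ ε₀ h₀ using ex
  let X : SSet.{u} := B ⋙ Cat.objects
  have key : ∀ (m : ℕ) (b : B.obj (op ⦋m⦌)), ∃ a ε, Cor _ a b ε ∧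
      ∀ (k : ℕ) (f : ⦋m⦌ ⟶ ⦋k⦌) (_ : Epi f) (y : X.nonDegenerate k),
        b = (B.map f.op).toFunctor.obj y.1 → a = (A.map f.op).toFunctor.obj (a₀ k y.1) ∧
          HEq ε ((B.map f.op).toFunctor.map (ε₀ k y.1)) := by
    intro m b
    obtain ⟨k, f, hf, y, hy⟩ := X.exists_nonDegenerate b
    have hy : b = (B.map f.op).toFunctor.obj y.1 := hy
    subst hy
    have e := Functor.congr_obj (levelwise_comm F f.op) (a₀ k y.1)
    have hε : HEq (eqToHom e.symm ≫ (B.map f.op).toFunctor.map (ε₀ k y.1))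
        ((B.map f.op).toFunctor.map (ε₀ k y.1)) := eqToHom_comp_heq _ _
    refine ⟨(A.map f.op).toFunctor.obj (a₀ k y.1), _, stab f _ _ _ (h₀ k y.1) _ hε,
      fun k' f' hf' y' hy' => ?_⟩
    obtain rfl := X.unique_nonDegenerate_dim _ f y rfl f' y' hy'
    obtain rfl := X.unique_nonDegenerate_simplex _ f y rfl f' y' hy'
    obtain rfl := X.unique_nonDegenerate_map _ f y rfl f' y hy'
    exact ⟨rfl, hε⟩
  choose r ε hc hu using key
  refine ⟨fun m => ⟨r m.unop.len, ε m.unop.len, fun b => univ m _ b _ (hc m.unop.len b)⟩,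
    fun {m k} g _ b => ?_⟩
  obtain ⟨l, f, hf, y, hy⟩ := X.exists_nonDegenerate b
  have hy : b = (B.map f.op).toFunctor.obj y.1 := hy
  obtain ⟨h₁, h₂⟩ := hu k b l f hf y hy
  have hA := congrArg Cat.Hom.toFunctor (A.map_comp f.op g.op)
  have hB := congrArg Cat.Hom.toFunctor (B.map_comp f.op g.op)
  obtain ⟨h₃, h₄⟩ := hu m ((B.map g.op).toFunctor.obj b) l (g ≫ f) inferInstance y (by
    rw [hy]
    exact (Functor.congr_obj hB y.1).symm)
  refine ⟨h₃.trans ((Functor.congr_obj hA _).trans (congrArg _ h₁.symm)), h₄.trans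
    ((functor_hext_iff hB _).trans (functor_map_heq _ ?_ hy.symm h₂.symm))⟩
  exact (Functor.congr_obj (levelwise_comm F f.op) _).trans
    (congrArg (F.app (op ⦋k⦌)).toFunctor.obj h₁.symm)

end WeakEq

/-! ### Systems with given values on singletons -/

section Existence

theorem tensorμ_symm {D : Type u} [Category.{v} D] [MonoidalCategory D] [SymmetricCategory D]
    {a b c d x y : D} {f : a ⊗ c ⟶ x} {f' : c ⊗ a ⟶ x} {g : b ⊗ d ⟶ y} {g' : d ⊗ b ⟶ y}
    (hf : f = (β_ a c).hom ≫ f') (hg : g = (β_ b d).hom ≫ g') :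
    tensorμ a b c d ≫ (f ⊗ₘ g) = (β_ (a ⊗ b) (c ⊗ d)).hom ≫ tensorμ c d a b ≫ (f' ⊗ₘ g') := by
  rw [hf, hg, ← tensorHom_comp_tensorHom, ← Category.assoc, ← Category.assoc]
  congr 1
  simp [tensorμ, SymmetricCategory.braiding_swap_eq_inv_braiding d a,
    MonoidalCategory.tensorHom_def]

theorem tensorμ_assoc {D : Type u} [Category.{v} D] [MonoidalCategory D] [SymmetricCategory D]
    {a b c a' b' c' p q r p' q' r' : D} {f : a ⊗ b ⟶ p} {g : p ⊗ c ⟶ r} {h : b ⊗ c ⟶ q}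
    {k : a ⊗ q ⟶ r} {f' : a' ⊗ b' ⟶ p'} {g' : p' ⊗ c' ⟶ r'} {h' : b' ⊗ c' ⟶ q'}
    {k' : a' ⊗ q' ⟶ r'} (e : (f ▷ c) ≫ g = (α_ a b c).hom ≫ (a ◁ h) ≫ k)
    (e' : (f' ▷ c') ≫ g' = (α_ a' b' c').hom ≫ (a' ◁ h') ≫ k') :
    ((tensorμ a a' b b' ≫ (f ⊗ₘ f')) ▷ (c ⊗ c')) ≫ tensorμ p p' c c' ≫ (g ⊗ₘ g') =
      (α_ (a ⊗ a') (b ⊗ b') (c ⊗ c')).hom ≫ ((a ⊗ a') ◁ (tensorμ b b' c c' ≫ (h ⊗ₘ h'))) ≫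
        tensorμ a a' q q' ≫ (k ⊗ₘ k') := by
  rw [comp_whiskerRight, Category.assoc, tensorμ_natural_left_assoc, tensorHom_comp_tensorHom, e,
    e', ← tensorHom_comp_tensorHom, ← tensorHom_comp_tensorHom]
  have := tensor_associativity a a' b b' c c'
  rw [← Category.assoc (tensorμ (a ⊗ b) _ _ _), ← Category.assoc (_ ▷ _), this,
    MonoidalCategory.whiskerLeft_comp]
  simp only [Category.assoc]
  rw [tensorμ_natural_right_assoc]

variable {X : Type} {A : Set X} {D : PermCat.{u}}

/-- The sum of two systems. -/
def SegBar.add (a b : SegBar D A) : SegBar D A :=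
  ⟨{ C := fun S => a.1.C S ⊗ b.1.C S
     ρ := fun i T U S h => tensorμ (a.1.C T) (b.1.C T) (a.1.C U) (b.1.C U) ≫
       (a.1.ρ i T U S h ⊗ₘ b.1.ρ i T U S h)
     C_empty := fun k S h => by rw [a.1.C_empty k S h, b.1.C_empty k S h, Permutative.unit_left]
     ρ_id := fun i T U S h h' => by
       have hT : T.1 i = ∅ ∨ U.1 i = ∅ := by
         rcases h' with h' | h' | ⟨_, h'⟩
         · exact Or.inl h'
         · exact Or.inr h'
         · exact Or.inl (Set.subset_eq_empty (h.subset i) h')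
       have key : ∀ c : SegBar D A, c.1.C T ⊗ c.1.C U = c.1.C S := fun c => by
         rcases hT with hT | hT
         · rw [c.1.C_empty i T hT, Permutative.unit_left, h.eq_right hT]
         · rw [c.1.C_empty i U hT, Permutative.unit_right, h.eq_left hT]
       have hμ : (a.1.C T ⊗ b.1.C T) ⊗ (a.1.C U ⊗ b.1.C U) =
           (a.1.C T ⊗ a.1.C U) ⊗ (b.1.C T ⊗ b.1.C U) := by
         rw [key a, key b]
         rcases hT with hT | hT
         · rw [a.1.C_empty i T hT, b.1.C_empty i T hT, Permutative.unit_left,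
             Permutative.unit_left, h.eq_right hT]
         · rw [a.1.C_empty i U hT, b.1.C_empty i U hT, Permutative.unit_left,
             Permutative.unit_right, h.eq_left hT]
       exact (heq_id_comp (tensorμ_heq_id (hT.imp (b.1.C_empty i T) (a.1.C_empty i U))) rfl
         hμ.symm).trans (tensor_heq_id (key a) (key b) (a.1.ρ_id i T U S h h')
           (b.1.ρ_id i T U S h h'))
     ρ_symm := fun i T U S h h' => tensorμ_symm (a.1.ρ_symm i T U S h h') (b.1.ρ_symm i T U S h h')
     ρ_assoc := fun i T U V TU UV S h₁ h₂ h₃ h₄ => tensorμ_assoc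
       (a.1.ρ_assoc i T U V TU UV S h₁ h₂ h₃ h₄) (b.1.ρ_assoc i T U V TU UV S h₁ h₂ h₃ h₄)
     ρ_exch := fun i j h => absurd rfl h },
   fun i T U S h => by
     have := a.2 i T U S h
     have := b.2 i T U S h
     have : IsIso (tensorμ (a.1.C T) (b.1.C T) (a.1.C U) (b.1.C U)) :=
       ⟨tensorδ _ _ _ _, tensorμ_tensorδ _ _ _ _, tensorδ_tensorμ _ _ _ _⟩
     change IsIso (tensorμ _ _ _ _ ≫ _)
     infer_instance⟩

open Classical in
/-- The system concentrated in one element. -/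
def SegBar.conc (A : Set X) (x : X) (c : D) : SegBar D A :=
  have key : ∀ {i : Unit} {T U S : Tup fun _ : Unit => A}, IsSplit i T U S →
      (if x ∈ T.1 () then c else 𝟙_ D) ⊗ (if x ∈ U.1 () then c else 𝟙_ D) =
        if x ∈ S.1 () then c else 𝟙_ D := fun {i T U S} h => by
    have hS : x ∈ S.1 () ↔ x ∈ T.1 () ∨ x ∈ U.1 () := by rw [← h.1]; rfl
    have hd : x ∈ T.1 () → x ∉ U.1 () := fun h₁ h₂ => Set.disjoint_left.1 h.2.1 h₁ h₂
    by_cases hT : x ∈ T.1 ()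
    · rw [if_pos hT, if_neg (hd hT), if_pos (hS.2 (Or.inl hT)), Permutative.unit_right]
    · rw [if_neg hT, Permutative.unit_left]
      exact if_congr (by rw [hS]; simp [hT]) rfl rfl
  ⟨{ C := fun S => if x ∈ S.1 () then c else 𝟙_ D
     ρ := fun i T U S h => eqToHom (key h)
     C_empty := fun k S h => if_neg (by
       change S.1 () = ∅ at h
       simp [h])
     ρ_id := fun i T U S h _ => eqToHom_heq_id_cod _ _ _
     ρ_symm := fun i T U S h h' => by
       have hd : x ∈ T.1 () → x ∉ U.1 () := fun h₁ h₂ => Set.disjoint_left.1 h.2.1 h₁ h₂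
       have hb : (if x ∈ T.1 () then c else 𝟙_ D) = 𝟙_ D ∨
           (if x ∈ U.1 () then c else 𝟙_ D) = 𝟙_ D := by
         by_cases hT : x ∈ T.1 ()
         · exact Or.inr (if_neg (hd hT))
         · exact Or.inl (if_neg hT)
       rw [eq_eqToHom_of_heq (braiding_heq_id hb) rfl ((key h').trans (key h).symm),
         eqToHom_trans]
     ρ_assoc := fun i T U V TU UV S h₁ h₂ h₃ h₄ => by
       rw [Permutative.associator_eq, eqToHom_whiskerRight, whiskerLeft_eqToHom, eqToHom_trans,
         eqToHom_trans, eqToHom_trans]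
     ρ_exch := fun i j h => absurd rfl h },
   fun i T U S h => by
     change IsIso (eqToHom (key h))
     infer_instance⟩

theorem SegBar.exists_of_singletons (A : Set X) (c : X → D) (t : Finset X) :
    ∃ a : SegBar D A, ∀ S x, S.1 () = {x} →
      (x ∈ t → Nonempty (a.1.C S ≅ c x)) ∧ (x ∉ t → Nonempty (a.1.C S ≅ 𝟙_ D)) := by
  classical
  induction t using Finset.induction_on with
  | empty => exact ⟨SegBar.zero D A, fun S x _ => ⟨nofun, fun _ => ⟨Iso.refl _⟩⟩⟩
  | insert y t hy ih =>
    obtain ⟨a, ha⟩ := ih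
    refine ⟨(SegBar.conc A y (c y)).add a, fun S x hx => ?_⟩
    have e₁ : y = x → (SegBar.conc A y (c y)).1.C S = c y := fun h => if_pos (by simp [hx, h])
    have e₂ : y ≠ x → (SegBar.conc A y (c y)).1.C S = 𝟙_ D := fun h => if_neg (by simp [hx, h])
    refine ⟨fun ht => ?_, fun ht => ?_⟩
    · by_cases hxy : y = x
      · subst hxy
        obtain ⟨e⟩ := (ha S y hx).2 hy
        exact ⟨(eqToIso (e₁ rfl) ⊗ᵢ e) ≪≫ ρ_ _⟩
      · obtain ⟨e⟩ := (ha S x hx).1 (by simpa [Ne.symm hxy] using ht)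
        exact ⟨(eqToIso (e₂ hxy) ⊗ᵢ e) ≪≫ λ_ _⟩
    · rw [Finset.mem_insert, not_or] at ht
      obtain ⟨e⟩ := (ha S x hx).2 ht.2
      exact ⟨(eqToIso (e₂ (Ne.symm ht.1)) ⊗ᵢ e) ≪≫ λ_ _⟩

end Existence

/-! ### The comparison maps are weak equivalences -/

section Comparison

variable {C : PermCat.{u}} {p k : ℕ}

theorem diagObj_bounded (p k : ℕ) : Bounded (diagObj p k).set :=
  ⟨fun _ => Set.finite_Icc _ _, Finset.range p, fun i hi => by
    have : (diagObj p k).set i = Set.Icc 1 1 :=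
      congrArg (Set.Icc 1) (if_neg (by simpa using hi))
    rw [this, Set.Icc_self]
    exact Set.subsingleton_singleton⟩

theorem smashSet_finite (p k : ℕ) : (smashSet p k).Finite :=
  (Set.Finite.pi' fun _ : Fin p => Set.finite_Icc 1 k).subset fun _ hx i => hx i

theorem smashSet_bounded (p k : ℕ) : Bounded (fun _ : Unit => smashSet p k) :=
  ⟨fun _ => smashSet_finite p k, Finset.univ, fun _ h => absurd (Finset.mem_univ _) h⟩

/-- Singletons as tuples. -/
def sgl (k : ℕ) (x : Fin p → ℕ) : Tup (diagObj p k).set :=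
  ⟨fun s => {extOne x s} ∩ (diagObj p k).set s, fun _ => Set.inter_subset_right⟩

theorem extOne_mem {x : Fin p → ℕ} (hx : x ∈ smashSet p k) (s : ℕ) :
    extOne x s ∈ (diagObj p k).set s := by
  change (if h : s < p then x ⟨s, h⟩ else 1) ∈ Set.Icc 1 (if s < p then k else 1)
  split_ifs with h
  · exact hx ⟨s, h⟩
  · simp

theorem sgl_val {x : Fin p → ℕ} (hx : x ∈ smashSet p k) (s : ℕ) :
    (sgl k x).1 s = {extOne x s} :=
  Set.inter_eq_left.2 (Set.singleton_subset_iff.2 (extOne_mem hx s))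

theorem extOne_inj {x y : Fin p → ℕ} (h : ∀ s, extOne x s = extOne y s) : x = y :=
  funext fun i => by
    have := h i
    unfold extOne at this
    rwa [dif_pos i.2, dif_pos i.2] at this

theorem smashCollect_sgl {x : Fin p → ℕ} (hx : x ∈ smashSet p k) :
    (((smashCollect p k).Φ (sgl k x)).1 () : Set (Fin p → ℕ)) = {x} := by
  refine Set.ext fun y => ⟨fun hy => extOne_inj fun s => ?_, fun hy s => ?_⟩
  · have := hy s
    rwa [sgl_val hx] at this
  · rw [Set.mem_singleton_iff.1 hy, sgl_val hx]
    rfl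

theorem exists_sgl {S : Tup (diagObj p k).set} (h : S.NE) (h' : S.Single) :
    ∃ x ∈ smashSet p k, S = sgl k x := by
  choose y hy using fun s => Set.nonempty_iff_ne_empty.2 (h s)
  have hx : (fun i : Fin p => y i) ∈ smashSet p k := fun i => by
    have : y i ∈ Set.Icc 1 (if (i : ℕ) < p then k else 1) := S.2 i (hy i)
    rwa [if_pos i.2] at this
  refine ⟨_, hx, Subtype.ext (funext fun s => ?_)⟩
  rw [sgl_val hx]
  refine ((h' s).eq_singleton_of_mem (hy s)).trans (congrArg _ ?_)
  unfold extOne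
  split_ifs with hs
  · rfl
  · have : y s ∈ Set.Icc 1 (if s < p then k else 1) := S.2 s (hy s)
    rw [if_neg hs] at this
    exact le_antisymm this.2 this.1

theorem smashCollect_single {S : Tup (fun _ : Unit => smashSet p k)} (h : S.NE) (h' : S.Single) :
    ∃ x ∈ smashSet p k, (smashCollect p k).Φ (sgl k x) = S := by
  obtain ⟨x, hx⟩ := Set.nonempty_iff_ne_empty.2 (h ())
  refine ⟨x, S.2 () hx, Subtype.ext (funext fun _ => ?_)⟩
  exact (smashCollect_sgl (S.2 () hx)).trans ((h' ()).eq_singleton_of_mem hx).symm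

theorem segF_faithful : (segF C p k).Faithful where
  map_injective {a b φ ψ} h := Bar.hom_ext_single (smashSet_bounded p k) a.2 fun S hS hS' => by
    obtain ⟨x, hx, rfl⟩ := smashCollect_single hS hS'
    exact congrArg (fun f => Bar.Hom.f f (sgl k x)) h

theorem segF_full : (segF C p k).Full where
  map_surjective {a b} g := by
    have key : ∀ S : Tup (fun _ : Unit => smashSet p k), S.NE → S.Single →
        ∃ q : a.1.C S ⟶ b.1.C S, ∀ x ∈ smashSet p k, (smashCollect p k).Φ (sgl k x) = S →
          HEq q (Bar.Hom.f g (sgl k x)) := fun S hS hS' => by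
      obtain ⟨x, hx, rfl⟩ := smashCollect_single hS hS'
      refine ⟨Bar.Hom.f g (sgl k x), fun y hy h => ?_⟩
      have h := congrArg (fun T : Tup (fun _ : Unit => smashSet p k) => T.1 ()) h
      rw [smashCollect_sgl hx, smashCollect_sgl hy, Set.singleton_eq_singleton_iff] at h
      rw [h]
      rfl
    choose q hq using key
    obtain ⟨φ, hφ⟩ := Bar.exists_hom (b := b.1) (smashSet_bounded p k) a.2 q
    refine ⟨φ, Bar.hom_ext_single (diagObj_bounded p k) (fun _ _ _ _ _ => a.2 _ _ _ _ _)
      fun S hS hS' => ?_⟩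
    obtain ⟨x, hx, rfl⟩ := exists_sgl hS hS'
    have e := smashCollect_sgl hx
    have h₁ : ((smashCollect p k).Φ (sgl k x)).NE := fun _ => by
      rw [e]
      exact Set.singleton_ne_empty _
    have h₂ : ((smashCollect p k).Φ (sgl k x)).Single := fun _ => by
      rw [e]
      exact Set.subsingleton_singleton
    exact (hφ _ h₁ h₂).trans (eq_of_heq (hq _ h₁ h₂ x hx rfl))

/-- Homomorphisms which are isomorphisms on singletons. -/
def IsCoref (a : SegBar C (smashSet p k)) (b : Bar C (diagObj p k).set)
    (ε : (segF C p k).obj a ⟶ b) : Prop :=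
  ∀ S : Tup (diagObj p k).set, S.NE → S.Single → IsIso (Bar.Hom.f ε S)

theorem exists_isCoref (b : Bar C (diagObj p k).set) :
    ∃ (a : SegBar C (smashSet p k)) (ε : (segF C p k).obj a ⟶ b), IsCoref a b ε := by
  obtain ⟨a, ha⟩ := SegBar.exists_of_singletons (smashSet p k) (fun x => b.C (sgl k x))
    (smashSet_finite p k).toFinset
  have key : ∀ S : Tup (diagObj p k).set, S.NE → S.Single →
      Nonempty (a.1.C ((smashCollect p k).Φ S) ≅ b.C S) := fun S hS hS' => by
    obtain ⟨x, hx, rfl⟩ := exists_sgl hS hS'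
    exact (ha _ x (smashCollect_sgl hx)).1 ((Set.Finite.mem_toFinset _).2 hx)
  obtain ⟨ε, hε⟩ := Bar.exists_hom (a := (segF C p k).obj a) (b := b) (diagObj_bounded p k)
    (fun _ _ _ _ _ => a.2 _ _ _ _ _) fun S hS hS' => (key S hS hS').some.hom
  refine ⟨a, ε, fun S hS hS' => ?_⟩
  rw [hε S hS hS']
  exact (key S hS hS').some.isIso_hom

theorem IsCoref.univ {a : SegBar C (smashSet p k)} {b : Bar C (diagObj p k).set}
    {ε : (segF C p k).obj a ⟶ b} (h : IsCoref a b ε) (a' : SegBar C (smashSet p k))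
    (g : (segF C p k).obj a' ⟶ b) :
    ∃! g' : (segF C p k).obj a' ⟶ (segF C p k).obj a, g' ≫ ε = g := by
  obtain ⟨g', hg'⟩ := Bar.exists_hom (a := (segF C p k).obj a') (b := (segF C p k).obj a)
    (diagObj_bounded p k) (fun _ _ _ _ _ => a'.2 _ _ _ _ _) fun S hS hS' =>
      have := h S hS hS'
      Bar.Hom.f g S ≫ inv (Bar.Hom.f ε S)
  refine ⟨g', Bar.hom_ext_single (diagObj_bounded p k) (fun _ _ _ _ _ => a'.2 _ _ _ _ _)
    fun S hS hS' => ?_, fun g'' hg'' => Bar.hom_ext_single (diagObj_bounded p k)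
      (fun _ _ _ _ _ => a'.2 _ _ _ _ _) fun S hS hS' => ?_⟩
  · have := h S hS hS'
    change Bar.Hom.f g' S ≫ Bar.Hom.f ε S = _
    rw [hg' S hS hS', Category.assoc, IsIso.inv_hom_id, Category.comp_id]
  · have := h S hS hS'
    rw [hg' S hS hS', ← hg'']
    change _ = (Bar.Hom.f g'' S ≫ Bar.Hom.f ε S) ≫ _
    rw [Category.assoc, IsIso.hom_inv_id, Category.comp_id]

theorem circMap_inj {a b : SimplexCategory} (θ : a ⟶ b) [Epi θ] {i j : ℕ} (hi : i ≤ b.len)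
    (hj : j ≤ b.len) (h : circMap θ i = circMap θ j) (h₁ : 1 ≤ circMap θ i) : i = j := by
  have key : ∀ {i j : ℕ}, j ≤ b.len → circMap θ i = circMap θ j → 1 ≤ circMap θ i → ¬i < j := by
    intro i j hj h h₁ hij
    have e : firstPos θ i = firstPos θ j := by
      rw [h] at h₁
      have h₂ := h ▸ h₁
      unfold circMap at h h₁ h₂
      split_ifs at h h₁ h₂
      · exact h
      all_goals omega
    obtain ⟨x, hx⟩ := (SimplexCategory.epi_iff_surjective.1 ‹Epi θ›) ⟨i, by omega⟩
    have hx : (θ.toOrderHom x : ℕ) = i := congrArg Fin.val hx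
    have := (lt_firstPos θ j x).2 (by omega)
    rw [← e, lt_firstPos] at this
    omega
  exact le_antisymm (not_lt.1 (key hi h.symm (h ▸ h₁))) (not_lt.1 (key hj h h₁))

theorem Bar.Hom.isIso_of_heq {I : Type} {X : I → Type} {A : ∀ i, Set (X i)} {a a' b : Bar C A}
    (ha : a = a') {φ : a ⟶ b} {ψ : a' ⟶ b} (h : HEq φ ψ) (S : Tup A)
    (hψ : IsIso (Bar.Hom.f ψ S)) : IsIso (Bar.Hom.f φ S) := by
  subst ha
  obtain rfl := eq_of_heq h
  exact hψ

theorem Bar.Hom.isIso_of_not_ne {I : Type} {X : I → Type} {A : ∀ i, Set (X i)} {a b : Bar C A}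
    (φ : a ⟶ b) {S : Tup A} (hS : ¬S.NE) : IsIso (Bar.Hom.f φ S) := by
  obtain ⟨i, hi⟩ := Tup.not_ne.1 hS
  have h := Bar.Hom.f_empty φ i S hi
  rw [eq_eqToHom_of_heq h (a.C_empty i S hi) (b.C_empty i S hi)]
  infer_instance

theorem barMap_single {d d' : SimplexCategoryᵒᵖ} (θ : d ⟶ d') [Epi θ.unop]
    {S : Tup (diagObj p d'.unop.len).set} (hS : S.Single) :
    ((Finfty.Hom.barMap ((diagS p).map θ)).Φ S).Single := fun i x hx y hy => by
  have h₁ := ((Finfty.Hom.barMap ((diagS p).map θ)).Φ S).2 i hx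
  have h₂ := ((Finfty.Hom.barMap ((diagS p).map θ)).Φ S).2 i hy
  change x ∈ Set.Icc 1 (if i < p then d.unop.len else 1) at h₁
  change y ∈ Set.Icc 1 (if i < p then d.unop.len else 1) at h₂
  change (if i < p then circMap θ.unop else idOn 1) x ∈ S.1 i at hx
  change (if i < p then circMap θ.unop else idOn 1) y ∈ S.1 i at hy
  split_ifs at h₁ h₂ hx hy
  · exact circMap_inj θ.unop h₁.2 h₂.2 (hS i hx hy) (S.2 i hx).1
  · exact (le_antisymm h₁.2 h₁.1).trans (le_antisymm h₂.2 h₂.1).symm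

theorem segHom_isWeakEq (C : PermCat.{u}) (p : ℕ) : IsWeakEq ((segHom C).app p) := by
  obtain ⟨R, hR⟩ := exists_coref (segNat C p)
    (fun m a b ε => IsCoref (C := C) (p := p) (k := m.unop.len) a b ε)
    (fun m b => exists_isCoref (C := C) (p := p) (k := m) b)
    (fun m a b ε h a' g => IsCoref.univ h a' g) (fun {m k} f _ a b ε h ε' hε S hS hS' => by
      refine Bar.Hom.isIso_of_heq (Functor.congr_obj (levelwise_comm (segNat C p) f.op) a).symm hε
        S ?_
      change IsIso (Bar.Hom.f ε ((Finfty.Hom.barMap ((diagS p).map f.op)).Φ S))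
      by_cases hne : ((Finfty.Hom.barMap ((diagS p).map f.op)).Φ S).NE
      · have : Epi f.op.unop := ‹Epi f›
        exact h _ hne (barMap_single f.op hS')
      · exact Bar.Hom.isIso_of_not_ne ε hne)
  exact diagNerveMap_isWeakEq (segNat C p) (fun d =>
    have : (segF C p d.unop.len).Full := segF_full
    have : (segF C p d.unop.len).Faithful := segF_faithful
    Functor.FullyFaithful.ofFullyFaithful (segF C p d.unop.len)) R hR

end Comparison

end MultKTheory

end

theorem mainTheorem1 :
    ∃ (P : CatMulticat permGraph.{u}) (SF : CatMulticat symFunGraph.{u})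
      (Sp : SMulticat spGraph.{u}) (J : CatMultifunctor P SF JFun.{u})
      (I : SMultifunctor SF.nerve Sp (fun F : SymFun.{u} => (IObj F).nerve)),
      IsPermMulticat P ∧ IsSymFunMulticat SF ∧ IsSpMulticat Sp ∧ IsJ J ∧ IsI I ∧
      ∃ η : ∀ C : PermCat.{u}, SymSpec.Hom (KSeg C) (IObj (JFun C)).nerve,
        (∀ C p, IsWeakEq ((η C).app p)) ∧
        ∀ (C D : PermCat.{u}) (f : MultiLin (fun _ : Unit => C) D) (hf : IsStrong f) (p : ℕ)
          (d : SimplexCategoryᵒᵖ) (x : ((KSeg C).X p).obj d)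
          (u : d.unop ⟶ SimplexCategory.mk 0),
          ((η D).app p).app d ((KSegLin f hf p).app d x) =
            SpHom.toFun (((J.nerve.comp I).fn (fun _ : Unit => C) D).app
                (Opposite.op (SimplexCategory.mk 0)) (ComposableArrows.mk₀ f))
              (fun _ => p) p (Equiv.uniqueSigma (fun _ : Unit => Fin p)) d
              (fun _ => ((η C).app p).app d x) u :=
  ⟨permMulticat, symFunMulticat, spMulticat, multifunctorJ, multifunctorI, isPermMulticat,
    isSymFunMulticat, isSpMulticat, isJ, isI, segHom, segHom_isWeakEq,
    fun _ _ f hf p d x u => segHom_lin f hf p d x u⟩
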